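/- **Setting.** Let $\mathbb Z^D$ carry the nearest-neighbour graph distance, with balls $b_u(L)$. Each site $x$ carries a Hilbert space $\mathcal H_x$ with $\sup_x\dim\mathcal H_x<\infty$; for finite $\Lambda$ put $\mathcal H_\Lambda=\bigotimes_{x\in\Lambda}\mathcal H_x$. For finite $\Lambda$ let $\partial_d\Lambda=\{x\in\Lambda:\operatorname{dist}(x,\Lambda^c)\le d\}$ with $\Lambda^c=\mathbb Z^D\setminus\Lambda$, and $\partial\Lambda=\partial_1\Lambda$. A Lindbladian is a superoperator of the form $\rho\mapsto i[\rho,H]+\sum_j\big(L_j\rho L_j^\dagger-\tfrac12\{L_j^\dagger L_j,\rho\}\big)$ with $H$ Hermitian. A *uniform family* consists of Lindbladians $\mathcal M_Z$ supported on the finite sets $Z\subset\mathbb Z^D$, and, for every ball $\Lambda=b_u(L)$, a Lindbladian $\mathcal B^{\partial\Lambda}=\sum_{d=1}^{L+1}\mathcal B^{\partial\Lambda}_d$ with $\mathcal B_d^{\partial\Lambda}$ supported on $\partial_d\Lambda$. The closed-boundary evolution on $\Lambda$ is $T_t^{\bar\Lambda}=\exp(t\mathcal L^{\bar\Lambda})$,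 where $\mathcal L^{\bar\Lambda}=\sum_{Z\subset\Lambda}\mathcal M_Z+\mathcal B^{\partial\Lambda}$; $T^{\bar\Lambda}_\infty=\lim_N\frac1N\sum_{n=0}^NT^{\bar\Lambda}_n$. **Assumptions.** 1. (Exponentially decaying interactions.) There are $\mu>0$, $v<\infty$ and a real polynomial $p$ such that, with $\nu(r)=e^{\mu r}$, for all $x\in\mathbb Z^D$, $N\ge0$, $r\ge1$, $$\sum_{Z\ni x}\|\mathcal M_Z\|_\diamond\,|Z|\,\nu(\operatorname{diam}Z)\le v,\qquad \nu(r)\sum_{d=r}^{N+1}\|\mathcal B_d^{\partial b_x(N)}\|_\diamond\le p(N).$$ 2. (Rapid mixing.) There are $c_0,\gamma,\delta>0$ such that for all balls $\Lambda$, all states $\rho$ and all $t\ge0$, $\|T_t^{\bar\Lambda}(\rho)-T_\infty^{\bar\Lambda}(\rho)\|_1\le c_0|\Lambda|^\delta e^{-\gamma t}$. 3. For every ball $\Lambda$ the evolution $T_t^{\bar\Lambda}$ has exactly one fixed state, and it is a pure state $|\phi_\Lambda\rangle\langle\phi_\Lambda|$. **Proposition.** There is $\kappa>0$ such that for every $K\in\mathbb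 N$ there is $c>0$ such that the following holds for every ball $\Lambda$ and every $A\subset\Lambda$ with $|A|\ge2$. Suppose that $$\operatorname{dist}(A,\Lambda^c)\ge\kappa\log|\Lambda|\qquad\text{or}\qquad|\Lambda|\le|A|^K .$$ Then the reduced state $\rho_A$ of $|\phi_\Lambda\rangle$ on $A$ satisfies $$S(\rho_A)\le c\,\log|A|\cdot|\partial A| ,$$ where $S(\rho)=-\operatorname{tr}\rho\log_2\rho$. The constants $\kappa$ and $c$ depend only on the family (and $c$ on $K$), not on $\Lambda$ or $A$. -/

import Mathlib

noncomputable section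

/-! ### Lattice geometry -/

/-- The sites of the lattice `ℤ^D`. -/
abbrev Site (D : ℕ) : Type := Fin D → ℤ

/-- The graph distance of the lattice `ℤ^D` (nearest-neighbour edges). -/
def gdist {D : ℕ} (x y : Site D) : ℕ := ∑ i, (x i - y i).natAbs

/-- The ball `b_u(L)` of the graph metric. -/
def ball {D : ℕ} (u : Site D) (L : ℕ) : Finset (Site D) :=
  (Finset.Icc (fun i => u i - (L : ℤ)) (fun i => u i + (L : ℤ))).filter (fun x => gdist u x ≤ L)

theorem mem_ball_iff {D : ℕ} (u : Site D) (L : ℕ) (x : Site D) :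
    x ∈ ball u L ↔ gdist u x ≤ L := by
  simp only [ball, Finset.mem_filter, Finset.mem_Icc, and_iff_right_iff_imp]
  intro h
  have key : ∀ i, (u i - x i).natAbs ≤ L := fun i =>
    le_trans (Finset.single_le_sum (f := fun i => (u i - x i).natAbs)
      (fun _ _ => Nat.zero_le _) (Finset.mem_univ i)) h
  constructor <;> intro i <;> have := key i <;> simp only <;> omega

/-- The inner boundary layer `∂_d Λ = {x ∈ Λ | dist(x, Λᶜ) ≤ d}`, the complement being taken in
the whole lattice. The boundary `∂Λ` is `∂_1 Λ`. -/
def layer {D : ℕ} (d : ℕ) (Λ : Finset (Site D)) : Finset (Site D) :=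
  @Finset.filter _ (fun x => ∃ y, y ∉ Λ ∧ gdist x y ≤ d) (Classical.decPred _) Λ

theorem layer_subset {D : ℕ} (d : ℕ) (Λ : Finset (Site D)) : layer d Λ ⊆ Λ :=
  @Finset.filter_subset _ _ (Classical.decPred _) Λ

theorem mem_layer_iff {D : ℕ} (d : ℕ) (Λ : Finset (Site D)) (x : Site D) :
    x ∈ layer d Λ ↔ x ∈ Λ ∧ ∃ y, y ∉ Λ ∧ gdist x y ≤ d :=
  @Finset.mem_filter _ _ (Classical.decPred _) Λ x

/-- The diameter of a finite set of sites in the graph metric. -/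
def gdiam {D : ℕ} (Z : Finset (Site D)) : ℕ := (Z ×ˢ Z).sup (fun p => gdist p.1 p.2)

/-! ### States and superoperators -/

/-- Superoperators on the operators of `ℂ^n`. -/
abbrev SuperOp (n : Type) : Type := Matrix n n ℂ →ₗ[ℂ] Matrix n n ℂ

open scoped ComplexOrder in
/-- Density matrices. -/
def IsState {n : Type} [Fintype n] (ρ : Matrix n n ℂ) : Prop :=
  ρ.PosSemidef ∧ ρ.trace = 1

/-- The rank one operator `|φ⟩⟨φ|`. -/
def pureOp {n : Type} (φ : n → ℂ) : Matrix n n ℂ := Matrix.vecMulVec φ (star φ)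

/-- The trace norm `‖X‖₁`: the sum of the singular values of `X`. -/
def traceNorm {n : Type} [Fintype n] [DecidableEq n] (X : Matrix n n ℂ) : ℝ :=
  ∑ i, Real.sqrt ((Matrix.isHermitian_conjTranspose_mul_self X).eigenvalues i)

/-- The von Neumann entropy `-tr ρ log₂ ρ` (used for Hermitian `ρ`). -/
def vnEntropy {n : Type} [Fintype n] [DecidableEq n] (ρ : Matrix n n ℂ) : ℝ :=
  open scoped Classical in
  if h : ρ.IsHermitian then ∑ i, -(h.eigenvalues i * Real.logb 2 (h.eigenvalues i)) else 0

/-- The superoperator `T ⊗ id` on `M_n ⊗ M_k`. -/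
def ampliate {n : Type} (k : ℕ) (T : SuperOp n) : SuperOp (n × Fin k) where
  toFun X := Matrix.of fun a b => T (Matrix.of fun i j => X (i, a.2) (j, b.2)) a.1 b.1
  map_add' X Y := by
    ext a b
    exact congrFun (congrFun (T.map_add (Matrix.of fun i j => X (i, a.2) (j, b.2))
      (Matrix.of fun i j => Y (i, a.2) (j, b.2))) a.1) b.1
  map_smul' c X := by
    ext a b
    exact congrFun (congrFun (T.map_smul c (Matrix.of fun i j => X (i, a.2) (j, b.2))) a.1) b.1

/-- The diamond norm `sup_k sup_{X ≠ 0} ‖(T ⊗ id_k)(X)‖₁ / ‖X‖₁`. -/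
def diamondNorm {n : Type} [Fintype n] [DecidableEq n] (T : SuperOp n) : ENNReal :=
  ⨆ (k : ℕ) (X : Matrix (n × Fin k) (n × Fin k) ℂ) (_ : X ≠ 0),
    ENNReal.ofReal (traceNorm (ampliate k T X) / traceNorm X)

/-- `𝓛` has the Lindblad form. -/
def IsLindbladian {n : Type} [Fintype n] (𝓛 : SuperOp n) : Prop :=
  ∃ (H : Matrix n n ℂ) (m : ℕ) (J : Fin m → Matrix n n ℂ), H.IsHermitian ∧
    ∀ ρ : Matrix n n ℂ, 𝓛 ρ = Complex.I • (ρ * H - H * ρ) +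
      ∑ j, (J j * ρ * (J j).conjTranspose -
        (1 / 2 : ℂ) • ((J j).conjTranspose * J j * ρ + ρ * ((J j).conjTranspose * J j)))

/-- The evolution `T_t = exp(t 𝓛)`, the exponential being computed in the basis of matrix units. -/
def evolution {n : Type} [Fintype n] [DecidableEq n] (𝓛 : SuperOp n) (t : ℝ) : SuperOp n :=
  Matrix.toLin (Matrix.stdBasis ℂ n n) (Matrix.stdBasis ℂ n n)
    (NormedSpace.exp ((t : ℂ) •
      LinearMap.toMatrix (Matrix.stdBasis ℂ n n) (Matrix.stdBasis ℂ n n) 𝓛))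

/-- `P` is the infinite time limit `T_∞ = lim_N (1/N) ∑_{k ≤ N} T_k` of the evolution. -/
def IsInfiniteTimeLimit {n : Type} [Fintype n] [DecidableEq n] (𝓛 P : SuperOp n) : Prop :=
  ∀ X : Matrix n n ℂ, Filter.Tendsto
    (fun N : ℕ => (N : ℂ)⁻¹ • ∑ k ∈ Finset.range (N + 1), evolution 𝓛 (k : ℝ) X)
    Filter.atTop (nhds (P X))

/-- The evolution generated by `𝓛` has exactly one fixed state, namely the pure state `|φ⟩⟨φ|`. -/
def HasUniquePureFixedPoint {n : Type} [Fintype n] [DecidableEq n]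
    (𝓛 : SuperOp n) (φ : n → ℂ) : Prop :=
  IsState (pureOp φ) ∧
    ∀ ρ : Matrix n n ℂ, IsState ρ → ((∀ t : ℝ, 0 ≤ t → evolution 𝓛 t ρ = ρ) ↔ ρ = pureOp φ)

/-! ### Many-body systems -/

/-- The canonical orthonormal basis of `H_Λ = ⨂_{x ∈ Λ} ℂ^{q x}`. -/
abbrev Conf {D : ℕ} (q : Site D → ℕ) (Λ : Finset (Site D)) : Type := (x : Λ) → Fin (q x)

/-- Operators on `H_Λ`. -/
abbrev Op {D : ℕ} (q : Site D → ℕ) (Λ : Finset (Site D)) : Type :=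
  Matrix (Conf q Λ) (Conf q Λ) ℂ

/-- The configuration on `Λ` that agrees with `z` on `Z` and with `a` off `Z`. -/
def overwrite {D : ℕ} {q : Site D → ℕ} {Z Λ : Finset (Site D)} (z : Conf q Z) (a : Conf q Λ) :
    Conf q Λ :=
  fun x => if h : x.1 ∈ Z then z ⟨x.1, h⟩ else a x

/-- The extension `T ⊗ id` to `Λ` of a superoperator `T` on `Z ⊆ Λ`. -/
def extend {D : ℕ} {q : Site D → ℕ} {Z Λ : Finset (Site D)} (h : Z ⊆ Λ)
    (T : SuperOp (Conf q Z)) : SuperOp (Conf q Λ) where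
  toFun X := Matrix.of fun a b =>
    T (Matrix.of fun z w => X (overwrite z a) (overwrite w b))
      (fun x => a ⟨x.1, h x.2⟩) (fun x => b ⟨x.1, h x.2⟩)
  map_add' X Y := by
    ext a b
    exact congrFun (congrFun (T.map_add (Matrix.of fun z w => X (overwrite z a) (overwrite w b))
      (Matrix.of fun z w => Y (overwrite z a) (overwrite w b))) _) _
  map_smul' c X := by
    ext a b
    exact congrFun (congrFun (T.map_smul c
      (Matrix.of fun z w => X (overwrite z a) (overwrite w b))) _) _

/-- The configuration on `Λ` assembled from one on `A` and one on `Λ \ A`. -/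
def join {D : ℕ} {q : Site D → ℕ} {A Λ : Finset (Site D)} (a : Conf q A) (r : Conf q (Λ \ A)) :
    Conf q Λ :=
  fun x => if h : x.1 ∈ A then a ⟨x.1, h⟩ else r ⟨x.1, Finset.mem_sdiff.2 ⟨x.2, h⟩⟩

/-- The reduced operator on `A ⊆ Λ`: the partial trace over `Λ \ A`. -/
def reduced {D : ℕ} {q : Site D → ℕ} {Λ : Finset (Site D)} (A : Finset (Site D)) (ρ : Op q Λ) :
    Op q A :=
  Matrix.of fun a b => ∑ r : Conf q (Λ \ A), ρ (join a r) (join b r)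

/-! ### Uniform families -/

/-- A uniform family of Lindbladians on `ℤ^D`: local terms `M_Z` supported on the finite sets `Z`,
and for every ball `Λ = b_u(L)` a boundary condition, a Lindbladian that is a sum of terms
`B_d`, `d ≥ 1`, supported on `∂_d Λ`. Since `∂_d Λ = Λ` for `d ≥ L + 1` (if `D ≥ 1`), the terms with
`d ≥ L + 1` are collected in one. -/
structure UniformFamily {D : ℕ} (q : Site D → ℕ) where
  bulk : (Z : Finset (Site D)) → SuperOp (Conf q Z)
  bulk_lindblad : ∀ Z, IsLindbladian (bulk Z)
  bdry : (u : Site D) → (L d : ℕ) → SuperOp (Conf q (layer d (ball u L)))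
  bdry_lindblad : ∀ u L, IsLindbladian
    (∑ d ∈ Finset.Icc 1 (L + 1), extend (layer_subset d (ball u L)) (bdry u L d))

namespace UniformFamily

variable {D : ℕ} {q : Site D → ℕ}

/-- The open boundary generator `∑_{Z ⊆ Λ} M_Z`. -/
def openGen (F : UniformFamily q) (Λ : Finset (Site D)) : SuperOp (Conf q Λ) :=
  ∑ Z ∈ Λ.powerset.attach, extend (Finset.mem_powerset.1 Z.2) (F.bulk Z.1)

/-- The closed boundary generator on the ball `Λ = b_u(L)`. -/
def closedGen (F : UniformFamily q) (u : Site D) (L : ℕ) : SuperOp (Conf q (ball u L)) :=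
  F.openGen (ball u L) +
    ∑ d ∈ Finset.Icc 1 (L + 1), extend (layer_subset d (ball u L)) (F.bdry u L d)

/-- The Lieb-Robinson assumptions with decay function `ν`. -/
def LiebRobinson (F : UniformFamily q) (ν : ℕ → ℝ) : Prop :=
  Monotone ν ∧ (∀ r s, ν (r + s) ≤ ν r * ν s) ∧
  (∃ v : ℝ, ∀ x : Site D, ∑' Z : {Z : Finset (Site D) // x ∈ Z},
    diamondNorm (F.bulk Z.1) * (Z.1.card : ENNReal) * ENNReal.ofReal (ν (gdiam Z.1))
      ≤ ENNReal.ofReal v) ∧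
  (∃ p : Polynomial ℝ, ∀ (x : Site D) (N r : ℕ), 1 ≤ r →
    ENNReal.ofReal (ν r) * ∑ d ∈ Finset.Icc r (N + 1), diamondNorm (F.bdry x N d)
      ≤ ENNReal.ofReal (p.eval (N : ℝ)))

/-- Rapid mixing of the closed boundary evolutions. -/
def RapidMixing (F : UniformFamily q) : Prop :=
  ∃ c γ δ : ℝ, 0 < c ∧ 0 < γ ∧ 0 < δ ∧ ∀ (u : Site D) (L : ℕ),
    ∃ P : SuperOp (Conf q (ball u L)), IsInfiniteTimeLimit (F.closedGen u L) P ∧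
      ∀ ρ : Op q (ball u L), IsState ρ → ∀ t : ℝ, 0 ≤ t →
        traceNorm (evolution (F.closedGen u L) t ρ - P ρ)
          ≤ c * ((ball u L).card : ℝ) ^ δ * Real.exp (-t * γ)

end UniformFamily

end

/-!
Why the area law holds. The state `φ_Λ` of a ball is reached, by rapid mixing, from a product state
in a time of the order of `log |Λ|`, and during this time the entropy of the reduced state on a
region `A` grows at most at a rate of the order of `|∂A|`.

*The rate.* A Lindbladian of diamond norm `b` can be written as `X ↦ ∑ L_j X L_j† + G X + X G†` with
`‖G‖ ≤ 3 b / 2` (`IsLindbladian.exists_isLForm_norm_le`: take the `L_j` traceless and test on the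
maximally entangled state). Along one Kraus step `1 + s G`, `√s L_j` of such a term, supported
on `Z`, the mean entropy of the pure states on `A` grows by at most `2 s ‖G‖ (5 + 4 log dim (A ∩ Z))`
to first order (`entRate_extend`). This is Gibbs' variational principle with two observables:
`-log ρ_A` in the deterministic branch and, in the jump branches, the logarithm of the state that is
maximally mixed on `A ∩ Z`, which commutes with the `L_j`. The difference of the two observables is
controlled by the variance of a relative logarithm (`trace_mul_log_sub_log_sq_le`), which is bounded
in terms of `dim (A ∩ Z)` only. Terms on either side of the cut do not contribute. Euler's
scheme turns the step estimate into a bound on linear functionals dominated by the entropy of pure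
states (`re_evolution_pureOp_le`). One such functional combines the trace with the overlap with
`φ_Λ`, and its value at `φ_Λ` is half the entropy up to a constant (`ent_mul_vnorm_sq_le`);
this replaces a continuity argument along the mixed state of the evolution.

*The boundary condition* has large norm near `∂Λ`. The part `A'` of `A` at distance of the order of
`log |Λ|` from the boundary is cut off, at a cost in entropy of `O(|∂A| log |Λ|)`, since a line in a
fixed direction leaves `A` through `∂A` (`card_sphere_le`). Up to a small tail the boundary
Lindbladian acts off `A'`, and it can be replaced by one that does so exactly, namely by preparing
and tracing out `A'` (`traceNorm_extend_localise_bdryTot_sub_le`). The strength of the remaining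
terms that cross the cut is of the order of `|∂A|` (`sum_bulkNorm_crossing_le`). This proves the
claim when `|Λ|` is polynomial in `|A|` (`QuantFamily.exists_ent_le`).

*Regions away from the boundary of a large ball.* If `A` extends further than its size it has an
empty shell and falls apart into two distant pieces, for which the claim is additive. Otherwise `A`
lies in a ball `B ⊆ Λ` whose radius is of the order of `|A|`, at distance of order `log |A|` from
the complement of `B` (`exists_sub_ball`). By a Lieb-Robinson bound
(`traceNorm_reduced_evolution_sub_le`) the evolutions on `Λ` and on `B` agree on `A` up to
times of order `log |A|`, by which time the evolution on `B` has mixed; so `φ_Λ` and `φ_B` have nearly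
the same reduced state on `A`, and the first case applies to `φ_B`.
-/

section

open scoped Matrix.Norms.L2Operator ComplexOrder
open Matrix

/-! ### Vectors, the operator norm and the trace norm -/

section TraceNorm

variable {n κ : Type} [Fintype n] [Fintype κ]

/-- The Euclidean norm of a vector of `ℂ^n`. -/
noncomputable def vnorm (x : n → ℂ) : ℝ := ‖(WithLp.toLp 2 x : EuclideanSpace ℂ n)‖

theorem vnorm_nonneg (x : n → ℂ) : 0 ≤ vnorm x := norm_nonneg _

theorem vnorm_sq (x : n → ℂ) : vnorm x ^ 2 = ∑ i, ‖x i‖ ^ 2 := by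
  simp [vnorm, EuclideanSpace.norm_sq_eq]

theorem star_dotProduct_self (x : n → ℂ) : star x ⬝ᵥ x = ((vnorm x ^ 2 : ℝ) : ℂ) := by
  rw [vnorm_sq, dotProduct]
  push_cast
  refine Finset.sum_congr rfl fun i _ => ?_
  simp [Complex.conj_mul']

theorem norm_star_dotProduct_le (x y : n → ℂ) : ‖star x ⬝ᵥ y‖ ≤ vnorm x * vnorm y := by
  have := norm_inner_le_norm (𝕜 := ℂ) (WithLp.toLp 2 x : EuclideanSpace ℂ n) (WithLp.toLp 2 y)
  rwa [EuclideanSpace.inner_eq_star_dotProduct, dotProduct_comm] at this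

theorem vnorm_eq_zero {x : n → ℂ} : vnorm x = 0 ↔ x = 0 := by
  simp [vnorm]

theorem vnorm_smul (c : ℂ) (x : n → ℂ) : vnorm (c • x) = ‖c‖ * vnorm x := by
  simp [vnorm, norm_smul]

theorem trace_mul_vecMulVec (A : Matrix n n ℂ) (u v : n → ℂ) :
    (A * vecMulVec u v).trace = v ⬝ᵥ (A *ᵥ u) := by
  rw [mul_vecMulVec, trace_vecMulVec, dotProduct_comm]

theorem sum_dotProduct_orthonormal_sq_le (u : κ → n → ℂ)
    (hu : ∀ i j, i ≠ j → star (u i) ⬝ᵥ u j = 0) (hu1 : ∀ i, vnorm (u i) ≤ 1) (x : n → ℂ) :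
    ∑ i, ‖star (u i) ⬝ᵥ x‖ ^ 2 ≤ vnorm x ^ 2 := by
  -- Bessel's inequality for vectors of norm at most one: expand `‖x - ∑ ⟨u_i, x⟩ u_i‖² ≥ 0`.
  set c : κ → ℂ := fun i => star (u i) ⬝ᵥ x with hc
  have h0 : 0 ≤ (star (x - ∑ i, c i • u i) ⬝ᵥ (x - ∑ i, c i • u i)).re := by
    rw [star_dotProduct_self, Complex.ofReal_re]; positivity
  have h1 : ∀ i, star x ⬝ᵥ u i = star (c i) := fun i => by
    rw [hc, star_dotProduct]
  have h2 : star (x - ∑ i, c i • u i) ⬝ᵥ (x - ∑ i, c i • u i)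
      = star x ⬝ᵥ x - ∑ i, c i * star (c i) - ∑ i, star (c i) * c i
        + ∑ i, star (c i) * c i * (star (u i) ⬝ᵥ u i) := by
    simp only [star_sub, sub_dotProduct, dotProduct_sub, dotProduct_sum, star_sum, sum_dotProduct,
      dotProduct_smul, star_smul, smul_dotProduct, smul_eq_mul, h1]
    have h3 : ∀ i, ∑ j, star (c j) * (star (u j) ⬝ᵥ u i) = star (c i) * (star (u i) ⬝ᵥ u i) :=
      fun i => by
        rw [Finset.sum_eq_single i]
        · intro j _ hj; rw [hu j i hj]; ring
        · simp
    have h4 : ∀ i, star (u i) ⬝ᵥ x = c i := fun i => rfl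
    simp only [h3, h4, mul_sub, Finset.sum_sub_distrib]
    have h5 : ∀ i, c i * (star (c i) * (star (u i) ⬝ᵥ u i))
        = star (c i) * c i * (star (u i) ⬝ᵥ u i) := fun i => by ring
    simp only [h5]
    ring
  rw [h2] at h0
  simp only [star_dotProduct_self] at h0
  have h5 : ∀ i, star (c i) * c i = ((‖c i‖ ^ 2 : ℝ) : ℂ) := fun i => by
    simp [Complex.conj_mul']
  have h6 : ∀ i, c i * star (c i) = ((‖c i‖ ^ 2 : ℝ) : ℂ) := fun i => by
    simp [Complex.mul_conj']
  simp only [h5, h6] at h0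
  rw [← Complex.ofReal_sum] at h0
  simp only [← Complex.ofReal_mul, ← Complex.ofReal_sum, ← Complex.ofReal_sub, ← Complex.ofReal_add,
    Complex.ofReal_re] at h0
  have h7 : ∑ i, ‖c i‖ ^ 2 * vnorm (u i) ^ 2 ≤ ∑ i, ‖c i‖ ^ 2 := by
    refine Finset.sum_le_sum fun i _ => ?_
    have : vnorm (u i) ^ 2 ≤ 1 := by
      nlinarith [hu1 i, vnorm_nonneg (u i)]
    nlinarith [sq_nonneg ‖c i‖]
  linarith

variable [DecidableEq n] [DecidableEq κ]

theorem vnorm_mulVec_le (A : Matrix n n ℂ) (x : n → ℂ) : vnorm (A *ᵥ x) ≤ ‖A‖ * vnorm x := by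
  simpa [vnorm] using l2_opNorm_mulVec A (WithLp.toLp 2 x)

theorem opNorm_le_of_mulVec (A : Matrix n n ℂ) (c : ℝ) (hc : 0 ≤ c)
    (h : ∀ x, vnorm (A *ᵥ x) ≤ c * vnorm x) : ‖A‖ ≤ c := by
  rw [Matrix.cstar_norm_def]
  refine ContinuousLinearMap.opNorm_le_bound _ hc fun x => ?_
  have := h x.ofLp
  rwa [vnorm, ← Matrix.toEuclideanCLM_toLp] at this

theorem norm_trace_mul_rankOne_le (A : Matrix n n ℂ) (u v : n → ℂ) :
    ‖(A * vecMulVec u (star v)).trace‖ ≤ ‖A‖ * (vnorm u * vnorm v) := by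
  rw [trace_mul_vecMulVec]
  refine (norm_star_dotProduct_le _ _).trans ?_
  nlinarith [vnorm_mulVec_le A u, vnorm_nonneg v]

/-- The singular value decomposition, in the form of a sum of rank one operators. -/
theorem exists_svd (X : Matrix n n ℂ) : ∃ (s : n → ℝ) (u v : n → n → ℂ),
    (∀ i, 0 ≤ s i) ∧ (∀ i, vnorm (u i) ≤ 1) ∧ (∀ i, vnorm (v i) ≤ 1) ∧
    X = ∑ i, (s i : ℂ) • vecMulVec (u i) (star (v i)) ∧ ∑ i, s i = traceNorm X ∧
    (∀ i j, i ≠ j → star (u i) ⬝ᵥ u j = 0) ∧ (∀ i j, i ≠ j → star (v i) ⬝ᵥ v j = 0) ∧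
    (∀ i, s i ≠ 0 → star (u i) ⬝ᵥ u i = 1 ∧ star (v i) ⬝ᵥ v i = 1) := by
  set hH := Matrix.isHermitian_conjTranspose_mul_self X
  set lam := hH.eigenvalues with hlam
  have hpos : ∀ i, 0 ≤ lam i := (Matrix.posSemidef_conjTranspose_mul_self X).eigenvalues_nonneg
  set v : n → n → ℂ := fun i => (hH.eigenvectorBasis i).ofLp with hv
  have hvv : ∀ i j, star (v i) ⬝ᵥ v j = if i = j then 1 else 0 := fun i j => by
    have := orthonormal_iff_ite.1 hH.eigenvectorBasis.orthonormal i j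
    rwa [EuclideanSpace.inner_eq_star_dotProduct, dotProduct_comm] at this
  have heig : ∀ i, (Xᴴ * X) *ᵥ v i = (lam i : ℂ) • v i := fun i => by
    simpa using hH.mulVec_eigenvectorBasis i
  have hXX : ∀ i j, star (X *ᵥ v i) ⬝ᵥ (X *ᵥ v j) = if i = j then (lam i : ℂ) else 0 := fun i j => by
    rw [star_mulVec, ← dotProduct_mulVec, mulVec_mulVec, heig, dotProduct_smul, hvv]
    split_ifs with h <;> simp [h]
  have hsum : ∑ i, vecMulVec (v i) (star (v i)) = (1 : Matrix n n ℂ) := by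
    have h1 : (hH.eigenvectorUnitary : Matrix n n ℂ) * star (hH.eigenvectorUnitary : Matrix n n ℂ) = 1 :=
      Unitary.coe_mul_star_self _
    rw [← h1]
    ext a b
    simp [Matrix.sum_apply, vecMulVec_apply, mul_apply, hv, IsHermitian.eigenvectorUnitary_apply]
  set s : n → ℝ := fun i => Real.sqrt (lam i) with hs
  set u : n → n → ℂ := fun i => ((s i)⁻¹ : ℂ) • (X *ᵥ v i) with hu
  have hs2 : ∀ i, (s i : ℂ) * s i = lam i := fun i => by
    rw [← Complex.ofReal_mul, hs]; simp [Real.mul_self_sqrt (hpos i)]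
  have huu : ∀ i j, i ≠ j → star (u i) ⬝ᵥ u j = 0 := fun i j h => by
    simp [hu, star_smul, smul_dotProduct, dotProduct_smul, hXX, h]
  have hu1 : ∀ i, s i ≠ 0 → star (u i) ⬝ᵥ u i = 1 := fun i h => by
    have h' : (s i : ℂ) ≠ 0 := by exact_mod_cast h
    simp only [hu, star_smul, smul_dotProduct, dotProduct_smul, hXX, if_true, smul_eq_mul, ← hs2]
    simp
    field_simp
  have hsu : ∀ i, (s i : ℂ) • u i = X *ᵥ v i := fun i => by
    by_cases h : s i = 0
    · have h0 : star (X *ᵥ v i) ⬝ᵥ (X *ᵥ v i) = 0 := by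
        rw [hXX, if_pos rfl, ← hs2, h]; simp
      rw [dotProduct_star_self_eq_zero.1 h0]
      simp [h]
    · have h' : (s i : ℂ) ≠ 0 := by exact_mod_cast h
      simp [hu, smul_smul, h']
  have hv1 : ∀ i, vnorm (v i) = 1 := fun i => by
    have := star_dotProduct_self (v i)
    rw [hvv, if_pos rfl] at this
    have h2 : vnorm (v i) ^ 2 = 1 := by exact_mod_cast this.symm
    nlinarith [vnorm_nonneg (v i)]
  refine ⟨s, u, v, fun i => Real.sqrt_nonneg _, fun i => ?_, fun i => (hv1 i).le, ?_, rfl, huu,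
    fun i j h => by rw [hvv, if_neg h], fun i h => ⟨hu1 i h, by rw [hvv, if_pos rfl]⟩⟩
  · by_cases h : s i = 0
    · simp [hu, h, vnorm]
    · have := star_dotProduct_self (u i)
      rw [hu1 i h] at this
      have h2 : vnorm (u i) ^ 2 = 1 := by exact_mod_cast this.symm
      nlinarith [vnorm_nonneg (u i)]
  · calc X = X * 1 := by simp
      _ = ∑ i, (s i : ℂ) • vecMulVec (u i) (star (v i)) := by
        rw [← hsum, Matrix.mul_sum]
        refine Finset.sum_congr rfl fun i _ => ?_
        rw [mul_vecMulVec, ← hsu, smul_vecMulVec]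

theorem traceNorm_nonneg (X : Matrix n n ℂ) : 0 ≤ traceNorm X :=
  Finset.sum_nonneg fun _ _ => Real.sqrt_nonneg _

theorem norm_trace_mul_le (O X : Matrix n n ℂ) : ‖(O * X).trace‖ ≤ ‖O‖ * traceNorm X := by
  obtain ⟨s, u, v, hs, hu, hv, hX, hsum, -⟩ := exists_svd X
  rw [← hsum, Finset.mul_sum]
  conv_lhs => rw [hX, Matrix.mul_sum, trace_sum]
  refine (norm_sum_le _ _).trans (Finset.sum_le_sum fun i _ => ?_)
  rw [mul_smul_comm, trace_smul, norm_smul, Complex.norm_real, Real.norm_of_nonneg (hs i)]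
  have := norm_trace_mul_rankOne_le O (u i) (v i)
  have h1 : vnorm (u i) * vnorm (v i) ≤ 1 := by
    nlinarith [hu i, hv i, vnorm_nonneg (u i), vnorm_nonneg (v i)]
  nlinarith [hs i, norm_nonneg O, mul_le_mul_of_nonneg_left h1 (norm_nonneg O)]

theorem exists_trace_mul_eq_traceNorm (X : Matrix n n ℂ) :
    ∃ O : Matrix n n ℂ, ‖O‖ ≤ 1 ∧ (O * X).trace = traceNorm X := by
  obtain ⟨s, u, v, hs, hu, hv, hX, hsum, huo, hvo, h1⟩ := exists_svd X
  refine ⟨∑ i, vecMulVec (v i) (star (u i)), ?_, ?_⟩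
  · refine opNorm_le_of_mulVec _ _ zero_le_one fun x => ?_
    -- dualize against an arbitrary vector and apply Bessel's inequality twice
    have key : ∀ y : n → ℂ, ‖star y ⬝ᵥ ((∑ i, vecMulVec (v i) (star (u i))) *ᵥ x)‖
        ≤ vnorm y * vnorm x := fun y => by
      have e : star y ⬝ᵥ ((∑ i, vecMulVec (v i) (star (u i))) *ᵥ x)
          = ∑ i, (star (u i) ⬝ᵥ x) * (star y ⬝ᵥ v i) := by
        rw [Matrix.sum_mulVec, dotProduct_sum]
        refine Finset.sum_congr rfl fun i _ => ?_
        rw [vecMulVec_mulVec]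
        simp [dotProduct_smul]
      have h2 : ∀ i, ‖star y ⬝ᵥ v i‖ = ‖star (v i) ⬝ᵥ y‖ := fun i => by
        rw [← norm_star (star y ⬝ᵥ v i), star_dotProduct, star_star]
      rw [e]
      refine (norm_sum_le _ _).trans ?_
      simp only [norm_mul, h2]
      have cs := Finset.sum_mul_sq_le_sq_mul_sq Finset.univ (fun i => ‖star (u i) ⬝ᵥ x‖)
        (fun i => ‖star (v i) ⬝ᵥ y‖)
      have b1 := sum_dotProduct_orthonormal_sq_le u huo hu x
      have b2 := sum_dotProduct_orthonormal_sq_le v hvo hv y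
      refine abs_le_of_sq_le_sq' ?_ (mul_nonneg (vnorm_nonneg _) (vnorm_nonneg _)) |>.2
      refine cs.trans ?_
      rw [mul_pow, mul_comm (vnorm y ^ 2)]
      exact mul_le_mul b1 b2 (Finset.sum_nonneg fun _ _ => by positivity) (by positivity)
    set z := (∑ i, vecMulVec (v i) (star (u i))) *ᵥ x
    have h3 := key z
    rw [star_dotProduct_self, Complex.norm_real, Real.norm_of_nonneg (by positivity)] at h3
    by_cases hz : vnorm z = 0
    · rw [hz]; have := vnorm_nonneg x; linarith
    · have : 0 < vnorm z := lt_of_le_of_ne (vnorm_nonneg z) (Ne.symm hz)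
      nlinarith
  · rw [← hsum]
    conv_lhs => rw [hX]
    rw [Matrix.mul_sum, trace_sum]
    push_cast
    refine Finset.sum_congr rfl fun i _ => ?_
    rw [mul_smul_comm, trace_smul, trace_mul_vecMulVec, Matrix.sum_mulVec, dotProduct_sum]
    by_cases hi : s i = 0
    · simp [hi]
    rw [Finset.sum_eq_single i]
    · rw [vecMulVec_mulVec]
      simp [(h1 i hi).1, (h1 i hi).2]
    · intro j _ hj
      rw [vecMulVec_mulVec]
      simp [huo j i hj]
    · simp

/-- The trace norm is dual to the operator norm. -/
theorem traceNorm_le_iff (X : Matrix n n ℂ) (c : ℝ) :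
    traceNorm X ≤ c ↔ ∀ O : Matrix n n ℂ, ‖O‖ ≤ 1 → ‖(O * X).trace‖ ≤ c := by
  constructor
  · intro h O hO
    refine (norm_trace_mul_le O X).trans (le_trans ?_ h)
    nlinarith [traceNorm_nonneg X]
  · intro h
    obtain ⟨O, hO, e⟩ := exists_trace_mul_eq_traceNorm X
    have := h O hO
    rwa [e, Complex.norm_real, Real.norm_of_nonneg (traceNorm_nonneg X)] at this

theorem traceNorm_add_le (X Y : Matrix n n ℂ) : traceNorm (X + Y) ≤ traceNorm X + traceNorm Y := by
  rw [traceNorm_le_iff]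
  intro O hO
  rw [Matrix.mul_add, trace_add]
  exact (norm_add_le _ _).trans (add_le_add ((traceNorm_le_iff X _).1 le_rfl O hO)
    ((traceNorm_le_iff Y _).1 le_rfl O hO))

theorem traceNorm_smul (c : ℂ) (X : Matrix n n ℂ) : traceNorm (c • X) ≤ ‖c‖ * traceNorm X := by
  rw [traceNorm_le_iff]
  intro O hO
  rw [mul_smul_comm, trace_smul, norm_smul]
  exact mul_le_mul_of_nonneg_left ((traceNorm_le_iff X _).1 le_rfl O hO) (norm_nonneg _)

theorem traceNorm_zero : traceNorm (0 : Matrix n n ℂ) = 0 :=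
  le_antisymm (by rw [traceNorm_le_iff]; simp) (traceNorm_nonneg _)

theorem traceNorm_sum_le {ι : Type*} (s : Finset ι) (X : ι → Matrix n n ℂ) :
    traceNorm (∑ i ∈ s, X i) ≤ ∑ i ∈ s, traceNorm (X i) := by
  classical
  induction s using Finset.induction_on with
  | empty => simp [traceNorm_zero]
  | insert a s ha ih =>
    rw [Finset.sum_insert ha, Finset.sum_insert ha]
    exact (traceNorm_add_le _ _).trans (add_le_add le_rfl ih)

theorem traceNorm_rankOne_le (u v : n → ℂ) :
    traceNorm (vecMulVec u (star v)) ≤ vnorm u * vnorm v := by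
  rw [traceNorm_le_iff]
  intro O hO
  refine (norm_trace_mul_rankOne_le O u v).trans ?_
  nlinarith [mul_nonneg (vnorm_nonneg u) (vnorm_nonneg v)]

theorem traceNorm_mul_le (A X : Matrix n n ℂ) : traceNorm (A * X) ≤ ‖A‖ * traceNorm X := by
  rw [traceNorm_le_iff]
  intro O hO
  rw [← Matrix.mul_assoc]
  refine (norm_trace_mul_le _ X).trans (mul_le_mul_of_nonneg_right ?_ (traceNorm_nonneg X))
  refine (norm_mul_le _ _).trans ?_
  nlinarith [norm_nonneg A]

theorem traceNorm_neg (X : Matrix n n ℂ) : traceNorm (-X) = traceNorm X := by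
  refine le_antisymm ?_ ?_
  · simpa using traceNorm_smul (-1) X
  · simpa using traceNorm_smul (-1) (-X)

theorem norm_apply_le_traceNorm (X : Matrix n n ℂ) (i j : n) : ‖X i j‖ ≤ traceNorm X := by
  have h := norm_trace_mul_le (vecMulVec (Pi.single j 1) (star (Pi.single i 1))) X
  rw [trace_mul_comm, trace_mul_vecMulVec] at h
  have e : star (Pi.single i (1 : ℂ) : n → ℂ) ⬝ᵥ (X *ᵥ Pi.single j 1) = X i j := by
    have : star (Pi.single i (1 : ℂ) : n → ℂ) = Pi.single i 1 := by
      ext k; by_cases hk : k = i <;> simp [hk]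
    rw [this]; simp
  rw [e] at h
  have h1 : ∀ k : n, vnorm (Pi.single k (1 : ℂ) : n → ℂ) = 1 := fun k => by
    simp [vnorm]
  refine h.trans (mul_le_of_le_one_left (traceNorm_nonneg X) ?_)
  refine opNorm_le_of_mulVec _ _ zero_le_one fun x => ?_
  rw [vecMulVec_mulVec]
  have h2 := norm_star_dotProduct_le (Pi.single i (1 : ℂ)) x
  rw [h1] at h2
  rw [op_smul_eq_smul, vnorm_smul, h1]
  linarith

/-- The trace norm is invariant under relabelling of the basis. -/
theorem traceNorm_reindex (e : κ ≃ n) (X : Matrix n n ℂ) :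
    traceNorm (X.submatrix e e) = traceNorm X := by
  have key : ∀ {n κ : Type} [Fintype n] [DecidableEq n] [Fintype κ] [DecidableEq κ] (e : κ ≃ n)
      (X : Matrix n n ℂ), traceNorm (X.submatrix e e) ≤ traceNorm X := by
    intro n κ _ _ _ _ e X
    rw [traceNorm_le_iff]
    intro O hO
    have h1 : (O * X.submatrix e e).trace = (O.submatrix e.symm e.symm * X).trace := by
      have : O * X.submatrix e e = (O.submatrix e.symm e.symm * X).submatrix e e := by
        rw [← Matrix.submatrix_mul_equiv _ _ e e e]; simp
      rw [this]
      simp only [trace, diag_apply, submatrix_apply]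
      exact e.sum_comp fun i => (O.submatrix e.symm e.symm * X) i i
    rw [h1]
    refine (norm_trace_mul_le _ _).trans (mul_le_of_le_one_left (traceNorm_nonneg X) ?_)
    refine opNorm_le_of_mulVec _ _ zero_le_one fun x => ?_
    have hv : ∀ y : κ → ℂ, vnorm (y ∘ e.symm) = vnorm y := fun y => by
      have : vnorm (y ∘ e.symm) ^ 2 = vnorm y ^ 2 := by
        rw [vnorm_sq, vnorm_sq]; exact e.symm.sum_comp fun i => ‖y i‖ ^ 2
      exact (pow_left_inj₀ (vnorm_nonneg _) (vnorm_nonneg _) two_ne_zero).1 this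
    have e1 : O.submatrix e.symm e.symm *ᵥ x = (O *ᵥ (x ∘ e)) ∘ e.symm := by
      rw [Matrix.submatrix_mulVec_equiv]; simp
    have e2 : vnorm x = vnorm (x ∘ e) := by
      rw [← hv (x ∘ e)]; congr 1; ext; simp
    rw [e1, hv, e2]
    refine (vnorm_mulVec_le _ _).trans ?_
    nlinarith [vnorm_nonneg (x ∘ e)]
  refine le_antisymm (key e X) ?_
  have := key e.symm (X.submatrix e e)
  simpa using this

end TraceNorm

end

section

set_option linter.unusedSectionVars false
open Matrix Filter Topology

/-! ### The evolution generated by a superoperator -/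

section Evolution

variable {n κ : Type} [Fintype n] [Fintype κ]

/-- The exponential `exp (z A)` of a bounded operator on a complex Banach space. -/
noncomputable def clmExp {V : Type*} [NormedAddCommGroup V] [NormedSpace ℂ V]
    (A : V →L[ℂ] V) (z : ℂ) : V →L[ℂ] V := NormedSpace.exp (z • A)

theorem clmExp_zero {V : Type*} [NormedAddCommGroup V] [NormedSpace ℂ V]
    (A : V →L[ℂ] V) : clmExp A 0 = 1 := by
  rw [clmExp, zero_smul, NormedSpace.exp_zero]

section Banach

variable {V W : Type*} [NormedAddCommGroup V] [NormedSpace ℂ V] [CompleteSpace V]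
  [NormedAddCommGroup W] [NormedSpace ℂ W] [CompleteSpace W]

theorem clmExp_add (A : V →L[ℂ] V) (z w : ℂ) : clmExp A (z + w) = clmExp A z * clmExp A w := by
  let _ : NormedAlgebra ℚ (V →L[ℂ] V) := NormedAlgebra.restrictScalars ℚ ℂ _
  rw [clmExp, add_smul, NormedSpace.exp_add_of_commute]
  · rfl
  · exact ((Commute.refl _).smul_left _).smul_right _

theorem hasDerivAt_clmExp (A : V →L[ℂ] V) (z : ℂ) :
    HasDerivAt (clmExp A) (clmExp A z * A) z := hasDerivAt_exp_smul_const A z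

theorem hasDerivAt_clmExp' (A : V →L[ℂ] V) (z : ℂ) :
    HasDerivAt (clmExp A) (A * clmExp A z) z := hasDerivAt_exp_smul_const' A z

theorem continuous_clmExp (A : V →L[ℂ] V) : Continuous (clmExp A) :=
  continuous_iff_continuousAt.2 fun z => (hasDerivAt_clmExp A z).continuousAt

theorem clmExp_pow (A : V →L[ℂ] V) (z : ℂ) (k : ℕ) : clmExp A z ^ k = clmExp A (k * z) := by
  induction k with
  | zero => simp [clmExp_zero]
  | succ k ih => rw [pow_succ, ih, ← clmExp_add]; push_cast; ring_nf

/-- The Duhamel interpolation in Banach spaces. -/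
theorem hasDerivAt_exp_interpolation
    (A : V →L[ℂ] V) (B : W →L[ℂ] W) (Φ : V →L[ℂ] W) (f : W →L[ℂ] ℂ) (s r : ℝ) (x : V) :
    HasDerivAt (fun r : ℝ => f (clmExp B r (Φ (clmExp A ((s - r : ℝ) : ℂ) x))))
      (f (clmExp B r (B (Φ (clmExp A ((s - r : ℝ) : ℂ) x))
        - Φ (A (clmExp A ((s - r : ℝ) : ℂ) x))))) r := by
  have h1 : HasDerivAt (fun z : ℂ => clmExp A ((s : ℂ) - z) x)
      (-(A (clmExp A ((s : ℂ) - r) x))) (r : ℂ) := by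
    have h0 : HasDerivAt (fun z : ℂ => (s : ℂ) - z) (-1) (r : ℂ) := by
      simpa using (hasDerivAt_id (r : ℂ)).const_sub (s : ℂ)
    have h := HasDerivAt.scomp (r : ℂ) (hasDerivAt_clmExp' A ((s : ℂ) - r)) h0
    have h' := h.clm_apply (hasDerivAt_const (r : ℂ) x)
    simpa using h'
  have h2 := Φ.hasFDerivAt.comp_hasDerivAt (r : ℂ) h1
  have h3 := (hasDerivAt_clmExp B (r : ℂ)).clm_apply h2
  have h4 := f.hasFDerivAt.comp_hasDerivAt (r : ℂ) h3
  have h5 := h4.comp_ofReal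
  convert h5 using 1
  · funext r
    simp
  · simp [sub_eq_add_neg]

theorem norm_pow_sub_pow_le {𝔸 : Type*} [NormedRing 𝔸] (a b : 𝔸) (M : ℝ) (hM : 0 ≤ M)
    (N : ℕ) (ha : ∀ k ≤ N, ‖a ^ k‖ ≤ M) (hb : ∀ k ≤ N, ‖b ^ k‖ ≤ M) :
    ‖a ^ N - b ^ N‖ ≤ N * (M * ‖a - b‖ * M) := by
  have : ∀ k ≤ N, ‖a ^ k * b ^ (N - k) - b ^ N‖ ≤ k * (M * ‖a - b‖ * M) := by
    intro k
    induction k with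
    | zero => simp
    | succ k ih =>
      intro hk
      have e : a ^ (k + 1) * b ^ (N - (k + 1)) - b ^ N
          = a ^ k * (a - b) * b ^ (N - (k + 1)) + (a ^ k * b ^ (N - k) - b ^ N) := by
        have : N - k = N - (k + 1) + 1 := by omega
        rw [this, pow_succ a, pow_succ' b]
        noncomm_ring
      rw [e]
      refine (norm_add_le _ _).trans ?_
      have h1 := ih (by omega)
      have h2 : ‖a ^ k * (a - b) * b ^ (N - (k + 1))‖ ≤ M * ‖a - b‖ * M := by
        refine (norm_mul_le _ _).trans (mul_le_mul ((norm_mul_le _ _).trans ?_) (hb _ (by omega))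
          (norm_nonneg _) (by positivity))
        exact mul_le_mul_of_nonneg_right (ha k (by omega)) (norm_nonneg _)
      push_cast
      linarith
  simpa using this N le_rfl

/-- Euler's scheme with a second order perturbation converges to the exponential. -/
theorem tendsto_euler (L R : V →L[ℂ] V) {t : ℝ} (ht : 0 ≤ t) :
    Tendsto (fun N : ℕ => (1 + ((t / N : ℝ) : ℂ) • L + (((t / N) ^ 2 : ℝ) : ℂ) • R) ^ N) atTop
      (𝓝 (clmExp L (t : ℂ))) := by
  set a : ℕ → V →L[ℂ] V := fun N => 1 + ((t / N : ℝ) : ℂ) • L + (((t / N) ^ 2 : ℝ) : ℂ) • R with ha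
  set b : ℕ → V →L[ℂ] V := fun N => clmExp L ((t / N : ℝ) : ℂ) with hb
  have hpow : ∀ N k : ℕ, b N ^ k = clmExp L ((k * (t / N) : ℝ) : ℂ) := fun N k => by
    rw [hb]
    simp only
    rw [clmExp_pow]
    push_cast
    rfl
  -- uniform bound on the powers of the exact step
  obtain ⟨M₁, hM₁⟩ : ∃ M : ℝ, ∀ s ∈ Set.Icc (0 : ℝ) t, ‖clmExp L (s : ℂ)‖ ≤ M := by
    have hc : Continuous fun s : ℝ => clmExp L (s : ℂ) :=
      (continuous_clmExp L).comp Complex.continuous_ofReal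
    exact isCompact_Icc.exists_bound_of_continuousOn hc.continuousOn
  set M₂ : ℝ := (‖(1 : (V →L[ℂ] V))‖ + 1) * Real.exp (t * (‖L‖ + t * ‖R‖)) with hM₂
  have hbb : ∀ N : ℕ, ∀ k ≤ N, ‖b N ^ k‖ ≤ max M₁ M₂ := fun N k hk => by
    rw [hpow]
    refine (hM₁ _ ⟨by positivity, ?_⟩).trans (le_max_left _ _)
    rcases Nat.eq_zero_or_pos N with rfl | hN
    · simpa using ht
    · have h0 : (0 : ℝ) < N := by exact_mod_cast hN
      have h1 : (k : ℝ) ≤ N := by exact_mod_cast hk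
      rw [mul_div_assoc', div_le_iff₀ h0]
      nlinarith
  have haa : ∀ N : ℕ, ∀ k ≤ N, ‖a N ^ k‖ ≤ max M₁ M₂ := fun N k hk => by
    refine le_trans ?_ (le_max_right _ _)
    rcases Nat.eq_zero_or_pos N with rfl | hN
    · obtain rfl : k = 0 := by omega
      rw [pow_zero, hM₂]
      have := Real.one_le_exp (x := t * (‖L‖ + t * ‖R‖)) (by positivity)
      nlinarith [norm_nonneg (1 : (V →L[ℂ] V))]
    · have h0 : (0 : ℝ) < N := by exact_mod_cast hN
      have h1 : (k : ℝ) ≤ N := by exact_mod_cast hk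
      have hN1 : (1 : ℝ) ≤ N := by exact_mod_cast hN
      set e : (V →L[ℂ] V) := ((t / N : ℝ) : ℂ) • L + (((t / N) ^ 2 : ℝ) : ℂ) • R with he
      have hen : ‖e‖ ≤ t * (‖L‖ + t * ‖R‖) / N := by
        refine (norm_add_le _ _).trans ?_
        rw [norm_smul, norm_smul, Complex.norm_real, Complex.norm_real,
          Real.norm_of_nonneg (by positivity), Real.norm_of_nonneg (by positivity)]
        have : (t / N) ^ 2 ≤ t ^ 2 / N := by
          rw [div_pow]
          exact div_le_div_of_nonneg_left (by positivity) h0 (by nlinarith)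
        calc t / N * ‖L‖ + (t / N) ^ 2 * ‖R‖ ≤ t / N * ‖L‖ + t ^ 2 / N * ‖R‖ := by
              gcongr
          _ = _ := by ring
      have key : ∀ j : ℕ, ‖(1 + e) ^ j‖ ≤ (‖(1 : (V →L[ℂ] V))‖ + 1) * (1 + ‖e‖) ^ j := by
        intro j
        induction j with
        | zero => simp
        | succ j ih =>
          have e1 : (1 + e) ^ (j + 1) = (1 + e) ^ j + (1 + e) ^ j * e := by
            rw [pow_succ]; noncomm_ring
          rw [e1]
          refine (norm_add_le _ _).trans ?_
          have := norm_mul_le ((1 + e) ^ j) e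
          have h3 := mul_le_mul_of_nonneg_right ih (norm_nonneg e)
          rw [pow_succ]
          linarith
      have e2 : a N = 1 + e := by rw [ha, he]; simp only; abel
      rw [e2]
      refine (key k).trans ?_
      rw [hM₂]
      refine mul_le_mul_of_nonneg_left ?_ (by positivity)
      calc (1 + ‖e‖) ^ k ≤ (Real.exp ‖e‖) ^ k := by
            refine pow_le_pow_left₀ (by positivity) ?_ _
            have := Real.add_one_le_exp ‖e‖
            linarith
        _ = Real.exp (k * ‖e‖) := by rw [← Real.exp_nat_mul]
        _ ≤ _ := by
          refine Real.exp_le_exp.2 ?_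
          calc (k : ℝ) * ‖e‖ ≤ N * (t * (‖L‖ + t * ‖R‖) / N) := by gcongr
            _ = _ := by field_simp
  set M := max M₁ M₂
  have hM : 0 ≤ M := le_trans (by positivity) (le_max_right M₁ M₂)
  -- the local error is `o(1/N)`
  have hloc : Tendsto (fun N : ℕ => (N : ℝ) * ‖a N - b N‖) atTop (𝓝 0) := by
    have hd : HasDerivAt (fun s : ℝ => (1 + ((s : ℂ)) • L + (((s) ^ 2 : ℝ) : ℂ) • R)
        - clmExp L (s : ℂ)) 0 0 := by
      have h1 : HasDerivAt (fun z : ℂ => (1 + z • L + (z ^ 2) • R)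
          - clmExp L z) 0 ((0 : ℝ) : ℂ) := by
        have e1 := ((hasDerivAt_id (0 : ℂ)).smul_const L).const_add 1
        have e2 := ((hasDerivAt_pow 2 (0 : ℂ))).smul_const R
        have e3 := hasDerivAt_clmExp L (0 : ℂ)
        have := (e1.add e2).sub e3
        rw [Complex.ofReal_zero]
        refine HasDerivAt.congr_deriv this ?_
        rw [clmExp_zero]
        simp
      have h2 := h1.scomp (0 : ℝ) Complex.ofRealCLM.hasDerivAt
      rw [smul_zero] at h2
      refine h2.congr_of_eventuallyEq (Eventually.of_forall fun s => ?_)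
      simp only [Function.comp_apply]
      push_cast
      rfl
    have h2 := hasDerivAt_iff_tendsto_slope_zero.1 hd
    rcases ht.eq_or_lt with rfl | ht'
    · have : ∀ N : ℕ, a N - b N = 0 := fun N => by simp [ha, hb, clmExp_zero]
      simp [this]
    · have h3 : Tendsto (fun N : ℕ => t / (N : ℝ)) atTop (𝓝[≠] 0) := by
        refine tendsto_nhdsWithin_iff.2 ⟨tendsto_const_div_atTop_nhds_zero_nat t, ?_⟩
        filter_upwards [eventually_gt_atTop 0] with N hN
        have h0 : (0 : ℝ) < N := by exact_mod_cast hN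
        exact (div_pos ht' h0).ne'
      have h4 := ((h2.comp h3).norm).const_mul t
      simp only [norm_zero, mul_zero] at h4
      refine h4.congr' ?_
      filter_upwards [eventually_gt_atTop 0] with N hN
      have h0 : (0 : ℝ) < N := by exact_mod_cast hN
      simp only [Function.comp_apply, zero_add, norm_smul, ha, hb]
      rw [Real.norm_of_nonneg (by positivity)]
      have e0 : (1 : V →L[ℂ] V) + ((0 : ℝ) : ℂ) • L + (((0 : ℝ) ^ 2 : ℝ) : ℂ) • R
          - clmExp L ((0 : ℝ) : ℂ) = 0 := by simp [clmExp_zero]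
      rw [e0, sub_zero, ← mul_assoc]
      congr 1
      field_simp
  have h5 : Tendsto (fun N : ℕ => a N ^ N - b N ^ N) atTop (𝓝 0) := by
    refine squeeze_zero_norm (fun N => norm_pow_sub_pow_le (a N) (b N) M hM N (haa N) (hbb N)) ?_
    have := hloc.const_mul (M * M)
    simp only [mul_zero] at this
    refine this.congr fun N => by ring
  have h6 : Tendsto (fun N : ℕ => b N ^ N) atTop (𝓝 (clmExp L (t : ℂ))) := by
    refine tendsto_const_nhds.congr' ?_
    filter_upwards [eventually_gt_atTop 0] with N hN
    have h0 : (N : ℝ) ≠ 0 := by exact_mod_cast hN.ne'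
    rw [hpow]
    congr 2
    field_simp
  have h7 := h5.add h6
  simp only [sub_add_cancel, zero_add] at h7
  exact h7

end Banach

variable [DecidableEq n] [DecidableEq κ]

/-- Coordinates of an operator in the basis of matrix units. -/
noncomputable def opCoord : Matrix n n ℂ ≃ₗ[ℂ] EuclideanSpace ℂ (n × n) :=
  (Matrix.stdBasis ℂ n n).equivFun.trans (WithLp.linearEquiv 2 ℂ (n × n → ℂ)).symm

/-- A superoperator in the coordinates of `opCoord`. -/
noncomputable def superCoord (𝓛 : SuperOp n) :
    EuclideanSpace ℂ (n × n) →L[ℂ] EuclideanSpace ℂ (n × n) :=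
  LinearMap.toContinuousLinearMap (opCoord.toLinearMap ∘ₗ 𝓛 ∘ₗ opCoord.symm.toLinearMap)

theorem superCoord_apply (𝓛 : SuperOp n) (v : EuclideanSpace ℂ (n × n)) :
    superCoord 𝓛 v = opCoord (𝓛 (opCoord.symm v)) := rfl

theorem evolution_eq (𝓛 : SuperOp n) (t : ℝ) (X : Matrix n n ℂ) :
    evolution 𝓛 t X = opCoord.symm (clmExp (superCoord 𝓛) t (opCoord X)) := by
  set b := Matrix.stdBasis ℂ n n
  let φ : Matrix (n × n) (n × n) ℂ ≃ₗ[ℂ]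
      (EuclideanSpace ℂ (n × n) →L[ℂ] EuclideanSpace ℂ (n × n)) :=
    (Matrix.toEuclideanCLM (𝕜 := ℂ) (n := n × n)).toAlgEquiv.toLinearEquiv
  set M := (t : ℂ) • LinearMap.toMatrix b b 𝓛
  have hM : φ M = (t : ℂ) • superCoord 𝓛 := by
    have h0 : φ (LinearMap.toMatrix b b 𝓛) = superCoord 𝓛 := by
      ext1 v
      change WithLp.toLp 2 (LinearMap.toMatrix b b 𝓛 *ᵥ v.ofLp) =
        WithLp.toLp 2 (b.equivFun (𝓛 (b.equivFun.symm v.ofLp)))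
      congr 1
      have := LinearMap.toMatrix_mulVec_repr b b 𝓛 (b.equivFun.symm v.ofLp)
      have e : ⇑(b.repr (b.equivFun.symm v.ofLp)) = v.ofLp := by
        rw [← b.equivFun_apply, LinearEquiv.apply_symm_apply]
      rw [e] at this
      rw [this, b.equivFun_apply]
    rw [← h0]
    exact φ.map_smul _ _
  have hpow : ∀ k : ℕ, φ (M ^ k) = φ M ^ k := fun k =>
    map_pow (Matrix.toEuclideanCLM (𝕜 := ℂ) (n := n × n)) M k
  have hs : HasSum (fun k : ℕ => (k.factorial⁻¹ : ℂ) • (φ M) ^ k) (NormedSpace.exp (φ M)) :=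
    NormedSpace.exp_series_hasSum_exp' (𝕂 := ℂ) _
  have hc : Continuous φ.symm.toLinearMap := LinearMap.continuous_of_finiteDimensional _
  have h2 := hs.map φ.symm.toLinearMap hc
  have h3 : NormedSpace.exp M = φ.symm (NormedSpace.exp (φ M)) := by
    rw [NormedSpace.exp_eq_tsum ℂ]
    refine HasSum.tsum_eq ?_
    have h4 : (fun k : ℕ => (k.factorial⁻¹ : ℂ) • M ^ k)
        = ⇑φ.symm.toLinearMap ∘ fun k : ℕ => (k.factorial⁻¹ : ℂ) • (φ M) ^ k := by
      funext k
      apply φ.injective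
      change φ ((k.factorial⁻¹ : ℂ) • M ^ k) = φ (φ.symm ((k.factorial⁻¹ : ℂ) • (φ M) ^ k))
      rw [LinearEquiv.apply_symm_apply, ← hpow]
      exact φ.map_smul _ _
    rw [h4]
    exact h2
  have h4 : φ (NormedSpace.exp M) = clmExp (superCoord 𝓛) t := by
    rw [h3, LinearEquiv.apply_symm_apply, hM, clmExp]
  rw [← h4]
  change Matrix.toLin b b (NormedSpace.exp M) X
    = b.equivFun.symm (NormedSpace.exp M *ᵥ b.equivFun X)
  apply b.equivFun.injective
  rw [LinearEquiv.apply_symm_apply, b.equivFun_apply, b.equivFun_apply,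
    ← LinearMap.toMatrix_mulVec_repr b b, LinearMap.toMatrix_toLin]

theorem evolution_zero (𝓛 : SuperOp n) (X : Matrix n n ℂ) : evolution 𝓛 0 X = X := by
  simp [evolution_eq, clmExp_zero]

theorem evolution_add (𝓛 : SuperOp n) (s t : ℝ) (X : Matrix n n ℂ) :
    evolution 𝓛 (s + t) X = evolution 𝓛 s (evolution 𝓛 t X) := by
  simp only [evolution_eq]
  rw [Complex.ofReal_add, clmExp_add]
  simp

/-- The interpolation `r ↦ f (e^{r 𝓛'} Φ e^{(s - r) 𝓛} X)` behind Duhamel's formula. -/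
theorem hasDerivAt_duhamel (𝓛 : SuperOp n) (𝓛' : SuperOp κ)
    (Φ : Matrix n n ℂ →ₗ[ℂ] Matrix κ κ ℂ) (f : Matrix κ κ ℂ →ₗ[ℂ] ℂ) (s r : ℝ) (X : Matrix n n ℂ) :
    HasDerivAt (fun r : ℝ => f (evolution 𝓛' r (Φ (evolution 𝓛 (s - r) X))))
      (f (evolution 𝓛' r (𝓛' (Φ (evolution 𝓛 (s - r) X)) - Φ (𝓛 (evolution 𝓛 (s - r) X))))) r := by
  have h := hasDerivAt_exp_interpolation (superCoord 𝓛) (superCoord 𝓛')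
    (LinearMap.toContinuousLinearMap (opCoord.toLinearMap ∘ₗ Φ ∘ₗ opCoord.symm.toLinearMap))
    (LinearMap.toContinuousLinearMap (f ∘ₗ opCoord.symm.toLinearMap)) s r (opCoord X)
  simp only [evolution_eq]
  simpa [superCoord_apply] using h

/-- Duhamel's formula, as an estimate: `b'` bounds the derivative of the interpolation. -/
theorem norm_duhamel_le (𝓛 : SuperOp n) (𝓛' : SuperOp κ)
    (Φ : Matrix n n ℂ →ₗ[ℂ] Matrix κ κ ℂ) (f : Matrix κ κ ℂ →ₗ[ℂ] ℂ) (X : Matrix n n ℂ)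
    {s : ℝ} (hs : 0 ≤ s) (b b' : ℝ → ℝ) (hb : ∀ r, HasDerivAt b (b' r) r)
    (h : ∀ r, 0 ≤ r → r ≤ s → ‖f (evolution 𝓛' r
      (𝓛' (Φ (evolution 𝓛 (s - r) X)) - Φ (𝓛 (evolution 𝓛 (s - r) X))))‖ ≤ b' r) :
    ‖f (evolution 𝓛' s (Φ X)) - f (Φ (evolution 𝓛 s X))‖ ≤ b s - b 0 := by
  set y : ℝ → ℂ := fun r => f (evolution 𝓛' r (Φ (evolution 𝓛 (s - r) X)))
  have hy := hasDerivAt_duhamel 𝓛 𝓛' Φ f s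
  have key := image_norm_le_of_norm_deriv_right_le_deriv_boundary' (a := 0) (b := s)
    (f := fun r => y r - y 0) (f' := fun r => f (evolution 𝓛' r
      (𝓛' (Φ (evolution 𝓛 (s - r) X)) - Φ (𝓛 (evolution 𝓛 (s - r) X)))))
    (B := fun r => b r - b 0) (B' := b')
    (fun r _ => ((hy r X).continuousAt.sub continuousAt_const).continuousWithinAt)
    (fun r _ => ((hy r X).sub_const _).hasDerivWithinAt) (by simp)
    (fun r _ => ((hb r).continuousAt.sub continuousAt_const).continuousWithinAt)
    (fun r _ => ((hb r).sub_const _).hasDerivWithinAt)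
    (fun r hr => h r hr.1 hr.2.le)
  have := key (Set.right_mem_Icc.2 hs)
  simpa [y, evolution_zero] using this

/-- A linear map that intertwines two generators intertwines the evolutions. -/
theorem evolution_intertwine (𝓛 : SuperOp n) (𝓛' : SuperOp κ)
    (Φ : Matrix n n ℂ →ₗ[ℂ] Matrix κ κ ℂ) (h : ∀ X, 𝓛' (Φ X) = Φ (𝓛 X)) (X : Matrix n n ℂ)
    {s : ℝ} (hs : 0 ≤ s) : evolution 𝓛' s (Φ X) = Φ (evolution 𝓛 s X) := by
  ext i j
  have := norm_duhamel_le 𝓛 𝓛' Φ (Matrix.entryLinearMap ℂ ℂ i j) X hs (fun _ => 0) (fun _ => 0)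
    (fun r => hasDerivAt_const r 0) (fun r _ _ => by rw [h]; simp)
  have h0 : ‖evolution 𝓛' s (Φ X) i j - Φ (evolution 𝓛 s X) i j‖ ≤ 0 := by simpa using this
  exact sub_eq_zero.1 (norm_le_zero_iff.1 h0)

/-- Euler's scheme for the evolution of an operator. -/
theorem tendsto_euler_evolution (𝓛 R : SuperOp n) (X : Matrix n n ℂ) {t : ℝ} (ht : 0 ≤ t) :
    Tendsto (fun N : ℕ => ((1 + ((t / N : ℝ) : ℂ) • 𝓛 + (((t / N) ^ 2 : ℝ) : ℂ) • R :
      Module.End ℂ (Matrix n n ℂ)) ^ N) X) atTop (𝓝 (evolution 𝓛 t X)) := by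
  have h := tendsto_euler (superCoord 𝓛) (superCoord R) ht
  have h1 : Continuous (opCoord (n := n)).symm.toLinearMap :=
    LinearMap.continuous_of_finiteDimensional _
  have h2 : Continuous fun A : EuclideanSpace ℂ (n × n) →L[ℂ] EuclideanSpace ℂ (n × n) =>
      opCoord.symm.toLinearMap (A (opCoord X)) :=
    h1.comp (continuous_id.clm_apply continuous_const)
  have h3 := (h2.tendsto _).comp h
  rw [evolution_eq]
  refine h3.congr fun N => ?_
  simp only [Function.comp_apply]
  generalize ((t / N : ℝ) : ℂ) = c
  generalize (((t / N) ^ 2 : ℝ) : ℂ) = d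
  induction N with
  | zero => simp
  | succ N ih =>
    rw [pow_succ', pow_succ']
    simp only [Module.End.mul_apply, mul_apply_eq_comp]
    rw [← ih]
    apply opCoord.injective
    simp [superCoord_apply]

end Evolution

end

section

open scoped Matrix.Norms.L2Operator ComplexOrder
open Matrix Filter Topology

/-! ### Lindblad forms -/

section Lindblad

variable {n : Type} [Fintype n]

/-- `M` is the generator `X ↦ ∑ L_j X L_j† + G X + X G†` with the effective (non-Hermitian)
Hamiltonian `G` and the jump operators `L_j`; the normalization makes it trace annihilating. -/
def IsLForm (M : SuperOp n) (G : Matrix n n ℂ) {ι : Type} [Fintype ι] (L : ι → Matrix n n ℂ) :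
    Prop :=
  (∀ X, M X = ∑ j, L j * X * (L j)ᴴ + G * X + X * Gᴴ) ∧ G + Gᴴ + ∑ j, (L j)ᴴ * L j = 0

/-- `M` has a Lindblad form with some finite family of jump operators. -/
def HasLForm (M : SuperOp n) : Prop :=
  ∃ (ι : Type) (_ : Fintype ι) (G : Matrix n n ℂ) (L : ι → Matrix n n ℂ), IsLForm M G L

theorem IsLindbladian.exists_isLForm {M : SuperOp n} (h : IsLindbladian M) :
    ∃ (m : ℕ) (G : Matrix n n ℂ) (L : Fin m → Matrix n n ℂ), IsLForm M G L := by
  obtain ⟨H, m, J, hH, hM⟩ := h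
  refine ⟨m, -(Complex.I • H) - (1 / 2 : ℂ) • ∑ j, (J j)ᴴ * J j, J, fun X => ?_, ?_⟩
  · rw [hM X, Finset.sum_sub_distrib, ← Finset.smul_sum, Finset.sum_add_distrib]
    have e1 : (∑ j, (J j)ᴴ * J j)ᴴ = ∑ j, (J j)ᴴ * J j := by
      simp [conjTranspose_sum]
    rw [conjTranspose_sub, conjTranspose_neg, conjTranspose_smul, conjTranspose_smul, e1, hH.eq,
      ← Finset.sum_mul, ← Finset.mul_sum]
    simp only [sub_mul, mul_sub, neg_mul, mul_neg, smul_mul_assoc, mul_smul_comm, smul_sub,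
      smul_add]
    simp
    module
  · have e1 : (∑ j, (J j)ᴴ * J j)ᴴ = ∑ j, (J j)ᴴ * J j := by
      simp [conjTranspose_sum]
    rw [conjTranspose_sub, conjTranspose_neg, conjTranspose_smul, conjTranspose_smul, e1, hH.eq]
    simp
    module

theorem IsLindbladian.hasLForm {M : SuperOp n} (h : IsLindbladian M) : HasLForm M := by
  obtain ⟨m, G, L, h⟩ := h.exists_isLForm
  exact ⟨Fin m, inferInstance, G, L, h⟩

theorem HasLForm.zero : HasLForm (0 : SuperOp n) :=
  ⟨Empty, inferInstance, 0, fun _ => 0, by simp [IsLForm]⟩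

theorem HasLForm.add {M N : SuperOp n} (hM : HasLForm M) (hN : HasLForm N) : HasLForm (M + N) := by
  obtain ⟨ι, _, G, L, h1, h2⟩ := hM
  obtain ⟨ι', _, G', L', h1', h2'⟩ := hN
  refine ⟨ι ⊕ ι', inferInstance, G + G', Sum.elim L L', fun X => ?_, ?_⟩
  · simp only [LinearMap.add_apply, h1, h1', Fintype.sum_sum_type, Sum.elim_inl, Sum.elim_inr,
      conjTranspose_add, add_mul, mul_add]
    abel
  · simp only [Fintype.sum_sum_type, Sum.elim_inl, Sum.elim_inr, conjTranspose_add]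
    calc _ = (G + Gᴴ + ∑ j, (L j)ᴴ * L j) + (G' + G'ᴴ + ∑ j, (L' j)ᴴ * L' j) := by abel
      _ = 0 := by rw [h2, h2', add_zero]

theorem HasLForm.sum {α : Type*} (s : Finset α) (M : α → SuperOp n) (h : ∀ i ∈ s, HasLForm (M i)) :
    HasLForm (∑ i ∈ s, M i) := by
  classical
  induction s using Finset.induction_on with
  | empty => simpa using HasLForm.zero
  | insert a s ha ih =>
    rw [Finset.sum_insert ha]
    exact (h a (Finset.mem_insert_self _ _)).add (ih fun i hi => h i (Finset.mem_insert_of_mem hi))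

theorem IsLForm.trace_eq_zero {M : SuperOp n} {G : Matrix n n ℂ} {ι : Type} [Fintype ι]
    {L : ι → Matrix n n ℂ} (h : IsLForm M G L) (X : Matrix n n ℂ) : (M X).trace = 0 := by
  rw [h.1]
  have e : ((G + Gᴴ + ∑ j, (L j)ᴴ * L j) * X).trace = 0 := by rw [h.2]; simp
  rw [add_mul, add_mul, Finset.sum_mul, trace_add, trace_add, trace_sum] at e
  rw [trace_add, trace_add, trace_sum]
  have e1 : ∀ j, (L j * X * (L j)ᴴ).trace = ((L j)ᴴ * L j * X).trace := fun j => by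
    rw [trace_mul_comm, ← Matrix.mul_assoc]
  simp only [e1]
  rw [trace_mul_comm X Gᴴ, ← e]
  ring

theorem HasLForm.trace_eq_zero {M : SuperOp n} (h : HasLForm M) (X : Matrix n n ℂ) :
    (M X).trace = 0 := by
  obtain ⟨ι, _, G, L, h⟩ := h
  exact h.trace_eq_zero X

theorem vnorm_add_sq (x y : n → ℂ) :
    vnorm (x + y) ^ 2 = vnorm x ^ 2 + 2 * (star x ⬝ᵥ y).re + vnorm y ^ 2 := by
  have h : ∀ z : n → ℂ, vnorm z ^ 2 = (star z ⬝ᵥ z).re := fun z => by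
    rw [star_dotProduct_self, Complex.ofReal_re]
  have h2 : (star y ⬝ᵥ x).re = (star x ⬝ᵥ y).re := by
    rw [star_dotProduct]; simp
  rw [h, h, h, star_add, add_dotProduct, dotProduct_add, dotProduct_add]
  simp only [Complex.add_re, h2]
  ring

theorem IsLForm.sum_re {M : SuperOp n} {G : Matrix n n ℂ} {ι : Type} [Fintype ι]
    {L : ι → Matrix n n ℂ} (h : IsLForm M G L) (x : n → ℂ) :
    2 * (star x ⬝ᵥ (G *ᵥ x)).re + ∑ j, vnorm (L j *ᵥ x) ^ 2 = 0 := by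
  have e : (star x ⬝ᵥ ((G + Gᴴ + ∑ j, (L j)ᴴ * L j) *ᵥ x)).re = 0 := by rw [h.2]; simp
  rw [add_mulVec, add_mulVec, sum_mulVec, dotProduct_add, dotProduct_add, dotProduct_sum,
    Complex.add_re, Complex.add_re, Complex.re_sum] at e
  have e1 : ∀ j, (star x ⬝ᵥ (((L j)ᴴ * L j) *ᵥ x)).re = vnorm (L j *ᵥ x) ^ 2 := fun j => by
    rw [← mulVec_mulVec, dotProduct_mulVec, ← star_mulVec, star_dotProduct_self, Complex.ofReal_re]
  have e2 : (star x ⬝ᵥ (Gᴴ *ᵥ x)).re = (star x ⬝ᵥ (G *ᵥ x)).re := by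
    rw [dotProduct_mulVec, ← star_mulVec, star_dotProduct]
    simp
  simp only [e1, e2] at e
  linarith

/-- The Kraus operators `1 + s G`, `√s L_j` of a short time step preserve the norm to first
order. -/
theorem IsLForm.kraus_norm {M : SuperOp n} {G : Matrix n n ℂ} {ι : Type} [Fintype ι]
    {L : ι → Matrix n n ℂ} (h : IsLForm M G L) (s : ℝ) (x : n → ℂ) :
    vnorm (x + (s : ℂ) • (G *ᵥ x)) ^ 2 + s * ∑ j, vnorm (L j *ᵥ x) ^ 2
      = vnorm x ^ 2 + s ^ 2 * vnorm (G *ᵥ x) ^ 2 := by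
  have := h.sum_re x
  rw [vnorm_add_sq, dotProduct_smul, smul_eq_mul, Complex.re_ofReal_mul, vnorm_smul,
    Complex.norm_real, mul_pow, Real.norm_eq_abs, sq_abs]
  linear_combination s * this

theorem vecMulVec_conj (A B : Matrix n n ℂ) (u v : n → ℂ) :
    A * vecMulVec u (star v) * Bᴴ = vecMulVec (A *ᵥ u) (star (B *ᵥ v)) := by
  rw [mul_vecMulVec, vecMulVec_mul, star_mulVec]

theorem isClosed_posSemidef : IsClosed {X : Matrix n n ℂ | X.PosSemidef} := by
  have : {X : Matrix n n ℂ | X.PosSemidef}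
      = {X | Xᴴ = X} ∩ ⋂ v : n → ℂ, {X | 0 ≤ (star v ⬝ᵥ (X *ᵥ v)).re} := by
    ext X
    simp only [Set.mem_ofPred_eq, Set.mem_inter_iff, Set.mem_iInter]
    constructor
    · intro h
      exact ⟨h.1, fun v => (Complex.le_def.1 (h.dotProduct_mulVec_nonneg v)).1⟩
    · rintro ⟨h1, h2⟩
      refine PosSemidef.of_dotProduct_mulVec_nonneg h1 fun v => ?_
      refine Complex.le_def.2 ⟨h2 v, ?_⟩
      have : star (star v ⬝ᵥ (X *ᵥ v)) = star v ⬝ᵥ (X *ᵥ v) := by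
        conv_lhs => rw [star_dotProduct, star_star, star_mulVec, h1, ← dotProduct_mulVec]
      have h3 := congrArg Complex.im this
      simp at h3 ⊢
      linarith
  rw [this]
  refine IsClosed.inter (isClosed_eq (by fun_prop) (by fun_prop)) (isClosed_iInter fun v => ?_)
  exact isClosed_le continuous_const (Complex.continuous_re.comp (by fun_prop))

variable [DecidableEq n]

/-- The second order perturbation `X + s M X + s² G X G†` of the Euler step is in Kraus form. -/
theorem IsLForm.kraus_eq {M : SuperOp n} {G : Matrix n n ℂ} {ι : Type} [Fintype ι]
    {L : ι → Matrix n n ℂ} (h : IsLForm M G L) (s : ℝ) (X : Matrix n n ℂ) :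
    X + (s : ℂ) • M X + ((s ^ 2 : ℝ) : ℂ) • (G * X * Gᴴ)
      = (1 + (s : ℂ) • G) * X * (1 + (s : ℂ) • G)ᴴ + (s : ℂ) • ∑ j, L j * X * (L j)ᴴ := by
  rw [h.1]
  simp only [conjTranspose_add, conjTranspose_one, conjTranspose_smul, add_mul, mul_add, one_mul,
    mul_one, smul_mul_assoc, mul_smul_comm, smul_add, smul_smul, Complex.star_def,
    Complex.conj_ofReal]
  push_cast
  module

/-- The superoperator `X ↦ G X G†`. -/
def sandwich (G : Matrix n n ℂ) : SuperOp n :=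
  LinearMap.mulLeft ℂ G ∘ₗ LinearMap.mulRight ℂ Gᴴ

theorem sandwich_apply (G X : Matrix n n ℂ) : sandwich G X = G * X * Gᴴ := by
  simp [sandwich, Matrix.mul_assoc]

theorem IsLForm.kraus_traceNorm_le {M : SuperOp n} {G : Matrix n n ℂ} {ι : Type} [Fintype ι]
    {L : ι → Matrix n n ℂ} (h : IsLForm M G L) {s : ℝ} (hs : 0 ≤ s) (X : Matrix n n ℂ) :
    traceNorm (X + (s : ℂ) • M X + ((s ^ 2 : ℝ) : ℂ) • sandwich G X)
      ≤ (1 + s ^ 2 * ‖G‖ ^ 2) * traceNorm X := by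
  obtain ⟨c, u, v, hc, hu, hv, hX, hsum, -⟩ := exists_svd X
  set T : SuperOp n := LinearMap.id + (s : ℂ) • M + ((s ^ 2 : ℝ) : ℂ) • sandwich G with hT
  have hTX : ∀ Y, T Y = Y + (s : ℂ) • M Y + ((s ^ 2 : ℝ) : ℂ) • sandwich G Y := fun Y => by
    simp [hT]
  rw [← hTX]
  have key : ∀ u v : n → ℂ, vnorm u ≤ 1 → vnorm v ≤ 1 →
      traceNorm (T (vecMulVec u (star v))) ≤ 1 + s ^ 2 * ‖G‖ ^ 2 := by
    intro u v hu hv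
    rw [hTX, sandwich_apply, h.kraus_eq]
    simp only [vecMulVec_conj]
    refine (traceNorm_add_le _ _).trans ?_
    have h1 := traceNorm_rankOne_le ((1 + (s : ℂ) • G) *ᵥ u) ((1 + (s : ℂ) • G) *ᵥ v)
    have h2 : traceNorm ((s : ℂ) • ∑ j, vecMulVec (L j *ᵥ u) (star (L j *ᵥ v)))
        ≤ s * ∑ j, vnorm (L j *ᵥ u) * vnorm (L j *ᵥ v) := by
      refine (traceNorm_smul _ _).trans ?_
      rw [Complex.norm_real, Real.norm_of_nonneg hs]
      refine mul_le_mul_of_nonneg_left ((traceNorm_sum_le _ _).trans ?_) hs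
      exact Finset.sum_le_sum fun j _ => traceNorm_rankOne_le _ _
    have e : ∀ w : n → ℂ, (1 + (s : ℂ) • G) *ᵥ w = w + (s : ℂ) • (G *ᵥ w) := fun w => by
      rw [add_mulVec, one_mulVec, smul_mulVec]
    have k1 := h.kraus_norm s u
    have k2 := h.kraus_norm s v
    have h3 : ∑ j, vnorm (L j *ᵥ u) * vnorm (L j *ᵥ v)
        ≤ (∑ j, vnorm (L j *ᵥ u) ^ 2 + ∑ j, vnorm (L j *ᵥ v) ^ 2) / 2 := by
      rw [← Finset.sum_add_distrib, Finset.sum_div]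
      refine Finset.sum_le_sum fun j _ => ?_
      nlinarith [sq_nonneg (vnorm (L j *ᵥ u) - vnorm (L j *ᵥ v))]
    have h4 := mul_le_mul_of_nonneg_left h3 hs
    rw [e, e] at h1
    have hG : ∀ w : n → ℂ, vnorm w ≤ 1 →
        vnorm w ^ 2 + s ^ 2 * vnorm (G *ᵥ w) ^ 2 ≤ 1 + s ^ 2 * ‖G‖ ^ 2 := fun w hw => by
      have h5 : vnorm (G *ᵥ w) ≤ ‖G‖ := (vnorm_mulVec_le G w).trans
        (mul_le_of_le_one_right (norm_nonneg _) hw)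
      have h6 : vnorm (G *ᵥ w) ^ 2 ≤ ‖G‖ ^ 2 := pow_le_pow_left₀ (vnorm_nonneg _) h5 2
      have h7 : vnorm w ^ 2 ≤ 1 := pow_le_one₀ (vnorm_nonneg _) hw
      nlinarith [sq_nonneg s]
    rw [e, e]
    nlinarith [sq_nonneg (vnorm (u + (s : ℂ) • (G *ᵥ u)) - vnorm (v + (s : ℂ) • (G *ᵥ v))),
      hG u hu, hG v hv]
  rw [← hsum, Finset.mul_sum]
  conv_lhs => rw [hX, map_sum]
  refine (traceNorm_sum_le _ _).trans (Finset.sum_le_sum fun i _ => ?_)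
  rw [map_smul]
  refine (traceNorm_smul _ _).trans ?_
  rw [Complex.norm_real, Real.norm_of_nonneg (hc i), mul_comm]
  exact mul_le_mul_of_nonneg_right (key _ _ (hu i) (hv i)) (hc i)

theorem tendsto_one_add_div_sq_pow (c : ℝ) (hc : 0 ≤ c) :
    Tendsto (fun N : ℕ => (1 + c / (N : ℝ) ^ 2) ^ N) atTop (𝓝 1) := by
  have h1 : Tendsto (fun N : ℕ => Real.exp (c / N)) atTop (𝓝 1) := by
    have := (Real.continuous_exp.tendsto 0).comp (tendsto_const_div_atTop_nhds_zero_nat c)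
    simpa [Function.comp_def] using this
  refine tendsto_of_tendsto_of_tendsto_of_le_of_le' tendsto_const_nhds h1
    (Eventually.of_forall fun N => one_le_pow₀ (by have : 0 ≤ c / (N : ℝ) ^ 2 := by positivity
                                                   linarith)) ?_
  filter_upwards [eventually_gt_atTop 0] with N hN
  have h0 : (0 : ℝ) < N := by exact_mod_cast hN
  calc (1 + c / (N : ℝ) ^ 2) ^ N ≤ (Real.exp (c / (N : ℝ) ^ 2)) ^ N := by
        refine pow_le_pow_left₀ (by positivity) ?_ _
        have := Real.add_one_le_exp (c / (N : ℝ) ^ 2)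
        linarith
    _ = Real.exp (c / N) := by
        rw [← Real.exp_nat_mul]
        congr 1
        field_simp

theorem traceNorm_pow_apply_le (T : Module.End ℂ (Matrix n n ℂ)) {c : ℝ} (hc : 0 ≤ c)
    (hT : ∀ Y, traceNorm (T Y) ≤ c * traceNorm Y) (k : ℕ) (X : Matrix n n ℂ) :
    traceNorm ((T ^ k) X) ≤ c ^ k * traceNorm X := by
  induction k with
  | zero => simp
  | succ k ih =>
    rw [pow_succ', pow_succ', Module.End.mul_apply, mul_assoc]
    exact (hT _).trans (mul_le_mul_of_nonneg_left ih hc)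

/-- Lindblad evolutions are contractions for the trace norm. -/
theorem HasLForm.traceNorm_evolution_le {M : SuperOp n} (h : HasLForm M) {t : ℝ} (ht : 0 ≤ t)
    (X : Matrix n n ℂ) : traceNorm (evolution M t X) ≤ traceNorm X := by
  obtain ⟨ι, _, G, L, h⟩ := h
  rw [traceNorm_le_iff]
  intro O hO
  have h1 := tendsto_euler_evolution M (sandwich G) X ht
  have hc : Continuous fun Y : Matrix n n ℂ => ‖(O * Y).trace‖ := by fun_prop
  have h2 := (hc.tendsto _).comp h1
  have h3 := (tendsto_one_add_div_sq_pow (t ^ 2 * ‖G‖ ^ 2) (by positivity)).mul_const (traceNorm X)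
  rw [one_mul] at h3
  refine le_of_tendsto_of_tendsto' h2 h3 fun N => ?_
  simp only [Function.comp_apply]
  refine ((traceNorm_le_iff _ _).1 le_rfl O hO).trans ?_
  have e : 1 + (t / N) ^ 2 * ‖G‖ ^ 2 = 1 + t ^ 2 * ‖G‖ ^ 2 / (N : ℝ) ^ 2 := by ring
  rw [← e]
  have hs : 0 ≤ t / N := by positivity
  refine traceNorm_pow_apply_le _ (add_nonneg zero_le_one (mul_nonneg (sq_nonneg _)
    (sq_nonneg _))) (fun Y => ?_) N X
  rw [LinearMap.add_apply, LinearMap.add_apply, LinearMap.smul_apply, LinearMap.smul_apply,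
    Module.End.one_apply]
  exact h.kraus_traceNorm_le hs Y

theorem evolution_zero_generator (t : ℝ) (X : Matrix n n ℂ) :
    evolution (0 : SuperOp n) t X = X := by
  have e : superCoord (0 : SuperOp n) = 0 := by ext1 v; simp [superCoord_apply]
  rw [evolution_eq, e, clmExp, smul_zero, NormedSpace.exp_zero]
  simp

theorem HasLForm.trace_evolution {M : SuperOp n} (h : HasLForm M) {t : ℝ} (ht : 0 ≤ t)
    (X : Matrix n n ℂ) : (evolution M t X).trace = X.trace := by
  have := norm_duhamel_le M 0 LinearMap.id (Matrix.traceLinearMap n ℂ ℂ) X ht (fun _ => 0)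
    (fun _ => 0) (fun r => hasDerivAt_const r 0) (fun r _ _ => by
      simp [evolution_zero_generator, h.trace_eq_zero])
  rw [evolution_zero_generator] at this
  have h0 : ‖X.trace - (evolution M t X).trace‖ ≤ 0 := by simpa using this
  exact (sub_eq_zero.1 (norm_le_zero_iff.1 h0)).symm

theorem HasLForm.posSemidef_evolution {M : SuperOp n} (h : HasLForm M) {t : ℝ} (ht : 0 ≤ t)
    {X : Matrix n n ℂ} (hX : X.PosSemidef) : (evolution M t X).PosSemidef := by
  obtain ⟨ι, _, G, L, h⟩ := h
  refine isClosed_posSemidef.mem_of_tendsto (tendsto_euler_evolution M (sandwich G) X ht)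
    (Eventually.of_forall fun N => ?_)
  simp only [Set.mem_ofPred_eq]
  have key : ∀ k : ℕ, (((1 + ((t / N : ℝ) : ℂ) • M + (((t / N) ^ 2 : ℝ) : ℂ) • sandwich G :
      Module.End ℂ (Matrix n n ℂ)) ^ k) X).PosSemidef := by
    intro k
    induction k with
    | zero => simpa using hX
    | succ k ih =>
      rw [pow_succ', Module.End.mul_apply]
      set Y := ((1 + ((t / N : ℝ) : ℂ) • M + (((t / N) ^ 2 : ℝ) : ℂ) • sandwich G :
        Module.End ℂ (Matrix n n ℂ)) ^ k) X
      have e := h.kraus_eq (t / N) Y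
      rw [← sandwich_apply] at e
      change (Y + ((t / N : ℝ) : ℂ) • M Y + (((t / N) ^ 2 : ℝ) : ℂ) • sandwich G Y).PosSemidef
      rw [e]
      refine (ih.mul_mul_conjTranspose_same _).add (PosSemidef.smul ?_ ?_)
      · exact posSemidef_sum _ fun j _ => ih.mul_mul_conjTranspose_same _
      · exact_mod_cast (by positivity : (0 : ℝ) ≤ t / N)
  exact key N

theorem HasLForm.isState_evolution {M : SuperOp n} (h : HasLForm M) {t : ℝ} (ht : 0 ≤ t)
    {X : Matrix n n ℂ} (hX : IsState X) : IsState (evolution M t X) :=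
  ⟨h.posSemidef_evolution ht hX.1, (h.trace_evolution ht X).trans hX.2⟩

end Lindblad

end

section

open scoped Matrix.Norms.L2Operator ComplexOrder
open Matrix

/-! ### Local operators, partial traces and extensions -/

section Tensor

variable {D : ℕ} {q : Site D → ℕ} {A B Z Λ : Finset (Site D)}

/-- The restriction of a configuration. -/
def restr (h : A ⊆ Λ) (a : Conf q Λ) : Conf q A := fun x => a ⟨x.1, h x.2⟩

/-- The operator `O ⊗ 1` on `Λ`, for `O` on `A ⊆ Λ`. -/
def emb (h : A ⊆ Λ) (O : Op q A) : Op q Λ :=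
  Matrix.of fun a b => if ∀ x : Λ, x.1 ∉ A → a x = b x then O (restr h a) (restr h b) else 0

theorem overwrite_mem (z : Conf q Z) (a : Conf q Λ) (x : Λ) (h : x.1 ∈ Z) :
    overwrite z a x = z ⟨x.1, h⟩ := by simp [overwrite, h]

theorem overwrite_not_mem (z : Conf q Z) (a : Conf q Λ) (x : Λ) (h : x.1 ∉ Z) :
    overwrite z a x = a x := by simp [overwrite, h]

theorem restr_overwrite (h : Z ⊆ Λ) (z : Conf q Z) (a : Conf q Λ) :
    restr h (overwrite z a) = z := by
  funext x; simp [restr, overwrite]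

theorem restr_overwrite_of_disjoint (h : A ⊆ Λ) (hd : Disjoint A Z) (z : Conf q Z)
    (a : Conf q Λ) : restr h (overwrite z a) = restr h a := by
  funext x; simp [restr, overwrite, Finset.disjoint_left.1 hd x.2]

theorem overwrite_comm (hd : Disjoint A Z) (c : Conf q A) (z : Conf q Z) (a : Conf q Λ) :
    overwrite c (overwrite z a) = overwrite z (overwrite c a) := by
  funext x
  by_cases h1 : x.1 ∈ A
  · simp [overwrite, h1, Finset.disjoint_left.1 hd h1]
  · by_cases h2 : x.1 ∈ Z <;> simp [overwrite, h1, h2]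

theorem overwrite_self (h : Z ⊆ Λ) (a b : Conf q Λ) (hab : ∀ x : Λ, x.1 ∉ Z → a x = b x) :
    overwrite (restr h b) a = b := by
  funext x
  by_cases h1 : x.1 ∈ Z
  · simp [overwrite, h1, restr]
  · simp [overwrite, h1, hab]

theorem emb_mul_apply (h : A ⊆ Λ) (O : Op q A) (X : Op q Λ) (a b : Conf q Λ) :
    (emb h O * X) a b = ∑ c : Conf q A, O (restr h a) c * X (overwrite c a) b := by
  rw [Matrix.mul_apply]
  symm
  refine Finset.sum_of_injOn (fun c => overwrite c a) ?_ (by simp) ?_ ?_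
  · intro c _ c' _ hc
    rw [← restr_overwrite h c a, ← restr_overwrite h c' a]
    exact congrArg _ hc
  · intro d _ hd
    rw [emb, Matrix.of_apply, if_neg, zero_mul]
    intro hx
    exact hd ⟨restr h d, by simp, overwrite_self h a d hx⟩
  · intro c _
    rw [emb, Matrix.of_apply, if_pos, restr_overwrite]
    intro x hx
    rw [overwrite_not_mem _ _ _ hx]

theorem mul_emb_apply (h : A ⊆ Λ) (O : Op q A) (X : Op q Λ) (a b : Conf q Λ) :
    (X * emb h O) a b = ∑ c : Conf q A, X a (overwrite c b) * O c (restr h b) := by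
  rw [Matrix.mul_apply]
  symm
  refine Finset.sum_of_injOn (fun c => overwrite c b) ?_ (by simp) ?_ ?_
  · intro c _ c' _ hc
    rw [← restr_overwrite h c b, ← restr_overwrite h c' b]
    exact congrArg _ hc
  · intro d _ hd
    rw [emb, Matrix.of_apply, if_neg, mul_zero]
    intro hx
    exact hd ⟨restr h d, by simp, overwrite_self h b d fun x hx' => (hx x hx').symm⟩
  · intro c _
    rw [emb, Matrix.of_apply, if_pos, restr_overwrite]
    intro x hx
    rw [overwrite_not_mem _ _ _ hx]

theorem emb_one (h : A ⊆ Λ) : emb h (1 : Op q A) = 1 := by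
  ext a b
  rw [emb, Matrix.of_apply]
  by_cases hab : a = b
  · subst hab; simp
  · rw [Matrix.one_apply_ne hab]
    split_ifs with h1
    · rw [Matrix.one_apply_ne]
      intro h2
      apply hab
      rw [← overwrite_self h a b h1, ← h2]
      exact (overwrite_self h a a fun _ _ => rfl).symm
    · rfl

theorem emb_mul (h : A ⊆ Λ) (O O' : Op q A) : emb h (O * O') = emb h O * emb h O' := by
  ext a b
  rw [emb_mul_apply]
  simp only [emb, Matrix.of_apply, restr_overwrite, Matrix.mul_apply]
  have e : ∀ c : Conf q A, (∀ x : Λ, x.1 ∉ A → overwrite c a x = b x) ↔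
      ∀ x : Λ, x.1 ∉ A → a x = b x := fun c =>
    forall_congr' fun x => forall_congr' fun hx => by rw [overwrite_not_mem _ _ _ hx]
  simp only [e]
  split_ifs <;> simp

theorem emb_add (h : A ⊆ Λ) (O O' : Op q A) : emb h (O + O') = emb h O + emb h O' := by
  ext a b
  simp only [emb, Matrix.of_apply, Matrix.add_apply]
  split_ifs <;> simp

theorem emb_smul (h : A ⊆ Λ) (c : ℂ) (O : Op q A) : emb h (c • O) = c • emb h O := by
  ext a b
  simp only [emb, Matrix.of_apply, Matrix.smul_apply]
  split_ifs <;> simp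

theorem emb_conjTranspose (h : A ⊆ Λ) (O : Op q A) : emb h Oᴴ = (emb h O)ᴴ := by
  ext a b
  simp only [emb, Matrix.of_apply, Matrix.conjTranspose_apply]
  simp only [eq_comm (a := b _)]
  split_ifs <;> simp

/-- The embedding `O ↦ O ⊗ 1` as a homomorphism of star algebras. -/
def embHom (h : A ⊆ Λ) : Op q A →⋆ₐ[ℂ] Op q Λ where
  toFun := emb h
  map_one' := emb_one h
  map_mul' := emb_mul h
  map_zero' := by ext a b; simp [emb]
  map_add' := emb_add h
  commutes' c := by
    rw [Algebra.algebraMap_eq_smul_one, Algebra.algebraMap_eq_smul_one, emb_smul, emb_one]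
  map_star' O := by rw [star_eq_conjTranspose, emb_conjTranspose, star_eq_conjTranspose]

theorem emb_sum (h : A ⊆ Λ) {ι : Type*} (s : Finset ι) (O : ι → Op q A) :
    emb h (∑ i ∈ s, O i) = ∑ i ∈ s, emb h (O i) := map_sum (embHom h) O s

theorem emb_zero (h : A ⊆ Λ) : emb h (0 : Op q A) = 0 := map_zero (embHom h)

theorem norm_emb_le (h : A ⊆ Λ) (O : Op q A) : ‖emb h O‖ ≤ ‖O‖ :=
  NonUnitalStarAlgHom.norm_apply_le (embHom h) O

theorem emb_emb (hAB : A ⊆ B) (hB : B ⊆ Λ) (O : Op q A) :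
    emb hB (emb hAB O) = emb (hAB.trans hB) O := by
  ext a b
  simp only [emb, Matrix.of_apply]
  by_cases h1 : ∀ x : Λ, x.1 ∉ A → a x = b x
  · have h2 : ∀ x : Λ, x.1 ∉ B → a x = b x := fun x hx => h1 x fun h => hx (hAB h)
    have h3 : ∀ x : B, x.1 ∉ A → restr hB a x = restr hB b x := fun x hx => h1 _ hx
    rw [if_pos h1, if_pos h2, if_pos h3]
    rfl
  · rw [if_neg h1]
    by_cases h2 : ∀ x : Λ, x.1 ∉ B → a x = b x
    · rw [if_pos h2, if_neg]
      intro h3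
      apply h1
      intro x hx
      by_cases hxB : x.1 ∈ B
      · exact h3 ⟨x.1, hxB⟩ hx
      · exact h2 x hxB
    · rw [if_neg h2]

/-- Splitting a configuration into its parts on `A` and off `A`. -/
def splitEquiv (h : A ⊆ Λ) : Conf q Λ ≃ Conf q A × Conf q (Λ \ A) where
  toFun a := (restr h a, restr Finset.sdiff_subset a)
  invFun p := join p.1 p.2
  left_inv a := by
    funext x
    by_cases hx : x.1 ∈ A <;> simp [join, hx, restr]
  right_inv p := by
    ext1
    · funext x; simp [restr, join]
    · funext x
      have := (Finset.mem_sdiff.1 x.2).2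
      simp [restr, join, this]

theorem splitEquiv_symm_apply (h : A ⊆ Λ) (p : Conf q A × Conf q (Λ \ A)) :
    (splitEquiv h).symm p = join p.1 p.2 := rfl

theorem restr_join (h : A ⊆ Λ) (c : Conf q A) (r : Conf q (Λ \ A)) : restr h (join c r) = c :=
  congrArg Prod.fst ((splitEquiv h).apply_symm_apply (c, r))

theorem overwrite_join (c c' : Conf q A) (r : Conf q (Λ \ A)) :
    overwrite c' (join c r : Conf q Λ) = join c' r := by
  funext x
  by_cases hx : x.1 ∈ A <;> simp [overwrite, join, hx]

theorem trace_emb_mul (h : A ⊆ Λ) (O : Op q A) (X : Op q Λ) :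
    (emb h O * X).trace = (O * reduced A X).trace := by
  simp only [Matrix.trace, Matrix.diag_apply, emb_mul_apply]
  rw [← (splitEquiv h).symm.sum_comp, Fintype.sum_prod_type]
  refine Finset.sum_congr rfl fun a _ => ?_
  rw [Finset.sum_comm, Matrix.mul_apply]
  refine Finset.sum_congr rfl fun c _ => ?_
  simp only [splitEquiv_symm_apply, restr_join, overwrite_join, reduced, Matrix.of_apply,
    Finset.mul_sum]

theorem ext_of_trace_mul {n : Type} [Fintype n] [DecidableEq n] {X Y : Matrix n n ℂ}
    (h : ∀ O : Matrix n n ℂ, (O * X).trace = (O * Y).trace) : X = Y :=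
  Matrix.ext_iff_trace_mul_left.2 h

theorem reduced_reduced (hAB : A ⊆ B) (hB : B ⊆ Λ) (X : Op q Λ) :
    reduced A (reduced B X) = reduced A X := by
  refine ext_of_trace_mul fun O => ?_
  rw [← trace_emb_mul hAB, ← trace_emb_mul hB, emb_emb, trace_emb_mul]

/-- The partial trace as a linear map. -/
def reducedLin (A Λ : Finset (Site D)) : Op q Λ →ₗ[ℂ] Op q A where
  toFun X := reduced A X
  map_add' X Y := by
    ext a b; simp [reduced, Finset.sum_add_distrib]
  map_smul' c X := by
    ext a b; simp [reduced, Finset.mul_sum]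

theorem reducedLin_apply (X : Op q Λ) : reducedLin A Λ X = reduced A X := rfl

theorem trace_reduced (h : A ⊆ Λ) (X : Op q Λ) : (reduced A X).trace = X.trace := by
  have := trace_emb_mul h 1 X
  rw [emb_one, one_mul, one_mul] at this
  exact this.symm

theorem posSemidef_reduced {X : Op q Λ} (hX : X.PosSemidef) : (reduced A X).PosSemidef := by
  have : reduced A X = ∑ r : Conf q (Λ \ A), X.submatrix (fun a => join a r) fun a => join a r := by
    ext a b; simp [reduced, Matrix.sum_apply]
  rw [this]
  exact posSemidef_sum _ fun r _ => hX.submatrix _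

theorem isState_reduced (h : A ⊆ Λ) {X : Op q Λ} (hX : IsState X) : IsState (reduced A X) :=
  ⟨posSemidef_reduced hX.1, (trace_reduced h X).trans hX.2⟩

theorem traceNorm_reduced_le (h : A ⊆ Λ) (X : Op q Λ) :
    traceNorm (reduced A X) ≤ traceNorm X := by
  rw [traceNorm_le_iff]
  intro O hO
  rw [← trace_emb_mul h]
  exact (traceNorm_le_iff X _).1 le_rfl _ ((norm_emb_le h O).trans hO)

theorem extend_apply (h : Z ⊆ Λ) (T : SuperOp (Conf q Z)) (X : Op q Λ) (a b : Conf q Λ) :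
    extend h T X a b = T (Matrix.of fun z w => X (overwrite z a) (overwrite w b))
      (restr h a) (restr h b) := rfl

/-- A superoperator on `Z` commutes with multiplication by operators off `Z`. -/
theorem extend_emb_mul (h : Z ⊆ Λ) (hA : A ⊆ Λ) (hd : Disjoint A Z) (T : SuperOp (Conf q Z))
    (O : Op q A) (X : Op q Λ) : extend h T (emb hA O * X) = emb hA O * extend h T X := by
  ext a b
  rw [emb_mul_apply, extend_apply]
  have e : (Matrix.of fun z w => (emb hA O * X) (overwrite z a) (overwrite w b) : Op q Z)
      = ∑ c : Conf q A, O (restr hA a) c •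
        (Matrix.of fun z w => X (overwrite z (overwrite c a)) (overwrite w b) : Op q Z) := by
    ext z w
    simp only [Matrix.of_apply, emb_mul_apply, Matrix.sum_apply, Matrix.smul_apply, smul_eq_mul,
      restr_overwrite_of_disjoint hA hd, overwrite_comm hd]
  rw [e, map_sum, Matrix.sum_apply]
  refine Finset.sum_congr rfl fun c _ => ?_
  rw [map_smul, extend_apply, Matrix.smul_apply, smul_eq_mul,
    restr_overwrite_of_disjoint h hd.symm]

theorem extend_mul_emb (h : Z ⊆ Λ) (hA : A ⊆ Λ) (hd : Disjoint A Z) (T : SuperOp (Conf q Z))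
    (O : Op q A) (X : Op q Λ) : extend h T (X * emb hA O) = extend h T X * emb hA O := by
  ext a b
  rw [mul_emb_apply, extend_apply]
  have e : (Matrix.of fun z w => (X * emb hA O) (overwrite z a) (overwrite w b) : Op q Z)
      = ∑ c : Conf q A, O c (restr hA b) •
        (Matrix.of fun z w => X (overwrite z a) (overwrite w (overwrite c b)) : Op q Z) := by
    ext z w
    simp only [Matrix.of_apply, mul_emb_apply, Matrix.sum_apply, Matrix.smul_apply, smul_eq_mul,
      restr_overwrite_of_disjoint hA hd, overwrite_comm hd, mul_comm]
  rw [e, map_sum, Matrix.sum_apply]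
  refine Finset.sum_congr rfl fun c _ => ?_
  rw [map_smul, extend_apply, Matrix.smul_apply, smul_eq_mul,
    restr_overwrite_of_disjoint h hd.symm, mul_comm]

/-- The superoperator `X ↦ P X Q`. -/
def mulBoth {n : Type} [Fintype n] (P Q : Matrix n n ℂ) : SuperOp n :=
  LinearMap.mulLeft ℂ P ∘ₗ LinearMap.mulRight ℂ Q

theorem mulBoth_apply {n : Type} [Fintype n] (P Q X : Matrix n n ℂ) :
    mulBoth P Q X = P * X * Q := by simp [mulBoth, Matrix.mul_assoc]

theorem extend_mulBoth (h : Z ⊆ Λ) (P Q : Op q Z) (X : Op q Λ) :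
    extend h (mulBoth P Q) X = emb h P * X * emb h Q := by
  ext a b
  rw [mul_emb_apply, extend_apply, mulBoth_apply, Matrix.mul_apply]
  refine Finset.sum_congr rfl fun c _ => ?_
  rw [emb_mul_apply, Matrix.mul_apply]
  rfl

theorem emb_mul_emb_comm (hA : A ⊆ Λ) (hZ : Z ⊆ Λ) (hd : Disjoint A Z) (O : Op q A) (P : Op q Z) :
    emb hA O * emb hZ P = emb hZ P * emb hA O := by
  have := extend_emb_mul hZ hA hd (mulBoth P 1) O 1
  rw [extend_mulBoth, extend_mulBoth] at this
  simpa [emb_one] using this.symm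

theorem extend_add (h : Z ⊆ Λ) (T T' : SuperOp (Conf q Z)) :
    extend h (T + T') = extend h T + extend h T' := by
  ext1 X; rfl

theorem extend_zero (h : Z ⊆ Λ) : extend h (0 : SuperOp (Conf q Z)) = 0 := by
  ext1 X; rfl

theorem extend_sum (h : Z ⊆ Λ) {ι : Type*} (s : Finset ι) (T : ι → SuperOp (Conf q Z)) :
    extend h (∑ i ∈ s, T i) = ∑ i ∈ s, extend h (T i) := by
  classical
  induction s using Finset.induction_on with
  | empty => simp [extend_zero]
  | insert a s ha ih => rw [Finset.sum_insert ha, Finset.sum_insert ha, extend_add, ih]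

theorem IsLForm.extend {M : SuperOp (Conf q Z)} {G : Op q Z} {ι : Type} [Fintype ι]
    {L : ι → Op q Z} (hM : IsLForm M G L) (h : Z ⊆ Λ) :
    IsLForm (extend h M) (emb h G) (fun j => emb h (L j)) := by
  refine ⟨fun X => ?_, ?_⟩
  · have e : M = ∑ j, mulBoth (L j) (L j)ᴴ + mulBoth G 1 + mulBoth 1 Gᴴ := by
      ext1 Y
      rw [hM.1]
      simp [mulBoth_apply]
    rw [e, extend_add, extend_add, extend_sum]
    simp [extend_mulBoth, emb_one, emb_conjTranspose]
  · have := congrArg (emb h) hM.2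
    rw [emb_zero, emb_add, emb_add, emb_sum] at this
    simpa [emb_mul, emb_conjTranspose] using this

theorem HasLForm.extend {M : SuperOp (Conf q Z)} (hM : HasLForm M) (h : Z ⊆ Λ) :
    HasLForm (extend h M) := by
  obtain ⟨ι, _, G, L, hM⟩ := hM
  exact ⟨ι, inferInstance, _, _, hM.extend h⟩

theorem extend_extend (hZ : Z ⊆ B) (hB : B ⊆ Λ) (T : SuperOp (Conf q Z)) :
    extend hB (extend hZ T) = extend (hZ.trans hB) T := by
  ext1 X
  ext a b
  rw [extend_apply, extend_apply, extend_apply]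
  have e1 : ∀ (z : Conf q Z) (a : Conf q Λ),
      overwrite (overwrite z (restr hB a)) a = overwrite z a := by
    intro z a
    funext x
    by_cases h1 : x.1 ∈ Z
    · simp [overwrite, h1, hZ h1]
    · by_cases h2 : x.1 ∈ B <;> simp [overwrite, h1, h2, restr]
  simp only [Matrix.of_apply, e1]
  rfl

theorem reduced_extend (hZ : Z ⊆ B) (hB : B ⊆ Λ) (T : SuperOp (Conf q Z)) (X : Op q Λ) :
    reduced B (extend (hZ.trans hB) T X) = extend hZ T (reduced B X) := by
  ext a b
  rw [extend_apply]
  have e : (Matrix.of fun z w => reduced B X (overwrite z a) (overwrite w b) : Op q Z)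
      = ∑ r : Conf q (Λ \ B), (Matrix.of fun z w =>
        X (overwrite z (join a r)) (overwrite w (join b r)) : Op q Z) := by
    have e1 : ∀ (z : Conf q Z) (a : Conf q B) (r : Conf q (Λ \ B)),
        (overwrite z (join a r) : Conf q Λ) = join (overwrite z a) r := by
      intro z a r
      funext x
      by_cases h1 : x.1 ∈ Z
      · simp [overwrite, join, h1, hZ h1]
      · by_cases h2 : x.1 ∈ B <;> simp [overwrite, join, h1, h2]
    ext z w
    simp [reduced, Matrix.sum_apply, e1]
  rw [e, map_sum, Matrix.sum_apply]
  simp only [reduced, Matrix.of_apply, extend_apply]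
  refine Finset.sum_congr rfl fun r _ => ?_
  have e2 : ∀ a : Conf q B, restr (hZ.trans hB) (join a r : Conf q Λ) = restr hZ a := by
    intro a
    funext x
    simp [restr, join, hZ x.2]
  rw [e2, e2]

end Tensor

/-! ### The diamond norm and extensions -/

section Diamond

variable {n κ : Type} [Fintype n] [DecidableEq n] [Fintype κ] [DecidableEq κ]

/-- The superoperator `T ⊗ id` on `M_n ⊗ M_κ`. -/
def amp (κ : Type) (T : SuperOp n) : SuperOp (n × κ) where
  toFun X := Matrix.of fun a b => T (Matrix.of fun i j => X (i, a.2) (j, b.2)) a.1 b.1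
  map_add' X Y := by
    ext a b
    exact congrFun (congrFun (T.map_add (Matrix.of fun i j => X (i, a.2) (j, b.2))
      (Matrix.of fun i j => Y (i, a.2) (j, b.2))) a.1) b.1
  map_smul' c X := by
    ext a b
    exact congrFun (congrFun (T.map_smul c (Matrix.of fun i j => X (i, a.2) (j, b.2))) a.1) b.1

theorem traceNorm_eq_zero {X : Matrix n n ℂ} : traceNorm X = 0 ↔ X = 0 := by
  refine ⟨fun h => ?_, fun h => by rw [h, traceNorm_zero]⟩
  ext i j
  have := norm_apply_le_traceNorm X i j
  rw [h] at this
  simpa using this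

theorem traceNorm_amp_le (T : SuperOp n) (hT : diamondNorm T ≠ ⊤) (X : Matrix (n × κ) (n × κ) ℂ) :
    traceNorm (amp κ T X) ≤ (diamondNorm T).toReal * traceNorm X := by
  by_cases hX : X = 0
  · rw [hX, map_zero, traceNorm_zero, mul_zero]
  set k := Fintype.card κ
  let e : n × Fin k ≃ n × κ := (Equiv.refl n).prodCongr (Fintype.equivFin κ).symm
  have h1 : (amp κ T X).submatrix e e = ampliate k T (X.submatrix e e) := rfl
  rw [← traceNorm_reindex e (amp κ T X), ← traceNorm_reindex e X, h1]
  have hX' : X.submatrix e e ≠ 0 := by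
    intro h
    apply hX
    ext i j
    have := congrFun (congrFun h (e.symm i)) (e.symm j)
    simpa using this
  have hpos : 0 < traceNorm (X.submatrix e e) :=
    lt_of_le_of_ne (traceNorm_nonneg _) fun h => hX' (traceNorm_eq_zero.1 h.symm)
  have h2 : ENNReal.ofReal (traceNorm (ampliate k T (X.submatrix e e)) / traceNorm (X.submatrix e e))
      ≤ diamondNorm T := by
    unfold diamondNorm
    exact le_iSup_of_le k (le_iSup_of_le (X.submatrix e e) (le_iSup_of_le hX' le_rfl))
  have h3 := ENNReal.toReal_mono hT h2
  rw [ENNReal.toReal_ofReal (div_nonneg (traceNorm_nonneg _) hpos.le), div_le_iff₀ hpos] at h3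
  exact h3

variable {D : ℕ} {q : Site D → ℕ} {Z Λ : Finset (Site D)}

theorem traceNorm_amp_extend_le (h : Z ⊆ Λ) (T : SuperOp (Conf q Z)) (hT : diamondNorm T ≠ ⊤)
    (X : Matrix (Conf q Λ × κ) (Conf q Λ × κ) ℂ) :
    traceNorm (amp κ (extend h T) X) ≤ (diamondNorm T).toReal * traceNorm X := by
  let e : Conf q Z × (Conf q (Λ \ Z) × κ) ≃ Conf q Λ × κ :=
    (Equiv.prodAssoc _ _ _).symm.trans ((splitEquiv h).symm.prodCongr (Equiv.refl κ))
  have h1 : (amp κ (extend h T) X).submatrix e e = amp (Conf q (Λ \ Z) × κ) T (X.submatrix e e) := by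
    ext a b
    obtain ⟨a1, a2, a3⟩ := a
    obtain ⟨b1, b2, b3⟩ := b
    change T _ (restr h (join a1 a2)) (restr h (join b1 b2)) = _
    rw [restr_join, restr_join]
    have e1 : (Matrix.of fun z w => X (overwrite z (join a1 a2), a3) (overwrite w (join b1 b2), b3) :
        Op q Z) = Matrix.of fun z w => X (join z a2, a3) (join w b2, b3) := by
      simp only [overwrite_join]
    exact congrArg (fun Y => T Y a1 b1) e1
  rw [← traceNorm_reindex e, ← traceNorm_reindex e X, h1]
  exact traceNorm_amp_le T hT _

theorem traceNorm_extend_le (h : Z ⊆ Λ) (T : SuperOp (Conf q Z)) (hT : diamondNorm T ≠ ⊤)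
    (X : Op q Λ) : traceNorm (extend h T X) ≤ (diamondNorm T).toReal * traceNorm X := by
  let e : Conf q Λ × Unit ≃ Conf q Λ := Equiv.prodPUnit _
  have := traceNorm_amp_extend_le (κ := Unit) h T hT (X.submatrix e e)
  have h1 : amp Unit (extend h T) (X.submatrix e e) = (extend h T X).submatrix e e := rfl
  rw [h1, traceNorm_reindex, traceNorm_reindex] at this
  exact this

end Diamond

end

section

open scoped Matrix.Norms.L2Operator ComplexOrder
set_option linter.unusedSectionVars false
open Matrix

/-! ### A Lindblad form whose effective Hamiltonian is bounded by the diamond norm -/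

section Gauge

variable {n : Type} [Fintype n] [DecidableEq n]

theorem vnorm_single (i : n) : vnorm (Pi.single i (1 : ℂ) : n → ℂ) = 1 := by
  simp [vnorm]

theorem star_single (i : n) : star (Pi.single i (1 : ℂ) : n → ℂ) = Pi.single i 1 := by
  ext k; by_cases hk : k = i
  · subst hk; simp
  · simp [hk]

theorem norm_apply_le_opNorm (A : Matrix n n ℂ) (i j : n) : ‖A i j‖ ≤ ‖A‖ := by
  have h1 := norm_star_dotProduct_le (Pi.single i (1 : ℂ)) (A *ᵥ Pi.single j 1)
  have h2 := vnorm_mulVec_le A (Pi.single j 1)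
  rw [vnorm_single] at h1 h2
  have e : star (Pi.single i (1 : ℂ) : n → ℂ) ⬝ᵥ (A *ᵥ Pi.single j 1) = A i j := by
    rw [star_single]; simp
  rw [e] at h1
  linarith

theorem norm_rankOne_le (u v : n → ℂ) : ‖vecMulVec u (star v)‖ ≤ vnorm u * vnorm v := by
  refine opNorm_le_of_mulVec _ _ (mul_nonneg (vnorm_nonneg u) (vnorm_nonneg v)) fun x => ?_
  rw [vecMulVec_mulVec, op_smul_eq_smul, vnorm_smul]
  nlinarith [norm_star_dotProduct_le v x, vnorm_nonneg u]

theorem norm_scalar_le (c : ℂ) : ‖(c • (1 : Matrix n n ℂ))‖ ≤ ‖c‖ := by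
  refine opNorm_le_of_mulVec _ _ (norm_nonneg _) fun x => ?_
  rw [smul_mulVec, one_mulVec, vnorm_smul]

/-- The jump operators of a Lindblad form may be taken traceless and the trace of the effective
Hamiltonian real. -/
theorem IsLForm.exists_traceless [Nonempty n] {M : SuperOp n} {G : Matrix n n ℂ} {ι : Type}
    [Fintype ι] {L : ι → Matrix n n ℂ} (h : IsLForm M G L) :
    ∃ (G' : Matrix n n ℂ) (L' : ι → Matrix n n ℂ), IsLForm M G' L' ∧
      (∀ j, (L' j).trace = 0) ∧ G'.trace.im = 0 := by
  set d : ℂ := (Fintype.card n : ℂ) with hd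
  have hd0 : d ≠ 0 := by
    rw [hd]; exact_mod_cast Fintype.card_ne_zero
  set c : ι → ℂ := fun j => (L j).trace / d with hc
  set L' : ι → Matrix n n ℂ := fun j => L j - c j • 1 with hL'
  have hL : ∀ j, L j = L' j + c j • 1 := fun j => by rw [hL']; simp
  set G₁ : Matrix n n ℂ := G + ∑ j, (star (c j) • L' j + ((1 / 2 : ℂ) * (c j * star (c j))) • 1)
    with hG₁
  set θ : ℝ := G₁.trace.im / Fintype.card n with hθ
  have hself : ∀ z : ℂ, star ((1 / 2 : ℂ) * (z * star z)) = (1 / 2 : ℂ) * (z * star z) := fun z => by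
    simp
    ring
  have key1 : IsLForm M G₁ L' := by
    refine ⟨fun X => ?_, ?_⟩
    · rw [h.1, hG₁, conjTranspose_add, conjTranspose_sum, add_mul, mul_add, Finset.sum_mul,
        Finset.mul_sum]
      have e : ∀ j, L j * X * (L j)ᴴ = L' j * X * (L' j)ᴴ
          + (star (c j) • L' j + ((1 / 2 : ℂ) * (c j * star (c j))) • 1) * X
          + X * (star (c j) • L' j + ((1 / 2 : ℂ) * (c j * star (c j))) • 1)ᴴ := fun j => by
        rw [hL j]
        simp only [conjTranspose_add, conjTranspose_smul, conjTranspose_one, add_mul, mul_add,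
          smul_mul_assoc, mul_smul_comm, one_mul, mul_one, hself, star_star, smul_add, smul_smul]
        module
      simp only [e, Finset.sum_add_distrib]
      abel
    · rw [hG₁, conjTranspose_add, conjTranspose_sum, ← h.2]
      have e : ∀ j, (L j)ᴴ * L j = (star (c j) • L' j + ((1 / 2 : ℂ) * (c j * star (c j))) • 1)
          + (star (c j) • L' j + ((1 / 2 : ℂ) * (c j * star (c j))) • 1)ᴴ
          + (L' j)ᴴ * L' j := fun j => by
        rw [hL j]
        simp only [conjTranspose_add, conjTranspose_smul, conjTranspose_one, add_mul, mul_add,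
          smul_mul_assoc, mul_smul_comm, one_mul, mul_one, hself, star_star, smul_add, smul_smul]
        module
      simp only [e, Finset.sum_add_distrib]
      abel
  refine ⟨G₁ - (Complex.I * θ) • 1, L', ⟨fun X => ?_, ?_⟩, fun j => ?_, ?_⟩
  · rw [key1.1, conjTranspose_sub, conjTranspose_smul, conjTranspose_one]
    simp only [sub_mul, mul_sub, smul_mul_assoc, mul_smul_comm, one_mul, mul_one]
    simp
    abel
  · rw [← key1.2, conjTranspose_sub, conjTranspose_smul, conjTranspose_one]
    simp
  · rw [hL']
    simp only [trace_sub, trace_smul, trace_one, smul_eq_mul, hc]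
    rw [div_mul_cancel₀ _ hd0, sub_self]
  · rw [trace_sub, trace_smul, trace_one, smul_eq_mul, Complex.sub_im]
    have h0 : (Fintype.card n : ℝ) ≠ 0 := by exact_mod_cast Fintype.card_ne_zero
    simp [hθ]

/-- A Lindbladian has a Lindblad form whose effective Hamiltonian is bounded by its diamond norm,
with a constant that does not depend on the dimension: contract `(M ⊗ id)(|χ⟩⟨Ω|)` with the
maximally entangled vector `Ω`. -/
theorem IsLindbladian.exists_isLForm_norm_le {M : SuperOp n} (h : IsLindbladian M)
    (hfin : diamondNorm M ≠ ⊤) :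
    ∃ (m : ℕ) (G : Matrix n n ℂ) (L : Fin m → Matrix n n ℂ), IsLForm M G L ∧
      ‖G‖ ≤ 3 / 2 * (diamondNorm M).toReal := by
  obtain ⟨m, G₀, L₀, h₀⟩ := h.exists_isLForm
  rcases isEmpty_or_nonempty n with hn | hn
  · refine ⟨m, G₀, L₀, h₀, ?_⟩
    have : G₀ = 0 := by ext i; exact hn.elim i
    rw [this, norm_zero]; positivity
  obtain ⟨G, L, hL, htr, him⟩ := h₀.exists_traceless
  refine ⟨m, G, L, hL, ?_⟩
  set b := (diamondNorm M).toReal with hb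
  have hb0 : 0 ≤ b := ENNReal.toReal_nonneg
  set d : ℝ := ((Fintype.card n : ℕ) : ℝ) with hd
  have hd0 : 0 < d := by rw [hd]; exact_mod_cast Fintype.card_pos
  obtain ⟨k0⟩ := hn
  set Ω : n × n → ℂ := fun p => if p.1 = p.2 then 1 else 0 with hΩ
  have hΩn : vnorm Ω ^ 2 = d := by
    rw [vnorm_sq, Fintype.sum_prod_type]
    simp [hΩ, hd, apply_ite]
  set lift : (n → ℂ) → n × n → ℂ := fun v p => if p.2 = k0 then v p.1 else 0 with hlift
  have hliftn : ∀ v, vnorm (lift v) = vnorm v := fun v => by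
    have : vnorm (lift v) ^ 2 = vnorm v ^ 2 := by
      rw [vnorm_sq, vnorm_sq, Fintype.sum_prod_type]
      simp [hlift, apply_ite]
    exact (pow_left_inj₀ (vnorm_nonneg _) (vnorm_nonneg _) two_ne_zero).1 this
  set g : ℂ := G.trace / d with hg
  have hGtr : star G.trace = G.trace := by
    apply Complex.ext <;> simp [him]
  -- the contraction with the maximally entangled vector
  have hcontr : ∀ v y : n → ℂ, (vecMulVec Ω (star (lift y)) *
      amp n M (vecMulVec (lift v) (star Ω))).trace = d * (star y ⬝ᵥ ((G + g • 1) *ᵥ v)) := by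
    intro v y
    have e1 : ∀ l : n, (Matrix.of fun i j => vecMulVec (lift v) (star Ω) (i, k0) (j, l))
        = vecMulVec v (star (Pi.single l 1)) := fun l => by
      ext i j
      by_cases hjl : j = l
      · subst hjl; simp [vecMulVec_apply, hlift, hΩ]
      · simp [vecMulVec_apply, hlift, hΩ, hjl]
    have e2 : ∀ i : n, ∑ l, M (vecMulVec v (star (Pi.single l 1))) i l
        = d * ((G + g • 1) *ᵥ v) i := fun i => by
      have e3 : ∀ l, M (vecMulVec v (star (Pi.single l 1))) i l
          = ∑ j, (L j *ᵥ v) i * star (L j l l) + (G *ᵥ v) i + v i * star (G l l) := fun l => by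
        have h1 : ∀ B : Matrix n n ℂ, star (B *ᵥ Pi.single l 1) l = star (B l l) := fun B => by
          simp
        rw [hL.1]
        simp only [vecMulVec_conj, Matrix.add_apply, Matrix.sum_apply]
        have h2 := vecMulVec_conj G 1 v (Pi.single l 1)
        have h3 := vecMulVec_conj 1 G v (Pi.single l 1)
        rw [conjTranspose_one, mul_one] at h2
        rw [one_mul] at h3
        rw [h2, h3]
        simp only [vecMulVec_apply, h1, one_mulVec]
        simp
      simp only [e3, Finset.sum_add_distrib]
      rw [Finset.sum_comm]
      have h4 : ∀ j, ∑ l, (L j *ᵥ v) i * star (L j l l) = 0 := fun j => by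
        rw [← Finset.mul_sum, ← star_sum]
        have : ∑ l, L j l l = 0 := htr j
        rw [this, star_zero, mul_zero]
      have h5 : ∑ l, v i * star (G l l) = v i * G.trace := by
        rw [← Finset.mul_sum, ← star_sum, ← hGtr]; rfl
      simp only [h4, h5]
      rw [add_mulVec, smul_mulVec, one_mulVec]
      have hd1 : (Fintype.card n : ℂ) ≠ 0 := by
        have := hd0.ne'
        rw [hd] at this
        exact_mod_cast this
      simp [hg, hd]
      field_simp
    rw [vecMulVec_mul, trace_vecMulVec]
    simp only [dotProduct, vecMul, Fintype.sum_prod_type]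
    have e4 : ∀ i k : n, ∑ x, ∑ x_1, star (lift y) (x, x_1)
        * amp n M (vecMulVec (lift v) (star Ω)) (x, x_1) (i, k)
        = ∑ x, star (y x) * M (vecMulVec v (star (Pi.single k 1))) x i := fun i k => by
      refine Finset.sum_congr rfl fun x _ => ?_
      rw [Finset.sum_eq_single k0]
      · change _ * M (Matrix.of fun i' j => vecMulVec (lift v) (star Ω) (i', k0) (j, k)) x i = _
        rw [e1]
        simp [hlift]
      · intro l _ hl
        simp [hlift, hl]
      · simp
    simp only [e4]
    have e5 : ∀ i : n, ∑ k, Ω (i, k) * ∑ x, star (y x) * M (vecMulVec v (star (Pi.single k 1))) x i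
        = ∑ x, star (y x) * M (vecMulVec v (star (Pi.single i 1))) x i := fun i => by
      rw [Finset.sum_eq_single i]
      · simp [hΩ]
      · intro k _ hk; simp [hΩ, Ne.symm hk]
      · simp
    simp only [e5]
    rw [Finset.sum_comm]
    simp only [← Finset.mul_sum, e2]
    rw [Finset.mul_sum]
    refine Finset.sum_congr rfl fun x _ => ?_
    simp only [Pi.star_apply]
    ring
  have hbound : ‖G + g • (1 : Matrix n n ℂ)‖ ≤ b := by
    refine opNorm_le_of_mulVec _ _ hb0 fun v => ?_
    set y := (G + g • (1 : Matrix n n ℂ)) *ᵥ v with hy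
    have h1 := hcontr v y
    have h2 := norm_trace_mul_le (vecMulVec Ω (star (lift y)))
      (amp n M (vecMulVec (lift v) (star Ω)))
    rw [h1, ← hy, star_dotProduct_self, norm_mul, Complex.norm_real, Complex.norm_real,
      Real.norm_of_nonneg hd0.le, Real.norm_of_nonneg (by positivity)] at h2
    have h3 : ‖vecMulVec Ω (star (lift y))‖ ≤ vnorm Ω * vnorm y := by
      have := norm_rankOne_le Ω (lift y)
      rwa [hliftn] at this
    have h4 : traceNorm (amp n M (vecMulVec (lift v) (star Ω))) ≤ b * (vnorm v * vnorm Ω) := by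
      refine (traceNorm_amp_le M hfin _).trans (mul_le_mul_of_nonneg_left ?_ hb0)
      have := traceNorm_rankOne_le (lift v) Ω
      rwa [hliftn] at this
    have h5 : d * vnorm y ^ 2 ≤ d * (vnorm y * (b * vnorm v)) := by
      refine h2.trans ?_
      refine (mul_le_mul h3 h4 (traceNorm_nonneg _)
        (mul_nonneg (vnorm_nonneg _) (vnorm_nonneg _))).trans (le_of_eq ?_)
      rw [← hΩn]; ring
    have h6 := le_of_mul_le_mul_left h5 hd0
    rcases (vnorm_nonneg y).eq_or_lt with h7 | h7
    · rw [← h7]; exact mul_nonneg hb0 (vnorm_nonneg v)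
    · rw [sq] at h6
      exact le_of_mul_le_mul_left h6 h7
  have hgn : ‖g‖ ≤ b / 2 := by
    have e : (G + g • (1 : Matrix n n ℂ)).trace = d * (2 * g) := by
      have hd1 : (Fintype.card n : ℂ) ≠ 0 := by
        have := hd0.ne'
        rw [hd] at this
        exact_mod_cast this
      rw [trace_add, trace_smul, trace_one]
      simp [hg, hd]
      field_simp
      ring
    have h1 : ‖(G + g • (1 : Matrix n n ℂ)).trace‖ ≤ d * b := by
      refine (norm_sum_le _ _).trans ?_
      refine (Finset.sum_le_card_nsmul _ _ b fun i _ =>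
        (norm_apply_le_opNorm _ i i).trans hbound).trans (le_of_eq ?_)
      rw [nsmul_eq_mul, Finset.card_univ]
    rw [e, norm_mul, Complex.norm_real, Real.norm_of_nonneg hd0.le, norm_mul] at h1
    have := le_of_mul_le_mul_left h1 hd0
    simp at this
    linarith
  have e : G = (G + g • (1 : Matrix n n ℂ)) - g • 1 := by simp
  calc ‖G‖ = ‖(G + g • (1 : Matrix n n ℂ)) - g • 1‖ := by rw [← e]
    _ ≤ ‖G + g • (1 : Matrix n n ℂ)‖ + ‖g • (1 : Matrix n n ℂ)‖ := norm_sub_le _ _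
    _ ≤ b + b / 2 := add_le_add hbound ((norm_scalar_le g).trans hgn)
    _ = 3 / 2 * b := by ring

end Gauge

end

section

open scoped Matrix.Norms.L2Operator ComplexOrder
set_option linter.unusedSectionVars false
open Matrix

/-! ### Entropy -/

section Entropy

variable {n κ : Type} [Fintype n] [DecidableEq n] [Fintype κ] [DecidableEq κ]

/-- The Hermitian operator with eigenbasis the columns of `U` and eigenvalues `k`. -/
noncomputable def ofDiag (U : Matrix n n ℂ) (k : n → ℝ) : Matrix n n ℂ :=
  U * diagonal (fun i => (k i : ℂ)) * Uᴴ

theorem ofDiag_isHermitian (U : Matrix n n ℂ) (k : n → ℝ) : (ofDiag U k).IsHermitian := by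
  rw [IsHermitian, ofDiag, conjTranspose_mul, conjTranspose_mul, conjTranspose_conjTranspose,
    diagonal_conjTranspose, mul_assoc]
  congr 2
  congr 1
  ext i
  simp

theorem exists_ofDiag {ρ : Matrix n n ℂ} (h : ρ.IsHermitian) :
    ∃ U : Matrix n n ℂ, Uᴴ * U = 1 ∧ ρ = ofDiag U h.eigenvalues := by
  refine ⟨h.eigenvectorUnitary, ?_, ?_⟩
  · exact (Unitary.mem_iff.1 h.eigenvectorUnitary.2).1
  · have := h.spectral_theorem
    rw [Unitary.conjStarAlgAut_apply] at this
    exact this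

theorem star_dotProduct_ofDiag (U : Matrix n n ℂ) (k : n → ℝ) (v : n → ℂ) :
    star v ⬝ᵥ (ofDiag U k *ᵥ v) = ((∑ j, k j * ‖(Uᴴ *ᵥ v) j‖ ^ 2 : ℝ) : ℂ) := by
  have e : star v ᵥ* U = star (Uᴴ *ᵥ v) := by
    rw [star_mulVec, conjTranspose_conjTranspose]
  rw [ofDiag, ← mulVec_mulVec, ← mulVec_mulVec, dotProduct_mulVec, e]
  simp only [dotProduct, mulVec_diagonal, Pi.star_apply]
  push_cast
  refine Finset.sum_congr rfl fun j _ => ?_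
  rw [← Complex.mul_conj']
  simp only [RCLike.star_def]
  ring

theorem ofDiag_mul {U : Matrix n n ℂ} (hU : Uᴴ * U = 1) (k l : n → ℝ) :
    ofDiag U k * ofDiag U l = ofDiag U (fun i => k i * l i) := by
  calc ofDiag U k * ofDiag U l
      = U * diagonal (fun i => (k i : ℂ)) * (Uᴴ * U) * diagonal (fun i => (l i : ℂ)) * Uᴴ := by
        simp only [ofDiag, mul_assoc]
    _ = ofDiag U (fun i => k i * l i) := by
        rw [hU, mul_one, mul_assoc U, diagonal_mul_diagonal, ofDiag]
        simp

theorem ofDiag_const {U : Matrix n n ℂ} (hU : Uᴴ * U = 1) (c : ℝ) :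
    ofDiag U (fun _ => c) = (c : ℂ) • 1 := by
  have : (diagonal fun _ : n => (c : ℂ)) = (c : ℂ) • (1 : Matrix n n ℂ) := by
    rw [← diagonal_one, ← diagonal_smul]; congr 1; ext i; simp
  rw [ofDiag, this, mul_smul_comm, mul_one, smul_mul_assoc, mul_eq_one_comm.1 hU]

theorem ofDiag_add (U : Matrix n n ℂ) (k l : n → ℝ) :
    ofDiag U (fun i => k i + l i) = ofDiag U k + ofDiag U l := by
  rw [ofDiag, ofDiag, ofDiag, ← add_mul, ← mul_add, diagonal_add]
  simp

theorem ofDiag_smul (U : Matrix n n ℂ) (c : ℝ) (k : n → ℝ) :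
    ofDiag U (fun i => c * k i) = (c : ℂ) • ofDiag U k := by
  have : (diagonal fun i : n => ((c * k i : ℝ) : ℂ)) = (c : ℂ) • diagonal fun i => (k i : ℂ) := by
    rw [← diagonal_smul]; congr 1; ext i; simp
  rw [ofDiag, ofDiag, this, mul_smul_comm, smul_mul_assoc]

theorem norm_ofDiag_le {U : Matrix n n ℂ} (hU : Uᴴ * U = 1) {k : n → ℝ} {c : ℝ} (hc : 0 ≤ c)
    (hk : ∀ i, |k i| ≤ c) : ‖ofDiag U k‖ ≤ c := by
  refine opNorm_le_of_mulVec _ _ hc fun v => ?_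
  have h1 : ∀ w : n → ℂ, ∀ V : Matrix n n ℂ, Vᴴ * V = 1 → vnorm (V *ᵥ w) = vnorm w := by
    intro w V hV
    have : ((vnorm (V *ᵥ w) ^ 2 : ℝ) : ℂ) = ((vnorm w ^ 2 : ℝ) : ℂ) := by
      rw [← star_dotProduct_self, ← star_dotProduct_self, star_mulVec, ← dotProduct_mulVec,
        mulVec_mulVec, hV, one_mulVec]
    have := Complex.ofReal_injective this
    exact (pow_left_inj₀ (vnorm_nonneg _) (vnorm_nonneg _) two_ne_zero).1 this
  have h2 : vnorm (Uᴴ *ᵥ v) = vnorm v := h1 v _ (by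
    rw [conjTranspose_conjTranspose]; exact mul_eq_one_comm.1 hU)
  rw [ofDiag, ← mulVec_mulVec, ← mulVec_mulVec, h1 _ U hU, ← h2]
  refine (pow_le_pow_iff_left₀ (vnorm_nonneg _) (mul_nonneg hc (vnorm_nonneg _)) two_ne_zero).1 ?_
  rw [mul_pow, vnorm_sq, vnorm_sq, Finset.mul_sum]
  refine Finset.sum_le_sum fun i _ => ?_
  rw [mulVec_diagonal, norm_mul, mul_pow, Complex.norm_real, Real.norm_eq_abs]
  gcongr
  exact hk i

theorem trace_ofDiag_mul_ofDiag (V U : Matrix n n ℂ) (a k : n → ℝ) :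
    (ofDiag V a * ofDiag U k).trace = ((∑ i, ∑ j, a i * k j * ‖(Vᴴ * U) i j‖ ^ 2 : ℝ) : ℂ) := by
  have e : (ofDiag V a * ofDiag U k).trace = (diagonal (fun i => (a i : ℂ)) *
      ((Vᴴ * U) * diagonal (fun i => (k i : ℂ)) * (Vᴴ * U)ᴴ)).trace := by
    rw [conjTranspose_mul, conjTranspose_conjTranspose, ofDiag, ofDiag, mul_assoc V, mul_assoc V,
      trace_mul_comm V]
    simp only [mul_assoc]
  rw [e, trace]
  push_cast
  refine Finset.sum_congr rfl fun i _ => ?_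
  rw [diag_apply, diagonal_mul, mul_apply, Finset.mul_sum]
  refine Finset.sum_congr rfl fun j _ => ?_
  rw [mul_diagonal, conjTranspose_apply, ← Complex.mul_conj', RCLike.star_def]
  ring

theorem sum_norm_sq_row {W : Matrix n n ℂ} (hW : W * Wᴴ = 1) (i : n) :
    ∑ j, ‖W i j‖ ^ 2 = 1 := by
  have h := congrFun (congrFun hW i) i
  rw [mul_apply, one_apply_eq] at h
  simp only [conjTranspose_apply, RCLike.star_def, Complex.mul_conj'] at h
  exact_mod_cast h

theorem sum_norm_sq_col {W : Matrix n n ℂ} (hW : Wᴴ * W = 1) (j : n) :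
    ∑ i, ‖W i j‖ ^ 2 = 1 := by
  have h := congrFun (congrFun hW j) j
  rw [mul_apply, one_apply_eq] at h
  simp only [conjTranspose_apply, RCLike.star_def, mul_comm, Complex.mul_conj'] at h
  exact_mod_cast h

theorem conjTranspose_mul_unitary {V U : Matrix n n ℂ} (hV : Vᴴ * V = 1) (hU : Uᴴ * U = 1) :
    (Vᴴ * U)ᴴ * (Vᴴ * U) = 1 ∧ (Vᴴ * U) * (Vᴴ * U)ᴴ = 1 := by
  have : (Vᴴ * U)ᴴ * (Vᴴ * U) = 1 := by
    rw [conjTranspose_mul, conjTranspose_conjTranspose, mul_assoc, ← mul_assoc V,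
      mul_eq_one_comm.1 hV, one_mul, hU]
  exact ⟨this, mul_eq_one_comm.1 this⟩

/-- The entropy `-∑ λ log (λ / τ)` of a positive operator with eigenvalues `λ` and trace `τ`, in
natural units; it is homogeneous of degree one. -/
noncomputable def ent (ρ : Matrix n n ℂ) : ℝ :=
  open scoped Classical in
  if h : ρ.IsHermitian then
    ∑ i, Real.negMulLog (h.eigenvalues i) + (∑ i, h.eigenvalues i) * Real.log (∑ i, h.eigenvalues i)
  else 0

theorem ent_eq {ρ : Matrix n n ℂ} (h : ρ.IsHermitian) :
    ent ρ = ∑ i, Real.negMulLog (h.eigenvalues i) +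
      (∑ i, h.eigenvalues i) * Real.log (∑ i, h.eigenvalues i) := dif_pos h

theorem re_trace_eq_sum_eigenvalues {ρ : Matrix n n ℂ} (h : ρ.IsHermitian) :
    ρ.trace.re = ∑ i, h.eigenvalues i := by
  rw [h.trace_eq_sum_eigenvalues, ← RCLike.ofReal_sum]
  exact Complex.ofReal_re _

theorem vnEntropy_eq {ρ : Matrix n n ℂ} (h : IsState ρ) :
    vnEntropy ρ = ent ρ / Real.log 2 := by
  have hH := h.1.isHermitian
  have h1 : ∑ i, hH.eigenvalues i = 1 := by
    rw [← re_trace_eq_sum_eigenvalues, h.2, Complex.one_re]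
  rw [vnEntropy, dif_pos hH, ent_eq hH, h1, Real.log_one, mul_zero, add_zero, Finset.sum_div]
  refine Finset.sum_congr rfl fun i _ => ?_
  rw [Real.negMulLog, Real.logb]; ring

/-- Gibbs' variational principle: `-log` of any subnormalised operator bounds the entropy. -/
theorem ent_le_trace {ρ : Matrix n n ℂ} (hρ : ρ.PosSemidef) {U : Matrix n n ℂ}
    (hU : Uᴴ * U = 1) {k : n → ℝ} (hk : ∑ j, Real.exp (-k j) ≤ 1) :
    ent ρ ≤ (ρ * ofDiag U k).trace.re := by
  obtain ⟨V, hV, e⟩ := exists_ofDiag hρ.isHermitian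
  have h0 := hρ.eigenvalues_nonneg
  set a := hρ.isHermitian.eigenvalues with ha
  set W := Vᴴ * U with hW
  obtain ⟨hW1, hW2⟩ : Wᴴ * W = 1 ∧ W * Wᴴ = 1 := conjTranspose_mul_unitary hV hU
  have e1 : (ρ * ofDiag U k).trace.re = ∑ i, ∑ j, a i * k j * ‖W i j‖ ^ 2 := by
    rw [e, trace_ofDiag_mul_ofDiag, Complex.ofReal_re]
  set τ := ∑ i, a i with hτ
  have hτ0 : 0 ≤ τ := Finset.sum_nonneg fun i _ => h0 i
  have hpt : ∀ i j, a i - τ * Real.exp (-k j) ≤ a i * k j - (Real.negMulLog (a i) + a i * Real.log τ) := by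
    intro i j
    rcases (h0 i).eq_or_lt with h | h
    · rw [← h]; simp; positivity
    · have hτ1 : 0 < τ := lt_of_lt_of_le h (Finset.single_le_sum (fun i _ => h0 i) (Finset.mem_univ i))
      have h2 : 0 < τ * Real.exp (-k j) / a i := by positivity
      have h3 := Real.log_le_sub_one_of_pos h2
      rw [Real.log_div (by positivity) h.ne', Real.log_mul hτ1.ne' (Real.exp_ne_zero _),
        Real.log_exp] at h3
      have h4 := mul_le_mul_of_nonneg_left h3 h.le
      rw [mul_sub, mul_sub, mul_one, mul_div_assoc', mul_div_cancel_left₀ _ h.ne'] at h4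
      rw [Real.negMulLog]
      nlinarith
  have h1 : ∑ i, ∑ j, (a i - τ * Real.exp (-k j)) * ‖W i j‖ ^ 2
      ≤ ∑ i, ∑ j, (a i * k j - (Real.negMulLog (a i) + a i * Real.log τ)) * ‖W i j‖ ^ 2 :=
    Finset.sum_le_sum fun i _ => Finset.sum_le_sum fun j _ =>
      mul_le_mul_of_nonneg_right (hpt i j) (by positivity)
  have e2 : ∑ i, ∑ j, (a i - τ * Real.exp (-k j)) * ‖W i j‖ ^ 2
      = τ - τ * ∑ j, Real.exp (-k j) := by
    simp only [sub_mul, Finset.sum_sub_distrib]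
    congr 1
    · simp only [← Finset.mul_sum, sum_norm_sq_row hW2, mul_one, hτ]
    · rw [Finset.sum_comm]
      simp only [← Finset.mul_sum, sum_norm_sq_col hW1, mul_one]
  have e3 : ∑ i, ∑ j, (a i * k j - (Real.negMulLog (a i) + a i * Real.log τ)) * ‖W i j‖ ^ 2
      = (ρ * ofDiag U k).trace.re - ent ρ := by
    simp only [sub_mul, Finset.sum_sub_distrib]
    rw [e1, ent_eq hρ.isHermitian]
    congr 1
    simp only [← Finset.mul_sum, sum_norm_sq_row hW2, mul_one, Finset.sum_add_distrib,
      ← Finset.sum_mul, hτ, ha]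
  rw [e2, e3] at h1
  have : τ * ∑ j, Real.exp (-k j) ≤ τ * 1 := mul_le_mul_of_nonneg_left hk hτ0
  linarith

theorem ent_zero : ent (0 : Matrix n n ℂ) = 0 := by
  have h : ∀ i, (isHermitian_zero (n := n) (α := ℂ)).eigenvalues i = 0 := fun i =>
    congrFun (((isHermitian_zero (n := n) (α := ℂ)).eigenvalues_eq_zero_iff).2 rfl) i
  rw [ent_eq isHermitian_zero]
  simp [h]

/-- The operator `-log ((1 - ε) ρ / τ + ε / D)`, with its spectral decomposition: it is bounded and
its expectation in `ρ` is the entropy of `ρ`, up to a small error. -/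
theorem exists_regularized_log {ρ : Matrix n n ℂ} (hρ : ρ.PosSemidef) {τ ε : ℝ}
    (hτ : ρ.trace.re = τ) (hτ0 : 0 < τ) (hε : 0 < ε) (hε1 : ε < 1) :
    ∃ (U : Matrix n n ℂ) (k : n → ℝ), Uᴴ * U = 1 ∧ ∑ j, Real.exp (-k j) = 1 ∧
      (∀ j, 0 ≤ k j) ∧ (∀ j, k j ≤ Real.log (Fintype.card n / ε)) ∧
      (ρ * ofDiag U k).trace.re ≤ ent ρ - τ * Real.log (1 - ε) ∧
      ofDiag U (fun j => Real.exp (-k j))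
        = (((1 - ε) / τ : ℝ) : ℂ) • ρ + ((ε / Fintype.card n : ℝ) : ℂ) • 1 := by
  obtain ⟨U, hU, e⟩ := exists_ofDiag hρ.isHermitian
  have h0 := hρ.eigenvalues_nonneg
  rw [re_trace_eq_sum_eigenvalues hρ.isHermitian] at hτ
  have hent := ent_eq hρ.isHermitian
  set a := hρ.isHermitian.eigenvalues with ha
  have hn : Nonempty n := by
    by_contra h
    rw [not_nonempty_iff] at h
    rw [Finset.univ_eq_empty, Finset.sum_empty] at hτ
    exact hτ0.ne hτ
  set d : ℝ := ((Fintype.card n : ℕ) : ℝ) with hd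
  have hd0 : 0 < d := by rw [hd]; exact_mod_cast Fintype.card_pos
  have hpos : ∀ i, 0 < (1 - ε) / τ * a i + ε / d := fun i =>
    add_pos_of_nonneg_of_pos (mul_nonneg (div_nonneg (by linarith) hτ0.le) (h0 i)) (by positivity)
  set k : n → ℝ := fun i => -Real.log ((1 - ε) / τ * a i + ε / d) with hk
  have hexp : ∀ i, Real.exp (-k i) = (1 - ε) / τ * a i + ε / d := fun i => by
    rw [hk]; simp only [neg_neg]; exact Real.exp_log (hpos i)
  have hsum : ∑ j, Real.exp (-k j) = 1 := by
    simp only [hexp, Finset.sum_add_distrib, ← Finset.mul_sum, hτ, Finset.sum_const,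
      Finset.card_univ, nsmul_eq_mul]
    rw [← hd]; field_simp; ring
  refine ⟨U, k, hU, hsum, fun j => ?_, fun j => ?_, ?_, ?_⟩
  · have : Real.exp (-k j) ≤ 1 := hsum ▸ Finset.single_le_sum
      (f := fun j => Real.exp (-k j)) (fun i _ => (Real.exp_pos _).le) (Finset.mem_univ j)
    have := Real.exp_le_one_iff.1 this
    linarith
  · simp only [hk]
    rw [← Real.log_inv]
    refine Real.log_le_log (inv_pos.2 (hpos j)) ?_
    rw [show d / ε = (ε / d)⁻¹ from (inv_div _ _).symm]
    refine inv_anti₀ (by positivity) ?_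
    exact le_add_of_nonneg_left (mul_nonneg (div_nonneg (by linarith) hτ0.le) (h0 j))
  · have e1 : (ρ * ofDiag U k).trace.re = ∑ i, a i * k i := by
      have e2 : ofDiag U (fun i => a i * k i) = ofDiag U (fun i => a i * k i) * ofDiag U (fun _ => 1) := by
        rw [ofDiag_mul hU]; simp
      rw [e, ofDiag_mul hU, e2, trace_ofDiag_mul_ofDiag, Complex.ofReal_re]
      obtain ⟨-, hW2⟩ := conjTranspose_mul_unitary hU hU
      simp only [mul_one, ← Finset.mul_sum, sum_norm_sq_row hW2]
    rw [e1, hent, hτ, ← hτ, Finset.sum_mul, Finset.sum_mul, ← Finset.sum_add_distrib,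
      ← Finset.sum_sub_distrib, hτ]
    refine Finset.sum_le_sum fun i _ => ?_
    rcases (h0 i).eq_or_lt with h | h
    · rw [← h]; simp
    · have h1 : Real.log ((1 - ε) / τ * a i) ≤ -k i := by
        rw [hk]; simp only [neg_neg]
        refine Real.log_le_log (mul_pos (div_pos (by linarith) hτ0) h) ?_
        have : 0 < ε / d := by positivity
        linarith
      rw [Real.log_mul (div_pos (by linarith) hτ0).ne' h.ne',
        Real.log_div (by linarith) hτ0.ne'] at h1
      rw [Real.negMulLog]
      nlinarith
  · have : (fun j => Real.exp (-k j)) = fun j => (1 - ε) / τ * a j + ε / d := funext hexp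
    rw [this, ofDiag_add U (fun j => (1 - ε) / τ * a j) (fun _ => ε / d), ofDiag_smul,
      ofDiag_const hU, ← e]

theorem sq_le_exp_of_nonneg {t : ℝ} (ht : 0 ≤ t) : t ^ 2 ≤ Real.exp t := by
  have h1 : 1 + t / 4 ≤ Real.exp (t / 4) := by linarith [Real.add_one_le_exp (t / 4)]
  have h2 : Real.exp t = (Real.exp (t / 4) ^ 2) ^ 2 := by
    rw [← pow_mul, ← Real.exp_nat_mul]; congr 1; push_cast; ring
  rw [h2]
  refine pow_le_pow_left₀ ht ?_ 2
  have h3 : (1 + t / 4) ^ 2 ≤ Real.exp (t / 4) ^ 2 := pow_le_pow_left₀ (by positivity) h1 2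
  nlinarith [sq_nonneg (1 - t / 4)]

/-- The second moment of the relative logarithm `log ω - log σ` in the state `ω` is bounded in
terms of a constant `C` with `ω ≤ C σ`, irrespective of the dimension. -/
theorem trace_mul_log_sub_log_sq_le {U V : Matrix n n ℂ} (hU : Uᴴ * U = 1) (hV : Vᴴ * V = 1)
    {k l : n → ℝ} (hk : ∑ j, Real.exp (-k j) = 1) (hl : ∑ j, Real.exp (-l j) ≤ 1) {C : ℝ}
    (hC : 1 ≤ C)
    (h : ∀ v : n → ℂ, (star v ⬝ᵥ (ofDiag U (fun j => Real.exp (-k j)) *ᵥ v)).re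
      ≤ C * (star v ⬝ᵥ (ofDiag V (fun j => Real.exp (-l j)) *ᵥ v)).re) :
    (ofDiag U (fun j => Real.exp (-k j)) *
      ((ofDiag U k - ofDiag V l) * (ofDiag U k - ofDiag V l))).trace.re
      ≤ 2 * Real.log C ^ 2 + 3 := by
  set W := Uᴴ * V with hW
  obtain ⟨hW1, hW2⟩ : Wᴴ * W = 1 ∧ W * Wᴴ = 1 := conjTranspose_mul_unitary hU hV
  have hC0 : 0 < C := by linarith
  have e1 : (ofDiag U (fun j => Real.exp (-k j)) *
      ((ofDiag U k - ofDiag V l) * (ofDiag U k - ofDiag V l))).trace.re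
      = ∑ i, ∑ j, Real.exp (-k i) * (l j - k i) ^ 2 * ‖W i j‖ ^ 2 := by
    have e2 : (ofDiag U (fun j => Real.exp (-k j)) *
        ((ofDiag U k - ofDiag V l) * (ofDiag U k - ofDiag V l))).trace
        = (ofDiag U (fun i => Real.exp (-k i) * (k i * k i)) * ofDiag V (fun _ => 1)).trace
          - 2 * (ofDiag U (fun i => Real.exp (-k i) * k i) * ofDiag V l).trace
          + (ofDiag U (fun i => Real.exp (-k i)) * ofDiag V (fun j => l j * l j)).trace := by
      rw [ofDiag_const hV, ← ofDiag_mul hV, ← ofDiag_mul hU, ← ofDiag_mul hU, ← ofDiag_mul hU]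
      have hc : ofDiag U (fun j => Real.exp (-k j)) * ofDiag U k
          = ofDiag U k * ofDiag U (fun j => Real.exp (-k j)) := by
        rw [ofDiag_mul hU, ofDiag_mul hU]; simp only [mul_comm]
      have h3 : (ofDiag U (fun j => Real.exp (-k j)) * (ofDiag V l * ofDiag U k)).trace
          = (ofDiag U (fun j => Real.exp (-k j)) * ofDiag U k * ofDiag V l).trace := by
        rw [← mul_assoc, trace_mul_comm, ← mul_assoc, hc]
      simp only [sub_mul, mul_sub, trace_sub, Complex.ofReal_one, one_smul, mul_one,
        ← mul_assoc]
      rw [mul_assoc _ (ofDiag V l) (ofDiag U k), h3]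
      ring
    rw [e2]
    simp only [trace_ofDiag_mul_ofDiag]
    norm_cast
    rw [Finset.mul_sum, ← Finset.sum_sub_distrib, ← Finset.sum_add_distrib]
    refine Finset.sum_congr rfl fun i _ => ?_
    rw [Finset.mul_sum, ← Finset.sum_sub_distrib, ← Finset.sum_add_distrib]
    refine Finset.sum_congr rfl fun j _ => ?_
    rw [← hW]; ring
  -- the expectation of the likelihood ratio is at most `C`, eigenvector by eigenvector
  have hq : ∀ i, Real.exp (-k i) * ∑ j, Real.exp (l j) * ‖W i j‖ ^ 2 ≤ C := by
    intro i
    set qi := ∑ j, Real.exp (l j) * ‖W i j‖ ^ 2 with hqi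
    have hq0 : 0 ≤ qi := Finset.sum_nonneg fun j _ => by positivity
    set v : n → ℂ := V *ᵥ (fun j => (Real.exp (l j) : ℂ) * star (W i j)) with hv
    have hVv : Vᴴ *ᵥ v = fun j => (Real.exp (l j) : ℂ) * star (W i j) := by
      rw [hv, mulVec_mulVec, hV, one_mulVec]
    have h1 := h v
    rw [star_dotProduct_ofDiag, star_dotProduct_ofDiag, Complex.ofReal_re, Complex.ofReal_re, hVv]
      at h1
    have h2 : ∑ j, Real.exp (-l j) * ‖(Real.exp (l j) : ℂ) * star (W i j)‖ ^ 2 = qi := by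
      rw [hqi]
      refine Finset.sum_congr rfl fun j _ => ?_
      rw [norm_mul, norm_star, Complex.norm_real, Real.norm_of_nonneg (Real.exp_pos _).le, mul_pow,
        ← mul_assoc, sq (Real.exp _), ← mul_assoc, ← Real.exp_add]
      simp
    have h3 : (Uᴴ *ᵥ v) i = (qi : ℂ) := by
      rw [hv, mulVec_mulVec, ← hW, hqi, mulVec, dotProduct]
      push_cast
      refine Finset.sum_congr rfl fun j _ => ?_
      rw [← Complex.mul_conj', RCLike.star_def]; ring
    have h4 : Real.exp (-k i) * qi ^ 2 ≤ ∑ j, Real.exp (-k j) * ‖(Uᴴ *ᵥ v) j‖ ^ 2 := by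
      have := Finset.single_le_sum (f := fun j => Real.exp (-k j) * ‖(Uᴴ *ᵥ v) j‖ ^ 2)
        (fun j _ => by positivity) (Finset.mem_univ i)
      simp only [h3, Complex.norm_real, Real.norm_of_nonneg hq0] at this
      exact this
    rw [h2] at h1
    rcases hq0.eq_or_lt with h5 | h5
    · rw [← h5, mul_zero]; exact hC0.le
    · have h6 : Real.exp (-k i) * qi * qi ≤ C * qi := by
        calc _ = Real.exp (-k i) * qi ^ 2 := by ring
          _ ≤ _ := h4.trans h1
      exact le_of_mul_le_mul_right h6 h5
  have hpt : ∀ t : ℝ, t ^ 2 ≤ 2 * Real.log C ^ 2 + 2 * (Real.exp t / C) + Real.exp (-t) := by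
    intro t
    have hlC : 0 ≤ Real.log C := Real.log_nonneg hC
    rcases le_total t 0 with ht | ht
    · have := sq_le_exp_of_nonneg (neg_nonneg.2 ht)
      have h2 : 0 ≤ 2 * (Real.exp t / C) := by positivity
      nlinarith [sq_nonneg (Real.log C)]
    · have h2 : 0 < Real.exp (-t) := Real.exp_pos _
      have h3 : 0 ≤ 2 * (Real.exp t / C) := by positivity
      rcases le_total t (Real.log C) with ht' | ht'
      · nlinarith
      · have := sq_le_exp_of_nonneg (sub_nonneg.2 ht')
        rw [Real.exp_sub, Real.exp_log hC0] at this
        nlinarith [sq_nonneg (t - 2 * Real.log C)]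
  rw [e1]
  calc ∑ i, ∑ j, Real.exp (-k i) * (l j - k i) ^ 2 * ‖W i j‖ ^ 2
      ≤ ∑ i, ∑ j, (2 * Real.log C ^ 2 * Real.exp (-k i) * ‖W i j‖ ^ 2
          + 2 / C * (Real.exp (-k i) * (Real.exp (-k i) * (Real.exp (l j) * ‖W i j‖ ^ 2)))
          + Real.exp (-l j) * ‖W i j‖ ^ 2) := by
        refine Finset.sum_le_sum fun i _ => Finset.sum_le_sum fun j _ => ?_
        have h1 := mul_le_mul_of_nonneg_left (hpt (l j - k i))
          (mul_nonneg (Real.exp_pos (-k i)).le (sq_nonneg ‖W i j‖))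
        have h2 : Real.exp (l j - k i) = Real.exp (l j) * Real.exp (-k i) := by
          rw [← Real.exp_add]; ring_nf
        have h3 : Real.exp (-k i) * Real.exp (-(l j - k i)) = Real.exp (-l j) := by
          rw [← Real.exp_add]; ring_nf
        rw [h2] at h1
        calc _ = Real.exp (-k i) * ‖W i j‖ ^ 2 * (l j - k i) ^ 2 := by ring
          _ ≤ _ := h1
          _ = _ := by rw [← h3]; ring
    _ = 2 * Real.log C ^ 2 * ∑ i, Real.exp (-k i)
          + 2 / C * ∑ i, Real.exp (-k i) * (Real.exp (-k i) * ∑ j, Real.exp (l j) * ‖W i j‖ ^ 2)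
          + ∑ j, Real.exp (-l j) := by
        simp only [Finset.sum_add_distrib]
        congr 1
        · congr 1
          · simp only [← Finset.mul_sum, sum_norm_sq_row hW2, mul_one]
          · simp only [← Finset.mul_sum]
        · rw [Finset.sum_comm]
          simp only [← Finset.mul_sum, sum_norm_sq_col hW1, mul_one]
    _ ≤ 2 * Real.log C ^ 2 * 1 + 2 / C * (1 * C) + 1 := by
        rw [hk]
        gcongr
        calc _ ≤ ∑ i, Real.exp (-k i) * C :=
              Finset.sum_le_sum fun i _ => mul_le_mul_of_nonneg_left (hq i) (Real.exp_pos _).le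
          _ = _ := by rw [← Finset.sum_mul, hk]
    _ = _ := by field_simp; ring

/-- The entropy only depends on the nonzero part of the spectrum. -/
theorem ent_eq_of_charpoly {ρ : Matrix n n ℂ} {σ : Matrix κ κ ℂ} (hρ : ρ.IsHermitian)
    (hσ : σ.IsHermitian) {a b : ℕ}
    (h : Polynomial.X ^ a * ρ.charpoly = Polynomial.X ^ b * σ.charpoly) : ent ρ = ent σ := by
  have key : ∀ f : ℝ → ℝ, f 0 = 0 →
      ∑ i, f (hρ.eigenvalues i) = ∑ i, f (hσ.eigenvalues i) := by
    intro f hf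
    have h1 : ∀ {m : Type} [Fintype m] [DecidableEq m] {M : Matrix m m ℂ} (hM : M.IsHermitian)
        (c : ℕ), ∑ i, f (hM.eigenvalues i)
          = ((Polynomial.X ^ c * M.charpoly).roots.map fun z : ℂ => f z.re).sum := by
      intro m _ _ M hM c
      rw [Polynomial.roots_mul (mul_ne_zero (pow_ne_zero _ Polynomial.X_ne_zero)
        M.charpoly_monic.ne_zero), Polynomial.roots_pow, Polynomial.roots_X,
        hM.roots_charpoly_eq_eigenvalues, Multiset.map_add, Multiset.sum_add, Multiset.map_nsmul,
        Multiset.sum_nsmul]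
      simp [hf]
    rw [h1 hρ a, h1 hσ b, h]
  rw [ent_eq hρ, ent_eq hσ, key _ Real.negMulLog_zero]
  have := key id rfl
  simp only [id] at this
  rw [this]

end Entropy

end

section

open scoped Matrix.Norms.L2Operator ComplexOrder
set_option linter.unusedSectionVars false
open Matrix

/-! ### Entropy of reduced states -/

section ManyBodyEntropy

variable {D : ℕ} {q : Site D → ℕ} {A B Z Λ : Finset (Site D)}

theorem pureOp_posSemidef {n : Type} [Finite n] (x : n → ℂ) : (pureOp x).PosSemidef :=
  posSemidef_vecMulVec_self_star x

theorem trace_pureOp {n : Type} [Fintype n] (x : n → ℂ) :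
    (pureOp x).trace = ((vnorm x ^ 2 : ℝ) : ℂ) := by
  rw [pureOp, trace_vecMulVec, dotProduct_comm, star_dotProduct_self]

theorem trace_reduced_pureOp_mul (h : A ⊆ Λ) (K : Op q A) (x : Conf q Λ → ℂ) :
    (reduced A (pureOp x) * K).trace = star x ⬝ᵥ (emb h K *ᵥ x) := by
  rw [trace_mul_comm, ← trace_emb_mul h, pureOp, trace_mul_vecMulVec]

theorem emb_diagonal (h : A ⊆ Λ) (k : Conf q A → ℂ) :
    emb h (diagonal k) = diagonal fun a => k (restr h a) := by
  ext a b
  simp only [emb, of_apply, diagonal_apply]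
  by_cases hab : a = b
  · subst hab; simp
  · rw [if_neg hab]
    by_cases h1 : ∀ x : Λ, x.1 ∉ A → a x = b x
    · rw [if_pos h1, if_neg]
      intro h2
      apply hab
      funext x
      by_cases hx : x.1 ∈ A
      · exact congrFun h2 ⟨x.1, hx⟩
      · exact h1 x hx
    · rw [if_neg h1]

theorem emb_ofDiag (h : A ⊆ Λ) (U : Op q A) (k : Conf q A → ℝ) :
    emb h (ofDiag U k) = ofDiag (emb h U) (fun a => k (restr h a)) := by
  rw [ofDiag, ofDiag, emb_mul, emb_mul, emb_diagonal, emb_conjTranspose]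

theorem emb_unitary (h : A ⊆ Λ) {U : Op q A} (hU : Uᴴ * U = 1) : (emb h U)ᴴ * emb h U = 1 := by
  rw [← emb_conjTranspose, ← emb_mul, hU, emb_one]

theorem trace_reduced_re (h : A ⊆ Λ) (X : Op q Λ) : (reduced A X).trace.re = X.trace.re := by
  rw [trace_reduced h]

/-- Subadditivity of the entropy. -/
theorem ent_union_le {A₁ A₂ : Finset (Site D)} (h₁ : A₁ ⊆ A) (hA : A₂ = A \ A₁)
    {ρ : Op q A} (hρ : ρ.PosSemidef) : ent ρ ≤ ent (reduced A₁ ρ) + ent (reduced A₂ ρ) := by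
  have h₂ : A₂ ⊆ A := hA ▸ Finset.sdiff_subset
  have hdisj : Disjoint A₁ A₂ := hA ▸ Finset.disjoint_sdiff
  rcases (show 0 ≤ ρ.trace.re from (Complex.le_def.1 hρ.trace_nonneg).1).eq_or_lt with h0 | h0
  · have : ρ.trace = 0 :=
      Complex.ext h0.symm (Complex.le_def.1 hρ.trace_nonneg).2.symm
    have h1 := hρ.trace_eq_zero_iff.1 this
    have e1 : reduced A₁ (0 : Op q A) = 0 := map_zero (reducedLin A₁ A)
    have e2 : reduced A₂ (0 : Op q A) = 0 := map_zero (reducedLin A₂ A)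
    rw [h1, e1, e2, ent_zero, ent_zero, ent_zero, add_zero]
  set τ := ρ.trace.re with hτ
  have key : ∀ ε : ℝ, 0 < ε → ε < 1 →
      ent ρ ≤ ent (reduced A₁ ρ) + ent (reduced A₂ ρ) - 2 * (τ * Real.log (1 - ε)) := by
    intro ε hε hε1
    obtain ⟨U₁, k₁, hU₁, hk₁, -, -, hT₁, -⟩ := exists_regularized_log
      (posSemidef_reduced (A := A₁) hρ) (trace_reduced_re h₁ ρ) h0 hε hε1
    obtain ⟨U₂, k₂, hU₂, hk₂, -, -, hT₂, -⟩ := exists_regularized_log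
      (posSemidef_reduced (A := A₂) hρ) (trace_reduced_re h₂ ρ) h0 hε hε1
    set U := emb h₁ U₁ * emb h₂ U₂ with hU
    set k : Conf q A → ℝ := fun a => k₁ (restr h₁ a) + k₂ (restr h₂ a) with hk
    have hUU : Uᴴ * U = 1 := by
      rw [hU, conjTranspose_mul, mul_assoc, ← mul_assoc (emb h₁ U₁)ᴴ, emb_unitary h₁ hU₁, one_mul,
        emb_unitary h₂ hU₂]
    have e1 : ofDiag U (fun a => k₁ (restr h₁ a)) = emb h₁ (ofDiag U₁ k₁) := by
      rw [ofDiag, hU, ← emb_diagonal h₁ (fun a => (k₁ a : ℂ)), conjTranspose_mul,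
        mul_assoc (emb h₁ U₁), ← emb_mul_emb_comm h₁ h₂ hdisj]
      calc _ = emb h₁ U₁ * emb h₁ (diagonal fun a => (k₁ a : ℂ)) *
            (emb h₂ U₂ * (emb h₂ U₂)ᴴ) * (emb h₁ U₁)ᴴ := by simp only [mul_assoc]
        _ = _ := by
          rw [mul_eq_one_comm.1 (emb_unitary h₂ hU₂), mul_one, ← emb_conjTranspose, ← emb_mul,
            ← emb_mul, ofDiag]
    have e2 : ofDiag U (fun a => k₂ (restr h₂ a)) = emb h₂ (ofDiag U₂ k₂) := by
      rw [ofDiag, hU, ← emb_diagonal h₂ (fun a => (k₂ a : ℂ)),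
        emb_mul_emb_comm h₁ h₂ hdisj, conjTranspose_mul, mul_assoc (emb h₂ U₂),
        emb_mul_emb_comm h₁ h₂ hdisj]
      calc _ = emb h₂ U₂ * emb h₂ (diagonal fun a => (k₂ a : ℂ)) *
            (emb h₁ U₁ * (emb h₁ U₁)ᴴ) * (emb h₂ U₂)ᴴ := by simp only [mul_assoc]
        _ = _ := by
          rw [mul_eq_one_comm.1 (emb_unitary h₁ hU₁), mul_one, ← emb_conjTranspose, ← emb_mul,
            ← emb_mul, ofDiag]
    have hsum : ∑ a, Real.exp (-k a) ≤ 1 := by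
      subst hA
      refine le_of_eq ?_
      rw [← (splitEquiv (q := q) h₁).symm.sum_comp, Fintype.sum_prod_type]
      have : ∀ (a : Conf q A₁) (r : Conf q (A \ A₁)), Real.exp (-k ((splitEquiv h₁).symm (a, r)))
          = Real.exp (-k₁ a) * Real.exp (-k₂ r) := fun a r => by
        have h3 : (restr h₁ ((splitEquiv h₁).symm (a, r)), restr h₂ ((splitEquiv h₁).symm (a, r)))
            = (a, r) := (splitEquiv (q := q) h₁).apply_symm_apply (a, r)
        rw [Prod.mk.injEq] at h3
        rw [hk, ← Real.exp_add]
        simp only [h3]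
        ring_nf
      simp only [this, ← Finset.mul_sum, hk₂, mul_one, hk₁]
    have h3 := ent_le_trace hρ hUU hsum
    rw [hk, ofDiag_add U (fun a => k₁ (restr h₁ a)) (fun a => k₂ (restr h₂ a)), e1, e2, mul_add,
      trace_add, trace_mul_comm, trace_emb_mul, trace_mul_comm ρ, trace_emb_mul, Complex.add_re,
      trace_mul_comm, trace_mul_comm (ofDiag U₂ k₂)] at h3
    linarith
  have hlim : Filter.Tendsto (fun ε : ℝ => ent (reduced A₁ ρ) + ent (reduced A₂ ρ)
      - 2 * (τ * Real.log (1 - ε))) (nhdsWithin 0 (Set.Ioi 0))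
      (nhds (ent (reduced A₁ ρ) + ent (reduced A₂ ρ) - 2 * (τ * Real.log (1 - 0)))) := by
    have : ContinuousAt (fun ε : ℝ => ent (reduced A₁ ρ) + ent (reduced A₂ ρ)
      - 2 * (τ * Real.log (1 - ε))) 0 := by
      have : ContinuousAt (fun ε : ℝ => Real.log (1 - ε)) 0 :=
        ContinuousAt.log (by fun_prop) (by norm_num)
      fun_prop
    exact this.tendsto.mono_left nhdsWithin_le_nhds
  rw [sub_zero, Real.log_one, mul_zero, mul_zero, sub_zero] at hlim
  refine ge_of_tendsto hlim ?_
  filter_upwards [Ioo_mem_nhdsGT (show (0 : ℝ) < 1 by norm_num)] with ε hε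
  exact key ε hε.1 hε.2

theorem ent_le_log_card {n : Type} [Fintype n] [DecidableEq n] [Nonempty n] {ρ : Matrix n n ℂ}
    (hρ : ρ.PosSemidef) : ent ρ ≤ ρ.trace.re * Real.log (Fintype.card n) := by
  have hc : (0 : ℝ) < Fintype.card n := by exact_mod_cast Fintype.card_pos
  have h := ent_le_trace hρ (U := 1) (by simp) (k := fun _ => Real.log (Fintype.card n)) (by
    rw [Finset.sum_const, Real.exp_neg, Real.exp_log hc, nsmul_eq_mul, Finset.card_univ,
      mul_inv_cancel₀ hc.ne'])
  rw [ofDiag_const (by simp), mul_smul_comm, mul_one, trace_smul, smul_eq_mul,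
    Complex.re_ofReal_mul] at h
  linarith

theorem card_conf (A : Finset (Site D)) : Fintype.card (Conf q A) = ∏ x ∈ A, q x := by
  rw [Fintype.card_pi]
  simp only [Fintype.card_fin]
  exact Finset.prod_coe_sort A q

theorem log_card_conf_le {m : ℕ} (hq : ∀ x, q x ≤ m) (hm : 1 ≤ m) (A : Finset (Site D)) :
    Real.log (Fintype.card (Conf q A)) ≤ A.card * Real.log m := by
  rw [card_conf, ← Real.log_pow]
  rcases Nat.eq_zero_or_pos (∏ x ∈ A, q x) with h | h
  · rw [h, Nat.cast_zero, Real.log_zero]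
    exact Real.log_nonneg (one_le_pow₀ (by exact_mod_cast hm))
  · refine Real.log_le_log (by exact_mod_cast h) ?_
    rw [← Nat.cast_pow]
    exact_mod_cast Finset.prod_le_pow_card A q m fun x _ => hq x

/-- The amplitudes of a vector as a matrix between a region and its complement. -/
theorem ent_reduced_compl (h : A ⊆ Λ) (x : Conf q Λ → ℂ) :
    ent (reduced A (pureOp x)) = ent (reduced (Λ \ A) (pureOp x)) := by
  have hc : Λ \ (Λ \ A) = A := Finset.sdiff_sdiff_eq_self h
  set M : Matrix (Conf q A) (Conf q (Λ \ A)) ℂ := of fun a r => x (join a r) with hM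
  have e1 : reduced A (pureOp x) = M * Mᴴ := by
    ext a b
    simp [reduced, pureOp, vecMulVec_apply, mul_apply, hM]
  have e2 : reduced (Λ \ A) (pureOp x) = (Mᴴ * M)ᵀ := by
    ext r s
    simp only [reduced, pureOp, vecMulVec_apply, mul_apply, of_apply, transpose_apply,
      conjTranspose_apply, hM, Pi.star_apply]
    have hsub : A ⊆ Λ \ (Λ \ A) := hc.ge
    have hsub' : Λ \ (Λ \ A) ⊆ A := hc.le
    let e : Conf q A ≃ Conf q (Λ \ (Λ \ A)) :=
      { toFun := restr hsub', invFun := restr hsub, left_inv := fun a => rfl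
        right_inv := fun a => rfl }
    rw [← e.sum_comp]
    have hj : ∀ (a : Conf q A) (r : Conf q (Λ \ A)), (join r (e a) : Conf q Λ) = join a r := by
      intro a r
      funext y
      by_cases hy : y.1 ∈ A
      · have : y.1 ∉ Λ \ A := fun h' => (Finset.mem_sdiff.1 h').2 hy
        simp only [join, dif_pos hy, dif_neg this]
        rfl
      · have : y.1 ∈ Λ \ A := Finset.mem_sdiff.2 ⟨y.2, hy⟩
        simp only [join, dif_neg hy, dif_pos this]
    refine Finset.sum_congr rfl fun a _ => ?_
    rw [hj, hj, mul_comm]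
  have hh1 : (reduced A (pureOp x)).IsHermitian :=
    (posSemidef_reduced (pureOp_posSemidef x)).isHermitian
  have hh2 : (reduced (Λ \ A) (pureOp x)).IsHermitian :=
    (posSemidef_reduced (pureOp_posSemidef x)).isHermitian
  refine ent_eq_of_charpoly hh1 hh2 (a := Fintype.card (Conf q (Λ \ A)))
    (b := Fintype.card (Conf q A)) ?_
  rw [e1, e2, charpoly_transpose, charpoly_mul_comm']

open scoped MatrixOrder in
theorem exists_eq_conjTranspose_mul_self {n : Type} [Fintype n] [DecidableEq n] {ω : Matrix n n ℂ}
    (hω : ω.PosSemidef) : ∃ Q : Matrix n n ℂ, ω = Qᴴ * Q :=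
  CStarAlgebra.nonneg_iff_eq_star_mul_self.mp hω.nonneg

/-- An operator is dominated by its partial trace, tensored with the identity, up to
the dimension of the factor that is traced out. -/
theorem re_dotProduct_le_emb_reduced (h : B ⊆ A) {ω : Op q A} (hω : ω.PosSemidef)
    (v : Conf q A → ℂ) :
    (star v ⬝ᵥ (ω *ᵥ v)).re ≤ Fintype.card (Conf q (A \ B)) *
      (star v ⬝ᵥ (emb h (reduced B ω) *ᵥ v)).re := by
  obtain ⟨Q, hQ⟩ := exists_eq_conjTranspose_mul_self hω
  have hω' : ∀ w : Conf q A → ℂ, (star w ⬝ᵥ (ω *ᵥ w)).re = vnorm (Q *ᵥ w) ^ 2 := fun w => by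
    rw [hQ, ← mulVec_mulVec, dotProduct_mulVec, ← star_mulVec, star_dotProduct_self,
      Complex.ofReal_re]
  -- the component of `v` on the basis vector `r` of the traced factor, moved to `s`
  set P : Conf q (A \ B) → Conf q (A \ B) → Conf q A → ℂ := fun r s a =>
    if restr Finset.sdiff_subset a = s then v (join (restr h a) r) else 0 with hP
  have hv : v = ∑ r, P r r := by
    funext a
    rw [Finset.sum_apply, Finset.sum_eq_single (restr Finset.sdiff_subset a)]
    · simp only [hP, if_true]
      exact congrArg v ((splitEquiv (q := q) h).symm_apply_apply a).symm
    · intro r _ hr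
      simp only [hP, if_neg (Ne.symm hr)]
    · simp
  have h1 : (star v ⬝ᵥ (ω *ᵥ v)).re ≤ Fintype.card (Conf q (A \ B)) *
      ∑ r, vnorm (Q *ᵥ P r r) ^ 2 := by
    rw [hω']
    have h2 : Q *ᵥ v = ∑ r, Q *ᵥ P r r := by
      conv_lhs => rw [hv]
      exact map_sum (mulVecLin Q) _ _
    have h3 : vnorm (Q *ᵥ v) ≤ ∑ r, vnorm (Q *ᵥ P r r) := by
      rw [h2]
      simp only [vnorm, WithLp.toLp_sum]
      exact norm_sum_le _ _
    calc vnorm (Q *ᵥ v) ^ 2 ≤ (∑ r, vnorm (Q *ᵥ P r r)) ^ 2 :=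
          pow_le_pow_left₀ (vnorm_nonneg _) h3 2
      _ ≤ _ := by
          have := sq_sum_le_card_mul_sum_sq (s := (Finset.univ : Finset (Conf q (A \ B))))
            (f := fun r => vnorm (Q *ᵥ P r r))
          rwa [Finset.card_univ] at this
  have h2 : (star v ⬝ᵥ (emb h (reduced B ω) *ᵥ v)).re
      = ∑ r, ∑ s, vnorm (Q *ᵥ P r s) ^ 2 := by
    have h3 : ∀ r s, vnorm (Q *ᵥ P r s) ^ 2 = (∑ a, ∑ b, star (v (join a r)) *
        (ω (join a s) (join b s) * v (join b r))).re := by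
      intro r s
      rw [← hω']
      congr 1
      simp only [dotProduct, mulVec, Pi.star_apply]
      rw [← (splitEquiv (q := q) h).symm.sum_comp, Fintype.sum_prod_type]
      refine Finset.sum_congr rfl fun a _ => ?_
      have h4 : ∀ (a : Conf q B) (t : Conf q (A \ B)), P r s ((splitEquiv h).symm (a, t))
          = if t = s then v (join a r) else 0 := fun a t => by
        have h5 : (restr h ((splitEquiv h).symm (a, t)),
            restr Finset.sdiff_subset ((splitEquiv h).symm (a, t)))
            = (a, t) := (splitEquiv (q := q) h).apply_symm_apply (a, t)
        rw [Prod.mk.injEq] at h5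
        simp only [hP, h5]
      rw [Finset.sum_eq_single s]
      · rw [h4, if_pos rfl, Finset.mul_sum, ← (splitEquiv (q := q) h).symm.sum_comp,
          Fintype.sum_prod_type]
        refine Finset.sum_congr rfl fun b _ => ?_
        rw [Finset.sum_eq_single s]
        · rw [h4, if_pos rfl]; rfl
        · intro t _ ht; rw [h4, if_neg ht]; simp
        · simp
      · intro t _ ht; rw [h4, if_neg ht]; simp
      · simp
    simp only [h3, ← Complex.re_sum]
    congr 1
    have h6 : star v ⬝ᵥ (emb h (reduced B ω) *ᵥ v) = (reduced B (pureOp v) * reduced B ω).trace :=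
      (trace_reduced_pureOp_mul h _ _).symm
    rw [h6, trace_mul_comm]
    have h7 : (reduced B ω * reduced B (pureOp v)).trace =
        ∑ a : Conf q B, ∑ b : Conf q B, ∑ r : Conf q (A \ B), ∑ s : Conf q (A \ B),
        star (v (join a r)) * (ω (join a s) (join b s) * v (join b r)) := by
      simp only [trace, diag_apply, mul_apply, reduced, of_apply, pureOp, vecMulVec_apply,
        Pi.star_apply]
      refine Finset.sum_congr rfl fun a _ => Finset.sum_congr rfl fun b _ => ?_
      rw [Finset.sum_mul_sum, Finset.sum_comm]
      exact Finset.sum_congr rfl fun r _ => Finset.sum_congr rfl fun s _ => by ring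
    rw [h7]
    calc _ = ∑ a : Conf q B, ∑ r : Conf q (A \ B), ∑ b : Conf q B, ∑ s : Conf q (A \ B),
          star (v (join a r)) * (ω (join a s) (join b s) * v (join b r)) :=
          Finset.sum_congr rfl fun a _ => Finset.sum_comm
      _ = ∑ r : Conf q (A \ B), ∑ a : Conf q B, ∑ b : Conf q B, ∑ s : Conf q (A \ B),
          star (v (join a r)) * (ω (join a s) (join b s) * v (join b r)) := Finset.sum_comm
      _ = _ := by
          refine Finset.sum_congr rfl fun r _ => ?_
          exact (Finset.sum_congr rfl fun a _ => Finset.sum_comm).trans Finset.sum_comm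
  rw [h2]
  refine h1.trans (mul_le_mul_of_nonneg_left ?_ (by positivity))
  exact Finset.sum_le_sum fun r _ => Finset.single_le_sum
    (f := fun s => vnorm (Q *ᵥ P r s) ^ 2) (fun _ _ => by positivity) (Finset.mem_univ r)

end ManyBodyEntropy

end

section

open scoped Matrix.Norms.L2Operator ComplexOrder
set_option linter.unusedSectionVars false
open Matrix Filter Topology

/-! ### Entanglement rates -/

section EntanglementRate

variable {n : Type} [Fintype n] [DecidableEq n]

theorem star_dotProduct_mulVec (A : Matrix n n ℂ) (x y : n → ℂ) :
    star x ⬝ᵥ (A *ᵥ y) = star (Aᴴ *ᵥ x) ⬝ᵥ y := by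
  rw [star_mulVec, conjTranspose_conjTranspose, dotProduct_mulVec]

theorem star_mulVec_dotProduct (A : Matrix n n ℂ) (x y : n → ℂ) :
    star (A *ᵥ x) ⬝ᵥ y = star x ⬝ᵥ (Aᴴ *ᵥ y) := by
  rw [star_dotProduct_mulVec, conjTranspose_conjTranspose]

theorem re_star_dotProduct_comm (x y : n → ℂ) : (star x ⬝ᵥ y).re = (star y ⬝ᵥ x).re := by
  rw [star_dotProduct, ← Complex.conj_re, dotProduct_comm]
  rfl

/-- Expectation of an observable along one Kraus step. On the jump terms the observable is replaced
by one that commutes with the generator; the first order terms then involve only the difference of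
the two observables. -/
theorem IsLForm.kraus_expectation_le {M : SuperOp n} {G : Matrix n n ℂ} {ι : Type} [Fintype ι]
    {L : ι → Matrix n n ℂ} (h : IsLForm M G L) {T T' : Matrix n n ℂ} (hT : T.IsHermitian)
    (hT' : T'.IsHermitian) (hG : T' * G = G * T') (hL : ∀ j, T' * L j = L j * T') {s : ℝ}
    (hs : 0 ≤ s) (x : n → ℂ) :
    (star (x + (s : ℂ) • (G *ᵥ x)) ⬝ᵥ (T *ᵥ (x + (s : ℂ) • (G *ᵥ x)))).re +
        s * ∑ j, (star (L j *ᵥ x) ⬝ᵥ (T' *ᵥ (L j *ᵥ x))).re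
      ≤ (star x ⬝ᵥ (T *ᵥ x)).re + 2 * s * (vnorm ((T - T') *ᵥ x) * vnorm (G *ᵥ x))
        + s ^ 2 * (‖T‖ * vnorm (G *ᵥ x) ^ 2) := by
  have e1 : (star (x + (s : ℂ) • (G *ᵥ x)) ⬝ᵥ (T *ᵥ (x + (s : ℂ) • (G *ᵥ x)))).re
      = (star x ⬝ᵥ (T *ᵥ x)).re + 2 * s * (star (T *ᵥ x) ⬝ᵥ (G *ᵥ x)).re
        + s ^ 2 * (star (G *ᵥ x) ⬝ᵥ (T *ᵥ (G *ᵥ x))).re := by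
    have h1 : (star x ⬝ᵥ (T *ᵥ (G *ᵥ x))) = star (T *ᵥ x) ⬝ᵥ (G *ᵥ x) := by
      rw [star_dotProduct_mulVec, hT.eq]
    have h2 := re_star_dotProduct_comm (G *ᵥ x) (T *ᵥ x)
    rw [mulVec_add, mulVec_smul, star_add, star_smul, add_dotProduct, dotProduct_add,
      dotProduct_add, smul_dotProduct, smul_dotProduct, dotProduct_smul, dotProduct_smul, h1]
    simp only [RCLike.star_def, Complex.conj_ofReal, smul_eq_mul, Complex.add_re,
      Complex.re_ofReal_mul, h2]
    ring
  have e2 : ∑ j, (star (L j *ᵥ x) ⬝ᵥ (T' *ᵥ (L j *ᵥ x))).re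
      = -2 * (star (T' *ᵥ x) ⬝ᵥ (G *ᵥ x)).re := by
    have h1 : ∀ j, star (L j *ᵥ x) ⬝ᵥ (T' *ᵥ (L j *ᵥ x))
        = star (T' *ᵥ x) ⬝ᵥ (((L j)ᴴ * L j) *ᵥ x) := fun j => by
      have h2 : (L j)ᴴ * T' = T' * (L j)ᴴ := by
        have := congrArg conjTranspose (hL j)
        rwa [conjTranspose_mul, conjTranspose_mul, hT'.eq] at this
      rw [star_mulVec_dotProduct, star_mulVec_dotProduct, hT'.eq, mulVec_mulVec, mulVec_mulVec,
        mulVec_mulVec, ← mul_assoc, h2]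
    simp only [h1]
    rw [← Complex.re_sum, ← dotProduct_sum, ← Matrix.sum_mulVec]
    have h2 : ∑ j, (L j)ᴴ * L j = -(G + Gᴴ) := by
      rw [eq_neg_iff_add_eq_zero, add_comm]; exact h.2
    rw [h2, neg_mulVec, dotProduct_neg, add_mulVec, dotProduct_add, Complex.neg_re, Complex.add_re]
    have h3 : (star (T' *ᵥ x) ⬝ᵥ (Gᴴ *ᵥ x)).re = (star (T' *ᵥ x) ⬝ᵥ (G *ᵥ x)).re := by
      rw [star_dotProduct_mulVec, conjTranspose_conjTranspose, mulVec_mulVec, ← hG,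
        ← mulVec_mulVec, re_star_dotProduct_comm, star_dotProduct_mulVec, hT'.eq]
    rw [h3]; ring
  have h3 : (star (T *ᵥ x) ⬝ᵥ (G *ᵥ x)).re - (star (T' *ᵥ x) ⬝ᵥ (G *ᵥ x)).re
      ≤ vnorm ((T - T') *ᵥ x) * vnorm (G *ᵥ x) := by
    rw [← Complex.sub_re, ← sub_dotProduct, ← star_sub, ← sub_mulVec]
    exact (Complex.re_le_norm _).trans (norm_star_dotProduct_le _ _)
  have h4 : (star (G *ᵥ x) ⬝ᵥ (T *ᵥ (G *ᵥ x))).re ≤ ‖T‖ * vnorm (G *ᵥ x) ^ 2 := by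
    refine (Complex.re_le_norm _).trans ((norm_star_dotProduct_le _ _).trans ?_)
    have := mul_le_mul_of_nonneg_left (vnorm_mulVec_le T (G *ᵥ x)) (vnorm_nonneg (G *ᵥ x))
    refine this.trans (le_of_eq (by ring))
  rw [e1, e2]
  have h5 := mul_le_mul_of_nonneg_left h3 (show 0 ≤ 2 * s by linarith)
  have h6 := mul_le_mul_of_nonneg_left h4 (sq_nonneg s)
  linarith

variable {D : ℕ} {q : Site D → ℕ} {A B Z Λ : Finset (Site D)}

/-- The logarithm of the maximally mixed extension of a marginal dominates, up to a constant
depending on the dimension of the complementary factor. -/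
theorem exists_marginal_log (h : B ⊆ A) {ω : Op q A} (hω : ω.PosSemidef) (h1 : ω.trace.re = 1) :
    ∃ (V : Op q A) (l : Conf q A → ℝ), Vᴴ * V = 1 ∧ ∑ j, Real.exp (-l j) = 1 ∧
      (∃ K : Op q B, ofDiag V l = emb h K) ∧
      ∀ v : Conf q A → ℂ, (star v ⬝ᵥ (ω *ᵥ v)).re ≤ 2 * (Fintype.card (Conf q (A \ B)) : ℝ) ^ 2 *
        (star v ⬝ᵥ (ofDiag V (fun j => Real.exp (-l j)) *ᵥ v)).re := by
  have hne : Nonempty (Conf q A) := by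
    by_contra hn
    rw [not_nonempty_iff] at hn
    rw [trace, Finset.univ_eq_empty, Finset.sum_empty] at h1
    norm_num at h1
  have hne' : Nonempty (Conf q (A \ B)) := hne.map (restr Finset.sdiff_subset)
  set d : ℝ := (Fintype.card (Conf q (A \ B)) : ℝ) with hd
  have hd0 : 0 < d := by rw [hd]; exact_mod_cast Fintype.card_pos
  obtain ⟨V, l, hV, hl, -, -, -, hσ⟩ := exists_regularized_log (posSemidef_reduced (A := B) hω)
    ((trace_reduced_re h ω).trans h1) one_pos (show (0 : ℝ) < 1 / 2 by norm_num) (by norm_num)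
  have hexp : ∀ a : Conf q A, Real.exp (-(l (restr h a) + Real.log d))
      = d⁻¹ * Real.exp (-l (restr h a)) := fun a => by
    rw [neg_add, Real.exp_add, Real.exp_neg (Real.log d), Real.exp_log hd0, mul_comm]
  refine ⟨emb h V, fun a => l (restr h a) + Real.log d, emb_unitary h hV, ?_,
    ⟨ofDiag V l + (Real.log d : ℂ) • 1, ?_⟩, fun v => ?_⟩
  · simp only [hexp]
    rw [← (splitEquiv (q := q) h).symm.sum_comp, Fintype.sum_prod_type]
    have h5 : ∀ (a : Conf q B) (t : Conf q (A \ B)), restr h ((splitEquiv h).symm (a, t)) = a :=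
      fun a t => restr_join h a t
    simp only [h5, Finset.sum_const, Finset.card_univ, nsmul_eq_mul]
    rw [← Finset.mul_sum, ← Finset.mul_sum, hl, mul_one, mul_inv_cancel₀ hd0.ne']
  · rw [ofDiag_add (emb h V) (fun a => l (restr h a)) (fun _ => Real.log d), ← emb_ofDiag,
      ofDiag_const (emb_unitary h hV), emb_add, emb_smul, emb_one]
  · have e : ofDiag (emb h V) (fun j => Real.exp (-(l (restr h j) + Real.log d)))
        = ((d⁻¹ : ℝ) : ℂ) • ((((1 - 1 / 2) / 1 : ℝ) : ℂ) • emb h (reduced B ω)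
          + ((1 / 2 / Fintype.card (Conf q B) : ℝ) : ℂ) • 1) := by
      simp only [hexp]
      rw [ofDiag_smul, ← emb_ofDiag h V (fun a => Real.exp (-l a)), hσ, emb_add, emb_smul,
        emb_smul, emb_one]
    rw [e, smul_mulVec, add_mulVec, smul_mulVec, smul_mulVec, one_mulVec, dotProduct_smul,
      dotProduct_add, dotProduct_smul, dotProduct_smul, star_dotProduct_self]
    simp only [smul_eq_mul, Complex.re_ofReal_mul, Complex.add_re, Complex.ofReal_re]
    have h2 := re_dotProduct_le_emb_reduced h hω v
    rw [← hd] at h2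
    refine h2.trans ?_
    have h3 : 0 ≤ 2 * d * (1 / 2 / (Fintype.card (Conf q B) : ℝ) * vnorm v ^ 2) := by positivity
    have h4 : 2 * d ^ 2 * (d⁻¹ * ((1 - 1 / 2) / 1 * (star v ⬝ᵥ (emb h (reduced B ω) *ᵥ v)).re
        + 1 / 2 / (Fintype.card (Conf q B) : ℝ) * vnorm v ^ 2))
        = d * (star v ⬝ᵥ (emb h (reduced B ω) *ᵥ v)).re
          + 2 * d * (1 / 2 / (Fintype.card (Conf q B) : ℝ) * vnorm v ^ 2) := by
      field_simp
      ring
    rw [h4]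
    linarith

/-- `R` bounds the rate at which the generator `M` creates entanglement between `A` and its
complement: along one Kraus step of length `s`, the mean entropy of the reduced states on `A` grows
by at most `s R`, up to a higher order error. -/
def EntRate (A : Finset (Site D)) (M : SuperOp (Conf q Λ)) (R : ℝ) : Prop :=
  ∃ (ι : Type) (_ : Fintype ι) (G : Op q Λ) (L : ι → Op q Λ), IsLForm M G L ∧
    ∃ C : ℝ, 0 ≤ C ∧ ∀ (s : ℝ) (x : Conf q Λ → ℂ), 0 < s → s ≤ 1 / 2 →
      ent (reduced A (pureOp (x + (s : ℂ) • (G *ᵥ x)))) +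
          s * ∑ j, ent (reduced A (pureOp (L j *ᵥ x)))
        ≤ ent (reduced A (pureOp x)) + (s * R + C * (s * √s)) * vnorm x ^ 2

theorem EntRate.mono {M : SuperOp (Conf q Λ)} {R R' : ℝ} (h : EntRate A M R) (hR : R ≤ R') :
    EntRate A M R' := by
  obtain ⟨ι, i, G, L, hL, C, hC, h⟩ := h
  refine ⟨ι, i, G, L, hL, C, hC, fun s x hs hs1 => (h s x hs hs1).trans ?_⟩
  gcongr

theorem reduced_pureOp_zero : reduced A (pureOp (0 : Conf q Λ → ℂ)) = 0 := by
  have : pureOp (0 : Conf q Λ → ℂ) = 0 := by ext; simp [pureOp, vecMulVec_apply]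
  rw [this]
  exact map_zero (reducedLin A Λ)

set_option maxHeartbeats 1000000 in
/-- The entanglement rate of a term on `Z` is controlled by the distance, in mean square, between the
regularised `-log ρ` and an operator that commutes with everything on `Z` and is itself the `-log` of
a state. The former observable serves for the deterministic branch of a Kraus step, the latter
for the jumps. The regularisation by `s²` keeps the former bounded by `O(log (1 / s))`. -/
theorem entRate_of_log (hA : A ⊆ Λ) (hZ : Z ⊆ Λ) {N : SuperOp (Conf q Z)} {G : Op q Z} {ι : Type}
    [Fintype ι] {L : ι → Op q Z} (h : IsLForm N G L) {r : ℝ} (hr : 0 ≤ r)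
    (hlog : ∀ (ρ : Op q A) (s : ℝ) (U : Op q A) (k : Conf q A → ℝ), ρ.PosSemidef →
      0 < ρ.trace.re → 0 < s → s ≤ 1 / 2 → Uᴴ * U = 1 → ∑ j, Real.exp (-k j) = 1 →
      ofDiag U (fun j => Real.exp (-k j)) = (((1 - s ^ 2) / ρ.trace.re : ℝ) : ℂ) • ρ
        + ((s ^ 2 / Fintype.card (Conf q A) : ℝ) : ℂ) • 1 →
      ∃ (V : Op q A) (l : Conf q A → ℝ), Vᴴ * V = 1 ∧ ∑ j, Real.exp (-l j) ≤ 1 ∧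
        (∀ P : Op q Z, emb hA (ofDiag V l) * emb hZ P = emb hZ P * emb hA (ofDiag V l)) ∧
        (ρ * ((ofDiag U k - ofDiag V l) * (ofDiag U k - ofDiag V l))).trace.re
          ≤ r ^ 2 * ρ.trace.re) :
    EntRate A (extend hZ N) (2 * ‖G‖ * r) := by
  set d : ℝ := (Fintype.card (Conf q A) : ℝ) with hd
  refine ⟨ι, inferInstance, emb hZ G, fun j => emb hZ (L j), h.extend hZ,
    2 + (Real.log d + 4) * ‖G‖ ^ 2, ?_, ?_⟩
  · have : 0 ≤ Real.log d := Real.log_natCast_nonneg _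
    positivity
  intro s x hs hs1
  rcases eq_or_ne x 0 with hx | hx
  · subst hx
    simp only [mulVec_zero, smul_zero, add_zero, reduced_pureOp_zero, ent_zero, Finset.sum_const_zero,
      mul_zero]
    rw [vnorm_eq_zero.2 rfl]
    simp
  have hτ0 : 0 < vnorm x ^ 2 := by
    have := vnorm_eq_zero.not.2 hx
    positivity
  have htr : (reduced A (pureOp x)).trace.re = vnorm x ^ 2 := by
    rw [trace_reduced_re hA, trace_pureOp, Complex.ofReal_re]
  have hρ : (reduced A (pureOp x)).PosSemidef := posSemidef_reduced (pureOp_posSemidef x)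
  have hs2 : s ^ 2 ≤ 1 / 4 := by nlinarith
  obtain ⟨U, k, hU, hk, hk0, hk1, hT, hω⟩ := exists_regularized_log hρ htr hτ0
    (show 0 < s ^ 2 by positivity) (by linarith)
  rw [← htr] at hω
  obtain ⟨V, l, hV, hl, hcomm, hvar⟩ := hlog _ s U k hρ (htr ▸ hτ0) hs hs1 hU hk hω
  rw [htr] at hvar
  set T := emb hA (ofDiag U k) with hTdef
  set T' := emb hA (ofDiag V l) with hT'def
  have hTh : T.IsHermitian := by
    rw [IsHermitian, hTdef, ← emb_conjTranspose, (ofDiag_isHermitian U k).eq]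
  have hT'h : T'.IsHermitian := by
    rw [IsHermitian, hT'def, ← emb_conjTranspose, (ofDiag_isHermitian V l).eq]
  have h1 := (h.extend hZ).kraus_expectation_le hTh hT'h (hcomm G) (fun j => hcomm (L j)) hs.le x
  have hgibbs : ∀ y : Conf q Λ → ℂ, ent (reduced A (pureOp y)) ≤ (star y ⬝ᵥ (T *ᵥ y)).re :=
    fun y => by
      rw [← trace_reduced_pureOp_mul hA]
      exact ent_le_trace (posSemidef_reduced (pureOp_posSemidef y)) hU hk.le
  have hgibbs' : ∀ y : Conf q Λ → ℂ, ent (reduced A (pureOp y)) ≤ (star y ⬝ᵥ (T' *ᵥ y)).re :=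
    fun y => by
      rw [← trace_reduced_pureOp_mul hA]
      exact ent_le_trace (posSemidef_reduced (pureOp_posSemidef y)) hV hl
  have h2 : (star x ⬝ᵥ (T *ᵥ x)).re ≤ ent (reduced A (pureOp x)) + 2 * s ^ 2 * vnorm x ^ 2 := by
    rw [← trace_reduced_pureOp_mul hA]
    refine hT.trans ?_
    have h3 : -Real.log (1 - s ^ 2) ≤ 2 * s ^ 2 := by
      have h4 := Real.one_sub_inv_le_log_of_pos (show 0 < 1 - s ^ 2 by linarith)
      have h5 : (1 - s ^ 2)⁻¹ ≤ 1 + 2 * s ^ 2 := by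
        rw [inv_le_iff_one_le_mul₀ (by linarith)]
        nlinarith
      linarith
    nlinarith
  have h3 : vnorm ((T - T') *ᵥ x) ≤ r * vnorm x := by
    refine (pow_le_pow_iff_left₀ (vnorm_nonneg _) (mul_nonneg hr (vnorm_nonneg _)) two_ne_zero).1 ?_
    have e : ((vnorm ((T - T') *ᵥ x) ^ 2 : ℝ) : ℂ)
        = (reduced A (pureOp x) * ((ofDiag U k - ofDiag V l) * (ofDiag U k - ofDiag V l))).trace := by
      have : emb hA (ofDiag U k - ofDiag V l) = T - T' := map_sub (embHom hA) _ _
      rw [trace_reduced_pureOp_mul hA, emb_mul, ← star_dotProduct_self, ← mulVec_mulVec, this,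
        star_mulVec_dotProduct, (hTh.sub hT'h).eq]
    have := congrArg Complex.re e
    rw [Complex.ofReal_re] at this
    rw [this, mul_pow]
    exact hvar
  have h4 : vnorm (emb hZ G *ᵥ x) ≤ ‖G‖ * vnorm x :=
    (vnorm_mulVec_le _ _).trans (mul_le_mul_of_nonneg_right (norm_emb_le hZ G) (vnorm_nonneg _))
  have hne : Nonempty (Conf q A) := by
    by_contra hn
    rw [not_nonempty_iff] at hn
    rw [Finset.univ_eq_empty, Finset.sum_empty] at hk
    exact zero_ne_one hk
  have hd1 : 1 ≤ d := by rw [hd]; exact_mod_cast Fintype.card_pos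
  have hTn : ‖T‖ ≤ Real.log d + 4 / √s := by
    have h5 : Real.log (d / s ^ 2) ≤ Real.log d + 4 / √s := by
      have h6 : 0 < √s := Real.sqrt_pos.2 hs
      have h7 := Real.log_le_sub_one_of_pos (inv_pos.2 h6)
      have h8 : s = √s ^ 2 := (Real.sq_sqrt hs.le).symm
      rw [Real.log_inv] at h7
      rw [Real.log_div (by linarith) (by positivity), Real.log_pow]
      nth_rw 1 [h8]
      rw [Real.log_pow, div_eq_mul_inv]
      push_cast
      linarith
    refine (norm_emb_le hA _).trans (norm_ofDiag_le hU ?_ fun i => ?_)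
    · have := Real.log_nonneg hd1
      positivity
    · rw [abs_of_nonneg (hk0 i)]
      exact (hk1 i).trans h5
  have h5 : vnorm ((T - T') *ᵥ x) * vnorm (emb hZ G *ᵥ x) ≤ (r * vnorm x) * (‖G‖ * vnorm x) :=
    mul_le_mul h3 h4 (vnorm_nonneg _) (mul_nonneg hr (vnorm_nonneg _))
  have h6 : ‖T‖ * vnorm (emb hZ G *ᵥ x) ^ 2 ≤ (Real.log d + 4 / √s) * (‖G‖ * vnorm x) ^ 2 :=
    mul_le_mul hTn (pow_le_pow_left₀ (vnorm_nonneg _) h4 2) (by positivity)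
      ((norm_nonneg _).trans hTn)
  have h7 : ∑ j, ent (reduced A (pureOp (emb hZ (L j) *ᵥ x)))
      ≤ ∑ j, (star (emb hZ (L j) *ᵥ x) ⬝ᵥ (T' *ᵥ (emb hZ (L j) *ᵥ x))).re :=
    Finset.sum_le_sum fun j _ => hgibbs' _
  have h8 := hgibbs (x + (s : ℂ) • (emb hZ G *ᵥ x))
  -- second order terms are bounded by multiples of `s √s`
  have hss : 0 < √s := Real.sqrt_pos.2 hs
  have hs3 : s ^ 2 ≤ s * √s := by
    have : s ≤ √s := Real.le_sqrt_of_sq_le (by nlinarith)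
    nlinarith
  have hs4 : s ^ 2 * (4 / √s) = 4 * (s * √s) := by
    calc s ^ 2 * (4 / √s) = 4 * (s * (s / √s)) := by ring
      _ = _ := by rw [Real.div_sqrt]
  calc _ ≤ (star x ⬝ᵥ (T *ᵥ x)).re + 2 * s * (vnorm ((T - T') *ᵥ x) * vnorm (emb hZ G *ᵥ x))
        + s ^ 2 * (‖T‖ * vnorm (emb hZ G *ᵥ x) ^ 2) := by
        refine le_trans ?_ h1
        gcongr
    _ ≤ ent (reduced A (pureOp x)) + 2 * s ^ 2 * vnorm x ^ 2
        + 2 * s * ((r * vnorm x) * (‖G‖ * vnorm x))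
        + s ^ 2 * ((Real.log d + 4 / √s) * (‖G‖ * vnorm x) ^ 2) := by
        gcongr
    _ = ent (reduced A (pureOp x)) + (s * (2 * ‖G‖ * r) + (2 * s ^ 2
          + (s ^ 2 * Real.log d + s ^ 2 * (4 / √s)) * ‖G‖ ^ 2)) * vnorm x ^ 2 := by ring
    _ ≤ ent (reduced A (pureOp x)) + (s * (2 * ‖G‖ * r) + (2 * (s * √s)
          + (s * √s * Real.log d + 4 * (s * √s)) * ‖G‖ ^ 2)) * vnorm x ^ 2 := by
        rw [hs4]
        have := Real.log_nonneg hd1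
        gcongr
    _ = _ := by ring

/-- The entanglement rate of a local generator is bounded by its strength and the number of its
degrees of freedom in `A`. -/
theorem entRate_extend (hA : A ⊆ Λ) (hZ : Z ⊆ Λ) {N : SuperOp (Conf q Z)} {G : Op q Z} {ι : Type}
    [Fintype ι] {L : ι → Op q Z} (h : IsLForm N G L) :
    EntRate A (extend hZ N)
      (2 * ‖G‖ * (5 + 4 * Real.log (Fintype.card (Conf q (A \ (A \ Z)))))) := by
  have hlog0 : 0 ≤ Real.log (Fintype.card (Conf q (A \ (A \ Z)))) := Real.log_natCast_nonneg _
  refine entRate_of_log hA hZ h (by positivity) ?_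
  intro ρ s U k hρ hτ hs hs1 hU hk hω
  have hs2 : s ^ 2 ≤ 1 / 4 := by nlinarith
  set ω := ofDiag U (fun j => Real.exp (-k j)) with hωdef
  have hωp : ω.PosSemidef := by
    refine PosSemidef.of_dotProduct_mulVec_nonneg (ofDiag_isHermitian _ _) fun v => ?_
    rw [star_dotProduct_ofDiag]
    exact_mod_cast Finset.sum_nonneg fun j _ => by positivity
  have hω1 : ω.trace.re = 1 := by
    have := trace_ofDiag_mul_ofDiag U U (fun j => Real.exp (-k j)) (fun _ => 1)
    rw [ofDiag_const hU, Complex.ofReal_one, one_smul, mul_one] at this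
    rw [hωdef, this, Complex.ofReal_re]
    simp only [mul_one, ← Finset.mul_sum, sum_norm_sq_row (conjTranspose_mul_unitary hU hU).2, hk]
  obtain ⟨V, l, hV, hl, ⟨K, hK⟩, hdom⟩ := exists_marginal_log (Finset.sdiff_subset (t := Z)) hωp hω1
  refine ⟨V, l, hV, hl.le, fun P => ?_, ?_⟩
  · rw [hK, emb_emb]
    exact emb_mul_emb_comm _ hZ Finset.sdiff_disjoint K P
  have hne : Nonempty (Conf q A) := by
    by_contra hn
    rw [not_nonempty_iff] at hn
    rw [Finset.univ_eq_empty, Finset.sum_empty] at hk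
    exact zero_ne_one hk
  have hne' : Nonempty (Conf q (A \ (A \ Z))) := hne.map (restr Finset.sdiff_subset)
  set d : ℝ := (Fintype.card (Conf q (A \ (A \ Z))) : ℝ) with hd
  have hd1 : 1 ≤ d := by rw [hd]; exact_mod_cast Fintype.card_pos
  set Δ := ofDiag U k - ofDiag V l with hΔ
  have hΔh : Δ.IsHermitian := (ofDiag_isHermitian U k).sub (ofDiag_isHermitian V l)
  have hvar := trace_mul_log_sub_log_sq_le hU hV hk hl.le (C := 2 * d ^ 2) (by nlinarith) hdom
  rw [← hωdef, ← hΔ, hω, add_mul, smul_mul_assoc, smul_mul_assoc, one_mul, trace_add, trace_smul,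
    trace_smul, smul_eq_mul, smul_eq_mul, Complex.add_re, Complex.re_ofReal_mul,
    Complex.re_ofReal_mul] at hvar
  have hΔ0 : 0 ≤ (Δ * Δ).trace.re := by
    have h1 : (Δ * Δ).PosSemidef := by
      have := posSemidef_conjTranspose_mul_self Δ
      rwa [hΔh.eq] at this
    exact (Complex.le_def.1 h1.trace_nonneg).1
  have h1 : (1 - s ^ 2) / ρ.trace.re * (ρ * (Δ * Δ)).trace.re
      ≤ 2 * Real.log (2 * d ^ 2) ^ 2 + 3 := by
    have : 0 ≤ s ^ 2 / (Fintype.card (Conf q A) : ℝ) * (Δ * Δ).trace.re := by positivity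
    linarith
  have h2 : Real.log (2 * d ^ 2) = Real.log 2 + 2 * Real.log d := by
    rw [Real.log_mul two_ne_zero (by positivity), Real.log_pow]; norm_num
  have hl2 : Real.log 2 ≤ 0.7 := by linarith [Real.log_two_lt_d9]
  have hl2' : 0 ≤ Real.log 2 := Real.log_nonneg (by norm_num)
  have h3 : (1 - s ^ 2) * (ρ * (Δ * Δ)).trace.re
      ≤ (2 * (Real.log 2 + 2 * Real.log d) ^ 2 + 3) * ρ.trace.re := by
    rw [h2, div_mul_eq_mul_div, div_le_iff₀ hτ] at h1
    exact h1
  rcases le_total (ρ * (Δ * Δ)).trace.re 0 with h4 | h4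
  · exact h4.trans (by positivity)
  · have h5 : (ρ * (Δ * Δ)).trace.re ≤ (4 * (Real.log 2 + 2 * Real.log d) ^ 2 + 6) * ρ.trace.re := by
      nlinarith
    refine h5.trans (mul_le_mul_of_nonneg_right ?_ hτ.le)
    nlinarith

/-- A generator supported away from `A` creates no entanglement. -/
theorem entRate_extend_of_disjoint (hA : A ⊆ Λ) (hZ : Z ⊆ Λ) (hd : Disjoint A Z)
    {N : SuperOp (Conf q Z)} (h : HasLForm N) : EntRate A (extend hZ N) 0 := by
  obtain ⟨ι, _, G, L, h⟩ := h
  refine (entRate_of_log hA hZ h le_rfl ?_).mono (by simp)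
  intro ρ s U k hρ hτ hs hs1 hU hk hω
  refine ⟨U, k, hU, hk.le, fun P => emb_mul_emb_comm hA hZ hd _ P, ?_⟩
  simp

theorem EntRate.of_compl (hA : A ⊆ Λ) {M : SuperOp (Conf q Λ)} {R : ℝ}
    (h : EntRate (Λ \ A) M R) : EntRate A M R := by
  simpa only [EntRate, ent_reduced_compl hA] using h

/-- A generator supported inside `A` creates no entanglement. -/
theorem entRate_extend_of_subset (hA : A ⊆ Λ) (hZ : Z ⊆ A) {N : SuperOp (Conf q Z)}
    (h : HasLForm N) : EntRate A (extend (hZ.trans hA) N) 0 :=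
  (entRate_extend_of_disjoint Finset.sdiff_subset (hZ.trans hA)
    (Finset.sdiff_disjoint.mono_right hZ) h).of_compl hA

end EntanglementRate

end

section

open scoped Matrix.Norms.L2Operator ComplexOrder
set_option linter.unusedSectionVars false
open Matrix Filter Topology

/-! ### Growth of the entanglement entropy -/

section Growth

theorem pureOp_mulVec {n : Type} [Fintype n] [DecidableEq n] (B : Matrix n n ℂ) (x : n → ℂ) :
    pureOp (B *ᵥ x) = B * pureOp x * Bᴴ := (vecMulVec_conj B B x x).symm

variable {D : ℕ} {q : Site D → ℕ} {A Λ : Finset (Site D)}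

set_option maxHeartbeats 1000000 in
/-- A linear functional that is dominated by the entropy of the reduced state on pure states grows
at most with the sum of the entanglement rates. The evolution is approximated by products of
averaged Kraus steps, each of which turns a pure state into a mixture of pure states whose mean
entropy is controlled. -/
theorem re_evolution_pureOp_le {α : Type} [Fintype α] (M : α → SuperOp (Conf q Λ)) {R : α → ℝ}
    (hR0 : ∀ i, 0 ≤ R i) (hR : ∀ i, EntRate A (M i) (R i)) (f : Op q Λ →ₗ[ℂ] ℂ)
    (hf : ∀ x : Conf q Λ → ℂ, (f (pureOp x)).re ≤ ent (reduced A (pureOp x)))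
    (x : Conf q Λ → ℂ) {t : ℝ} (ht : 0 ≤ t) :
    (f (evolution (∑ i, M i) t (pureOp x))).re
      ≤ ent (reduced A (pureOp x)) + t * (∑ i, R i) * vnorm x ^ 2 := by
  rcases isEmpty_or_nonempty α with hα | hα
  · rw [Fintype.sum_empty, Fintype.sum_empty, evolution_zero_generator]
    simpa using hf x
  choose ι fι G L hL C hC hstep using hR
  set k : ℝ := ((Fintype.card α : ℕ) : ℝ) with hk
  have hk0 : 0 < k := by rw [hk]; exact_mod_cast Fintype.card_pos
  set g : ℝ := ∑ i, ‖G i‖ with hg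
  have hgi : ∀ i, ‖G i‖ ≤ g := fun i =>
    Finset.single_le_sum (f := fun i => ‖G i‖) (fun _ _ => norm_nonneg _) (Finset.mem_univ i)
  set C' : ℝ := ∑ i, C i with hC'
  have hC'0 : 0 ≤ C' := Finset.sum_nonneg fun i _ => hC i
  have hCi : ∀ i, C i ≤ C' := fun i =>
    Finset.single_le_sum (f := C) (fun i _ => hC i) (Finset.mem_univ i)
  have hRs : 0 ≤ ∑ i, R i := Finset.sum_nonneg fun i _ => hR0 i
  set Q : SuperOp (Conf q Λ) := (k : ℂ) • ∑ i, sandwich (G i) with hQ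
  -- one step, as an average over the elementary generators
  have hkraus : ∀ (σ : ℝ) (y : Conf q Λ → ℂ),
      (1 + (σ : ℂ) • (∑ i, M i) + ((σ ^ 2 : ℝ) : ℂ) • Q : Module.End ℂ (Op q Λ)) (pureOp y)
        = ((k⁻¹ : ℝ) : ℂ) • ∑ i, (pureOp (y + ((k * σ : ℝ) : ℂ) • (G i *ᵥ y))
          + ((k * σ : ℝ) : ℂ) • ∑ j, pureOp (L i j *ᵥ y)) := by
    intro σ y
    have h1 : ∀ i, pureOp (y + ((k * σ : ℝ) : ℂ) • (G i *ᵥ y))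
          + ((k * σ : ℝ) : ℂ) • ∑ j, pureOp (L i j *ᵥ y)
        = pureOp y + ((k * σ : ℝ) : ℂ) • M i (pureOp y)
          + (((k * σ) ^ 2 : ℝ) : ℂ) • (G i * pureOp y * (G i)ᴴ) := fun i => by
      rw [(hL i).kraus_eq]
      have : y + ((k * σ : ℝ) : ℂ) • (G i *ᵥ y) = (1 + ((k * σ : ℝ) : ℂ) • G i) *ᵥ y := by
        rw [add_mulVec, one_mulVec, smul_mulVec]
      rw [this]
      simp only [pureOp_mulVec]
    simp only [h1, Finset.sum_add_distrib, ← Finset.smul_sum]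
    rw [LinearMap.add_apply, LinearMap.add_apply, Module.End.one_apply, LinearMap.smul_apply,
      LinearMap.smul_apply, hQ, LinearMap.smul_apply, LinearMap.sum_apply, LinearMap.sum_apply]
    simp only [sandwich_apply, Finset.sum_const, Finset.card_univ, smul_add, smul_smul]
    rw [← Nat.cast_smul_eq_nsmul ℂ, smul_smul]
    have hk1 : (k : ℂ) ≠ 0 := by exact_mod_cast hk0.ne'
    have hk2 : ((Fintype.card α : ℕ) : ℂ) = (k : ℂ) := by rw [hk]; push_cast; rfl
    rw [hk2]
    congr 1
    · congr 1
      · push_cast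
        rw [inv_mul_cancel₀ hk1, one_smul]
      · push_cast
        rw [← mul_assoc, inv_mul_cancel₀ hk1, one_mul]
    · push_cast
      congr 1
      field_simp
  have hclaim : ∀ (σ : ℝ), 0 < σ → k * σ ≤ 1 / 2 → ∀ (N : ℕ) (y : Conf q Λ → ℂ),
      (f (((1 + (σ : ℂ) • (∑ i, M i) + ((σ ^ 2 : ℝ) : ℂ) • Q : Module.End ℂ (Op q Λ)) ^ N)
        (pureOp y))).re ≤ ent (reduced A (pureOp y)) + N * (σ * (∑ i, R i)
          + C' * (k * σ * √(k * σ))) * (1 + (k * σ) ^ 2 * g ^ 2) ^ N * vnorm y ^ 2 := by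
    intro σ hσ hkσ N
    set e : ℝ := σ * (∑ i, R i) + C' * (k * σ * √(k * σ)) with he
    have he0 : 0 ≤ e := by positivity
    set w : ℝ := 1 + (k * σ) ^ 2 * g ^ 2 with hw
    have hw1 : 1 ≤ w := by rw [hw]; exact le_add_of_nonneg_right (by positivity)
    have hks : 0 < k * σ := by positivity
    induction N with
    | zero =>
      intro y
      rw [pow_zero, Module.End.one_apply]
      simpa using hf y
    | succ N ih =>
      intro y
      rw [pow_succ, Module.End.mul_apply, hkraus]
      simp only [map_smul, map_sum, map_add, smul_eq_mul, Complex.re_ofReal_mul, Complex.re_sum,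
        Complex.add_re]
      set c : ℝ := N * e * w ^ N with hc
      have hc0 : 0 ≤ c := by positivity
      have h1 : ∀ i, (f (((1 + (σ : ℂ) • (∑ i, M i) + ((σ ^ 2 : ℝ) : ℂ) • Q :
            Module.End ℂ (Op q Λ)) ^ N) (pureOp (y + ((k * σ : ℝ) : ℂ) • (G i *ᵥ y))))).re
          + k * σ * ∑ j, (f (((1 + (σ : ℂ) • (∑ i, M i) + ((σ ^ 2 : ℝ) : ℂ) • Q :
            Module.End ℂ (Op q Λ)) ^ N) (pureOp (L i j *ᵥ y)))).re
          ≤ ent (reduced A (pureOp y)) + (k * σ * R i + C' * (k * σ * √(k * σ))) * vnorm y ^ 2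
            + c * (w * vnorm y ^ 2) := by
        intro i
        have h2 := hstep i (k * σ) y hks hkσ
        have h3 : ∑ j, (f (((1 + (σ : ℂ) • (∑ i, M i) + ((σ ^ 2 : ℝ) : ℂ) • Q :
            Module.End ℂ (Op q Λ)) ^ N) (pureOp (L i j *ᵥ y)))).re
            ≤ ∑ j, (ent (reduced A (pureOp (L i j *ᵥ y))) + c * vnorm (L i j *ᵥ y) ^ 2) :=
          Finset.sum_le_sum fun j _ => ih _
        have h4 := ih (y + ((k * σ : ℝ) : ℂ) • (G i *ᵥ y))
        have h5 := (hL i).kraus_norm (k * σ) y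
        have h6 : vnorm (G i *ᵥ y) ^ 2 ≤ g ^ 2 * vnorm y ^ 2 := by
          rw [← mul_pow]
          exact pow_le_pow_left₀ (vnorm_nonneg _) ((vnorm_mulVec_le _ _).trans
            (mul_le_mul_of_nonneg_right (hgi i) (vnorm_nonneg _))) 2
        have h7 : vnorm (y + ((k * σ : ℝ) : ℂ) • (G i *ᵥ y)) ^ 2
            + k * σ * ∑ j, vnorm (L i j *ᵥ y) ^ 2 ≤ w * vnorm y ^ 2 := by
          rw [h5, hw, add_mul, one_mul, mul_assoc]
          gcongr
        have h8 := mul_le_mul_of_nonneg_left h7 hc0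
        have h9 := mul_le_mul_of_nonneg_left h3 hks.le
        rw [Finset.sum_add_distrib, ← Finset.mul_sum] at h9
        have h10 : (k * σ * R i + C i * (k * σ * √(k * σ))) * vnorm y ^ 2
            ≤ (k * σ * R i + C' * (k * σ * √(k * σ))) * vnorm y ^ 2 := by
          have := hCi i
          gcongr
        linarith
      calc _ ≤ k⁻¹ * ∑ i, (ent (reduced A (pureOp y))
            + (k * σ * R i + C' * (k * σ * √(k * σ))) * vnorm y ^ 2 + c * (w * vnorm y ^ 2)) := by
            refine mul_le_mul_of_nonneg_left ?_ (by positivity)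
            exact Finset.sum_le_sum fun i _ => h1 i
        _ = ent (reduced A (pureOp y)) + e * vnorm y ^ 2 + c * (w * vnorm y ^ 2) := by
            simp only [Finset.sum_add_distrib, ← Finset.sum_mul, ← Finset.mul_sum,
              Finset.sum_const, Finset.card_univ, nsmul_eq_mul]
            rw [← hk, he]
            field_simp
        _ ≤ _ := by
            rw [hc]
            push_cast
            have h2 : e * 1 ≤ e * w ^ (N + 1) :=
              mul_le_mul_of_nonneg_left (one_le_pow₀ hw1) he0
            have h3 := mul_le_mul_of_nonneg_right h2 (sq_nonneg (vnorm y))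
            rw [pow_succ w N] at h3 ⊢
            linarith
  rcases ht.eq_or_lt with h0 | h0
  · rw [← h0, evolution_zero]
    simpa using hf x
  have hlim := tendsto_euler_evolution (∑ i, M i) Q (pureOp x) ht
  have hfc : Continuous f := LinearMap.continuous_of_finiteDimensional f
  have hlim' := (Complex.continuous_re.comp hfc).continuousAt.tendsto.comp hlim
  have hrhs : Tendsto (fun N : ℕ => ent (reduced A (pureOp x)) + (t * (∑ i, R i)
      + C' * (k * t * √(k * (t / N)))) * (1 + (k * t * g) ^ 2 / (N : ℝ) ^ 2) ^ N * vnorm x ^ 2)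
      atTop (𝓝 (ent (reduced A (pureOp x)) + (t * (∑ i, R i) + C' * (k * t * √(k * 0))) * 1
        * vnorm x ^ 2)) := by
    have h1 := tendsto_one_add_div_sq_pow ((k * t * g) ^ 2) (by positivity)
    have h2 : Tendsto (fun N : ℕ => √(k * (t / N))) atTop (𝓝 (√(k * 0))) :=
      (Real.continuous_sqrt.tendsto _).comp
        (tendsto_const_nhds.mul (tendsto_const_div_atTop_nhds_zero_nat t))
    exact tendsto_const_nhds.add (((tendsto_const_nhds.add
      (tendsto_const_nhds.mul (tendsto_const_nhds.mul h2))).mul h1).mul tendsto_const_nhds)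
  rw [mul_zero, Real.sqrt_zero, mul_zero, mul_zero, add_zero, mul_one] at hrhs
  refine le_of_tendsto_of_tendsto hlim' hrhs ?_
  have hev : ∀ᶠ N : ℕ in atTop, k * (t / N) ≤ 1 / 2 := by
    have h2 : Tendsto (fun N : ℕ => k * (t / N)) atTop (𝓝 (k * 0)) :=
      tendsto_const_nhds.mul (tendsto_const_div_atTop_nhds_zero_nat t)
    rw [mul_zero] at h2
    exact (h2.eventually (gt_mem_nhds (show (0 : ℝ) < 1 / 2 by norm_num))).mono fun _ h => h.le
  filter_upwards [hev, eventually_gt_atTop 0] with N hN hN0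
  have hN' : (0 : ℝ) < N := by exact_mod_cast hN0
  have h1 := hclaim (t / N) (by positivity) hN N x
  refine h1.trans (le_of_eq ?_)
  congr 3
  · field_simp
  · congr 2
    field_simp

/-- A pure state of large overlap with `x` has an entropy bounded by twice that of `x`. -/
theorem ent_mul_vnorm_sq_le (hA : A ⊆ Λ) [Nonempty (Conf q A)] {φ : Conf q Λ → ℂ}
    (hφ : vnorm φ = 1) (x : Conf q Λ → ℂ) :
    ent (reduced A (pureOp φ)) * vnorm x ^ 2 ≤ 2 * ent (reduced A (pureOp x))
      + 2 * Real.log 2 * vnorm x ^ 2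
      + 2 * Real.log (2 * Fintype.card (Conf q A)) * (vnorm x ^ 2 - ‖star x ⬝ᵥ φ‖ ^ 2) := by
  rcases eq_or_ne x 0 with hx | hx
  · subst hx
    rw [reduced_pureOp_zero, ent_zero, vnorm_eq_zero.2 rfl]
    simp
  have hτ0 : 0 < vnorm x ^ 2 := by
    have := vnorm_eq_zero.not.2 hx
    positivity
  set τ := vnorm x ^ 2 with hτ
  obtain ⟨U, k, hU, hk, hk0, hk1, hT, -⟩ := exists_regularized_log
    (posSemidef_reduced (A := A) (pureOp_posSemidef x))
    (by rw [trace_reduced_re hA, trace_pureOp, Complex.ofReal_re]) hτ0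
    (show (0 : ℝ) < 1 / 2 by norm_num) (by norm_num)
  set T := emb hA (ofDiag U k) with hTdef
  have hl2 : Real.log (1 - 1 / 2) = -Real.log 2 := by
    rw [← Real.log_inv]; norm_num
  set c := Real.log (2 * Fintype.card (Conf q A)) with hc
  have hk1' : ∀ j, k j ≤ c := fun j => (hk1 j).trans (le_of_eq (by rw [hc]; congr 1; ring))
  have hc0 : 0 ≤ c := by
    obtain ⟨a⟩ := ‹Nonempty (Conf q A)›
    exact (hk0 a).trans (hk1' a)
  rw [trace_reduced_pureOp_mul hA, hl2] at hT
  have hTn : ‖T‖ ≤ c := (norm_emb_le hA _).trans (norm_ofDiag_le hU hc0 fun i => by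
    rw [abs_of_nonneg (hk0 i)]; exact hk1' i)
  have hTe : ∀ y : Conf q Λ → ℂ, (star y ⬝ᵥ (T *ᵥ y)).re
      = ∑ j, k (restr hA j) * ‖((emb hA U)ᴴ *ᵥ y) j‖ ^ 2 := fun y => by
    rw [hTdef, emb_ofDiag, star_dotProduct_ofDiag, Complex.ofReal_re]
  have hTle : ∀ y : Conf q Λ → ℂ, (star y ⬝ᵥ (T *ᵥ y)).re ≤ c * vnorm y ^ 2 := fun y => by
    refine (Complex.re_le_norm _).trans ((norm_star_dotProduct_le _ _).trans ?_)
    have h1 := (vnorm_mulVec_le T y).trans (mul_le_mul_of_nonneg_right hTn (vnorm_nonneg _))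
    refine (mul_le_mul_of_nonneg_left h1 (vnorm_nonneg _)).trans (le_of_eq (by ring))
  have hTadd : ∀ y z : Conf q Λ → ℂ, (star (y + z) ⬝ᵥ (T *ᵥ (y + z))).re
      ≤ 2 * (star y ⬝ᵥ (T *ᵥ y)).re + 2 * (star z ⬝ᵥ (T *ᵥ z)).re := fun y z => by
    rw [hTe, hTe, hTe, Finset.mul_sum, Finset.mul_sum, ← Finset.sum_add_distrib]
    refine Finset.sum_le_sum fun j _ => ?_
    rw [mulVec_add, Pi.add_apply]
    set a := ((emb hA U)ᴴ *ᵥ y) j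
    set b := ((emb hA U)ᴴ *ᵥ z) j
    have h1 : ‖a + b‖ ^ 2 ≤ 2 * ‖a‖ ^ 2 + 2 * ‖b‖ ^ 2 := by
      have h2 := pow_le_pow_left₀ (norm_nonneg _) (norm_add_le a b) 2
      nlinarith [sq_nonneg (‖a‖ - ‖b‖)]
    have := mul_le_mul_of_nonneg_left h1 (hk0 (restr hA j))
    linarith
  have hTsmul : ∀ (z : ℂ) (y : Conf q Λ → ℂ), (star (z • y) ⬝ᵥ (T *ᵥ (z • y))).re
      = ‖z‖ ^ 2 * (star y ⬝ᵥ (T *ᵥ y)).re := fun z y => by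
    rw [hTe, hTe, Finset.mul_sum]
    refine Finset.sum_congr rfl fun j _ => ?_
    rw [mulVec_smul, Pi.smul_apply, norm_smul]
    ring
  have hgibbs : ent (reduced A (pureOp φ)) ≤ (star φ ⬝ᵥ (T *ᵥ φ)).re := by
    rw [← trace_reduced_pureOp_mul hA]
    exact ent_le_trace (posSemidef_reduced (pureOp_posSemidef φ)) hU hk.le
  -- split `φ` into its component along `x` and the orthogonal one
  set z : ℂ := (star x ⬝ᵥ φ) / τ with hz
  have hsplit : φ = z • x + (φ - z • x) := by abel
  have hzn : ‖z‖ = ‖star x ⬝ᵥ φ‖ / τ := by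
    rw [hz, norm_div, Complex.norm_real, Real.norm_of_nonneg hτ0.le]
  have hov : ‖star x ⬝ᵥ φ‖ ^ 2 ≤ τ := by
    have := norm_star_dotProduct_le x φ
    rw [hφ, mul_one] at this
    exact pow_le_pow_left₀ (norm_nonneg _) this 2
  have hperp : vnorm (φ - z • x) ^ 2 = 1 - ‖star x ⬝ᵥ φ‖ ^ 2 / τ := by
    have h1 := vnorm_add_sq (z • x) (φ - z • x)
    rw [← hsplit, hφ] at h1
    have h2 : star (z • x) ⬝ᵥ (φ - z • x) = 0 := by
      rw [star_smul, smul_dotProduct, dotProduct_sub, dotProduct_smul, star_dotProduct_self, ← hτ,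
        hz, smul_eq_mul, smul_eq_mul, div_mul_cancel₀ _ (by exact_mod_cast hτ0.ne'), sub_self,
        mul_zero]
    rw [h2, vnorm_smul, hzn, mul_pow, ← hτ] at h1
    simp only [Complex.zero_re, mul_zero, add_zero, one_pow, div_pow] at h1
    have : ‖star x ⬝ᵥ φ‖ ^ 2 / τ ^ 2 * τ = ‖star x ⬝ᵥ φ‖ ^ 2 / τ := by field_simp
    linarith
  have hmain : ent (reduced A (pureOp φ)) ≤ 2 * (‖star x ⬝ᵥ φ‖ ^ 2 / τ ^ 2 *
      (star x ⬝ᵥ (T *ᵥ x)).re) + 2 * (c * (1 - ‖star x ⬝ᵥ φ‖ ^ 2 / τ)) := by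
    refine hgibbs.trans ?_
    conv_lhs => rw [hsplit]
    refine (hTadd _ _).trans (add_le_add ?_ ?_)
    · rw [hTsmul, hzn, div_pow]
    · rw [← hperp]
      exact mul_le_mul_of_nonneg_left (hTle _) zero_le_two
  have hTx0 : 0 ≤ (star x ⬝ᵥ (T *ᵥ x)).re := by
    rw [hTe]
    exact Finset.sum_nonneg fun j _ => mul_nonneg (hk0 _) (by positivity)
  have h1 : ‖star x ⬝ᵥ φ‖ ^ 2 / τ * (star x ⬝ᵥ (T *ᵥ x)).re ≤ 1 * (star x ⬝ᵥ (T *ᵥ x)).re :=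
    mul_le_mul_of_nonneg_right ((div_le_one hτ0).2 hov) hTx0
  calc _ ≤ (2 * (‖star x ⬝ᵥ φ‖ ^ 2 / τ ^ 2 * (star x ⬝ᵥ (T *ᵥ x)).re)
        + 2 * (c * (1 - ‖star x ⬝ᵥ φ‖ ^ 2 / τ))) * τ := mul_le_mul_of_nonneg_right hmain hτ0.le
    _ = 2 * (‖star x ⬝ᵥ φ‖ ^ 2 / τ * (star x ⬝ᵥ (T *ᵥ x)).re)
        + 2 * c * (τ - ‖star x ⬝ᵥ φ‖ ^ 2) := by field_simp
    _ ≤ _ := by linarith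

end Growth

end

section

open scoped Matrix.Norms.L2Operator ComplexOrder
set_option linter.unusedSectionVars false
open Matrix Filter Topology

/-! ### Sums of exponentially decaying weights on the lattice -/

section Lattice

variable {D : ℕ}

theorem gdist_comm (x y : Site D) : gdist x y = gdist y x := by
  unfold gdist
  refine Finset.sum_congr rfl fun i _ => ?_
  omega

theorem gdist_self (x : Site D) : gdist x x = 0 := by simp [gdist]

theorem gdist_triangle (x y z : Site D) : gdist x z ≤ gdist x y + gdist y z := by
  unfold gdist
  rw [← Finset.sum_add_distrib]
  refine Finset.sum_le_sum fun i _ => ?_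
  omega

theorem gdist_le_gdiam {Z : Finset (Site D)} {x y : Site D} (hx : x ∈ Z) (hy : y ∈ Z) :
    gdist x y ≤ gdiam Z :=
  Finset.le_sup (f := fun p : Site D × Site D => gdist p.1 p.2) (b := (x, y))
    (Finset.mem_product.2 ⟨hx, hy⟩)

theorem summable_exp_neg_abs {μ : ℝ} (hμ : 0 < μ) :
    Summable fun k : ℤ => Real.exp (-μ * (k.natAbs : ℝ)) := by
  have h : Summable fun n : ℕ => Real.exp (-μ * (n : ℝ)) := by
    have := Real.summable_exp_nat_mul_iff.2 (neg_lt_zero.2 hμ)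
    exact this.congr fun n => by rw [mul_comm]
  refine Summable.of_nat_of_neg ?_ ?_
  · simpa using h
  · simpa using h

theorem sum_exp_gdist_le {μ : ℝ} (hμ : 0 < μ) (x : Site D) (S : Finset (Site D)) :
    ∑ z ∈ S, Real.exp (-μ * (gdist x z : ℝ))
      ≤ (∑' k : ℤ, Real.exp (-μ * (k.natAbs : ℝ))) ^ D := by
  classical
  set T : Fin D → Finset ℤ := fun i => S.image fun z => z i with hT
  have hsub : S ⊆ Fintype.piFinset T := fun z hz =>
    Fintype.mem_piFinset.2 fun i => Finset.mem_image_of_mem (fun z : Site D => z i) hz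
  have h1 : ∀ z : Site D, Real.exp (-μ * (gdist x z : ℝ))
      = ∏ i, Real.exp (-μ * ((x i - z i).natAbs : ℝ)) := fun z => by
    rw [← Real.exp_sum, gdist]
    push_cast
    rw [Finset.mul_sum]
  calc _ ≤ ∑ z ∈ Fintype.piFinset T, Real.exp (-μ * (gdist x z : ℝ)) :=
        Finset.sum_le_sum_of_subset_of_nonneg hsub fun _ _ _ => (Real.exp_pos _).le
    _ = ∏ i, ∑ k ∈ T i, Real.exp (-μ * ((x i - k).natAbs : ℝ)) := by
        rw [Finset.prod_univ_sum]
        exact Finset.sum_congr rfl fun z _ => h1 z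
    _ ≤ ∏ _i : Fin D, ∑' k : ℤ, Real.exp (-μ * (k.natAbs : ℝ)) := by
        refine Finset.prod_le_prod (fun i _ => Finset.sum_nonneg fun _ _ => (Real.exp_pos _).le)
          fun i _ => ?_
        have h2 : ∑ k ∈ T i, Real.exp (-μ * ((x i - k).natAbs : ℝ))
            = ∑ k ∈ (T i).image (fun k => x i - k), Real.exp (-μ * (k.natAbs : ℝ)) := by
          refine (Finset.sum_image (f := fun k : ℤ => Real.exp (-μ * (k.natAbs : ℝ)))
            fun a _ b _ h => ?_).symm
          simpa using h
        rw [h2]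
        exact (summable_exp_neg_abs hμ).sum_le_tsum _ fun _ _ => (Real.exp_pos _).le
    _ = _ := by rw [Finset.prod_const, Finset.card_univ, Fintype.card_fin]

theorem exists_sum_exp_gdist_le (D : ℕ) {μ : ℝ} (hμ : 0 < μ) :
    ∃ C : ℝ, 1 ≤ C ∧ ∀ (x : Site D) (S : Finset (Site D)) (r : ℝ),
      (∀ z ∈ S, r ≤ (gdist x z : ℝ)) →
      ∑ z ∈ S, Real.exp (-μ * (gdist x z : ℝ)) ≤ C * Real.exp (-μ / 2 * r) := by
  refine ⟨max 1 ((∑' k : ℤ, Real.exp (-(μ / 2) * (k.natAbs : ℝ))) ^ D), le_max_left _ _,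
    fun x S r h => ?_⟩
  calc ∑ z ∈ S, Real.exp (-μ * (gdist x z : ℝ))
      ≤ ∑ z ∈ S, Real.exp (-(μ / 2) * (gdist x z : ℝ)) * Real.exp (-μ / 2 * r) := by
        refine Finset.sum_le_sum fun z hz => ?_
        rw [← Real.exp_add]
        refine Real.exp_le_exp.2 ?_
        have := mul_le_mul_of_nonneg_left (h z hz) hμ.le
        linarith
    _ = (∑ z ∈ S, Real.exp (-(μ / 2) * (gdist x z : ℝ))) * Real.exp (-μ / 2 * r) := by
        rw [Finset.sum_mul]
    _ ≤ _ := mul_le_mul_of_nonneg_right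
        ((sum_exp_gdist_le (half_pos hμ) x S).trans (le_max_right _ _)) (Real.exp_pos _).le

/-- The weight of the region `Z` as seen from `A`: the sum of `exp (-μ gdist x z)` over `x ∈ A`
and `z ∈ Z`. -/
noncomputable def weight (μ : ℝ) (A Z : Finset (Site D)) : ℝ :=
  ∑ z ∈ Z, ∑ x ∈ A, Real.exp (-μ * (gdist x z : ℝ))

theorem weight_nonneg (μ : ℝ) (A Z : Finset (Site D)) : 0 ≤ weight μ A Z :=
  Finset.sum_nonneg fun _ _ => Finset.sum_nonneg fun _ _ => (Real.exp_pos _).le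

theorem exp_le_weight (μ : ℝ) {A Z : Finset (Site D)} {x z : Site D} (hx : x ∈ A) (hz : z ∈ Z) :
    Real.exp (-μ * (gdist x z : ℝ)) ≤ weight μ A Z :=
  (Finset.single_le_sum (f := fun x => Real.exp (-μ * (gdist x z : ℝ)))
    (fun _ _ => (Real.exp_pos _).le) hx).trans
  (Finset.single_le_sum (f := fun z => ∑ x ∈ A, Real.exp (-μ * (gdist x z : ℝ)))
    (fun _ _ => Finset.sum_nonneg fun _ _ => (Real.exp_pos _).le) hz)

theorem one_le_weight {μ : ℝ} {A Z : Finset (Site D)} (h : ¬Disjoint A Z) : 1 ≤ weight μ A Z := by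
  obtain ⟨x, hx, hz⟩ := Finset.not_disjoint_iff.1 h
  have := exp_le_weight μ hx hz
  rwa [gdist_self, Nat.cast_zero, mul_zero, Real.exp_zero] at this

/-- Within a set the weight varies at most by the exponential of the diameter. -/
theorem weight_le_of_mem {μ : ℝ} (hμ : 0 ≤ μ) (A : Finset (Site D)) {Y : Finset (Site D)}
    {z : Site D} (hz : z ∈ Y) :
    weight μ A Y ≤ Y.card * Real.exp (μ * gdiam Y) * weight μ A {z} := by
  have h : ∀ y ∈ Y, ∑ x ∈ A, Real.exp (-μ * (gdist x y : ℝ))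
      ≤ Real.exp (μ * gdiam Y) * weight μ A {z} := by
    intro y hy
    rw [weight, Finset.sum_singleton, Finset.mul_sum]
    refine Finset.sum_le_sum fun x _ => ?_
    rw [← Real.exp_add]
    refine Real.exp_le_exp.2 ?_
    have h1 : (gdist x z : ℝ) ≤ gdist x y + gdiam Y := by
      exact_mod_cast (gdist_triangle x y z).trans (Nat.add_le_add_left (gdist_le_gdiam hy hz) _)
    have := mul_le_mul_of_nonneg_left h1 hμ
    linarith
  refine (Finset.sum_le_card_nsmul _ _ _ h).trans (le_of_eq ?_)
  rw [nsmul_eq_mul, mul_assoc]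

theorem weight_le_card_mul {μ C r : ℝ} {A Z : Finset (Site D)}
    (hC : ∀ (x : Site D) (S : Finset (Site D)) (r : ℝ), (∀ z ∈ S, r ≤ (gdist x z : ℝ)) →
      ∑ z ∈ S, Real.exp (-μ * (gdist x z : ℝ)) ≤ C * Real.exp (-μ / 2 * r))
    (h : ∀ x ∈ A, ∀ z ∈ Z, r ≤ (gdist x z : ℝ)) :
    weight μ A Z ≤ A.card * (C * Real.exp (-μ / 2 * r)) := by
  rw [weight, Finset.sum_comm, ← nsmul_eq_mul]
  exact Finset.sum_le_card_nsmul _ _ _ fun x hx => hC x Z r (h x hx)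

end Lattice

/-! ### Quantitative form of the assumptions -/

section Family

variable {D : ℕ} {q : Site D → ℕ} {A B R Λ Z : Finset (Site D)}

/-- The norm of the bulk term on `Z`. -/
noncomputable def bulkNorm (F : UniformFamily q) (Z : Finset (Site D)) : ℝ :=
  (diamondNorm (F.bulk Z)).toReal

theorem bulkNorm_nonneg (F : UniformFamily q) (Z : Finset (Site D)) : 0 ≤ bulkNorm F Z :=
  ENNReal.toReal_nonneg

/-- The bulk terms have finite norms, and their sums decay exponentially. -/
def BulkDecay (F : UniformFamily q) (μ v : ℝ) : Prop :=
  (∀ Z, diamondNorm (F.bulk Z) ≠ ⊤) ∧ ∀ (x : Site D) (S : Finset (Finset (Site D))),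
    (∀ Z ∈ S, x ∈ Z) → ∑ Z ∈ S, bulkNorm F Z * (Z.card * Real.exp (μ * gdiam Z)) ≤ v

/-- The boundary terms have finite norms, and their tails decay exponentially. -/
def BdryDecay (F : UniformFamily q) (μ p : ℝ) (a : ℕ) : Prop :=
  ∀ (u : Site D) (L : ℕ), (∀ d ∈ Finset.Icc 1 (L + 1), diamondNorm (F.bdry u L d) ≠ ⊤) ∧
    ∀ r : ℕ, 1 ≤ r → ∑ d ∈ Finset.Icc r (L + 1), (diamondNorm (F.bdry u L d)).toReal
      ≤ p * ((L : ℝ) + 1) ^ a * Real.exp (-μ * r)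

theorem diamondNorm_zero {n : Type} [Fintype n] [DecidableEq n] :
    diamondNorm (0 : SuperOp n) = 0 := by
  simp only [diamondNorm, ENNReal.iSup_eq_zero, ENNReal.ofReal_eq_zero]
  intro k X _
  have : ampliate k (0 : SuperOp n) X = 0 := by ext; rfl
  rw [this, traceNorm_zero, zero_div]

/-- On the empty region there is only one state, so the Lindbladian vanishes. -/
theorem bulk_empty (F : UniformFamily q) : F.bulk ∅ = 0 := by
  have hs : Subsingleton (Conf q (∅ : Finset (Site D))) :=
    ⟨fun a b => funext fun x => absurd x.2 (Finset.notMem_empty _)⟩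
  refine LinearMap.ext fun X => Matrix.ext fun a b => ?_
  have h := (F.bulk_lindblad ∅).hasLForm.trace_eq_zero X
  rw [trace, Fintype.sum_subsingleton _ a] at h
  rw [Subsingleton.elim b a]
  exact h

theorem exists_bulkDecay (F : UniformFamily q) {μ : ℝ}
    (h : F.LiebRobinson (fun r => Real.exp (μ * r))) : ∃ v : ℝ, 1 ≤ v ∧ BulkDecay F μ v := by
  obtain ⟨-, -, ⟨v, hv⟩, -⟩ := h
  have hfin : ∀ Z, diamondNorm (F.bulk Z) ≠ ⊤ := by
    intro Z
    rcases Z.eq_empty_or_nonempty with hZ | ⟨x, hx⟩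
    · subst hZ; rw [bulk_empty, diamondNorm_zero]; exact ENNReal.zero_ne_top
    · intro htop
      have h1 := (ENNReal.le_tsum (⟨Z, hx⟩ : {Z : Finset (Site D) // x ∈ Z})).trans (hv x)
      have h2 : (Z.card : ENNReal) ≠ 0 := by
        exact_mod_cast (Finset.card_pos.2 ⟨x, hx⟩).ne'
      have h3 : ENNReal.ofReal (Real.exp (μ * gdiam Z)) ≠ 0 :=
        (ENNReal.ofReal_pos.2 (Real.exp_pos _)).ne'
      simp only [htop] at h1
      rw [ENNReal.top_mul h2, ENNReal.top_mul h3] at h1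
      exact absurd h1 (not_le.2 ENNReal.ofReal_lt_top)
  refine ⟨max 1 v, le_max_left _ _, hfin, fun x S hS => ?_⟩
  have h1 := (ENNReal.sum_le_tsum (f := fun Z : {Z : Finset (Site D) // x ∈ Z} =>
    diamondNorm (F.bulk Z.1) * (Z.1.card : ENNReal) * ENNReal.ofReal (Real.exp (μ * gdiam Z.1)))
    (S.subtype (fun Z => x ∈ Z))).trans (hv x)
  have h2 : ∑ Z ∈ S.subtype (fun Z => x ∈ Z), diamondNorm (F.bulk Z.1) * (Z.1.card : ENNReal) *
      ENNReal.ofReal (Real.exp (μ * gdiam Z.1))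
      = ENNReal.ofReal (∑ Z ∈ S, bulkNorm F Z * (Z.card * Real.exp (μ * gdiam Z))) := by
    rw [Finset.sum_subtype_of_mem (fun Z : Finset (Site D) => diamondNorm (F.bulk Z) *
      (Z.card : ENNReal) * ENNReal.ofReal (Real.exp (μ * gdiam Z))) hS,
      ENNReal.ofReal_sum_of_nonneg fun Z _ => mul_nonneg (bulkNorm_nonneg F Z) (by positivity)]
    refine Finset.sum_congr rfl fun Z _ => ?_
    rw [ENNReal.ofReal_mul (bulkNorm_nonneg F Z), ENNReal.ofReal_mul (by positivity), bulkNorm,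
      ENNReal.ofReal_toReal (hfin Z), ENNReal.ofReal_natCast, mul_assoc]
  rw [h2] at h1
  rcases ENNReal.ofReal_le_ofReal_iff'.1 h1 with h3 | h3
  · exact h3.trans (le_max_right _ _)
  · exact h3.trans (zero_le_one.trans (le_max_left _ _))

theorem exists_abs_eval_le (p : Polynomial ℝ) :
    ∃ (C : ℝ) (a : ℕ), 0 < C ∧ ∀ N : ℕ, |p.eval (N : ℝ)| ≤ C * ((N : ℝ) + 1) ^ a := by
  refine ⟨1 + ∑ i ∈ Finset.range (p.natDegree + 1), |p.coeff i|, p.natDegree, by positivity,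
    fun N => ?_⟩
  rw [Polynomial.eval_eq_sum_range]
  calc _ ≤ ∑ i ∈ Finset.range (p.natDegree + 1), |p.coeff i * (N : ℝ) ^ i| :=
        Finset.abs_sum_le_sum_abs _ _
    _ ≤ ∑ i ∈ Finset.range (p.natDegree + 1), |p.coeff i| * ((N : ℝ) + 1) ^ p.natDegree := by
        refine Finset.sum_le_sum fun i hi => ?_
        rw [abs_mul, abs_of_nonneg (by positivity : (0 : ℝ) ≤ (N : ℝ) ^ i)]
        gcongr
        calc (N : ℝ) ^ i ≤ ((N : ℝ) + 1) ^ i := by gcongr; linarith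
          _ ≤ _ := pow_le_pow_right₀ (by linarith [(Nat.cast_nonneg N : (0 : ℝ) ≤ N)])
            (Nat.lt_succ_iff.1 (Finset.mem_range.1 hi))
    _ ≤ _ := by
        rw [← Finset.sum_mul]
        gcongr
        linarith

theorem exists_bdryDecay (F : UniformFamily q) {μ : ℝ}
    (h : F.LiebRobinson (fun r => Real.exp (μ * r))) :
    ∃ (p : ℝ) (a : ℕ), 0 < p ∧ BdryDecay F μ p a := by
  obtain ⟨-, -, -, ⟨P, hP⟩⟩ := h
  obtain ⟨p, a, hp, hb⟩ := exists_abs_eval_le P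
  refine ⟨p, a, hp, fun u L => ?_⟩
  have hfin : ∀ d ∈ Finset.Icc 1 (L + 1), diamondNorm (F.bdry u L d) ≠ ⊤ := by
    intro d hd htop
    have h1 := hP u L 1 le_rfl
    have h2 : ∑ d ∈ Finset.Icc 1 (L + 1), diamondNorm (F.bdry u L d) = ⊤ :=
      ENNReal.sum_eq_top.2 ⟨d, hd, htop⟩
    rw [h2, ENNReal.mul_top (ENNReal.ofReal_pos.2 (Real.exp_pos _)).ne'] at h1
    exact absurd h1 (not_le.2 ENNReal.ofReal_lt_top)
  refine ⟨hfin, fun r hr => ?_⟩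
  have h1 := hP u L r hr
  have hfin' : ∀ d ∈ Finset.Icc r (L + 1), diamondNorm (F.bdry u L d) ≠ ⊤ := fun d hd =>
    hfin d (Finset.Icc_subset_Icc_left hr hd)
  have h2 : ∑ d ∈ Finset.Icc r (L + 1), diamondNorm (F.bdry u L d)
      = ENNReal.ofReal (∑ d ∈ Finset.Icc r (L + 1), (diamondNorm (F.bdry u L d)).toReal) := by
    rw [ENNReal.ofReal_sum_of_nonneg fun _ _ => ENNReal.toReal_nonneg]
    exact Finset.sum_congr rfl fun d hd => (ENNReal.ofReal_toReal (hfin' d hd)).symm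
  rw [h2, ← ENNReal.ofReal_mul (Real.exp_pos _).le] at h1
  have h3 : Real.exp (μ * r) * ∑ d ∈ Finset.Icc r (L + 1), (diamondNorm (F.bdry u L d)).toReal
      ≤ p * ((L : ℝ) + 1) ^ a := by
    rcases ENNReal.ofReal_le_ofReal_iff'.1 h1 with h3 | h3
    · exact h3.trans ((le_abs_self _).trans (hb L))
    · exact h3.trans (by positivity)
  rw [neg_mul, Real.exp_neg, ← div_eq_mul_inv, le_div_iff₀ (Real.exp_pos _), mul_comm]
  exact h3

/-- The bulk term on `Z`, as a superoperator on `Λ` (zero unless `Z ⊆ Λ`). -/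
noncomputable def bulkOn (F : UniformFamily q) (Λ Z : Finset (Site D)) : SuperOp (Conf q Λ) :=
  open scoped Classical in if h : Z ⊆ Λ then extend h (F.bulk Z) else 0

theorem bulkOn_eq (F : UniformFamily q) (h : Z ⊆ Λ) : bulkOn F Λ Z = extend h (F.bulk Z) :=
  dif_pos h

/-- The sum of the bulk terms supported in the region `R`, as a superoperator on `Λ`. -/
noncomputable def regionGen (F : UniformFamily q) (Λ R : Finset (Site D)) : SuperOp (Conf q Λ) :=
  ∑ Z ∈ R.powerset, bulkOn F Λ Z

theorem openGen_eq (F : UniformFamily q) (Λ : Finset (Site D)) :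
    F.openGen Λ = regionGen F Λ Λ := by
  rw [UniformFamily.openGen, regionGen,
    ← Finset.sum_attach Λ.powerset (fun Z => bulkOn F Λ Z)]
  exact Finset.sum_congr rfl fun Z _ => (bulkOn_eq F (Finset.mem_powerset.1 Z.2)).symm

theorem hasLForm_bulkOn (F : UniformFamily q) (Λ Z : Finset (Site D)) :
    HasLForm (bulkOn F Λ Z) := by
  by_cases h : Z ⊆ Λ
  · rw [bulkOn_eq F h]; exact (F.bulk_lindblad Z).hasLForm.extend h
  · rw [bulkOn, dif_neg h]; exact HasLForm.zero

theorem hasLForm_regionGen (F : UniformFamily q) (Λ R : Finset (Site D)) :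
    HasLForm (regionGen F Λ R) :=
  HasLForm.sum _ _ fun Z _ => hasLForm_bulkOn F Λ Z

theorem hasLForm_closedGen (F : UniformFamily q) (u : Site D) (L : ℕ) :
    HasLForm (F.closedGen u L) := by
  rw [UniformFamily.closedGen, openGen_eq]
  exact (hasLForm_regionGen F _ _).add (F.bdry_lindblad u L).hasLForm

theorem traceNorm_bulkOn_le {F : UniformFamily q} {μ v : ℝ} (hF : BulkDecay F μ v)
    (Λ Z : Finset (Site D)) (X : Op q Λ) :
    traceNorm (bulkOn F Λ Z X) ≤ bulkNorm F Z * traceNorm X := by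
  by_cases h : Z ⊆ Λ
  · rw [bulkOn_eq F h]; exact traceNorm_extend_le h _ (hF.1 Z) X
  · rw [bulkOn, dif_neg h, LinearMap.zero_apply, traceNorm_zero]
    exact mul_nonneg (bulkNorm_nonneg F Z) (traceNorm_nonneg X)

theorem reduced_regionGen (F : UniformFamily q) (hB : B ⊆ Λ) (X : Op q Λ) :
    reduced B (regionGen F Λ B X) = regionGen F B B (reduced B X) := by
  rw [← reducedLin_apply, regionGen, regionGen, LinearMap.sum_apply, LinearMap.sum_apply, map_sum]
  refine Finset.sum_congr rfl fun Z hZ => ?_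
  have hZB := Finset.mem_powerset.1 hZ
  rw [bulkOn_eq F hZB, bulkOn_eq F (hZB.trans hB), reducedLin_apply, reduced_extend hZB hB]

end Family

end

section

open scoped Matrix.Norms.L2Operator ComplexOrder
set_option linter.unusedSectionVars false
open Matrix Filter Topology

/-! ### Locality of the evolution -/

section LiebRobinson

variable {D : ℕ} {q : Site D → ℕ} {A B R Λ Z Y : Finset (Site D)}

/-- The linear functional `X ↦ tr (B X)`. -/
noncomputable def obs {n : Type} [Fintype n] (B : Matrix n n ℂ) : Matrix n n ℂ →ₗ[ℂ] ℂ :=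
  Matrix.traceLinearMap n ℂ ℂ ∘ₗ LinearMap.mulLeft ℂ B

theorem obs_apply {n : Type} [Fintype n] (B X : Matrix n n ℂ) : obs B X = (B * X).trace := rfl

theorem norm_obs_emb_le (hA : A ⊆ Λ) (O : Op q A) (X : Op q Λ) :
    ‖obs (emb hA O) X‖ ≤ ‖O‖ * traceNorm X :=
  (norm_trace_mul_le _ _).trans (mul_le_mul_of_nonneg_right (norm_emb_le hA O) (traceNorm_nonneg X))

theorem obs_emb_extend_eq_zero (hA : A ⊆ Λ) (hZ : Z ⊆ Λ) (hd : Disjoint A Z)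
    {T : SuperOp (Conf q Z)} (hT : HasLForm T) (O : Op q A) (X : Op q Λ) :
    obs (emb hA O) (extend hZ T X) = 0 := by
  rw [obs_apply, ← extend_emb_mul hZ hA hd]
  exact (hT.extend hZ).trace_eq_zero _

theorem extend_comm (hY : Y ⊆ Λ) (hZ : Z ⊆ Λ) (hd : Disjoint Y Z) {T : SuperOp (Conf q Y)}
    (hT : HasLForm T) (T' : SuperOp (Conf q Z)) (X : Op q Λ) :
    extend hY T (extend hZ T' X) = extend hZ T' (extend hY T X) := by
  obtain ⟨ι, _, G, L, h⟩ := hT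
  rw [(h.extend hY).1, (h.extend hY).1]
  simp only [map_add, map_sum, ← emb_conjTranspose, extend_mul_emb hZ hY hd,
    extend_emb_mul hZ hY hd]

theorem bulkOn_comm (F : UniformFamily q) (hZ : Z ⊆ Λ) (hd : Disjoint Y Z)
    (T : SuperOp (Conf q Z)) (X : Op q Λ) :
    bulkOn F Λ Y (extend hZ T X) = extend hZ T (bulkOn F Λ Y X) := by
  by_cases h : Y ⊆ Λ
  · rw [bulkOn_eq F h]
    exact extend_comm h hZ hd (F.bulk_lindblad Y).hasLForm T X
  · rw [bulkOn, dif_neg h, LinearMap.zero_apply, LinearMap.zero_apply, map_zero]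

/-- The interactions that meet `Z` have, weighted as seen from `A`, at most the weight of `Z`, up to
the constant `v`. This is what makes the Lieb-Robinson estimate reproduce itself. -/
theorem sum_bulkNorm_mul_weight_le {F : UniformFamily q} {μ v : ℝ} (hμ : 0 ≤ μ)
    (hF : BulkDecay F μ v) (A : Finset (Site D)) (S : Finset (Finset (Site D)))
    (hS : ∀ Y ∈ S, ¬Disjoint Y Z) :
    ∑ Y ∈ S, bulkNorm F Y * weight μ A Y ≤ v * weight μ A Z := by
  classical
  calc ∑ Y ∈ S, bulkNorm F Y * weight μ A Y
      ≤ ∑ Y ∈ S, ∑ z ∈ Z, if z ∈ Y then bulkNorm F Y * weight μ A Y else 0 := by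
        refine Finset.sum_le_sum fun Y hY => ?_
        obtain ⟨z, hzY, hzZ⟩ := Finset.not_disjoint_iff.1 (hS Y hY)
        have h0 := mul_nonneg (bulkNorm_nonneg F Y) (weight_nonneg μ A Y)
        refine le_trans (le_of_eq (if_pos hzY).symm) (Finset.single_le_sum
          (f := fun z => if z ∈ Y then bulkNorm F Y * weight μ A Y else 0)
          (fun z _ => ?_) hzZ)
        split_ifs
        · exact h0
        · exact le_rfl
    _ = ∑ z ∈ Z, ∑ Y ∈ S with z ∈ Y, bulkNorm F Y * weight μ A Y := by
        rw [Finset.sum_comm]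
        simp only [Finset.sum_filter]
    _ ≤ ∑ z ∈ Z, v * weight μ A {z} := by
        refine Finset.sum_le_sum fun z _ => ?_
        calc _ ≤ ∑ Y ∈ S with z ∈ Y, bulkNorm F Y * (Y.card * Real.exp (μ * gdiam Y))
                * weight μ A {z} := by
              refine Finset.sum_le_sum fun Y hY => ?_
              rw [mul_assoc]
              exact mul_le_mul_of_nonneg_left (weight_le_of_mem hμ A (Finset.mem_filter.1 hY).2)
                (bulkNorm_nonneg F Y)
          _ ≤ _ := by
              rw [← Finset.sum_mul]
              exact mul_le_mul_of_nonneg_right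
                (hF.2 z _ fun Y hY => (Finset.mem_filter.1 hY).2) (weight_nonneg _ _ _)
    _ = _ := by
        rw [← Finset.mul_sum]
        simp only [weight, Finset.sum_singleton]

/-- A Lieb-Robinson estimate with constant `c`: in the Heisenberg picture, an observable on `A` is
affected by the bulk term on `Z` in proportion to the weight of `Z` as seen from `A`. -/
def LRBound (F : UniformFamily q) (μ v : ℝ) (hA : A ⊆ Λ) (R : Finset (Site D)) (c : ℝ) : Prop :=
  ∀ Z, Z ⊆ Λ → ∀ (s : ℝ) (O : Op q A) (X : Op q Λ), 0 ≤ s →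
    ‖obs (emb hA O) (evolution (regionGen F Λ R) s (bulkOn F Λ Z X))‖
      ≤ c * Real.exp (2 * v * s) * (bulkNorm F Z * weight μ A Z) * (‖O‖ * traceNorm X)

/-- A superoperator `K` that commutes with the bulk terms away from `Z` is compared, by Duhamel's
formula, to the evolution without the terms that meet `Z`. -/
theorem LRBound.norm_obs_evolution_le {F : UniformFamily q} {μ v : ℝ} (hμ : 0 ≤ μ)
    (hF : BulkDecay F μ v) {hA : A ⊆ Λ} (hR : R ⊆ Λ) {c : ℝ} (hc : 0 ≤ c)
    (h : LRBound F μ v hA R c) {K : SuperOp (Conf q Λ)} (Z : Finset (Site D))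
    (hcomm : ∀ Y, Disjoint Y Z → ∀ X, bulkOn F Λ Y (K X) = K (bulkOn F Λ Y X)) {κ ε : ℝ}
    (hκ0 : 0 ≤ κ) (hκ : ∀ X, traceNorm (K X) ≤ κ * traceNorm X) (hε0 : 0 ≤ ε)
    (hε : ∀ (O : Op q A) X, ‖obs (emb hA O) (K X)‖ ≤ ε * (‖O‖ * traceNorm X)) {s : ℝ} (hs : 0 ≤ s)
    (O : Op q A) (X : Op q Λ) :
    ‖obs (emb hA O) (evolution (regionGen F Λ R) s (K X))‖
      ≤ (ε + κ * (c / 2) * weight μ A Z * Real.exp (2 * v * s)) * (‖O‖ * traceNorm X) := by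
  classical
  set 𝓡' : SuperOp (Conf q Λ) := ∑ Y ∈ R.powerset with Disjoint Y Z, bulkOn F Λ Y with h𝓡'
  have hL' : HasLForm 𝓡' := HasLForm.sum _ _ fun Y _ => hasLForm_bulkOn F Λ Y
  set N : ℝ := ‖O‖ * traceNorm X with hN
  have hN0 : 0 ≤ N := mul_nonneg (norm_nonneg _) (traceNorm_nonneg _)
  have hW0 := weight_nonneg μ A Z
  have hsplit : ∀ X', regionGen F Λ R (K X') - K (𝓡' X')
      = ∑ Y ∈ R.powerset with ¬Disjoint Y Z, bulkOn F Λ Y (K X') := by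
    intro X'
    have e1 : K (𝓡' X') = ∑ Y ∈ R.powerset with Disjoint Y Z, bulkOn F Λ Y (K X') := by
      rw [h𝓡', LinearMap.sum_apply, map_sum]
      exact Finset.sum_congr rfl fun Y hY => (hcomm Y (Finset.mem_filter.1 hY).2 X').symm
    rw [e1, regionGen, LinearMap.sum_apply,
      ← Finset.sum_filter_add_sum_filter_not R.powerset (fun Y => Disjoint Y Z)]
    abel
  have hsum := sum_bulkNorm_mul_weight_le hμ hF A (Z := Z)
    (R.powerset.filter fun Y => ¬Disjoint Y Z) fun Y hY => (Finset.mem_filter.1 hY).2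
  have hduh := norm_duhamel_le 𝓡' (regionGen F Λ R) K (obs (emb hA O)) X hs
    (fun r => κ * (c / 2) * weight μ A Z * N * Real.exp (2 * v * r))
    (fun r => κ * (c / 2) * weight μ A Z * N * (Real.exp (2 * v * r) * (2 * v)))
    (fun r => by
      have h1 : HasDerivAt (fun r : ℝ => 2 * v * r) (2 * v) r := by
        simpa using (hasDerivAt_id r).const_mul (2 * v)
      exact (h1.exp).const_mul _)
    (fun r hr0 hrs => by
      have hX' : traceNorm (K (evolution 𝓡' (s - r) X)) ≤ κ * traceNorm X :=
        (hκ _).trans (mul_le_mul_of_nonneg_left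
          (hL'.traceNorm_evolution_le (by linarith) X) hκ0)
      rw [hsplit, map_sum, map_sum]
      refine (norm_sum_le _ _).trans ?_
      calc _ ≤ ∑ Y ∈ R.powerset with ¬Disjoint Y Z, bulkNorm F Y * weight μ A Y *
              (c * Real.exp (2 * v * r) * (κ * N)) := by
            refine Finset.sum_le_sum fun Y hY => ?_
            have hYR := Finset.mem_powerset.1 (Finset.mem_filter.1 hY).1
            refine (h Y (hYR.trans hR) r O _ hr0).trans ?_
            have h0 := mul_nonneg (bulkNorm_nonneg F Y) (weight_nonneg μ A Y)
            calc _ ≤ c * Real.exp (2 * v * r) * (bulkNorm F Y * weight μ A Y) *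
                  (‖O‖ * (κ * traceNorm X)) := by gcongr
              _ = _ := by rw [hN]; ring
        _ ≤ v * weight μ A Z * (c * Real.exp (2 * v * r) * (κ * N)) := by
            rw [← Finset.sum_mul]
            exact mul_le_mul_of_nonneg_right hsum (by positivity)
        _ = _ := by ring)
  have h2 : ‖obs (emb hA O) (K (evolution 𝓡' s X))‖ ≤ ε * N := by
    refine (hε O _).trans (mul_le_mul_of_nonneg_left ?_ hε0)
    exact mul_le_mul_of_nonneg_left (hL'.traceNorm_evolution_le hs X) (norm_nonneg _)
  have h3 := norm_le_insert' (obs (emb hA O) (evolution (regionGen F Λ R) s (K X)))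
    (obs (emb hA O) (K (evolution 𝓡' s X)))
  have h4 : 0 ≤ κ * (c / 2) * weight μ A Z * N * Real.exp (2 * v * 0) := by positivity
  calc _ ≤ ε * N + κ * (c / 2) * weight μ A Z * N * Real.exp (2 * v * s) := by linarith
    _ = _ := by ring

/-- The Lieb-Robinson estimate. On a finite region it holds with some constant, and a constant `c` can
be improved to `1 + c / 2`; the constant `2` is the fixed point of this iteration. -/
theorem lrBound_two {F : UniformFamily q} {μ v : ℝ} (hμ : 0 ≤ μ) (hv : 0 ≤ v)
    (hF : BulkDecay F μ v) (hA : A ⊆ Λ) (hne : A.Nonempty) (hR : R ⊆ Λ) :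
    LRBound F μ v hA R 2 := by
  obtain ⟨x, hx⟩ := hne
  set B := Real.exp (μ * gdiam Λ) with hB
  have h0 : LRBound F μ v hA R B := by
    intro Z hZ s O X hs
    rcases Z.eq_empty_or_nonempty with hZe | ⟨z, hz⟩
    · subst hZe
      have : bulkOn F Λ ∅ X = 0 := by
        rw [bulkOn_eq F hZ, bulk_empty, extend_zero, LinearMap.zero_apply]
      rw [this, map_zero, map_zero, norm_zero]
      have := bulkNorm_nonneg F ∅
      have := weight_nonneg μ A ∅
      have := traceNorm_nonneg X
      positivity
    · have h1 : 1 ≤ B * weight μ A Z := by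
        have h2 := exp_le_weight μ hx hz
        have h3 : (gdist x z : ℝ) ≤ gdiam Λ := by
          exact_mod_cast gdist_le_gdiam (hA hx) (hZ hz)
        calc (1 : ℝ) ≤ B * Real.exp (-μ * (gdist x z : ℝ)) := by
              rw [hB, ← Real.exp_add]
              refine Real.one_le_exp ?_
              have := mul_le_mul_of_nonneg_left h3 hμ
              linarith
          _ ≤ _ := mul_le_mul_of_nonneg_left h2 (Real.exp_pos _).le
      have h4 : ‖obs (emb hA O) (evolution (regionGen F Λ R) s (bulkOn F Λ Z X))‖
          ≤ bulkNorm F Z * (‖O‖ * traceNorm X) := by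
        refine (norm_obs_emb_le hA O _).trans ?_
        calc _ ≤ ‖O‖ * (bulkNorm F Z * traceNorm X) :=
              mul_le_mul_of_nonneg_left (((hasLForm_regionGen F Λ R).traceNorm_evolution_le hs
                _).trans (traceNorm_bulkOn_le hF Λ Z X)) (norm_nonneg _)
          _ = _ := by ring
      have h5 : 1 ≤ Real.exp (2 * v * s) := Real.one_le_exp (by positivity)
      have h6 : 1 ≤ (B * weight μ A Z) * Real.exp (2 * v * s) := by nlinarith
      have h7 := mul_le_mul_of_nonneg_right h6 (mul_nonneg (bulkNorm_nonneg F Z)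
        (mul_nonneg (norm_nonneg O) (traceNorm_nonneg X)))
      refine h4.trans (le_trans (le_of_eq (one_mul _).symm) (h7.trans (le_of_eq (by ring))))
  have hstep : ∀ c, 0 ≤ c → LRBound F μ v hA R c → LRBound F μ v hA R (1 + c / 2) := by
    intro c hc h Z hZ s O X hs
    have hb := bulkNorm_nonneg F Z
    have hw := weight_nonneg μ A Z
    have h1 := h.norm_obs_evolution_le hμ hF hR hc (K := bulkOn F Λ Z) Z
      (fun Y hY X => by rw [bulkOn_eq F hZ]; exact bulkOn_comm F hZ hY _ X) hb
      (traceNorm_bulkOn_le hF Λ Z) (ε := bulkNorm F Z * weight μ A Z) (mul_nonneg hb hw)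
      (fun O X => by
        by_cases hd : Disjoint A Z
        · rw [bulkOn_eq F hZ, obs_emb_extend_eq_zero hA hZ hd (F.bulk_lindblad Z).hasLForm,
            norm_zero]
          have := traceNorm_nonneg X
          positivity
        · have h2 := one_le_weight (μ := μ) hd
          calc _ ≤ ‖O‖ * (bulkNorm F Z * traceNorm X) := (norm_obs_emb_le hA O _).trans
                (mul_le_mul_of_nonneg_left (traceNorm_bulkOn_le hF Λ Z X) (norm_nonneg _))
            _ = bulkNorm F Z * 1 * (‖O‖ * traceNorm X) := by ring
            _ ≤ _ := by
              have := traceNorm_nonneg X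
              gcongr) hs O X
    refine h1.trans (mul_le_mul_of_nonneg_right ?_ (mul_nonneg (norm_nonneg O) (traceNorm_nonneg X)))
    have h5 : 1 ≤ Real.exp (2 * v * s) := Real.one_le_exp (by positivity)
    have h6 := mul_le_mul_of_nonneg_left h5 (mul_nonneg hb hw)
    nlinarith
  have hk : ∀ k : ℕ, LRBound F μ v hA R (2 + B * (1 / 2) ^ k) := by
    intro k
    induction k with
    | zero =>
      intro Z hZ s O X hs
      refine (h0 Z hZ s O X hs).trans ?_
      have := bulkNorm_nonneg F Z
      have := weight_nonneg μ A Z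
      have := traceNorm_nonneg X
      gcongr
      linarith
    | succ k ih =>
      have hB0 : 0 < B := Real.exp_pos _
      have := hstep _ (by positivity) ih
      convert this using 1
      ring
  intro Z hZ s O X hs
  have hlim : Tendsto (fun k : ℕ => (2 + B * (1 / 2 : ℝ) ^ k) * Real.exp (2 * v * s) *
      (bulkNorm F Z * weight μ A Z) * (‖O‖ * traceNorm X)) atTop
      (𝓝 ((2 + B * 0) * Real.exp (2 * v * s) *
      (bulkNorm F Z * weight μ A Z) * (‖O‖ * traceNorm X))) :=
    (((tendsto_const_nhds.add (tendsto_const_nhds.mul (tendsto_pow_atTop_nhds_zero_of_lt_one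
      (by norm_num) (by norm_num)))).mul_const _).mul_const _).mul_const _
  rw [mul_zero, add_zero] at hlim
  exact ge_of_tendsto' hlim fun k => hk k Z hZ s O X hs

/-- The boundary term of index `d`, as a superoperator on the ball. -/
noncomputable def bdryOn (F : UniformFamily q) (u : Site D) (L d : ℕ) :
    SuperOp (Conf q (ball u L)) :=
  extend (layer_subset d (ball u L)) (F.bdry u L d)

/-- The sum of the norms of the boundary terms with indices at least `r` bounds the norm of any
partial sum of them. -/
theorem traceNorm_sum_bdryOn_le {F : UniformFamily q} {μ p : ℝ} {a : ℕ} (hF : BdryDecay F μ p a)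
    (u : Site D) (L : ℕ) {r : ℕ} (hr : 1 ≤ r) {S : Finset ℕ} (hS : S ⊆ Finset.Icc r (L + 1))
    (X : Op q (ball u L)) :
    traceNorm ((∑ d ∈ S, bdryOn F u L d) X)
      ≤ p * ((L : ℝ) + 1) ^ a * Real.exp (-μ * r) * traceNorm X := by
  rw [LinearMap.sum_apply]
  calc _ ≤ ∑ d ∈ S, traceNorm (bdryOn F u L d X) := traceNorm_sum_le _ _
    _ ≤ ∑ d ∈ S, (diamondNorm (F.bdry u L d)).toReal * traceNorm X :=
        Finset.sum_le_sum fun d hd => traceNorm_extend_le _ _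
          ((hF u L).1 d (Finset.Icc_subset_Icc_left hr (hS hd))) X
    _ ≤ ∑ d ∈ Finset.Icc r (L + 1), (diamondNorm (F.bdry u L d)).toReal * traceNorm X :=
        Finset.sum_le_sum_of_subset_of_nonneg hS fun _ _ _ =>
          mul_nonneg ENNReal.toReal_nonneg (traceNorm_nonneg X)
    _ ≤ _ := by
        rw [← Finset.sum_mul]
        exact mul_le_mul_of_nonneg_right ((hF u L).2 r hr) (traceNorm_nonneg X)

theorem layer_mono {d d' : ℕ} (h : d ≤ d') (Λ : Finset (Site D)) : layer d Λ ⊆ layer d' Λ := by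
  intro x hx
  rw [mem_layer_iff] at hx ⊢
  obtain ⟨hx, y, hy, hxy⟩ := hx
  exact ⟨hx, y, hy, hxy.trans h⟩

theorem LRBound.norm_obs_sum_bulkOn_le {F : UniformFamily q} {μ v C : ℝ} (hμ : 0 ≤ μ)
    (hv : 0 ≤ v) (hF : BulkDecay F μ v) (hC : ∀ (x : Site D) (S : Finset (Site D)) (r : ℝ),
      (∀ z ∈ S, r ≤ (gdist x z : ℝ)) →
      ∑ z ∈ S, Real.exp (-μ * (gdist x z : ℝ)) ≤ C * Real.exp (-μ / 2 * r))
    {hA : A ⊆ Λ} (h : LRBound F μ v hA R 2) {r₁ : ℝ}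
    (h₁ : ∀ x ∈ A, ∀ z ∈ Λ \ R, 2 * r₁ ≤ gdist x z) {s : ℝ} (hs : 0 ≤ s) (O : Op q A)
    (X : Op q Λ) :
    ‖obs (emb hA O) (evolution (regionGen F Λ R) s
        (∑ Z ∈ Λ.powerset with ¬Z ⊆ R, bulkOn F Λ Z X))‖
      ≤ 2 * v * Real.exp (2 * v * s) * (A.card * (C * Real.exp (-μ * r₁)))
        * (‖O‖ * traceNorm X) := by
  rw [map_sum, map_sum]
  have h3 := sum_bulkNorm_mul_weight_le hμ hF A (Z := Λ \ R)
    (Λ.powerset.filter fun Z => ¬Z ⊆ R) fun Y hY => by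
      rw [Finset.mem_filter, Finset.mem_powerset] at hY
      obtain ⟨z, hz, hzR⟩ := Finset.not_subset.1 hY.2
      exact Finset.not_disjoint_iff.2 ⟨z, hz, Finset.mem_sdiff.2 ⟨hY.1 hz, hzR⟩⟩
  have h4 : weight μ A (Λ \ R) ≤ A.card * (C * Real.exp (-μ / 2 * (2 * r₁))) :=
    weight_le_card_mul hC h₁
  have e3 : -μ / 2 * (2 * r₁) = -μ * r₁ := by ring
  rw [e3] at h4
  have hN : 0 ≤ ‖O‖ * traceNorm X := mul_nonneg (norm_nonneg _) (traceNorm_nonneg _)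
  set M := 2 * Real.exp (2 * v * s) * (‖O‖ * traceNorm X) with hM
  have hM0 : 0 ≤ M := by positivity
  have h5 : ∀ Z ∈ Λ.powerset.filter (fun Z => ¬Z ⊆ R), ‖obs (emb hA O)
      (evolution (regionGen F Λ R) s (bulkOn F Λ Z X))‖ ≤ bulkNorm F Z * weight μ A Z * M := by
    intro Z hZ
    have h6 := h Z (Finset.mem_powerset.1 (Finset.mem_filter.1 hZ).1) s O X hs
    refine h6.trans (le_of_eq ?_)
    rw [hM]; ring
  refine (norm_sum_le _ _).trans ((Finset.sum_le_sum h5).trans ?_)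
  rw [← Finset.sum_mul]
  refine (mul_le_mul_of_nonneg_right
    (h3.trans (mul_le_mul_of_nonneg_left h4 hv)) hM0).trans (le_of_eq ?_)
  rw [hM]; ring

theorem norm_trace_le_traceNorm {n : Type} [Fintype n] [DecidableEq n] (X : Matrix n n ℂ) :
    ‖X.trace‖ ≤ traceNorm X := by
  have h := (traceNorm_le_iff (X := X) (c := traceNorm X)).1 le_rfl 1
    (opNorm_le_of_mulVec _ _ zero_le_one fun x => by rw [one_mulVec, one_mul])
  rwa [one_mul] at h

section Boundary

variable (F : UniformFamily q) (u : Site D) (L r : ℕ)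

/-- The boundary terms of index at most `r`. -/
noncomputable def bdryNear : SuperOp (Conf q (ball u L)) :=
  ∑ d ∈ Finset.Icc 1 (L + 1) with d ≤ r, bdryOn F u L d

/-- The boundary terms of index greater than `r`. -/
noncomputable def bdryFar : SuperOp (Conf q (ball u L)) :=
  ∑ d ∈ Finset.Icc 1 (L + 1) with ¬d ≤ r, bdryOn F u L d

theorem bdryNear_add_bdryFar :
    bdryNear F u L r + bdryFar F u L r = ∑ d ∈ Finset.Icc 1 (L + 1), bdryOn F u L d :=
  Finset.sum_filter_add_sum_filter_not (Finset.Icc 1 (L + 1)) (fun d => d ≤ r)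
    (fun d => bdryOn F u L d)

variable {F} {μ p : ℝ} {a : ℕ}

theorem traceNorm_bdryFar_le (hμ : 0 ≤ μ) (hp : 0 ≤ p) (hF : BdryDecay F μ p a)
    (X : Op q (ball u L)) : traceNorm (bdryFar F u L r X)
      ≤ p * ((L : ℝ) + 1) ^ a * Real.exp (-μ * r) * traceNorm X := by
  have h := traceNorm_sum_bdryOn_le hF u L (r := r + 1) (by omega)
    (S := (Finset.Icc 1 (L + 1)).filter fun d => ¬d ≤ r)
    (fun d hd => by
      rw [Finset.mem_filter, Finset.mem_Icc] at hd
      rw [Finset.mem_Icc]; omega) X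
  refine h.trans (mul_le_mul_of_nonneg_right ?_ (traceNorm_nonneg X))
  refine mul_le_mul_of_nonneg_left (Real.exp_le_exp.2 ?_) (by positivity)
  push_cast
  linarith

theorem traceNorm_bdryNear_le (hμ : 0 ≤ μ) (hp : 0 ≤ p) (hF : BdryDecay F μ p a)
    (X : Op q (ball u L)) : traceNorm (bdryNear F u L r X)
      ≤ p * ((L : ℝ) + 1) ^ a * traceNorm X := by
  have h3 := traceNorm_sum_bdryOn_le hF u L le_rfl
    (S := (Finset.Icc 1 (L + 1)).filter fun d => d ≤ r) (Finset.filter_subset _ _) X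
  refine h3.trans (mul_le_mul_of_nonneg_right ?_ (traceNorm_nonneg X))
  refine mul_le_of_le_one_right (by positivity) (Real.exp_le_one_iff.2 ?_)
  have : 0 ≤ μ * ((1 : ℕ) : ℝ) := by positivity
  linarith

variable {u L r}

theorem bdryNear_emb_mul (hA : A ⊆ ball u L) (hd : Disjoint A (layer r (ball u L))) (O : Op q A)
    (X : Op q (ball u L)) :
    bdryNear F u L r (emb hA O * X) = emb hA O * bdryNear F u L r X := by
  rw [bdryNear, LinearMap.sum_apply, LinearMap.sum_apply, Finset.mul_sum]
  refine Finset.sum_congr rfl fun d hd' => ?_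
  exact extend_emb_mul _ hA (hd.mono_right (layer_mono (Finset.mem_filter.1 hd').2 _)) _ O X

theorem bulkOn_bdryNear_comm (hY : Disjoint Y (layer r (ball u L))) (X : Op q (ball u L)) :
    bulkOn F (ball u L) Y (bdryNear F u L r X) = bdryNear F u L r (bulkOn F (ball u L) Y X) := by
  rw [bdryNear, LinearMap.sum_apply, LinearMap.sum_apply, map_sum]
  refine Finset.sum_congr rfl fun d hd => ?_
  exact bulkOn_comm F _ (hY.mono_right (layer_mono (Finset.mem_filter.1 hd).2 _)) _ X

/-- Only the full boundary term annihilates the trace; the terms close to the boundary do so up to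
the tail. -/
theorem trace_bdryNear (X : Op q (ball u L)) :
    (bdryNear F u L r X).trace = -(bdryFar F u L r X).trace := by
  have h3 := (F.bdry_lindblad u L).hasLForm.trace_eq_zero X
  have h5 : ((bdryNear F u L r + bdryFar F u L r) X).trace = 0 := by
    rw [bdryNear_add_bdryFar]; exact h3
  rw [LinearMap.add_apply, trace_add] at h5
  exact eq_neg_of_add_eq_zero_left h5

theorem norm_obs_bdryNear_le (hμ : 0 ≤ μ) (hp : 0 ≤ p) (hF : BdryDecay F μ p a)
    (hA : A ⊆ ball u L) (hd : Disjoint A (layer r (ball u L))) (O : Op q A)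
    (X : Op q (ball u L)) :
    ‖obs (emb hA O) (bdryNear F u L r X)‖
      ≤ p * ((L : ℝ) + 1) ^ a * Real.exp (-μ * r) * (‖O‖ * traceNorm X) := by
  rw [obs_apply, ← bdryNear_emb_mul hA hd, trace_bdryNear, norm_neg]
  refine (norm_trace_le_traceNorm _).trans ((traceNorm_bdryFar_le u L r hμ hp hF _).trans ?_)
  refine mul_le_mul_of_nonneg_left ?_ (by positivity)
  exact (traceNorm_mul_le _ _).trans
    (mul_le_mul_of_nonneg_right (norm_emb_le hA O) (traceNorm_nonneg X))

theorem LRBound.norm_obs_bdry_le {v C : ℝ} (hμ : 0 ≤ μ) (hv : 0 ≤ v) (hp : 0 ≤ p)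
    (hF : BulkDecay F μ v) (hF' : BdryDecay F μ p a)
    (hC1 : 1 ≤ C) (hC : ∀ (x : Site D) (S : Finset (Site D)) (r : ℝ),
      (∀ z ∈ S, r ≤ (gdist x z : ℝ)) →
      ∑ z ∈ S, Real.exp (-μ * (gdist x z : ℝ)) ≤ C * Real.exp (-μ / 2 * r))
    {hA : A ⊆ ball u L} (hne : A.Nonempty) (hR : R ⊆ ball u L) (h : LRBound F μ v hA R 2)
    (hr : 1 ≤ r) (h₂ : ∀ x ∈ A, ∀ y, y ∉ ball u L → 2 * r ≤ gdist x y) {s : ℝ} (hs : 0 ≤ s)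
    (O : Op q A) (X : Op q (ball u L)) :
    ‖obs (emb hA O) (evolution (regionGen F (ball u L) R) s
        ((∑ d ∈ Finset.Icc 1 (L + 1), bdryOn F u L d) X))‖
      ≤ 3 * (p * ((L : ℝ) + 1) ^ a) * C * Real.exp (-μ / 2 * r) *
        (A.card * Real.exp (2 * v * s)) * (‖O‖ * traceNorm X) := by
  have hdisj : Disjoint A (layer r (ball u L)) := by
    rw [Finset.disjoint_left]
    intro x hx hx'
    obtain ⟨-, y, hy, hxy⟩ := (mem_layer_iff r _ x).1 hx'
    have := h₂ x hx y hy
    omega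
  have hW : weight μ A (layer r (ball u L)) ≤ A.card * (C * Real.exp (-μ / 2 * r)) := by
    refine weight_le_card_mul hC fun x hx z hz => ?_
    obtain ⟨-, y, hy, hzy⟩ := (mem_layer_iff r _ z).1 hz
    have h3 := h₂ x hx y hy
    have h4 := gdist_triangle x z y
    have : r ≤ gdist x z := by omega
    exact_mod_cast this
  have hexp : Real.exp (-μ * r) ≤ Real.exp (-μ / 2 * r) := by
    refine Real.exp_le_exp.2 ?_
    have : 0 ≤ μ * (r : ℝ) := by positivity
    linarith
  have hP0 : 0 ≤ p * ((L : ℝ) + 1) ^ a := by positivity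
  have hnear := h.norm_obs_evolution_le hμ hF hR zero_le_two (layer r (ball u L))
    (fun Y hY X => bulkOn_bdryNear_comm hY X) hP0 (traceNorm_bdryNear_le u L r hμ hp hF')
    (mul_nonneg hP0 (Real.exp_pos _).le) (norm_obs_bdryNear_le hμ hp hF' hA hdisj) hs O X
  have hfar : ‖obs (emb hA O) (evolution (regionGen F (ball u L) R) s (bdryFar F u L r X))‖
      ≤ ‖O‖ * (p * ((L : ℝ) + 1) ^ a * Real.exp (-μ * r) * traceNorm X) :=
    (norm_obs_emb_le hA O _).trans (mul_le_mul_of_nonneg_left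
      (((hasLForm_regionGen F _ R).traceNorm_evolution_le hs _).trans
        (traceNorm_bdryFar_le u L r hμ hp hF' X)) (norm_nonneg _))
  rw [← bdryNear_add_bdryFar F u L r, LinearMap.add_apply, map_add, map_add]
  refine (norm_add_le _ _).trans ((add_le_add hnear hfar).trans ?_)
  generalize p * ((L : ℝ) + 1) ^ a = P at hP0
  generalize Real.exp (-μ / 2 * r) = e at hexp hW
  have hE : 1 ≤ Real.exp (2 * v * s) := Real.one_le_exp (by positivity)
  generalize Real.exp (2 * v * s) = E at hE
  have he0 : 0 ≤ Real.exp (-μ * r) := (Real.exp_pos _).le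
  generalize Real.exp (-μ * r) = e' at hexp he0
  have hcard : (1 : ℝ) ≤ A.card := by exact_mod_cast hne.card_pos
  generalize (A.card : ℝ) = m at hcard hW
  have hN0 : 0 ≤ ‖O‖ * traceNorm X := mul_nonneg (norm_nonneg _) (traceNorm_nonneg _)
  have he : 0 ≤ e := he0.trans hexp
  have h1 : 1 ≤ m * E * C :=
    one_le_mul_of_one_le_of_one_le (one_le_mul_of_one_le_of_one_le hcard hE) hC1
  have h3 : P * e' ≤ P * e * (m * E * C) :=
    (mul_le_mul_of_nonneg_left hexp hP0).trans
      (le_mul_of_one_le_right (mul_nonneg hP0 he) h1)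
  have h4 : P * (2 / 2) * weight μ A (layer r (ball u L)) * E ≤ P * (2 / 2) * (m * (C * e)) * E := by
    gcongr
  have h5 := mul_le_mul_of_nonneg_right (add_le_add (add_le_add h3 h4) h3) hN0
  refine le_trans (le_of_eq (by ring)) (h5.trans (le_of_eq (by ring)))

end Boundary

set_option maxHeartbeats 1000000 in
/-- The closed boundary evolution of a ball, seen from a region `A` deep inside a region `R` of it,
is close to the evolution generated by the bulk terms in `R`. -/
theorem traceNorm_reduced_evolution_sub_le {F : UniformFamily q} {μ v p C : ℝ} {a : ℕ}
    (hμ : 0 ≤ μ) (hv : 0 ≤ v) (hp : 0 ≤ p) (hF : BulkDecay F μ v) (hF' : BdryDecay F μ p a)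
    (hC1 : 1 ≤ C) (hC : ∀ (x : Site D) (S : Finset (Site D)) (r : ℝ),
      (∀ z ∈ S, r ≤ (gdist x z : ℝ)) →
      ∑ z ∈ S, Real.exp (-μ * (gdist x z : ℝ)) ≤ C * Real.exp (-μ / 2 * r))
    {u : Site D} {L : ℕ} (hA : A ⊆ ball u L) (hne : A.Nonempty) (hR : R ⊆ ball u L) {r₁ : ℝ}
    {r₂ : ℕ} (hr₂ : 1 ≤ r₂) (h₁ : ∀ x ∈ A, ∀ z ∈ ball u L \ R, 2 * r₁ ≤ gdist x z)
    (h₂ : ∀ x ∈ A, ∀ y, y ∉ ball u L → 2 * r₂ ≤ gdist x y) {t : ℝ} (ht : 0 ≤ t)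
    (X : Op q (ball u L)) :
    traceNorm (reduced A (evolution (regionGen F (ball u L) R) t X)
        - reduced A (evolution (F.closedGen u L) t X))
      ≤ t * Real.exp (2 * v * t) * A.card * (2 * v * C * Real.exp (-μ * r₁)
        + 3 * p * C * ((L : ℝ) + 1) ^ a * Real.exp (-μ / 2 * r₂)) * traceNorm X := by
  have hLR := lrBound_two hμ hv hF hA hne hR
  have hgen : ∀ X', regionGen F (ball u L) R X' - F.closedGen u L X'
      = -(∑ Z ∈ (ball u L).powerset with ¬Z ⊆ R, bulkOn F (ball u L) Z X'
        + (∑ d ∈ Finset.Icc 1 (L + 1), bdryOn F u L d) X') := by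
    intro X'
    have e1 : F.closedGen u L X' = (∑ Z ∈ (ball u L).powerset, bulkOn F (ball u L) Z X')
        + (∑ d ∈ Finset.Icc 1 (L + 1), bdryOn F u L d) X' := by
      rw [UniformFamily.closedGen, openGen_eq, LinearMap.add_apply, regionGen,
        LinearMap.sum_apply]
      rfl
    have e2 : regionGen F (ball u L) R X'
        = ∑ Z ∈ (ball u L).powerset with Z ⊆ R, bulkOn F (ball u L) Z X' := by
      rw [regionGen, LinearMap.sum_apply]
      refine Finset.sum_congr ?_ fun _ _ => rfl
      ext Z
      simp only [Finset.mem_powerset, Finset.mem_filter]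
      exact ⟨fun h => ⟨h.trans hR, h⟩, fun h => h.2⟩
    rw [e1, e2, ← Finset.sum_filter_add_sum_filter_not (ball u L).powerset (fun Z => Z ⊆ R)]
    abel
  rw [traceNorm_le_iff]
  intro O hO
  rw [← reducedLin_apply, ← reducedLin_apply, ← map_sub, reducedLin_apply, ← trace_emb_mul hA,
    ← obs_apply, map_sub]
  have hTX := traceNorm_nonneg X
  obtain ⟨c, hc⟩ : ∃ c, c = 2 * v * Real.exp (2 * v * t) * (A.card * (C * Real.exp (-μ * r₁)))
        * traceNorm X + 3 * (p * ((L : ℝ) + 1) ^ a) * C * Real.exp (-μ / 2 * r₂) *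
        (A.card * Real.exp (2 * v * t)) * traceNorm X := ⟨_, rfl⟩
  have hbd : ∀ r, 0 ≤ r → r ≤ t → ∀ X', traceNorm X' ≤ traceNorm X →
      ‖obs (emb hA O) (evolution (regionGen F (ball u L) R) r
        (regionGen F (ball u L) R X' - F.closedGen u L X'))‖ ≤ c := by
    intro r hr0 hrt X' hX'
    have hEr : Real.exp (2 * v * r) ≤ Real.exp (2 * v * t) := Real.exp_le_exp.2 (by gcongr)
    have hO1 : ‖O‖ * traceNorm X' ≤ traceNorm X :=
      (mul_le_of_le_one_left (traceNorm_nonneg _) hO).trans hX'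
    have hO0 : 0 ≤ ‖O‖ * traceNorm X' := mul_nonneg (norm_nonneg _) (traceNorm_nonneg _)
    rw [hgen, map_neg, map_neg, norm_neg, map_add, map_add, hc]
    have h3 := hLR.norm_obs_sum_bulkOn_le hμ hv hF hC h₁ hr0 O X'
    have h4 := hLR.norm_obs_bdry_le hμ hv hp hF hF' hC1 hC hne hR hr₂ h₂ hr0 O X'
    refine (norm_add_le _ _).trans ((add_le_add h3 h4).trans ?_)
    have hcd : (0 : ℝ) ≤ A.card := Nat.cast_nonneg _
    have hC0 : 0 ≤ C := zero_le_one.trans hC1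
    refine add_le_add (mul_le_mul (mul_le_mul_of_nonneg_right (mul_le_mul_of_nonneg_left hEr ?_) ?_)
      hO1 hO0 ?_) (mul_le_mul (mul_le_mul_of_nonneg_left (mul_le_mul_of_nonneg_left hEr hcd) ?_)
      hO1 hO0 ?_)
    · positivity
    · exact mul_nonneg hcd (mul_nonneg hC0 (Real.exp_pos _).le)
    · exact mul_nonneg (mul_nonneg (by positivity) (Real.exp_pos _).le)
        (mul_nonneg hcd (mul_nonneg hC0 (Real.exp_pos _).le))
    · exact mul_nonneg (mul_nonneg (by positivity) hC0) (Real.exp_pos _).le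
    · exact mul_nonneg (mul_nonneg (mul_nonneg (by positivity) hC0) (Real.exp_pos _).le)
        (mul_nonneg hcd (Real.exp_pos _).le)
  have hduh := norm_duhamel_le (F.closedGen u L) (regionGen F (ball u L) R) LinearMap.id
    (obs (emb hA O)) X ht (fun r => c * r) (fun _ => c)
    (fun r => by simpa using (hasDerivAt_id r).const_mul c)
    (fun r hr0 hrt => hbd r hr0 hrt _
      ((hasLForm_closedGen F u L).traceNorm_evolution_le (by linarith) X))
  simp only [mul_zero, sub_zero, LinearMap.id_apply] at hduh
  refine hduh.trans (le_of_eq ?_)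
  rw [hc]; ring

end LiebRobinson

end

section

open scoped Matrix.Norms.L2Operator ComplexOrder
set_option linter.unusedSectionVars false
open Matrix

/-! ### Localising a Lindbladian -/

section Localise

section Product

variable {n κ : Type} [Fintype n] [DecidableEq n] [Fintype κ] [DecidableEq κ]

/-- The partial trace over the second tensor factor. -/
def ptrace (W : Matrix (n × κ) (n × κ) ℂ) : Matrix n n ℂ :=
  of fun x y => ∑ f, W (x, f) (y, f)

theorem traceNorm_ptrace_le (W : Matrix (n × κ) (n × κ) ℂ) :
    traceNorm (ptrace W) ≤ traceNorm W := by
  rw [traceNorm_le_iff]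
  intro O hO
  set O' : Matrix (n × κ) (n × κ) ℂ := of fun p r => if p.2 = r.2 then O p.1 r.1 else 0 with hO'
  have h1 : (O * ptrace W).trace = (O' * W).trace := by
    simp only [trace, diag_apply, mul_apply, ptrace, of_apply, hO', Fintype.sum_prod_type,
      Finset.mul_sum]
    refine Finset.sum_congr rfl fun x _ => ?_
    rw [Finset.sum_comm]
    refine Finset.sum_congr rfl fun f _ => ?_
    refine Finset.sum_congr rfl fun y _ => ?_
    simp
  have h2 : ‖O'‖ ≤ 1 := by
    refine opNorm_le_of_mulVec _ _ zero_le_one fun v => ?_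
    rw [one_mul]
    refine (pow_le_pow_iff_left₀ (vnorm_nonneg _) (vnorm_nonneg _) two_ne_zero).1 ?_
    rw [vnorm_sq, vnorm_sq, Fintype.sum_prod_type_right, Fintype.sum_prod_type_right]
    refine Finset.sum_le_sum fun f _ => ?_
    have h3 : ∀ x, (O' *ᵥ v) (x, f) = (O *ᵥ fun y => v (y, f)) x := fun x => by
      simp [mulVec, dotProduct, hO', Fintype.sum_prod_type]
    simp only [h3]
    rw [← vnorm_sq, ← vnorm_sq (fun y => v (y, f))]
    exact pow_le_pow_left₀ (vnorm_nonneg _) ((vnorm_mulVec_le _ _).trans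
      (mul_le_of_le_one_left (vnorm_nonneg _) hO)) 2
  rw [h1]
  exact (norm_trace_mul_le _ _).trans (mul_le_of_le_one_left (traceNorm_nonneg _) h2)

/-- The operator `X ⊗ |e⟩⟨e|`. -/
def tensorUnit (e : κ) (X : Matrix n n ℂ) : Matrix (n × κ) (n × κ) ℂ :=
  of fun p r => if p.2 = e ∧ r.2 = e then X p.1 r.1 else 0

theorem traceNorm_tensorUnit_le (e : κ) (X : Matrix n n ℂ) :
    traceNorm (tensorUnit e X) ≤ traceNorm X := by
  rw [traceNorm_le_iff]
  intro O hO
  set O' : Matrix n n ℂ := of fun x y => O (x, e) (y, e) with hO'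
  have h1 : (O * tensorUnit e X).trace = (O' * X).trace := by
    simp only [trace, diag_apply, mul_apply, tensorUnit, of_apply, hO', Fintype.sum_prod_type]
    refine Finset.sum_congr rfl fun x _ => ?_
    rw [Finset.sum_eq_single e]
    · refine Finset.sum_congr rfl fun y _ => ?_
      simp
    · intro f _ hf; simp [hf]
    · simp
  have h2 : ‖O'‖ ≤ 1 := by
    refine opNorm_le_of_mulVec _ _ zero_le_one fun v => ?_
    rw [one_mul]
    set w : n × κ → ℂ := fun p => if p.2 = e then v p.1 else 0 with hw
    have h3 : vnorm w = vnorm v := by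
      refine (pow_left_inj₀ (vnorm_nonneg _) (vnorm_nonneg _) two_ne_zero).1 ?_
      rw [vnorm_sq, vnorm_sq, Fintype.sum_prod_type]
      simp [hw, apply_ite]
    have h4 : ∀ x, (O' *ᵥ v) x = (O *ᵥ w) (x, e) := fun x => by
      simp [mulVec, dotProduct, hO', hw, Fintype.sum_prod_type]
    have h5 : vnorm (O' *ᵥ v) ≤ vnorm (O *ᵥ w) := by
      refine (pow_le_pow_iff_left₀ (vnorm_nonneg _) (vnorm_nonneg _) two_ne_zero).1 ?_
      rw [vnorm_sq, vnorm_sq, Fintype.sum_prod_type]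
      refine Finset.sum_le_sum fun x _ => ?_
      rw [h4]
      exact Finset.single_le_sum (f := fun f => ‖(O *ᵥ w) (x, f)‖ ^ 2)
        (fun _ _ => by positivity) (Finset.mem_univ e)
    rw [← h3]
    exact h5.trans ((vnorm_mulVec_le _ _).trans (mul_le_of_le_one_left (vnorm_nonneg _) hO))
  rw [h1]
  exact (norm_trace_mul_le _ _).trans (mul_le_of_le_one_left (traceNorm_nonneg _) h2)

end Product

variable {D : ℕ} {q : Site D → ℕ} {Y Λ : Finset (Site D)}

/-- The inclusion of `H_Y` in `H_Λ` that puts the configuration `f` outside `Y`. -/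
def inclusion (f : Conf q (Λ \ Y)) : Matrix (Conf q Λ) (Conf q Y) ℂ :=
  of fun c y => if c = join y f then 1 else 0

theorem inclusion_conj_apply (f g : Conf q (Λ \ Y)) (W : Op q Λ) (y y' : Conf q Y) :
    ((inclusion f)ᴴ * W * inclusion g : Op q Y) y y' = W (join y f) (join y' g) := by
  rw [Matrix.mul_apply]
  simp only [Matrix.mul_apply, inclusion, of_apply, conjTranspose_apply]
  rw [Finset.sum_eq_single (join y' g), Finset.sum_eq_single (join y f), if_pos rfl, if_pos rfl,
    star_one, one_mul, mul_one]
  · intro b _ hb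
    rw [if_neg hb, star_zero, zero_mul]
  · exact fun h => absurd (Finset.mem_univ _) h
  · intro b _ hb
    rw [if_neg hb, mul_zero]
  · exact fun h => absurd (Finset.mem_univ _) h

theorem join_inj (h : Y ⊆ Λ) {y y' : Conf q Y} {f f' : Conf q (Λ \ Y)} :
    (join y f : Conf q Λ) = join y' f' ↔ y = y' ∧ f = f' := by
  have := (splitEquiv (q := q) h).symm.injective.eq_iff (a := (y, f)) (b := (y', f'))
  rwa [Prod.mk.injEq] at this

theorem inclusion_conjTranspose_mul (h : Y ⊆ Λ) (f g : Conf q (Λ \ Y)) :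
    (inclusion f)ᴴ * inclusion (Y := Y) (Λ := Λ) g = if f = g then 1 else 0 := by
  have h1 := fun y y' => inclusion_conj_apply f g (1 : Op q Λ) y y'
  simp only [Matrix.mul_one] at h1
  ext y y'
  rw [h1, one_apply]
  by_cases hfg : f = g
  · subst hfg
    simp [join_inj h, one_apply]
  · simp [join_inj h, hfg]

theorem sum_inclusion_mul_conjTranspose (h : Y ⊆ Λ) :
    ∑ f : Conf q (Λ \ Y), inclusion f * (inclusion f)ᴴ = (1 : Op q Λ) := by
  ext c c'
  rw [Matrix.sum_apply]
  have h1 : ∀ f : Conf q (Λ \ Y), (inclusion f * (inclusion f)ᴴ : Op q Λ) c c'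
      = ∑ y : Conf q Y, if c = join y f ∧ c' = join y f then 1 else 0 := fun f => by
    rw [mul_apply]
    refine Finset.sum_congr rfl fun y _ => ?_
    simp only [inclusion, of_apply, conjTranspose_apply, apply_ite, star_one, star_zero]
    split_ifs <;> simp_all
  simp only [h1]
  rw [Finset.sum_comm, ← Fintype.sum_prod_type' (f := fun (y : Conf q Y) (f : Conf q (Λ \ Y)) =>
    if c = join y f ∧ c' = join y f then (1 : ℂ) else 0), ← (splitEquiv (q := q) h).sum_comp]
  have h2 : ∀ b : Conf q Λ, (join (splitEquiv h b).1 (splitEquiv h b).2 : Conf q Λ) = b :=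
    fun b => (splitEquiv h).symm_apply_apply b
  simp only [h2]
  rw [one_apply, Finset.sum_eq_single c]
  · simp [eq_comm]
  · intro b _ hb; simp [Ne.symm hb]
  · simp

theorem reduced_eq_sum (W : Op q Λ) :
    reduced Y W = ∑ f : Conf q (Λ \ Y), (inclusion f)ᴴ * W * inclusion f := by
  ext y y'
  rw [Matrix.sum_apply]
  simp only [inclusion_conj_apply]
  rfl

/-- The superoperator on `Y` obtained from `T` by preparing the configuration `e` outside `Y`,
applying `T` and tracing out the outside. -/
noncomputable def localise (e : Conf q (Λ \ Y)) (T : SuperOp (Conf q Λ)) : SuperOp (Conf q Y) :=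
  reducedLin Y Λ ∘ₗ T ∘ₗ
    { toFun := fun X => inclusion e * X * (inclusion e)ᴴ
      map_add' := fun X X' => by rw [Matrix.mul_add, Matrix.add_mul]
      map_smul' := fun c X => by rw [Matrix.mul_smul, Matrix.smul_mul]; rfl }

theorem localise_apply (e : Conf q (Λ \ Y)) (T : SuperOp (Conf q Λ)) (X : Op q Y) :
    localise e T X = reduced Y (T (inclusion e * X * (inclusion e)ᴴ)) := rfl

theorem localise_add (e : Conf q (Λ \ Y)) (T T' : SuperOp (Conf q Λ)) :
    localise e (T + T') = localise e T + localise e T' := by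
  refine LinearMap.ext fun X => ?_
  rw [LinearMap.add_apply, localise_apply, localise_apply, localise_apply, LinearMap.add_apply]
  exact map_add (reducedLin Y Λ) _ _

theorem hasLForm_localise (h : Y ⊆ Λ) (e : Conf q (Λ \ Y)) {T : SuperOp (Conf q Λ)}
    (hT : HasLForm T) : HasLForm (localise e T) := by
  obtain ⟨ι, _, G, L, hT1, hT2⟩ := hT
  refine ⟨ι × Conf q (Λ \ Y), inferInstance, (inclusion e)ᴴ * G * inclusion e,
    fun p => (inclusion p.2)ᴴ * L p.1 * inclusion e, fun X => ?_, ?_⟩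
  · rw [localise_apply, reduced_eq_sum, hT1]
    simp only [Matrix.mul_add, Matrix.add_mul, Finset.sum_add_distrib, Matrix.mul_sum,
      Matrix.sum_mul]
    congr 1
    · congr 1
      · rw [Fintype.sum_prod_type_right]
        refine Finset.sum_congr rfl fun f _ => Finset.sum_congr rfl fun j _ => ?_
        simp only [conjTranspose_mul, conjTranspose_conjTranspose, Matrix.mul_assoc]
      · rw [Finset.sum_eq_single e]
        · have := inclusion_conjTranspose_mul (q := q) h e e
          rw [if_pos rfl] at this
          simp only [Matrix.mul_assoc, this, Matrix.mul_one]
        · intro f _ hf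
          have := inclusion_conjTranspose_mul (q := q) h e f
          rw [if_neg (Ne.symm hf)] at this
          simp only [Matrix.mul_assoc, this, Matrix.mul_zero]
        · simp
    · rw [Finset.sum_eq_single e]
      · have := inclusion_conjTranspose_mul (q := q) h e e
        rw [if_pos rfl] at this
        simp only [conjTranspose_mul, conjTranspose_conjTranspose, ← Matrix.mul_assoc, this,
          Matrix.one_mul]
      · intro f _ hf
        have := inclusion_conjTranspose_mul (q := q) h f e
        rw [if_neg hf] at this
        simp only [← Matrix.mul_assoc, this, Matrix.zero_mul]
      · simp
  · have h1 : ∀ j, ∑ f : Conf q (Λ \ Y), ((inclusion f)ᴴ * L j * inclusion e)ᴴ *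
        ((inclusion f)ᴴ * L j * inclusion (Y := Y) e)
        = (inclusion e)ᴴ * ((L j)ᴴ * L j) * inclusion e := fun j => by
      calc _ = (inclusion e)ᴴ * (L j)ᴴ * (∑ f : Conf q (Λ \ Y), inclusion (Y := Y) f *
            (inclusion f)ᴴ) * L j * inclusion (Y := Y) e := by
            rw [Matrix.mul_sum, Matrix.sum_mul, Matrix.sum_mul]
            refine Finset.sum_congr rfl fun f _ => ?_
            simp only [conjTranspose_mul, conjTranspose_conjTranspose, Matrix.mul_assoc]
        _ = _ := by
            rw [sum_inclusion_mul_conjTranspose h]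
            simp only [Matrix.mul_assoc, Matrix.mul_one]
    rw [Fintype.sum_prod_type]
    simp only [h1]
    have h2 := congrArg (fun W => (inclusion e)ᴴ * W * inclusion (Y := Y) e) hT2
    simp only [Matrix.mul_add, Matrix.add_mul, Matrix.mul_sum, Matrix.sum_mul, Matrix.mul_zero,
      Matrix.zero_mul] at h2
    rw [← h2]
    simp only [conjTranspose_mul, conjTranspose_conjTranspose, Matrix.mul_assoc]

theorem localise_extend (h : Y ⊆ Λ) (e : Conf q (Λ \ Y)) (T : SuperOp (Conf q Y)) :
    localise e (extend h T) = T := by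
  refine LinearMap.ext fun X => ?_
  have h1 := reduced_extend (q := q) (le_refl Y) h T (inclusion e * X * (inclusion e)ᴴ)
  have h2 : extend (le_refl Y) T = T := by
    refine LinearMap.ext fun X => Matrix.ext fun a b => ?_
    have h3 : ∀ z a : Conf q Y, overwrite z a = z := fun z a => funext fun x =>
      overwrite_mem z a x x.2
    have h4 : (of fun z w => X (overwrite z a) (overwrite w b) : Op q Y) = X :=
      Matrix.ext fun z w => by rw [of_apply, h3, h3]
    rw [extend_apply, h4]
    rfl
  have h3 : reduced Y (inclusion e * X * (inclusion e)ᴴ : Op q Λ) = X := by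
    rw [reduced_eq_sum, Finset.sum_eq_single e]
    · have := inclusion_conjTranspose_mul (q := q) h e e
      rw [if_pos rfl] at this
      rw [← Matrix.mul_assoc, ← Matrix.mul_assoc, this, Matrix.one_mul, Matrix.mul_assoc, this,
        Matrix.mul_one]
    · intro f _ hf
      have := inclusion_conjTranspose_mul (q := q) h f e
      rw [if_neg hf] at this
      rw [← Matrix.mul_assoc, ← Matrix.mul_assoc, this, Matrix.zero_mul, Matrix.zero_mul,
        Matrix.zero_mul]
    · simp
  rw [localise_apply]
  rw [h2, h3] at h1
  exact h1

/-- The exchange of the part of a configuration outside `Y` with a second copy of it. -/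
def exchange (_h : Y ⊆ Λ) : Conf q Λ × Conf q (Λ \ Y) ≃ Conf q Λ × Conf q (Λ \ Y) where
  toFun p := (overwrite p.2 p.1, restr Finset.sdiff_subset p.1)
  invFun p := (overwrite p.2 p.1, restr Finset.sdiff_subset p.1)
  left_inv p := by
    refine Prod.ext ?_ ?_
    · funext x
      by_cases hx : x.1 ∈ Λ \ Y
      · simp [overwrite_mem _ _ x hx, restr]
      · simp [overwrite_not_mem _ _ x hx]
    · exact restr_overwrite (h := Finset.sdiff_subset) _ _
  right_inv p := by
    refine Prod.ext ?_ ?_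
    · funext x
      by_cases hx : x.1 ∈ Λ \ Y
      · simp [overwrite_mem _ _ x hx, restr]
      · simp [overwrite_not_mem _ _ x hx]
    · exact restr_overwrite (h := Finset.sdiff_subset) _ _

theorem inclusion_mul_mul_apply (h : Y ⊆ Λ) (e : Conf q (Λ \ Y)) (σ : Op q Y) (c c' : Conf q Λ) :
    (inclusion e * σ * (inclusion e)ᴴ : Op q Λ) c c' =
      if restr Finset.sdiff_subset c = e ∧ restr Finset.sdiff_subset c' = e then
        σ (restr h c) (restr h c') else 0 := by
  have h1 : ∀ (c : Conf q Λ) (y : Conf q Y),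
      c = join y e ↔ y = restr h c ∧ restr Finset.sdiff_subset c = e := fun c y => by
    have h2 : c = join y e ↔ splitEquiv h c = (y, e) :=
      Equiv.eq_symm_apply (splitEquiv h) (x := (y, e)) (y := c)
    rw [h2, Prod.ext_iff]
    exact and_congr eq_comm Iff.rfl
  simp only [Matrix.mul_apply, inclusion, of_apply, conjTranspose_apply, h1]
  by_cases hc : restr Finset.sdiff_subset c = e <;>
    by_cases hc' : restr Finset.sdiff_subset c' = e <;> simp [hc, hc', apply_ite]

theorem extend_localise_eq (h : Y ⊆ Λ) (e : Conf q (Λ \ Y)) (T : SuperOp (Conf q Λ))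
    (X : Op q Λ) : extend h (localise e T) X = ptrace ((amp (Conf q (Λ \ Y)) T
      ((tensorUnit e X).submatrix (exchange h) (exchange h))).submatrix
        (exchange h) (exchange h)) := by
  ext x x'
  have h1 : ∀ (x : Conf q Λ) (f : Conf q (Λ \ Y)), join (restr h x) f = overwrite f x :=
    fun x f => by
    funext z
    by_cases hz : z.1 ∈ Y
    · have : z.1 ∉ Λ \ Y := fun h' => (Finset.mem_sdiff.1 h').2 hz
      simp [join, hz, overwrite_not_mem _ _ z this, restr]
    · have : z.1 ∈ Λ \ Y := Finset.mem_sdiff.2 ⟨z.2, hz⟩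
      simp [join, hz, overwrite_mem _ _ z this]
  have h2 : ∀ x i : Conf q Λ, overwrite (restr h i) x
      = overwrite (restr (Finset.sdiff_subset (s := Λ) (t := Y)) x) i := fun x i => by
    funext z
    by_cases hz : z.1 ∈ Y
    · have : z.1 ∉ Λ \ Y := fun h' => (Finset.mem_sdiff.1 h').2 hz
      rw [overwrite_mem _ _ z hz, overwrite_not_mem _ _ z this]
      rfl
    · have : z.1 ∈ Λ \ Y := Finset.mem_sdiff.2 ⟨z.2, hz⟩
      rw [overwrite_mem _ _ z this, overwrite_not_mem _ _ z hz]
      rfl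
  rw [extend_apply, localise_apply]
  refine Finset.sum_congr rfl fun f _ => ?_
  have h3 := h1 x f
  have h4 := h1 x' f
  refine (congrArg₂ (T (inclusion e * of (fun z w => X (overwrite z x) (overwrite w x')) *
    (inclusion e)ᴴ)) h3 h4).trans ?_
  refine congrFun (congrFun (congrArg T ?_) _) _
  ext i j
  rw [inclusion_mul_mul_apply h]
  simp only [of_apply, submatrix_apply, tensorUnit, exchange, Equiv.coe_fn_mk, h2]

theorem traceNorm_extend_localise_le (h : Y ⊆ Λ) (e : Conf q (Λ \ Y)) {T : SuperOp (Conf q Λ)}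
    {M : ℝ} (hM : ∀ W, traceNorm (amp (Conf q (Λ \ Y)) T W) ≤ M * traceNorm W) (hM0 : 0 ≤ M)
    (X : Op q Λ) : traceNorm (extend h (localise e T) X) ≤ M * traceNorm X := by
  rw [extend_localise_eq]
  refine (traceNorm_ptrace_le _).trans ?_
  rw [traceNorm_reindex]
  refine (hM _).trans (mul_le_mul_of_nonneg_left ?_ hM0)
  rw [traceNorm_reindex]
  exact traceNorm_tensorUnit_le e X

end Localise

end

section

open scoped Matrix.Norms.L2Operator ComplexOrder
set_option linter.unusedSectionVars false
open Matrix

section Cut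

variable {D : ℕ} {q : Site D → ℕ} {A Y Λ : Finset (Site D)}

/-- The evolutions of two Lindbladians differ at most linearly in time. -/
theorem HasLForm.traceNorm_evolution_sub_le {n : Type} [Fintype n] [DecidableEq n]
    {M M' : SuperOp n} (h : HasLForm M) (h' : HasLForm M') {ε : ℝ} (hε0 : 0 ≤ ε)
    (hε : ∀ X, traceNorm (M' X - M X) ≤ ε * traceNorm X) {t : ℝ} (ht : 0 ≤ t)
    (X : Matrix n n ℂ) :
    traceNorm (evolution M' t X - evolution M t X) ≤ t * (ε * traceNorm X) := by
  rw [traceNorm_le_iff]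
  intro O hO
  have h1 := norm_duhamel_le M M' LinearMap.id (obs O) X ht
    (fun r => r * (ε * traceNorm X)) (fun _ => ε * traceNorm X)
    (fun r => by simpa using (hasDerivAt_id r).mul_const (ε * traceNorm X))
    (fun r hr0 hrt => by
      rw [obs_apply]
      refine (norm_trace_mul_le _ _).trans
        ((mul_le_of_le_one_left (traceNorm_nonneg _) hO).trans ?_)
      refine (h'.traceNorm_evolution_le hr0 _).trans ((hε _).trans ?_)
      exact mul_le_mul_of_nonneg_left (h.traceNorm_evolution_le (sub_nonneg.2 hrt) X) hε0)
  simpa [obs_apply, Matrix.mul_sub, trace_sub] using h1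

theorem localise_sum (e : Conf q (Λ \ Y)) {ι : Type*} (s : Finset ι)
    (T : ι → SuperOp (Conf q Λ)) : localise e (∑ i ∈ s, T i) = ∑ i ∈ s, localise e (T i) := by
  refine LinearMap.ext fun X => ?_
  rw [LinearMap.sum_apply, localise_apply, LinearMap.sum_apply]
  exact map_sum (reducedLin Y Λ) _ _

theorem traceNorm_amp_bdryFar_le {κ : Type} [Fintype κ] [DecidableEq κ] {F : UniformFamily q}
    {μ p : ℝ} {a : ℕ} (hμ : 0 ≤ μ) (hp : 0 ≤ p) (hF : BdryDecay F μ p a) (u : Site D) (L r : ℕ)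
    (X : Matrix (Conf q (ball u L) × κ) (Conf q (ball u L) × κ) ℂ) :
    traceNorm (amp κ (bdryFar F u L r) X)
      ≤ p * ((L : ℝ) + 1) ^ a * Real.exp (-μ * r) * traceNorm X := by
  have h1 : amp κ (bdryFar F u L r) X
      = ∑ d ∈ Finset.Icc 1 (L + 1) with ¬d ≤ r, amp κ (bdryOn F u L d) X := by
    ext i j
    rw [Matrix.sum_apply]
    change (bdryFar F u L r) _ _ _ = _
    rw [bdryFar, LinearMap.sum_apply, Matrix.sum_apply]
    rfl
  have hsub : ∀ d ∈ (Finset.Icc 1 (L + 1)).filter (fun d => ¬d ≤ r),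
      d ∈ Finset.Icc (r + 1) (L + 1) := fun d hd => by
    rw [Finset.mem_filter, Finset.mem_Icc] at hd
    rw [Finset.mem_Icc]; omega
  rw [h1]
  calc _ ≤ ∑ d ∈ Finset.Icc 1 (L + 1) with ¬d ≤ r, traceNorm (amp κ (bdryOn F u L d) X) :=
        traceNorm_sum_le _ _
    _ ≤ ∑ d ∈ Finset.Icc 1 (L + 1) with ¬d ≤ r,
          (diamondNorm (F.bdry u L d)).toReal * traceNorm X :=
        Finset.sum_le_sum fun d hd => traceNorm_amp_extend_le _ _
          ((hF u L).1 d (Finset.mem_filter.1 hd).1) X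
    _ ≤ ∑ d ∈ Finset.Icc (r + 1) (L + 1), (diamondNorm (F.bdry u L d)).toReal * traceNorm X :=
        Finset.sum_le_sum_of_subset_of_nonneg hsub fun _ _ _ =>
          mul_nonneg ENNReal.toReal_nonneg (traceNorm_nonneg X)
    _ ≤ _ := by
        rw [← Finset.sum_mul]
        refine mul_le_mul_of_nonneg_right (((hF u L).2 (r + 1) (by omega)).trans ?_)
          (traceNorm_nonneg X)
        refine mul_le_mul_of_nonneg_left (Real.exp_le_exp.2 ?_) (by positivity)
        push_cast
        linarith

/-- The full boundary term of a ball. -/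
noncomputable def bdryTot (F : UniformFamily q) (u : Site D) (L : ℕ) : SuperOp (Conf q (ball u L)) :=
  ∑ d ∈ Finset.Icc 1 (L + 1), bdryOn F u L d

theorem closedGen_eq (F : UniformFamily q) (u : Site D) (L : ℕ) :
    F.closedGen u L = regionGen F (ball u L) (ball u L) + bdryTot F u L := by
  rw [UniformFamily.closedGen, openGen_eq]
  rfl

theorem hasLForm_bdryTot (F : UniformFamily q) (u : Site D) (L : ℕ) : HasLForm (bdryTot F u L) :=
  (F.bdry_lindblad u L).hasLForm

/-- Localising does not change the boundary terms that are supported on `Y` already. -/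
theorem extend_localise_bdryNear {F : UniformFamily q} {u : Site D} {L r : ℕ}
    (hY : Y ⊆ ball u L) (hr : layer r (ball u L) ⊆ Y) (e : Conf q (ball u L \ Y)) :
    extend hY (localise e (bdryNear F u L r)) = bdryNear F u L r := by
  rw [bdryNear, localise_sum, extend_sum]
  refine Finset.sum_congr rfl fun d hd => ?_
  have hd' : layer d (ball u L) ⊆ Y := (layer_mono (Finset.mem_filter.1 hd).2 _).trans hr
  have h1 : bdryOn F u L d = extend hY (extend hd' (F.bdry u L d)) :=
    (extend_extend hd' hY (F.bdry u L d)).symm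
  rw [h1, localise_extend]

/-- The boundary term can be replaced by a Lindbladian that does not act on a region away from the
boundary, at the cost of the tail of the boundary term. -/
theorem traceNorm_extend_localise_bdryTot_sub_le {F : UniformFamily q}
    {μ p : ℝ} {a : ℕ} (hμ : 0 ≤ μ) (hp : 0 ≤ p) (hF : BdryDecay F μ p a) {u : Site D} {L r : ℕ}
    (hY : Y ⊆ ball u L) (hr : layer r (ball u L) ⊆ Y) (e : Conf q (ball u L \ Y))
    (X : Op q (ball u L)) :
    traceNorm (extend hY (localise e (bdryTot F u L)) X - bdryTot F u L X)
      ≤ 2 * (p * ((L : ℝ) + 1) ^ a * Real.exp (-μ * r)) * traceNorm X := by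
  have h1 : bdryTot F u L = bdryNear F u L r + bdryFar F u L r := (bdryNear_add_bdryFar F u L r).symm
  rw [h1, localise_add, extend_add, extend_localise_bdryNear hY hr, LinearMap.add_apply,
    LinearMap.add_apply, add_sub_add_left_eq_sub, sub_eq_add_neg]
  have h2 := traceNorm_extend_localise_le hY e (T := bdryFar F u L r)
    (fun W => traceNorm_amp_bdryFar_le hμ hp hF u L r W) (by positivity) X
  have h3 := traceNorm_bdryFar_le u L r hμ hp hF X
  refine (traceNorm_add_le _ _).trans ?_
  rw [traceNorm_neg]
  linarith

/-- The summands of a generator close to that of the closed boundary evolution: the bulk terms, and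
the boundary term localised on `Y` (the summand `none`). -/
noncomputable def cutTerm (F : UniformFamily q) {u : Site D} {L : ℕ} (hY : Y ⊆ ball u L)
    (e : Conf q (ball u L \ Y)) : Option {Z // Z ∈ (ball u L).powerset} → SuperOp (Conf q (ball u L))
  | none => extend hY (localise e (bdryTot F u L))
  | some Z => extend (Finset.mem_powerset.1 Z.2) (F.bulk Z.1)

theorem sum_cutTerm (F : UniformFamily q) {u : Site D} {L : ℕ} (hY : Y ⊆ ball u L)
    (e : Conf q (ball u L \ Y)) : ∑ i, cutTerm F hY e i
      = regionGen F (ball u L) (ball u L) + extend hY (localise e (bdryTot F u L)) := by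
  rw [Fintype.sum_option, add_comm, ← openGen_eq]
  rfl

theorem traceNorm_evolution_cutTerm_sub_le {F : UniformFamily q}
    {μ p : ℝ} {a : ℕ} (hμ : 0 ≤ μ) (hp : 0 ≤ p) (hF : BdryDecay F μ p a) {u : Site D} {L r : ℕ}
    (hY : Y ⊆ ball u L) (hr : layer r (ball u L) ⊆ Y) (e : Conf q (ball u L \ Y)) {t : ℝ}
    (ht : 0 ≤ t) (X : Op q (ball u L)) :
    traceNorm (evolution (∑ i, cutTerm F hY e i) t X - evolution (F.closedGen u L) t X)
      ≤ t * (2 * (p * ((L : ℝ) + 1) ^ a * Real.exp (-μ * r)) * traceNorm X) := by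
  have h1 : HasLForm (∑ i, cutTerm F hY e i) := by
    rw [sum_cutTerm]
    exact (hasLForm_regionGen F _ _).add ((hasLForm_localise hY e (hasLForm_bdryTot F u L)).extend hY)
  refine (hasLForm_closedGen F u L).traceNorm_evolution_sub_le h1 (by positivity) (fun X => ?_) ht X
  rw [sum_cutTerm, closedGen_eq, LinearMap.add_apply, LinearMap.add_apply, add_sub_add_left_eq_sub]
  exact traceNorm_extend_localise_bdryTot_sub_le hμ hp hF hY hr e X

end Cut

/-! ### Growth of the entropy along the evolution -/

section Growth

variable {D : ℕ} {q : Site D → ℕ} {A Y Λ : Finset (Site D)}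

/-- Basis states are product states. -/
theorem ent_reduced_pureOp_single_le (hA : A ⊆ Λ) (c : Conf q Λ) :
    ent (reduced A (pureOp (Pi.single c (1 : ℂ) : Conf q Λ → ℂ))) ≤ 0 := by
  have h1 : reduced A (pureOp (Pi.single c (1 : ℂ) : Conf q Λ → ℂ))
      = reduced A (pureOp (Pi.single (restr hA c) (1 : ℂ) : Conf q A → ℂ)) := by
    have h2 : ∀ {Λ : Finset (Site D)} (hA : A ⊆ Λ) (c : Conf q Λ) (O : Op q A),
        (O * reduced A (pureOp (Pi.single c (1 : ℂ) : Conf q Λ → ℂ))).trace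
          = O (restr hA c) (restr hA c) := fun hA c O => by
      rw [trace_mul_comm, trace_reduced_pureOp_mul hA, star_single, single_one_dotProduct,
        mulVec_single_one]
      simp [emb]
    exact ext_of_trace_mul fun O => (h2 hA c O).trans (h2 le_rfl (restr hA c) O).symm
  rw [h1, ent_reduced_compl le_rfl]
  have : Nonempty (Conf q (A \ A)) := ⟨restr (Finset.sdiff_subset.trans hA) c⟩
  refine (ent_le_log_card (posSemidef_reduced (pureOp_posSemidef _))).trans (le_of_eq ?_)
  have h2 : Fintype.card (Conf q (A \ A)) = 1 := by
    rw [Fintype.card_eq_one_iff]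
    exact ⟨Classical.arbitrary _, fun y => funext fun x => absurd x.2 (by simp)⟩
  rw [h2]; simp

/-- If the evolution drives a basis state close to `φ`, the entropy of `φ` is bounded by the time
times the sum of the entanglement rates. -/
theorem ent_le_of_evolution_near {α : Type} [Fintype α] (M : α → SuperOp (Conf q Λ)) {R : α → ℝ}
    (hR0 : ∀ i, 0 ≤ R i) (hR : ∀ i, EntRate A (M i) (R i)) (hA : A ⊆ Λ) (c : Conf q Λ)
    {φ : Conf q Λ → ℂ} (hφ : vnorm φ = 1) {t : ℝ} (ht : 0 ≤ t) {ε : ℝ}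
    (hM : HasLForm (∑ i, M i))
    (hε : traceNorm (evolution (∑ i, M i) t (pureOp (Pi.single c (1 : ℂ) : Conf q Λ → ℂ))
      - pureOp φ) ≤ ε) :
    ent (reduced A (pureOp φ)) ≤ 2 * Real.log 2
      + 2 * Real.log (2 * Fintype.card (Conf q A)) * ε + 2 * (t * ∑ i, R i) := by
  have : Nonempty (Conf q A) := ⟨restr hA c⟩
  have hcard : (1 : ℝ) ≤ Fintype.card (Conf q A) := by exact_mod_cast Fintype.card_pos
  set S := ent (reduced A (pureOp φ)) with hS
  set l := Real.log (2 * Fintype.card (Conf q A)) with hl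
  have hl0 : 0 ≤ l := Real.log_nonneg (by linarith)
  set f : Op q Λ →ₗ[ℂ] ℂ := ((S / 2 - Real.log 2 - l : ℝ) : ℂ) • obs 1 + (l : ℂ) • obs (pureOp φ)
    with hf
  have hφφ : ∀ x : Conf q Λ → ℂ, obs (pureOp φ) (pureOp x) = ((‖star x ⬝ᵥ φ‖ ^ 2 : ℝ) : ℂ) := by
    intro x
    rw [obs_apply, pureOp, pureOp, vecMulVec_mul_vecMulVec, trace_vecMulVec, dotProduct_smul,
      dotProduct_comm φ, smul_eq_mul, ← Complex.normSq_eq_norm_sq, ← Complex.mul_conj, mul_comm]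
    congr 1
    change _ = star (star x ⬝ᵥ φ)
    simp [dotProduct, mul_comm]
  have hfx : ∀ X, (f X).re = (S / 2 - Real.log 2 - l) * X.trace.re + l * (obs (pureOp φ) X).re := by
    intro X
    rw [hf, LinearMap.add_apply, LinearMap.smul_apply, LinearMap.smul_apply, smul_eq_mul,
      smul_eq_mul, Complex.add_re, Complex.re_ofReal_mul, Complex.re_ofReal_mul, obs_apply 1,
      Matrix.one_mul]
  -- `f` is dominated by the entropy, and at `φ` it is half the entropy up to a constant
  have h1 := re_evolution_pureOp_le M hR0 hR f (fun x => by
    rw [hfx, trace_pureOp, hφφ, Complex.ofReal_re, Complex.ofReal_re]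
    have := ent_mul_vnorm_sq_le hA hφ x
    linarith) (Pi.single c (1 : ℂ)) ht
  rw [vnorm_single, hfx, hM.trace_evolution ht, trace_pureOp, vnorm_single] at h1
  set ρ := evolution (∑ i, M i) t (pureOp (Pi.single c (1 : ℂ) : Conf q Λ → ℂ)) with hρ
  have h2 : 1 - (obs (pureOp φ) ρ).re ≤ ε := by
    have h3 : obs (pureOp φ) (pureOp φ) = 1 := by
      rw [hφφ, star_dotProduct_self, hφ]; simp
    have h4 : ‖obs (pureOp φ) (ρ - pureOp φ)‖ ≤ ε := by
      rw [obs_apply]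
      refine (norm_trace_mul_le _ _).trans ((mul_le_of_le_one_left (traceNorm_nonneg _) ?_).trans hε)
      refine (norm_rankOne_le φ φ).trans ?_
      rw [hφ, one_mul]
    rw [map_sub, h3] at h4
    have h5 := (Complex.abs_re_le_norm _).trans h4
    rw [Complex.sub_re, Complex.one_re, abs_le] at h5
    linarith [h5.1]
  have h6 := ent_reduced_pureOp_single_le hA c
  have h7 := mul_le_mul_of_nonneg_left h2 hl0
  simp only [one_pow, Complex.ofReal_one, Complex.one_re, mul_one] at h1
  linarith

end Growth

end

section

open scoped Matrix.Norms.L2Operator ComplexOrder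
set_option linter.unusedSectionVars false
open Matrix

/-! ### Boundaries of lattice regions -/

section Boundary

variable {D : ℕ}

theorem mem_layer_one_of_not_mem {A : Finset (Site D)} {x y : Site D} (hx : x ∈ A) (hy : y ∉ A)
    (h : gdist x y ≤ 1) : x ∈ layer 1 A :=
  (mem_layer_iff 1 A x).2 ⟨hx, y, hy, h⟩

theorem gdist_update (x y : Site D) (i : Fin D) (k : ℤ) :
    gdist (Function.update x i k) y + (x i - y i).natAbs = gdist x y + (k - y i).natAbs := by
  simp only [gdist]
  rw [← Finset.add_sum_erase _ _ (Finset.mem_univ i), ← Finset.add_sum_erase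
    (a := i) Finset.univ (fun i => (x i - y i).natAbs) (Finset.mem_univ i)]
  have : ∑ j ∈ Finset.univ.erase i, (Function.update x i k j - y j).natAbs
      = ∑ j ∈ Finset.univ.erase i, (x j - y j).natAbs :=
    Finset.sum_congr rfl fun j hj => by rw [Function.update_of_ne (Finset.ne_of_mem_erase hj)]
  rw [this, Function.update_self]
  ring

theorem gdist_update_self (x : Site D) (i : Fin D) (k : ℤ) :
    gdist x (Function.update x i k) = (x i - k).natAbs := by
  have h := gdist_update x x i k
  rw [gdist_comm, gdist_self, sub_self] at h
  omega

theorem gdist_eq_zero {x y : Site D} (h : gdist x y = 0) : x = y := by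
  funext i
  have := Finset.sum_eq_zero_iff.1 h i (Finset.mem_univ i)
  omega

theorem exists_gdist_step {x y : Site D} (h : x ≠ y) :
    ∃ x' : Site D, gdist x x' = 1 ∧ gdist x' y + 1 = gdist x y := by
  obtain ⟨i, hi⟩ := Function.ne_iff.1 h
  rcases lt_or_gt_of_ne hi with hlt | hlt
  · refine ⟨Function.update x i (x i + 1), ?_, ?_⟩
    · rw [gdist_update_self]; omega
    · have := gdist_update x y i (x i + 1); omega
  · refine ⟨Function.update x i (x i - 1), ?_, ?_⟩
    · rw [gdist_update_self]; omega
    · have := gdist_update x y i (x i - 1); omega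

/-- A path that leaves `A` meets the boundary of `A`. -/
theorem exists_mem_layer_one (A : Finset (Site D)) {x y : Site D} (hx : x ∈ A) (hy : y ∉ A) :
    ∃ w ∈ layer 1 A, gdist x w ≤ gdist x y := by
  induction hn : gdist x y generalizing x with
  | zero => exact absurd (gdist_eq_zero hn ▸ hx) hy
  | succ k ih =>
    have hxy : x ≠ y := fun h => hy (h ▸ hx)
    obtain ⟨x', h1, h2⟩ := exists_gdist_step hxy
    by_cases hx' : x' ∈ A
    · obtain ⟨w, hw, hw'⟩ := ih hx' (by omega)
      refine ⟨w, hw, (gdist_triangle x x' w).trans ?_⟩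
      omega
    · exact ⟨x, mem_layer_one_of_not_mem hx hx' h1.le, by rw [gdist_self]; omega⟩

theorem exists_not_mem (i : Fin D) (A : Finset (Site D)) (x : Site D) :
    ∃ k : ℕ, Function.update x i (x i + k) ∉ A := by
  by_contra! h
  have hinj : Function.Injective fun k : ℕ => Function.update x i (x i + (k : ℤ)) := fun k l hkl => by
    have := congrFun hkl i
    simp only [Function.update_self] at this
    omega
  exact Set.infinite_of_injective_forall_mem (s := (A : Set (Site D))) hinj h A.finite_toSet

theorem layer_one_nonempty (i : Fin D) {A : Finset (Site D)} (hA : A.Nonempty) :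
    (layer 1 A).Nonempty := by
  obtain ⟨x, hx⟩ := hA
  obtain ⟨k, hk⟩ := exists_not_mem i A x
  obtain ⟨w, hw, -⟩ := exists_mem_layer_one A hx hk
  exact ⟨w, hw⟩

/-- The sites of a region at a given distance from `u` are at most twice as many as its boundary
sites: a line in a fixed direction meets the sphere in at most two points, and leaves the region
through the boundary. -/
theorem card_sphere_le (i : Fin D) (A : Finset (Site D)) (u : Site D) (R : ℕ) :
    (A.filter fun x => gdist u x = R).card ≤ 2 * (layer 1 A).card := by
  classical
  set top : Site D → Site D := fun x =>
    Function.update x i (x i + ((Nat.find (exists_not_mem i A x) - 1 : ℕ) : ℤ)) with htop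
  have htopx : ∀ x, top x = Function.update x i
    (x i + ((Nat.find (exists_not_mem i A x) - 1 : ℕ) : ℤ)) := fun x => rfl
  refine Finset.card_le_mul_card_image_of_maps_to (f := top) (n := 2) ?_ ?_
  · intro x hx
    have hxA := (Finset.mem_filter.1 hx).1
    have h1 := Nat.find_spec (exists_not_mem i A x)
    have h0 : Nat.find (exists_not_mem i A x) ≠ 0 := by
      intro h0
      rw [h0, Nat.cast_zero, add_zero, Function.update_eq_self] at h1
      exact h1 hxA
    have h2 : top x ∈ A := not_not.1
      (Nat.find_min (exists_not_mem i A x) (m := Nat.find (exists_not_mem i A x) - 1) (by omega))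
    refine mem_layer_one_of_not_mem h2 h1 ?_
    have h3 : Function.update x i (x i + (Nat.find (exists_not_mem i A x) : ℤ))
        = Function.update (top x) i (x i + (Nat.find (exists_not_mem i A x) : ℤ)) := by
      rw [htopx, Function.update_idem]
    rw [h3, gdist_update_self, htopx, Function.update_self]
    omega
  · intro w _
    set s : ℤ := (R : ℤ) - ∑ j ∈ Finset.univ.erase i, ((u j - w j).natAbs : ℤ) with hs
    have hsub : (A.filter fun x => gdist u x = R).filter (fun x => top x = w)
        ⊆ {Function.update w i (u i + s), Function.update w i (u i - s)} := by
      intro x hx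
      rw [Finset.mem_filter, Finset.mem_filter] at hx
      have hj : ∀ j, j ≠ i → x j = w j := fun j hji => by
        rw [← hx.2, htopx, Function.update_of_ne hji]
      have hx' : x = Function.update w i (x i) := by
        funext j
        by_cases hji : j = i
        · subst hji; rw [Function.update_self]
        · rw [Function.update_of_ne hji, hj j hji]
      have hR : ((u i - x i).natAbs : ℤ) = s := by
        have h1 := hx.1.2
        rw [gdist, ← Finset.add_sum_erase _ _ (Finset.mem_univ i)] at h1
        have h2 : ∑ j ∈ Finset.univ.erase i, (u j - x j).natAbs
            = ∑ j ∈ Finset.univ.erase i, (u j - w j).natAbs :=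
          Finset.sum_congr rfl fun j hji => by rw [hj j (Finset.ne_of_mem_erase hji)]
        rw [h2] at h1
        rw [hs, ← h1]
        push_cast
        ring
      rw [Finset.mem_insert, Finset.mem_singleton, hx']
      rcases abs_choice (u i - x i) with h | h <;> rw [← Int.natCast_natAbs, hR] at h
      · right; congr 1; omega
      · left; congr 1; omega
    exact (Finset.card_le_card hsub).trans Finset.card_le_two

/-- The outermost `r` spheres of the ball contain at most `2 r |∂A|` sites of `A`. -/
theorem card_shell_le (i : Fin D) {A : Finset (Site D)} {u : Site D} {L : ℕ} (hA : A ⊆ ball u L)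
    (r : ℕ) : (A.filter fun x => ¬gdist u x + r ≤ L).card ≤ r * (2 * (layer 1 A).card) := by
  classical
  have hsub : (A.filter fun x => ¬gdist u x + r ≤ L)
      ⊆ (Finset.Icc (L + 1 - r) L).biUnion fun R => A.filter fun x => gdist u x = R := by
    intro x hx
    rw [Finset.mem_filter] at hx
    have := (mem_ball_iff u L x).1 (hA hx.1)
    refine Finset.mem_biUnion.2 ⟨gdist u x, Finset.mem_Icc.2 ⟨by omega, this⟩,
      Finset.mem_filter.2 ⟨hx.1, rfl⟩⟩
  refine (Finset.card_le_card hsub).trans ((Finset.card_biUnion_le_card_mul _ _ _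
    fun R _ => card_sphere_le i A u R).trans (Nat.mul_le_mul_right _ ?_))
  rw [Nat.card_Icc]; omega

theorem sum_exp_pow_le {μ : ℝ} (hμ : 0 < μ) (n : ℕ) :
    ∑ k ∈ Finset.range n, Real.exp (-μ * k) ≤ (1 - Real.exp (-μ))⁻¹ := by
  have h1 : ∀ k : ℕ, Real.exp (-μ * k) = Real.exp (-μ) ^ k := fun k => by
    rw [← Real.exp_nat_mul, mul_comm]
  have h2 : Real.exp (-μ) < 1 := Real.exp_lt_one_iff.2 (by linarith)
  simp only [h1]
  rw [← tsum_geometric_of_lt_one (Real.exp_pos _).le h2]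
  exact (summable_geometric_of_lt_one (Real.exp_pos _).le h2).sum_le_tsum _
    fun _ _ => by positivity

/-- The sites of `A` off the outermost `r` spheres of a ball, weighted by the decay of the interactions
with these spheres. -/
theorem sum_exp_radius_le (i : Fin D) (A : Finset (Site D)) (u : Site D) (L r : ℕ) {μ : ℝ}
    (hμ : 0 < μ) :
    ∑ x ∈ A with gdist u x + r ≤ L, Real.exp (-μ * ((L : ℝ) - r - gdist u x))
      ≤ (1 - Real.exp (-μ))⁻¹ * (2 * (layer 1 A).card) := by
  classical
  set S := A.filter fun x => gdist u x + r ≤ L with hS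
  calc ∑ x ∈ S, Real.exp (-μ * ((L : ℝ) - r - gdist u x))
      = ∑ k ∈ Finset.range (L + 1), ∑ x ∈ S with L - r - gdist u x = k,
          Real.exp (-μ * ((L : ℝ) - r - gdist u x)) :=
        (Finset.sum_fiberwise_of_maps_to (fun x _ => Finset.mem_range.2 (by omega)) _).symm
    _ ≤ ∑ k ∈ Finset.range (L + 1), Real.exp (-μ * k) * (2 * (layer 1 A).card) := by
        refine Finset.sum_le_sum fun k _ => ?_
        have h1 : ∀ x ∈ S.filter (fun x => L - r - gdist u x = k),
            Real.exp (-μ * ((L : ℝ) - r - gdist u x)) = Real.exp (-μ * k) := by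
          intro x hx
          rw [hS, Finset.mem_filter, Finset.mem_filter] at hx
          have h2 : L = k + r + gdist u x := by omega
          have h3 : (L : ℝ) = k + r + gdist u x := by exact_mod_cast h2
          rw [h3]; congr 1; ring
        rw [Finset.sum_congr rfl h1, Finset.sum_const, nsmul_eq_mul, mul_comm]
        refine mul_le_mul_of_nonneg_left ?_ (Real.exp_pos _).le
        have h4 : (S.filter fun x => L - r - gdist u x = k).card ≤ 2 * (layer 1 A).card := by
          refine (Finset.card_le_card ?_).trans (card_sphere_le i A u (L - r - k))
          intro x hx
          rw [hS, Finset.mem_filter, Finset.mem_filter] at hx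
          exact Finset.mem_filter.2 ⟨hx.1.1, by omega⟩
        exact_mod_cast h4
    _ ≤ _ := by
        rw [← Finset.sum_mul]
        exact mul_le_mul_of_nonneg_right (sum_exp_pow_le hμ _) (by positivity)

theorem sum_exp_layer_le {μ C : ℝ} (hC : ∀ (x : Site D) (S : Finset (Site D)),
      ∑ z ∈ S, Real.exp (-μ * (gdist x z : ℝ)) ≤ C) (A S : Finset (Site D)) :
    ∑ x ∈ S, ∑ w ∈ layer 1 A, Real.exp (-μ * (gdist x w : ℝ)) ≤ (layer 1 A).card * C := by
  rw [Finset.sum_comm, ← nsmul_eq_mul]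
  refine Finset.sum_le_card_nsmul _ _ _ fun w _ => ?_
  have := hC w S
  simpa only [gdist_comm w] using this

end Boundary

/-! ### Entanglement rates across a cut -/

section Crossing

variable {D : ℕ} {q : Site D → ℕ}

/-- The interactions that cross the boundary of the part of `A` off the outermost `r` spheres of the
ball have a total strength of the order of the boundary of `A`. -/
theorem sum_bulkNorm_crossing_le (i : Fin D) {F : UniformFamily q} {μ v C : ℝ} (hμ : 0 < μ)
    (hv : 0 ≤ v) (hF : BulkDecay F μ v) (hC : ∀ (x : Site D) (S : Finset (Site D)),
      ∑ z ∈ S, Real.exp (-μ * (gdist x z : ℝ)) ≤ C) (A : Finset (Site D)) (u : Site D) (L r : ℕ)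
    (S : Finset (Finset (Site D)))
    (hS : ∀ Y ∈ S, Y ⊆ ball u L ∧ ¬Disjoint (A.filter fun x => gdist u x + r ≤ L) Y ∧
      ¬Y ⊆ A.filter fun x => gdist u x + r ≤ L) :
    ∑ Y ∈ S, bulkNorm F Y * Y.card
      ≤ v * ((C + 2 * (1 - Real.exp (-μ))⁻¹) * (layer 1 A).card) := by
  classical
  set A' := A.filter fun x => gdist u x + r ≤ L with hA'
  set g : Site D → ℝ := fun x => (∑ w ∈ layer 1 A, Real.exp (-μ * (gdist x w : ℝ)))
    + Real.exp (-μ * ((L : ℝ) - r - gdist u x)) with hg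
  have hg0 : ∀ x, 0 ≤ g x := fun x => by positivity
  -- a crossing set containing `x` reaches either the complement of `A`, hence `∂A`, or the collar
  have key : ∀ Y ∈ S, ∀ x ∈ Y, x ∈ A' → Real.exp (-μ * gdiam Y) ≤ g x := by
    intro Y hY x hxY hxA
    obtain ⟨-, -, hY3⟩ := hS Y hY
    obtain ⟨y, hyY, hyA⟩ := Finset.not_subset.1 hY3
    have hd := gdist_le_gdiam hxY hyY
    by_cases hy : y ∈ A
    · have hyu : ¬gdist u y + r ≤ L := fun h => hyA (Finset.mem_filter.2 ⟨hy, h⟩)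
      have h1 := gdist_triangle u x y
      have h2 : L ≤ r + gdist u x + gdiam Y := by omega
      have h3 : (L : ℝ) ≤ r + gdist u x + gdiam Y := by exact_mod_cast h2
      refine le_add_of_nonneg_of_le (by positivity) (Real.exp_le_exp.2 ?_)
      have := mul_le_mul_of_nonneg_left h3 hμ.le
      linarith
    · obtain ⟨w, hw, hxw⟩ := exists_mem_layer_one A (Finset.mem_filter.1 hxA).1 hy
      have h3 : (gdist x w : ℝ) ≤ gdiam Y := by exact_mod_cast hxw.trans hd
      refine le_add_of_le_of_nonneg (le_trans (Real.exp_le_exp.2 ?_) (Finset.single_le_sum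
        (f := fun w => Real.exp (-μ * (gdist x w : ℝ))) (fun _ _ => (Real.exp_pos _).le) hw))
        (Real.exp_pos _).le
      have := mul_le_mul_of_nonneg_left h3 hμ.le
      linarith
  calc ∑ Y ∈ S, bulkNorm F Y * Y.card
      ≤ ∑ Y ∈ S, ∑ x ∈ A', if x ∈ Y then
          bulkNorm F Y * (Y.card * Real.exp (μ * gdiam Y)) * g x else 0 := by
        refine Finset.sum_le_sum fun Y hY => ?_
        obtain ⟨x, hxA, hxY⟩ := Finset.not_disjoint_iff.1 (hS Y hY).2.1
        have hb := bulkNorm_nonneg F Y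
        have h0 : ∀ x, 0 ≤ bulkNorm F Y * (Y.card * Real.exp (μ * gdiam Y)) * g x := fun x =>
          mul_nonneg (by positivity) (hg0 x)
        refine le_trans ?_ (Finset.single_le_sum (f := fun x => if x ∈ Y then
          bulkNorm F Y * (Y.card * Real.exp (μ * gdiam Y)) * g x else 0) (fun x _ => ?_) hxA)
        · rw [if_pos hxY]
          have h1 := mul_le_mul_of_nonneg_left (key Y hY x hxY hxA)
            (by positivity : 0 ≤ bulkNorm F Y * (Y.card * Real.exp (μ * gdiam Y)))
          refine le_trans (le_of_eq ?_) h1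
          rw [mul_assoc, mul_assoc, ← Real.exp_add]
          simp
        · split_ifs
          · exact h0 x
          · exact le_rfl
    _ = ∑ x ∈ A', (∑ Y ∈ S with x ∈ Y,
          bulkNorm F Y * (Y.card * Real.exp (μ * gdiam Y))) * g x := by
        rw [Finset.sum_comm]
        refine Finset.sum_congr rfl fun x _ => ?_
        rw [← Finset.sum_filter, Finset.sum_mul]
    _ ≤ ∑ x ∈ A', v * g x := Finset.sum_le_sum fun x _ => mul_le_mul_of_nonneg_right
        (hF.2 x _ fun Y hY => (Finset.mem_filter.1 hY).2) (hg0 x)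
    _ ≤ _ := by
        rw [← Finset.mul_sum, hg, Finset.sum_add_distrib]
        refine mul_le_mul_of_nonneg_left ?_ hv
        have h1 := sum_exp_layer_le hC A A'
        have h2 := sum_exp_radius_le i A u L r hμ
        linarith

/-- Only the bulk terms that cross the cut create entanglement, with a total rate of the order of the
boundary of `A`. -/
theorem exists_entRate_cutTerm (i : Fin D) {F : UniformFamily q} {m : ℕ} (hq : ∀ x, q x ≤ m)
    (hm : 1 ≤ m) {μ v C : ℝ} (hμ : 0 < μ)
    (hv : 0 ≤ v) (hF : BulkDecay F μ v) (hC : ∀ (x : Site D) (S : Finset (Site D)),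
      ∑ z ∈ S, Real.exp (-μ * (gdist x z : ℝ)) ≤ C) {A : Finset (Site D)} {u : Site D} {L : ℕ}
    (r : ℕ) (hA : A ⊆ ball u L) {A' : Finset (Site D)}
    (hA' : A' = A.filter fun x => gdist u x + r ≤ L)
    (e : Conf q (ball u L \ (ball u L \ A'))) :
    ∃ R : Option {Z // Z ∈ (ball u L).powerset} → ℝ, (∀ j, 0 ≤ R j) ∧
      (∀ j, EntRate A' (cutTerm F Finset.sdiff_subset e j) (R j)) ∧
      ∑ j, R j ≤ 3 * (5 + 4 * Real.log m) *
        (v * ((C + 2 * (1 - Real.exp (-μ))⁻¹) * (layer 1 A).card)) := by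
  classical
  have hA'Λ : A' ⊆ ball u L := by rw [hA']; exact (Finset.filter_subset _ _).trans hA
  have hlm : 0 ≤ Real.log m := Real.log_natCast_nonneg m
  set cr : Finset (Site D) → Prop := fun Y => ¬Disjoint A' Y ∧ ¬Y ⊆ A' with hcr
  set R : Option {Z // Z ∈ (ball u L).powerset} → ℝ := fun j => j.elim 0 fun Z =>
    if cr Z.1 then 3 * (5 + 4 * Real.log m) * (bulkNorm F Z.1 * Z.1.card) else 0 with hR
  refine ⟨R, ?_, ?_, ?_⟩
  · rintro (_ | Z)
    · exact le_rfl
    · simp only [hR, Option.elim]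
      split_ifs
      · have := bulkNorm_nonneg F Z.1
        positivity
      · exact le_rfl
  · rintro (_ | ⟨Z, hZ⟩)
    · exact entRate_extend_of_disjoint hA'Λ Finset.sdiff_subset Finset.disjoint_sdiff
        (hasLForm_localise Finset.sdiff_subset e (hasLForm_bdryTot F u L))
    · have hZΛ := Finset.mem_powerset.1 hZ
      simp only [hR, Option.elim, cutTerm]
      split_ifs with h
      · obtain ⟨k, G, J, hL, hG⟩ := (F.bulk_lindblad Z).exists_isLForm_norm_le (hF.1 Z)
        refine (entRate_extend hA'Λ hZΛ hL).mono ?_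
        have h1 : Real.log (Fintype.card (Conf q (A' \ (A' \ Z)))) ≤ Z.card * Real.log m := by
          refine (log_card_conf_le hq hm _).trans (mul_le_mul_of_nonneg_right ?_ hlm)
          exact_mod_cast Finset.card_le_card fun x hx => by
            simp only [Finset.mem_sdiff] at hx; tauto
        have hcard : (1 : ℝ) ≤ Z.card := by
          obtain ⟨x, -, hx⟩ := Finset.not_disjoint_iff.1 h.1
          exact_mod_cast Finset.card_pos.2 ⟨x, hx⟩
        have hG' : 2 * ‖G‖ ≤ 3 * bulkNorm F Z := by
          have : ‖G‖ ≤ 3 / 2 * bulkNorm F Z := hG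
          linarith
        have h2 : 5 + 4 * Real.log (Fintype.card (Conf q (A' \ (A' \ Z))))
            ≤ Z.card * (5 + 4 * Real.log m) := by nlinarith
        have hl0 : 0 ≤ Real.log (Fintype.card (Conf q (A' \ (A' \ Z)))) :=
          Real.log_natCast_nonneg _
        refine (mul_le_mul hG' h2 (by linarith) (by
          have := bulkNorm_nonneg F Z; linarith)).trans (le_of_eq ?_)
        ring
      · rw [hcr, not_and_or, not_not, not_not] at h
        rcases h with h | h
        · exact entRate_extend_of_disjoint hA'Λ hZΛ h (F.bulk_lindblad Z).hasLForm
        · exact entRate_extend_of_subset hA'Λ h (F.bulk_lindblad Z).hasLForm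
  · rw [Fintype.sum_option]
    simp only [hR, Option.elim, zero_add]
    rw [Finset.univ_eq_attach, Finset.sum_attach (ball u L).powerset (fun Z => if cr Z then
      3 * (5 + 4 * Real.log m) * (bulkNorm F Z * Z.card) else 0), ← Finset.sum_filter,
      ← Finset.mul_sum]
    refine mul_le_mul_of_nonneg_left ?_ (by positivity)
    refine sum_bulkNorm_crossing_le i hμ hv hF hC A u L r _ fun Y hY => ?_
    rw [Finset.mem_filter, Finset.mem_powerset, hcr, hA'] at hY
    exact hY

end Crossing

end

section

open scoped Matrix.Norms.L2Operator ComplexOrder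
set_option linter.unusedSectionVars false
open Matrix
open Filter Topology

/-! ### The entropy bound in balls of polynomial size -/

section Mixing

theorem isState_pureOp {n : Type} [Fintype n] {x : n → ℂ} (hx : vnorm x = 1) :
    IsState (pureOp x) :=
  ⟨pureOp_posSemidef x, by rw [trace_pureOp, hx]; simp⟩

theorem vnorm_eq_one_of_isState {n : Type} [Fintype n] {x : n → ℂ} (hx : IsState (pureOp x)) :
    vnorm x = 1 := by
  have h := hx.2
  rw [trace_pureOp] at h
  have h2 : vnorm x ^ 2 = 1 := by exact_mod_cast h
  nlinarith [vnorm_nonneg x]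

theorem traceNorm_pureOp_le {n : Type} [Fintype n] [DecidableEq n] {x : n → ℂ} (hx : vnorm x = 1) :
    traceNorm (pureOp x) ≤ 1 := by
  have := traceNorm_rankOne_le x x
  rw [hx, one_mul] at this
  exact this

/-- The evolution of a state that converges can only converge to a fixed state. -/
theorem eq_pureOp_of_tendsto {n : Type} [Fintype n] [DecidableEq n] {𝓛 : SuperOp n}
    (hL : HasLForm 𝓛) {φ : n → ℂ} (hφ : HasUniquePureFixedPoint 𝓛 φ) {ρ σ : Matrix n n ℂ}
    (hρ : IsState ρ) (h : Tendsto (fun t : ℝ => evolution 𝓛 t ρ) atTop (𝓝 σ)) : σ = pureOp φ := by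
  refine (hφ.2 σ ⟨?_, ?_⟩).1 fun s hs => ?_
  · exact isClosed_posSemidef.mem_of_tendsto h
      ((eventually_ge_atTop 0).mono fun t ht => (hL.isState_evolution ht hρ).1)
  · have h1 : Tendsto (fun t : ℝ => (evolution 𝓛 t ρ).trace) atTop (𝓝 σ.trace) :=
      ((continuous_id.matrix_trace).tendsto σ).comp h
    refine tendsto_nhds_unique h1 (tendsto_const_nhds.congr' ?_)
    filter_upwards [eventually_ge_atTop 0] with t ht
    exact (hL.isState_evolution ht hρ).2.symm
  · have h1 : Tendsto (fun t : ℝ => evolution 𝓛 s (evolution 𝓛 t ρ)) atTop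
        (𝓝 (evolution 𝓛 s σ)) :=
      (((evolution 𝓛 s).continuous_of_finiteDimensional).tendsto σ).comp h
    have h2 : Tendsto (fun t : ℝ => evolution 𝓛 (s + t) ρ) atTop (𝓝 σ) :=
      h.comp (tendsto_atTop_add_const_left _ s tendsto_id)
    refine tendsto_nhds_unique (h1.congr fun t => ?_) h2
    exact (evolution_add 𝓛 s t ρ).symm

theorem tendsto_of_traceNorm_le {n : Type} [Fintype n] [DecidableEq n] {f : ℝ → Matrix n n ℂ}
    {σ : Matrix n n ℂ} {b : ℝ → ℝ} (hb : Tendsto b atTop (𝓝 0))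
    (h : ∀ t, 0 ≤ t → traceNorm (f t - σ) ≤ b t) : Tendsto f atTop (𝓝 σ) := by
  refine tendsto_pi_nhds.2 fun i => tendsto_pi_nhds.2 fun j => ?_
  rw [tendsto_iff_norm_sub_tendsto_zero]
  refine squeeze_zero' (Eventually.of_forall fun _ => norm_nonneg _) ?_ hb
  filter_upwards [eventually_ge_atTop 0] with t ht
  exact (norm_apply_le_traceNorm (f t - σ) i j).trans (h t ht)

variable {D : ℕ} {q : Site D → ℕ}

/-- Since the fixed state is unique, rapid mixing drives every state to it. -/
theorem exists_mixing (F : UniformFamily q) (hmix : F.RapidMixing)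
    {φ : (u : Site D) → (L : ℕ) → Conf q (ball u L) → ℂ}
    (hφ : ∀ u L, HasUniquePureFixedPoint (F.closedGen u L) (φ u L)) :
    ∃ c γ δ : ℝ, 0 < c ∧ 0 < γ ∧ 0 < δ ∧ ∀ (u : Site D) (L : ℕ) (ρ : Op q (ball u L)),
      IsState ρ → ∀ t : ℝ, 0 ≤ t → traceNorm (evolution (F.closedGen u L) t ρ - pureOp (φ u L))
        ≤ c * ((ball u L).card : ℝ) ^ δ * Real.exp (-γ * t) := by
  obtain ⟨c, γ, δ, hc, hγ, hδ, h⟩ := hmix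
  refine ⟨c, γ, δ, hc, hγ, hδ, fun u L ρ hρ t ht => ?_⟩
  obtain ⟨P, -, hP⟩ := h u L
  have hb : Tendsto (fun t : ℝ => c * ((ball u L).card : ℝ) ^ δ * Real.exp (-t * γ)) atTop (𝓝 0) := by
    have h1 : Tendsto (fun t : ℝ => Real.exp (-t * γ)) atTop (𝓝 0) := by
      refine Real.tendsto_exp_atBot.comp ?_
      exact (tendsto_neg_atTop_atBot).atBot_mul_const hγ
    simpa using h1.const_mul (c * ((ball u L).card : ℝ) ^ δ)
  have h1 := eq_pureOp_of_tendsto (hasLForm_closedGen F u L) (hφ u L) hρ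
    (tendsto_of_traceNorm_le hb (hP ρ hρ))
  rw [← h1, show -γ * t = -t * γ by ring]
  exact hP ρ hρ t ht

/-- A continuity estimate for the entropy. -/
theorem ent_le_ent_add {n : Type} [Fintype n] [DecidableEq n] [Nonempty n] {ρ σ : Matrix n n ℂ}
    (hρ : IsState ρ) (hσ : IsState σ) :
    ent ρ ≤ ent σ + Real.log 2 + Real.log (2 * Fintype.card n) * traceNorm (ρ - σ) := by
  obtain ⟨U, k, hU, hk1, hk0, hk, hKσ, -⟩ := exists_regularized_log (τ := 1) hσ.1
    (by rw [hσ.2]; simp) one_pos (ε := 1 / 2) (by norm_num) (by norm_num)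
  have hl : Real.log (Fintype.card n / (1 / 2)) = Real.log (2 * Fintype.card n) := by
    congr 1; ring
  rw [hl] at hk
  have h1 : -(1 * Real.log (1 - 1 / 2 : ℝ)) = Real.log 2 := by
    rw [one_mul, ← Real.log_inv]; norm_num
  have h2 := ent_le_trace hρ.1 hU hk1.le
  have h3 : ‖ofDiag U k‖ ≤ Real.log (2 * Fintype.card n) := norm_ofDiag_le hU
    ((hk0 (Classical.arbitrary n)).trans (hk _)) fun i => by
    rw [abs_of_nonneg (hk0 i)]; exact hk i
  have h4 : ((ρ - σ) * ofDiag U k).trace.re ≤ Real.log (2 * Fintype.card n) * traceNorm (ρ - σ) := by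
    rw [trace_mul_comm]
    exact (Complex.re_le_norm _).trans ((norm_trace_mul_le _ _).trans
      (mul_le_mul_of_nonneg_right h3 (traceNorm_nonneg _)))
  rw [Matrix.sub_mul, trace_sub, Complex.sub_re] at h4
  linarith

end Mixing

section Ball

variable {D : ℕ} {q : Site D → ℕ}

theorem succ_le_card_ball (i : Fin D) (u : Site D) (L : ℕ) : L + 1 ≤ (ball u L).card := by
  have h : ((Finset.range (L + 1)).image fun k : ℕ => Function.update u i (u i + (k : ℤ)))
      ⊆ ball u L := by
    intro x hx
    obtain ⟨k, hk, rfl⟩ := Finset.mem_image.1 hx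
    rw [mem_ball_iff, gdist_update_self]
    have := Finset.mem_range.1 hk
    omega
  have h1 := Finset.card_le_card h
  rwa [Finset.card_image_of_injective _ fun k l hkl => by
    have := congrFun hkl i
    simp only [Function.update_self] at this
    omega, Finset.card_range] at h1

/-- The assumptions on a uniform family in quantitative form: the dimensions are at most `m`, the
interactions decay at rate `μ` with total strength `v`, the boundary terms on a ball of radius `L`
have the tail bound `p (L + 1) ^ a exp (-μ r)`, the lattice sums of the decay function are bounded
by `C`, and the evolution on a ball mixes to `φ` at rate `γ` with prefactor `c |Λ| ^ δ`. -/
structure QuantFamily (F : UniformFamily q) (φ : (u : Site D) → (L : ℕ) → Conf q (ball u L) → ℂ)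
    (m : ℕ) (μ v p C c γ δ : ℝ) (a : ℕ) : Prop where
  dim_le : ∀ x, q x ≤ m
  one_le_m : 1 ≤ m
  μ_pos : 0 < μ
  v_pos : 0 < v
  p_pos : 0 < p
  c_pos : 0 < c
  γ_pos : 0 < γ
  δ_pos : 0 < δ
  one_le_C : 1 ≤ C
  bulk : BulkDecay F μ v
  bdry : BdryDecay F μ p a
  sum_exp : ∀ (x : Site D) (S : Finset (Site D)) (r : ℝ), (∀ z ∈ S, r ≤ (gdist x z : ℝ)) →
    ∑ z ∈ S, Real.exp (-μ * (gdist x z : ℝ)) ≤ C * Real.exp (-μ / 2 * r)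
  norm_eq : ∀ u L, vnorm (φ u L) = 1
  fixed : ∀ (u : Site D) (L : ℕ) (t : ℝ), 0 ≤ t →
    evolution (F.closedGen u L) t (pureOp (φ u L)) = pureOp (φ u L)
  mixing : ∀ (u : Site D) (L : ℕ) (ρ : Op q (ball u L)), IsState ρ → ∀ t : ℝ, 0 ≤ t →
    traceNorm (evolution (F.closedGen u L) t ρ - pureOp (φ u L))
      ≤ c * ((ball u L).card : ℝ) ^ δ * Real.exp (-γ * t)

variable {F : UniformFamily q} {φ : (u : Site D) → (L : ℕ) → Conf q (ball u L) → ℂ} {m : ℕ}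
  {μ v p C c γ δ : ℝ} {a : ℕ}

theorem nonempty_conf_of_vnorm {Λ : Finset (Site D)} {x : Conf q Λ → ℂ} (hx : vnorm x = 1) :
    Nonempty (Conf q Λ) := by
  by_contra h
  rw [not_nonempty_iff] at h
  have := vnorm_sq x
  rw [hx, Fintype.sum_empty] at this
  norm_num at this

theorem log_two_mul_card_conf_le (hq : ∀ x, q x ≤ m) (hm : 1 ≤ m) {A : Finset (Site D)} {N : ℕ}
    (hN : 1 ≤ N) (hA : A.card ≤ N) (hne : Nonempty (Conf q A)) :
    Real.log (2 * Fintype.card (Conf q A)) ≤ N * (1 + Real.log m) := by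
  have h0 : (Fintype.card (Conf q A) : ℝ) ≠ 0 := by exact_mod_cast Fintype.card_ne_zero
  have h1 := log_card_conf_le hq hm A
  have h2 : (A.card : ℝ) ≤ N := by exact_mod_cast hA
  have h3 : (1 : ℝ) ≤ N := by exact_mod_cast hN
  have h4 := Real.log_two_lt_d9
  have h5 := mul_le_mul_of_nonneg_right h2 (Real.log_natCast_nonneg m)
  rw [Real.log_mul two_ne_zero h0]
  nlinarith

/-- The entropy of the part of `A` off the outermost `r` spheres of the ball, in terms of an evolution
time `t` at choice: an error from the cut boundary terms and from mixing, and the growth in time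
`t`. -/
theorem QuantFamily.ent_reduced_inner_le (h : QuantFamily F φ m μ v p C c γ δ a) (i : Fin D)
    {A : Finset (Site D)} {u : Site D} {L : ℕ} (hA : A ⊆ ball u L) (r : ℕ) {t : ℝ} (ht : 0 ≤ t)
    {N : ℕ} (hN : 1 ≤ N) (hAN : A.card ≤ N) :
    ent (reduced (A.filter fun x => gdist u x + r ≤ L) (pureOp (φ u L)))
      ≤ 2 * Real.log 2 + 2 * (N * (1 + Real.log m)) *
          (t * (2 * (p * ((L : ℝ) + 1) ^ a * Real.exp (-μ * r)))
            + c * ((ball u L).card : ℝ) ^ δ * Real.exp (-γ * t))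
        + 2 * (t * (3 * (5 + 4 * Real.log m) *
          (v * ((C + 2 * (1 - Real.exp (-μ))⁻¹) * (layer 1 A).card)))) := by
  generalize hA' : A.filter (fun x => gdist u x + r ≤ L) = A'
  have hA'A : A' ⊆ A := by rw [← hA']; exact Finset.filter_subset _ _
  have hA'Λ := hA'A.trans hA
  have hφ := h.norm_eq u L
  obtain ⟨b⟩ := nonempty_conf_of_vnorm hφ
  have hC : ∀ (x : Site D) (S : Finset (Site D)),
      ∑ z ∈ S, Real.exp (-μ * (gdist x z : ℝ)) ≤ C := fun x S => by
    simpa using h.sum_exp x S 0 fun _ _ => Nat.cast_nonneg _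
  set e : Conf q (ball u L \ (ball u L \ A')) := restr Finset.sdiff_subset b
  obtain ⟨R, hR0, hR, hRs⟩ := exists_entRate_cutTerm i h.dim_le h.one_le_m h.μ_pos h.v_pos.le h.bulk
    hC r hA hA'.symm e
  have hr : layer r (ball u L) ⊆ ball u L \ A' := by
    intro x hx
    obtain ⟨hx1, y, hy, hxy⟩ := (mem_layer_iff _ _ _).1 hx
    refine Finset.mem_sdiff.2 ⟨hx1, fun hxA => hy ?_⟩
    rw [← hA', Finset.mem_filter] at hxA
    rw [mem_ball_iff]
    exact (gdist_triangle u x y).trans (by omega)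
  set X : Op q (ball u L) := pureOp (Pi.single b (1 : ℂ)) with hX
  have hX1 : traceNorm X ≤ 1 := traceNorm_pureOp_le (vnorm_single b)
  have h1 := traceNorm_evolution_cutTerm_sub_le h.μ_pos.le h.p_pos.le h.bdry Finset.sdiff_subset
    hr e ht X
  have h2 := h.mixing u L X (isState_pureOp (vnorm_single b)) t ht
  have hp := h.p_pos
  have hε : traceNorm (evolution (∑ j, cutTerm F Finset.sdiff_subset e j) t X - pureOp (φ u L))
      ≤ t * (2 * (p * ((L : ℝ) + 1) ^ a * Real.exp (-μ * r)))
            + c * ((ball u L).card : ℝ) ^ δ * Real.exp (-γ * t) := by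
    rw [← sub_add_sub_cancel _ (evolution (F.closedGen u L) t X)]
    refine (traceNorm_add_le _ _).trans (add_le_add (h1.trans ?_) h2)
    refine mul_le_mul_of_nonneg_left (mul_le_of_le_one_right (by positivity) hX1) ht
  have hM : HasLForm (∑ j, cutTerm F Finset.sdiff_subset e j) := by
    rw [sum_cutTerm]
    exact (hasLForm_regionGen F _ _).add
      ((hasLForm_localise Finset.sdiff_subset e (hasLForm_bdryTot F u L)).extend _)
  have h3 := ent_le_of_evolution_near _ hR0 hR hA'Λ b hφ ht hM hε
  have h4 := log_two_mul_card_conf_le h.dim_le h.one_le_m hN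
    ((Finset.card_le_card hA'A).trans hAN) ⟨restr hA'Λ b⟩
  have hε0 := (traceNorm_nonneg _).trans hε
  refine h3.trans (add_le_add (add_le_add le_rfl ?_) ?_)
  · exact mul_le_mul_of_nonneg_right (mul_le_mul_of_nonneg_left h4 zero_le_two) hε0
  · exact mul_le_mul_of_nonneg_left (mul_le_mul_of_nonneg_left hRs ht) zero_le_two

/-- Cutting off the outermost `r` spheres changes the entropy by at most `2 r |∂A| log m`. -/
theorem QuantFamily.ent_reduced_le_add (h : QuantFamily F φ m μ v p C c γ δ a) (i : Fin D)
    {A : Finset (Site D)} {u : Site D} {L : ℕ} (hA : A ⊆ ball u L) (r : ℕ) :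
    ent (reduced A (pureOp (φ u L)))
      ≤ ent (reduced (A.filter fun x => gdist u x + r ≤ L) (pureOp (φ u L)))
        + r * (2 * (layer 1 A).card) * Real.log m := by
  generalize hA' : A.filter (fun x => gdist u x + r ≤ L) = A'
  have hA'A : A' ⊆ A := by rw [← hA']; exact Finset.filter_subset _ _
  obtain ⟨b⟩ := nonempty_conf_of_vnorm (h.norm_eq u L)
  have hst := isState_pureOp (h.norm_eq u L)
  have h1 := ent_union_le hA'A rfl (isState_reduced hA hst).1
  rw [reduced_reduced hA'A hA, reduced_reduced Finset.sdiff_subset hA] at h1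
  refine h1.trans (add_le_add le_rfl ?_)
  have : Nonempty (Conf q (A \ A')) := ⟨restr (Finset.sdiff_subset.trans hA) b⟩
  have hst2 := isState_reduced (Finset.sdiff_subset.trans hA : A \ A' ⊆ ball u L) hst
  refine (ent_le_log_card hst2.1).trans ?_
  rw [hst2.2, Complex.one_re, one_mul]
  refine (log_card_conf_le h.dim_le h.one_le_m _).trans
    (mul_le_mul_of_nonneg_right ?_ (Real.log_natCast_nonneg m))
  have h2 : A \ A' = A.filter fun x => ¬gdist u x + r ≤ L := by
    rw [← hA']
    ext x
    simp only [Finset.mem_sdiff, Finset.mem_filter]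
    tauto
  rw [h2]
  exact_mod_cast card_shell_le i hA r

/-- The area law in a ball of polynomial size. -/
theorem QuantFamily.exists_ent_le (h : QuantFamily F φ m μ v p C c γ δ a) (i : Fin D) (K : ℕ) :
    ∃ c' : ℝ, 0 < c' ∧ ∀ (u : Site D) (L : ℕ) (A : Finset (Site D)) (N : ℕ), A ⊆ ball u L →
      A.Nonempty → 2 ≤ N → A.card ≤ N → (ball u L).card ≤ N ^ K →
      ent (reduced A (pureOp (φ u L))) ≤ c' * (Real.log N * (layer 1 A).card) := by
  have hμ := h.μ_pos
  have hγ := h.γ_pos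
  have hδ := h.δ_pos
  have hp := h.p_pos
  have hc := h.c_pos
  have hv := h.v_pos
  have hlm : 0 ≤ Real.log m := Real.log_natCast_nonneg m
  -- the evolution time is `T log N`, such that the mixing error is of order `1 / N`
  set T : ℝ := (K * δ + 1) / γ with hT
  set B : ℝ := 3 * (5 + 4 * Real.log m) * (v * (C + 2 * (1 - Real.exp (-μ))⁻¹)) with hB
  have hE : 0 < (1 - Real.exp (-μ))⁻¹ :=
    inv_pos.2 (sub_pos.2 (Real.exp_lt_one_iff.2 (by linarith)))
  have hC := h.one_le_C
  have hB0 : 0 < B := by positivity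
  have hT0 : 0 < T := by positivity
  -- spheres are cut off to depth `κ log N`, such that the tail of the boundary terms is `1 / N²`
  set κ : ℝ := (K * a + 2) / μ with hκ
  have hκ0 : 0 < κ := by positivity
  refine ⟨2 * (2 + 2 * (1 + Real.log m) * (2 * p * T + c)) + 2 * T * B
    + 2 * Real.log m * (κ + 2), by positivity, fun u L A N hA hne hN hAN hΛ => ?_⟩
  set l := Real.log N with hl
  have hN2 : (2 : ℝ) ≤ N := by exact_mod_cast hN
  have hN0 : (0 : ℝ) < N := by linarith
  have hl2 : 1 / 2 ≤ l := by
    have h1 := Real.log_le_log two_pos hN2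
    have h2 := Real.log_two_gt_d9
    linarith
  have hlN : l ≤ N := (Real.log_le_sub_one_of_pos hN0).trans (by linarith)
  have hexp : Real.exp l = N := Real.exp_log hN0
  set s : ℝ := ((layer 1 A).card : ℝ) with hs
  have hs1 : 1 ≤ s := by
    rw [hs]; exact_mod_cast Finset.card_pos.2 (layer_one_nonempty i hne)
  set r : ℕ := ⌈κ * l⌉₊ with hr
  have hr1 : κ * l ≤ r := Nat.le_ceil _
  have hr2 : (r : ℝ) ≤ κ * l + 1 := (Nat.ceil_lt_add_one (by positivity)).le
  have hT1 : 0 ≤ T * l := by positivity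
  have h1 := h.ent_reduced_le_add i hA r
  have h2 := h.ent_reduced_inner_le i hA r hT1 (by omega) hAN
  have hΛ' : ((ball u L).card : ℝ) ≤ Real.exp (K * l) := by
    rw [Real.exp_nat_mul, hexp]; exact_mod_cast hΛ
  have hL : ((L : ℝ) + 1) ^ a * Real.exp (-μ * r) ≤ Real.exp (-(2 * l)) := by
    have h3 : (L : ℝ) + 1 ≤ Real.exp (K * l) :=
      le_trans (by exact_mod_cast succ_le_card_ball i u L) hΛ'
    have h4 : ((L : ℝ) + 1) ^ a ≤ Real.exp (a * (K * l)) := by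
      rw [Real.exp_nat_mul]; exact pow_le_pow_left₀ (by positivity) h3 a
    have h5 : Real.exp (-μ * r) ≤ Real.exp (-((K * a + 2) * l)) := by
      refine Real.exp_le_exp.2 ?_
      have h6 := mul_le_mul_of_nonneg_left hr1 hμ.le
      have h7 : μ * (κ * l) = (K * a + 2) * l := by rw [hκ]; field_simp
      linarith
    refine (mul_le_mul h4 h5 (Real.exp_pos _).le (Real.exp_pos _).le).trans (le_of_eq ?_)
    rw [← Real.exp_add]; congr 1; ring
  have hmx : ((ball u L).card : ℝ) ^ δ * Real.exp (-γ * (T * l)) ≤ Real.exp (-l) := by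
    have h3 : ((ball u L).card : ℝ) ^ δ ≤ Real.exp (K * l * δ) := by
      rw [Real.exp_mul]; exact Real.rpow_le_rpow (by positivity) hΛ' hδ.le
    have h4 : -γ * (T * l) = -((K * δ + 1) * l) := by rw [hT]; field_simp
    rw [h4]
    refine (mul_le_mul_of_nonneg_right h3 (Real.exp_pos _).le).trans (le_of_eq ?_)
    rw [← Real.exp_add]; congr 1; ring
  have hε : N * (T * l * (2 * (p * ((L : ℝ) + 1) ^ a * Real.exp (-μ * r)))
            + c * ((ball u L).card : ℝ) ^ δ * Real.exp (-γ * (T * l))) ≤ 2 * p * T + c := by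
    have e1 : Real.exp (-l) = (N : ℝ)⁻¹ := by rw [Real.exp_neg, hexp]
    have e2 : Real.exp (-(2 * l)) = (N : ℝ)⁻¹ * (N : ℝ)⁻¹ := by
      rw [← e1, ← Real.exp_add]; congr 1; ring
    rw [e2] at hL
    rw [e1] at hmx
    have h3 : N * (T * l * (2 * (p * ((L : ℝ) + 1) ^ a * Real.exp (-μ * r))))
        ≤ N * (T * N * (2 * (p * ((N : ℝ)⁻¹ * (N : ℝ)⁻¹)))) := by
      rw [mul_assoc p]; gcongr
    have h4 : N * (c * ((ball u L).card : ℝ) ^ δ * Real.exp (-γ * (T * l)))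
        ≤ N * (c * (N : ℝ)⁻¹) := by
      rw [mul_assoc c]; gcongr
    have e3 : N * (T * N * (2 * (p * ((N : ℝ)⁻¹ * (N : ℝ)⁻¹)))) = 2 * p * T := by field_simp
    have e4 : N * (c * (N : ℝ)⁻¹) = c := by field_simp
    rw [e3] at h3
    rw [e4] at h4
    rw [mul_add]
    linarith
  have h5 : 1 ≤ 2 * (l * s) := by nlinarith
  have h6 : 2 * Real.log 2 + 2 * (1 + Real.log m) * (2 * p * T + c)
      ≤ (2 + 2 * (1 + Real.log m) * (2 * p * T + c)) * (2 * (l * s)) := by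
    have h7 := Real.log_two_lt_d9
    have h8 : 0 ≤ 2 * (1 + Real.log m) * (2 * p * T + c) := by positivity
    nlinarith
  have h9 : (r : ℝ) * (2 * s) * Real.log m ≤ 2 * Real.log m * (κ + 2) * (l * s) := by
    have h10 : (r : ℝ) ≤ (κ + 2) * l := by linarith
    have h11 := mul_le_mul_of_nonneg_right h10 (by positivity : 0 ≤ 2 * s * Real.log m)
    linarith
  have h12 := mul_le_mul_of_nonneg_left hε (by positivity : 0 ≤ 2 * (1 + Real.log m))
  have e5 : 2 * (T * l * (3 * (5 + 4 * Real.log m) *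
          (v * ((C + 2 * (1 - Real.exp (-μ))⁻¹) * s)))) = 2 * T * B * (l * s) := by
    rw [hB]; ring
  rw [e5] at h2
  linarith

end Ball

end

section

open scoped Matrix.Norms.L2Operator ComplexOrder
set_option linter.unusedSectionVars false
open Matrix

/-! ### Comparison with a smaller ball -/

section SubBall

variable {D : ℕ} {q : Site D → ℕ}

theorem exists_gdist_add (i : Fin D) (u x : Site D) (k : ℕ) :
    ∃ y : Site D, gdist x y = k ∧ gdist u y = gdist u x + k := by
  rcases le_total (u i) (x i) with h | h
  · refine ⟨Function.update x i (x i + k), ?_, ?_⟩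
    · rw [gdist_update_self]; omega
    · have := gdist_update x u i (x i + k)
      rw [gdist_comm u, gdist_comm u]; omega
  · refine ⟨Function.update x i (x i - k), ?_, ?_⟩
    · rw [gdist_update_self]; omega
    · have := gdist_update x u i (x i - k)
      rw [gdist_comm u, gdist_comm u]; omega

theorem card_ball_le (u : Site D) (L : ℕ) : (ball u L).card ≤ (2 * L + 1) ^ D := by
  refine (Finset.card_filter_le _ _).trans (le_of_eq ?_)
  rw [Pi.card_Icc]
  have : ∀ i : Fin D, (Finset.Icc (u i - (L : ℤ)) (u i + (L : ℤ))).card = 2 * L + 1 := fun i => by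
    rw [Int.card_Icc]; omega
  simp [this]

/-- A region of extension `N` at distance `r` from the complement of a ball lies, at distance `r`
from the complement, in a smaller ball whose radius is of the order of `N + r`: either around one
of its sites, or touching the boundary of the large ball from inside. -/
theorem exists_sub_ball (i : Fin D) {A : Finset (Site D)} {u p : Site D} {L N r : ℕ}
    (hA : A ⊆ ball u L) (hp : p ∈ A) (hpA : ∀ x ∈ A, gdist p x ≤ N)
    (hr : ∀ x ∈ A, ∀ y, y ∉ ball u L → r ≤ gdist x y) :
    ∃ (u' : Site D) (L' : ℕ), ball u' L' ⊆ ball u L ∧ A ⊆ ball u' L' ∧ L' ≤ (D + 1) * N + r ∧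
      ∀ x ∈ A, ∀ y, y ∉ ball u' L' → r ≤ gdist x y := by
  have hAu : ∀ x ∈ A, gdist u x ≤ L := fun x hx => (mem_ball_iff u L x).1 (hA hx)
  by_cases hcase : gdist u p + N + r ≤ L
  · refine ⟨p, N + r, ?_, ?_, by nlinarith, ?_⟩
    · intro x hx
      rw [mem_ball_iff] at hx ⊢
      have := gdist_triangle u p x
      omega
    · intro x hx
      rw [mem_ball_iff]
      have := hpA x hx
      omega
    · intro x hx y hy
      rw [mem_ball_iff] at hy
      have h1 := hpA x hx
      have h2 := gdist_triangle p x y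
      omega
  · -- the centre is moved from `u` towards `p`, by the coordinate differences shortened by `N`
    set u' : Site D := fun j => if N ≤ p j - u j then p j - N else
      if (N : ℤ) ≤ u j - p j then p j + N else u j with hu'
    have hxu : ∀ x ∈ A, gdist u x = gdist u u' + gdist u' x := by
      intro x hx
      simp only [gdist]
      rw [← Finset.sum_add_distrib]
      refine Finset.sum_congr rfl fun j _ => ?_
      have h1 : (p j - x j).natAbs ≤ N := le_trans (Finset.single_le_sum
        (f := fun j => (p j - x j).natAbs) (fun _ _ => Nat.zero_le _) (Finset.mem_univ j))
        (hpA x hx)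
      simp only [hu']
      split_ifs <;> omega
    have hup : gdist u p ≤ gdist u u' + D * N := by
      have h1 : ∑ _j : Fin D, N = D * N := by simp
      simp only [gdist]
      rw [← h1, ← Finset.sum_add_distrib]
      refine Finset.sum_le_sum fun j _ => ?_
      simp only [hu']
      split_ifs <;> omega
    have hu'L : gdist u u' ≤ L := by
      have := hxu p hp
      have := hAu p hp
      omega
    refine ⟨u', L - gdist u u', ?_, ?_, ?_, ?_⟩
    · intro x hx
      rw [mem_ball_iff] at hx ⊢
      have := gdist_triangle u u' x
      omega
    · intro x hx
      rw [mem_ball_iff]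
      have := hxu x hx
      have := hAu x hx
      omega
    · have : (D + 1) * N = D * N + N := by ring
      omega
    · intro x hx y hy
      rw [mem_ball_iff] at hy
      have h1 := hxu x hx
      have h2 := gdist_triangle u' x y
      have h3 := hAu x hx
      obtain ⟨z, hz, hz'⟩ := exists_gdist_add i u x (L + 1 - gdist u x)
      have h4 := hr x hx z (by rw [mem_ball_iff]; omega)
      omega

variable {F : UniformFamily q} {φ : (u : Site D) → (L : ℕ) → Conf q (ball u L) → ℂ} {m : ℕ}
  {μ v p C c γ δ : ℝ} {a : ℕ}

/-- Away from the boundaries the fixed points on a ball and on a smaller ball look alike. -/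
theorem QuantFamily.traceNorm_reduced_sub_le (h : QuantFamily F φ m μ v p C c γ δ a)
    {A : Finset (Site D)} (hne : A.Nonempty) {u u' : Site D} {L L' : ℕ}
    (hB : ball u' L' ⊆ ball u L) (hA : A ⊆ ball u' L') {r₁ : ℝ} {r₂ r₂' : ℕ} (hr₂ : 1 ≤ r₂)
    (hr₂' : 1 ≤ r₂') (h₁ : ∀ x ∈ A, ∀ y, y ∉ ball u' L' → 2 * r₁ ≤ gdist x y)
    (h₂ : ∀ x ∈ A, ∀ y, y ∉ ball u L → 2 * r₂ ≤ gdist x y)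
    (h₂' : ∀ x ∈ A, ∀ y, y ∉ ball u' L' → 2 * r₂' ≤ gdist x y) {t : ℝ} (ht : 0 ≤ t) :
    traceNorm (reduced A (pureOp (φ u L)) - reduced A (pureOp (φ u' L')))
      ≤ t * Real.exp (2 * v * t) * A.card * (2 * v * C * Real.exp (-μ * r₁)
          + 3 * p * C * (((L : ℝ) + 1) ^ a * Real.exp (-μ / 2 * r₂)))
        + t * Real.exp (2 * v * t) * A.card * (2 * v * C * Real.exp (-μ * r₁)
          + 3 * p * C * (((L' : ℝ) + 1) ^ a * Real.exp (-μ / 2 * r₂')))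
        + c * ((ball u' L').card : ℝ) ^ δ * Real.exp (-γ * t) := by
  have hX := isState_pureOp (h.norm_eq u L)
  have hX1 := traceNorm_pureOp_le (h.norm_eq u L)
  set X := pureOp (φ u L) with hXdef
  have hY := isState_reduced hB hX
  have hY1 : traceNorm (reduced (ball u' L') X) ≤ 1 := (traceNorm_reduced_le hB X).trans hX1
  have hv := h.v_pos
  have hp := h.p_pos
  have hC : 0 < C := zero_lt_one.trans_le h.one_le_C
  have e1 := traceNorm_reduced_evolution_sub_le h.μ_pos.le h.v_pos.le h.p_pos.le h.bulk h.bdry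
    h.one_le_C h.sum_exp (hA.trans hB) hne hB hr₂
    (fun x hx z hz => h₁ x hx z (Finset.mem_sdiff.1 hz).2) h₂ ht X
  have e2 := traceNorm_reduced_evolution_sub_le h.μ_pos.le h.v_pos.le h.p_pos.le h.bulk h.bdry
    h.one_le_C h.sum_exp hA hne le_rfl hr₂'
    (fun x hx z hz => h₁ x hx z (Finset.mem_sdiff.1 hz).2) h₂' ht (reduced (ball u' L') X)
  have e3 := h.mixing u' L' _ hY t ht
  rw [h.fixed u L t ht] at e1
  have e4 : evolution (regionGen F (ball u' L') (ball u' L')) t (reduced (ball u' L') X)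
      = reduced (ball u' L') (evolution (regionGen F (ball u L) (ball u' L')) t X) :=
    evolution_intertwine _ _ (reducedLin (ball u' L') (ball u L))
      (fun X => (reduced_regionGen F hB X).symm) X ht
  -- the evolution by the bulk terms in the small ball links the two closed boundary evolutions
  rw [e4, reduced_reduced hA hB] at e2
  set V := reduced A (evolution (regionGen F (ball u L) (ball u' L')) t X)
  set W := evolution (F.closedGen u' L') t (reduced (ball u' L') X)
  have e5 : traceNorm (reduced A W - reduced A (pureOp (φ u' L')))
      ≤ c * ((ball u' L').card : ℝ) ^ δ * Real.exp (-γ * t) := by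
    refine le_trans (le_of_eq_of_le ?_ (traceNorm_reduced_le hA (W - pureOp (φ u' L')))) e3
    congr 1
    exact (map_sub (reducedLin A (ball u' L')) W (pureOp (φ u' L'))).symm
  have e6 : traceNorm (reduced A X - V) = traceNorm (V - reduced A X) := by
    rw [← neg_sub, traceNorm_neg]
  have e7 : reduced A X - reduced A (pureOp (φ u' L'))
      = (reduced A X - V) + (V - reduced A W) + (reduced A W - reduced A (pureOp (φ u' L'))) := by
    abel
  rw [e7]
  refine (traceNorm_add_le _ _).trans (add_le_add ((traceNorm_add_le _ _).trans
    (add_le_add ?_ ?_)) e5)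
  · rw [e6]
    refine e1.trans ((mul_le_of_le_one_right (by positivity) hX1).trans (le_of_eq ?_))
    ring
  · refine e2.trans ((mul_le_of_le_one_right (by positivity) hY1).trans (le_of_eq ?_))
    ring

/-- The error of the comparison in time `T l`, for distances at which the decay beats the exponential
growth of the Lieb-Robinson cone: here `exp l` is the size of the region. -/
theorem mul_exp_mul_le {T v C p l b e₁ e₂ n ε₁ ε₂ : ℝ} (hT : 0 ≤ T) (hv : 0 ≤ v) (hC : 0 ≤ C)
    (hp : 0 ≤ p) (hn0 : 0 ≤ n) (hn : n ≤ Real.exp l) (hε₁ : 0 ≤ ε₁) (hε₂ : 0 ≤ ε₂)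
    (hb : b = 2 * v * T + 3) (h₁ : ε₁ ≤ e₁ * Real.exp (-(b * l)))
    (h₂ : ε₂ ≤ e₂ * Real.exp (-(b * l))) :
    T * l * Real.exp (2 * v * (T * l)) * n * (2 * v * C * ε₁ + 3 * p * C * ε₂)
      ≤ T * (2 * v * C * e₁ + 3 * p * C * e₂) * Real.exp (-l) := by
  have hl' : l ≤ Real.exp l := by linarith [Real.add_one_le_exp l]
  calc T * l * Real.exp (2 * v * (T * l)) * n * (2 * v * C * ε₁ + 3 * p * C * ε₂)
      ≤ T * Real.exp l * Real.exp (2 * v * (T * l)) * Real.exp l *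
        (2 * v * C * (e₁ * Real.exp (-(b * l))) + 3 * p * C * (e₂ * Real.exp (-(b * l)))) := by
        gcongr
    _ = T * (2 * v * C * e₁ + 3 * p * C * e₂) *
        (Real.exp l * Real.exp (2 * v * (T * l)) * Real.exp l * Real.exp (-(b * l))) := by ring
    _ = _ := by
        rw [← Real.exp_add, ← Real.exp_add, ← Real.exp_add, hb]
        congr 2; ring

theorem le_floor_half {x : ℝ} (hx : 2 ≤ x) : 1 ≤ ⌊x⌋₊ / 2 ∧ x / 2 - 1 ≤ ((⌊x⌋₊ / 2 : ℕ) : ℝ) ∧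
    x / 2 - 1 / 2 ≤ (⌊x⌋₊ : ℝ) / 2 := by
  have h1 : 2 ≤ ⌊x⌋₊ := Nat.le_floor (by exact_mod_cast hx)
  have h2 := Nat.lt_floor_add_one x
  have h3 : ⌊x⌋₊ ≤ 2 * (⌊x⌋₊ / 2) + 1 := by omega
  have h4 : (⌊x⌋₊ : ℝ) ≤ 2 * ((⌊x⌋₊ / 2 : ℕ) : ℝ) + 1 := by exact_mod_cast h3
  exact ⟨by omega, by linarith, by linarith⟩

end SubBall

end

section

open scoped Matrix.Norms.L2Operator ComplexOrder
set_option linter.unusedSectionVars false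
open Matrix

/-! ### The area law -/

section AreaLaw

variable {D : ℕ} {q : Site D → ℕ}
variable {F : UniformFamily q} {φ : (u : Site D) → (L : ℕ) → Conf q (ball u L) → ℂ} {m : ℕ}
  {μ v p C c γ δ : ℝ} {a : ℕ}

set_option maxHeartbeats 2000000 in
/-- The area law for regions of extension `N` away from the boundary of the ball, by comparison with
the fixed point on a ball of polynomial size. -/
theorem QuantFamily.exists_ent_le_of_extension_le (h : QuantFamily F φ m μ v p C c γ δ a)
    (i : Fin D) : ∃ κ c' : ℝ, 0 < κ ∧ 0 < c' ∧ ∀ (u : Site D) (L : ℕ) (A : Finset (Site D)) (N : ℕ)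
      (x₀ : Site D), A ⊆ ball u L → x₀ ∈ A → (∀ x ∈ A, gdist x₀ x ≤ N) → 2 ≤ N → A.card ≤ N →
      N ≤ (ball u L).card →
      (∀ x ∈ A, ∀ y, y ∉ ball u L → κ * Real.log ((ball u L).card) ≤ gdist x y) →
      ent (reduced A (pureOp (φ u L))) ≤ c' * (Real.log N * (layer 1 A).card) := by
  have hμ := h.μ_pos
  have hγ := h.γ_pos
  have hδ := h.δ_pos
  have hp := h.p_pos
  have hc := h.c_pos
  have hv := h.v_pos
  have hC : 0 < C := zero_lt_one.trans_le h.one_le_C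
  have hlm : 0 ≤ Real.log m := Real.log_natCast_nonneg m
  -- the evolution time is `T log N`, such that the small ball mixes up to an error of order `1 / N`
  obtain ⟨T, hT⟩ : ∃ T : ℝ, T = (D * δ + 1) / γ := ⟨_, rfl⟩
  have hT0 : 0 < T := by rw [hT]; positivity
  have hTγ : γ * T = D * δ + 1 := by rw [hT]; field_simp
  obtain ⟨b, hb⟩ : ∃ b : ℝ, b = 2 * v * T + 3 := ⟨_, rfl⟩
  have hb0 : 0 < b := by rw [hb]; positivity
  -- the distance `κ log N` beats the growth of the Lieb-Robinson cone and of the boundary terms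
  obtain ⟨κ, hκ⟩ : ∃ κ : ℝ, κ = 4 * (b + a) / μ + 4 := ⟨_, rfl⟩
  have hκ4 : 4 ≤ κ := by rw [hκ]; exact le_add_of_nonneg_left (by positivity)
  have hμκ : 4 * (b + a) ≤ μ * κ := by
    have : μ * κ = 4 * (b + a) + 4 * μ := by rw [hκ]; field_simp
    linarith
  obtain ⟨W, hW⟩ : ∃ W : ℝ, W = D + 2 + κ := ⟨_, rfl⟩
  have hW0 : 0 < W := by rw [hW]; positivity
  obtain ⟨K, hK⟩ : ∃ K : ℕ, 2 * W < 2 ^ K := pow_unbounded_of_one_lt _ one_lt_two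
  obtain ⟨c₁, hc₁, hball⟩ := h.exists_ent_le i ((K + 1) * D)
  obtain ⟨Q, hQ⟩ : ∃ Q : ℝ, Q
      = T * (2 * v * C * Real.exp (μ / 2) + 3 * p * C * Real.exp (μ / 2))
      + T * (2 * v * C * Real.exp (μ / 2) + 3 * p * C * (W ^ a * Real.exp (μ / 2)))
      + c * ((2 * W) ^ D) ^ δ := ⟨_, rfl⟩
  have hQ0 : 0 < Q := by rw [hQ]; positivity
  refine ⟨κ, c₁ + (1 + (1 + Real.log m) * Q) * 2, by linarith, by positivity,
    fun u L A N x₀ hA hx₀ hext hN hAN hNΛ hdist => ?_⟩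
  have hne : A.Nonempty := ⟨x₀, hx₀⟩
  have hN2 : (2 : ℝ) ≤ N := by exact_mod_cast hN
  have hN0 : (0 : ℝ) < N := by linarith
  obtain ⟨l, hl⟩ : ∃ l : ℝ, l = Real.log N := ⟨_, rfl⟩
  obtain ⟨l', hl'⟩ : ∃ l' : ℝ, l' = Real.log ((ball u L).card) := ⟨_, rfl⟩
  rw [← hl'] at hdist
  rw [← hl]
  have hexp : Real.exp l = N := by rw [hl]; exact Real.exp_log hN0
  have hl2 : 1 / 2 ≤ l := by
    have h1 := Real.log_le_log two_pos hN2
    have h2 := Real.log_two_gt_d9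
    linarith
  have hlN : l ≤ N := by
    rw [hl]; exact (Real.log_le_sub_one_of_pos hN0).trans (by linarith)
  have hΛ0 : (0 : ℝ) < (ball u L).card := hN0.trans_le (by exact_mod_cast hNΛ)
  have hexp' : Real.exp l' = (ball u L).card := by rw [hl']; exact Real.exp_log hΛ0
  have hll' : l ≤ l' := by
    rw [hl, hl']; exact Real.log_le_log hN0 (by exact_mod_cast hNΛ)
  have hκl : κ * l ≤ κ * l' := mul_le_mul_of_nonneg_left hll' (by linarith)
  have hκl2 : 2 ≤ κ * l := by nlinarith
  obtain ⟨hr1, hr2, hr3⟩ := le_floor_half hκl2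
  obtain ⟨hs1, hs2, -⟩ := le_floor_half (hκl2.trans hκl)
  obtain ⟨u', L', hB, hAB, hL', hBdist⟩ := exists_sub_ball i hA hx₀ hext (r := ⌊κ * l⌋₊)
    fun x hx y hy => Nat.floor_le_of_le (hκl.trans (hdist x hx y hy))
  have key := h.traceNorm_reduced_sub_le hne hB hAB (r₁ := (⌊κ * l⌋₊ : ℝ) / 2) hs1 hr1
    (fun x hx y hy => by
      rw [mul_div_cancel₀ _ two_ne_zero]; exact_mod_cast hBdist x hx y hy)
    (fun x hx y hy => (Nat.mul_div_le _ _).trans (Nat.floor_le_of_le (hdist x hx y hy)))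
    (fun x hx y hy => (Nat.mul_div_le _ _).trans (hBdist x hx y hy))
    (t := T * l) (by positivity)
  -- the radius of the small ball is at most a multiple of `N`
  have hL'W : (L' : ℝ) + 1 ≤ W * N := by
    have h1 : (L' : ℝ) ≤ (D + 1) * N + ⌊κ * l⌋₊ := by exact_mod_cast hL'
    have h2 : (⌊κ * l⌋₊ : ℝ) ≤ κ * l := Nat.floor_le (by linarith)
    have h3 : κ * l ≤ κ * N := mul_le_mul_of_nonneg_left hlN (by linarith)
    have h4 : W * N = (D + 1) * N + κ * N + N := by rw [hW]; ring
    linarith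
  have hBcard : ((ball u' L').card : ℝ) ≤ (2 * W) ^ D * Real.exp (D * l) := by
    have h1 : ((ball u' L').card : ℝ) ≤ (2 * L' + 1) ^ D := by exact_mod_cast card_ball_le u' L'
    refine h1.trans ?_
    rw [Real.exp_nat_mul, hexp, ← mul_pow]
    exact pow_le_pow_left₀ (by positivity) (by linarith) D
  have hBK : (ball u' L').card ≤ N ^ ((K + 1) * D) := by
    have h1 : ((ball u' L').card : ℝ) ≤ (N : ℝ) ^ ((K + 1) * D) := by
      refine hBcard.trans ?_
      rw [Real.exp_nat_mul, hexp, ← mul_pow, pow_mul]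
      refine pow_le_pow_left₀ (by positivity) ?_ D
      rw [pow_succ]
      refine mul_le_mul_of_nonneg_right (hK.le.trans ?_) hN0.le
      exact pow_le_pow_left₀ zero_le_two hN2 K
    exact_mod_cast h1
  have hent := hball u' L' A N hAB hne hN hAN hBK
  rw [← hl] at hent
  have hcard : (A.card : ℝ) ≤ Real.exp l := by rw [hexp]; exact_mod_cast hAN
  have hl0 : 0 ≤ l := by linarith
  have hμκl : 4 * (b + a) * l ≤ μ * (κ * l) := by
    have := mul_le_mul_of_nonneg_right hμκ hl0; linarith
  have hμκl' : 4 * (b + a) * l' ≤ μ * (κ * l') := by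
    have := mul_le_mul_of_nonneg_right hμκ (hl0.trans hll'); linarith
  have ha0 : 0 ≤ a * l := by positivity
  have hbl : 0 ≤ b * l := by positivity
  have hbll' : b * l ≤ b * l' := mul_le_mul_of_nonneg_left hll' hb0.le
  have d₁ : Real.exp (-μ * ((⌊κ * l⌋₊ : ℝ) / 2)) ≤ Real.exp (μ / 2) * Real.exp (-(b * l)) := by
    rw [← Real.exp_add]
    refine Real.exp_le_exp.2 ?_
    have := mul_le_mul_of_nonneg_left hr3 hμ.le
    linarith
  have d₂ : ((L : ℝ) + 1) ^ a * Real.exp (-μ / 2 * ((⌊κ * l'⌋₊ / 2 : ℕ) : ℝ))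
      ≤ Real.exp (μ / 2) * Real.exp (-(b * l)) := by
    have h3 : (L : ℝ) + 1 ≤ Real.exp l' := by
      rw [hexp']; exact_mod_cast succ_le_card_ball i u L
    have h4 : ((L : ℝ) + 1) ^ a ≤ Real.exp (a * l') := by
      rw [Real.exp_nat_mul]; exact pow_le_pow_left₀ (by positivity) h3 a
    refine (mul_le_mul_of_nonneg_right h4 (Real.exp_pos _).le).trans ?_
    rw [← Real.exp_add, ← Real.exp_add]
    refine Real.exp_le_exp.2 ?_
    have := mul_le_mul_of_nonneg_left hs2 hμ.le
    linarith
  have d₃ : ((L' : ℝ) + 1) ^ a * Real.exp (-μ / 2 * ((⌊κ * l⌋₊ / 2 : ℕ) : ℝ))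
      ≤ W ^ a * Real.exp (μ / 2) * Real.exp (-(b * l)) := by
    have h4 : ((L' : ℝ) + 1) ^ a ≤ W ^ a * Real.exp (a * l) := by
      rw [Real.exp_nat_mul, hexp, ← mul_pow]; exact pow_le_pow_left₀ (by positivity) hL'W a
    refine (mul_le_mul_of_nonneg_right h4 (Real.exp_pos _).le).trans ?_
    rw [mul_assoc, mul_assoc, ← Real.exp_add, ← Real.exp_add]
    refine mul_le_mul_of_nonneg_left (Real.exp_le_exp.2 ?_) (by positivity)
    have := mul_le_mul_of_nonneg_left hr2 hμ.le
    linarith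
  have d₄ : c * ((ball u' L').card : ℝ) ^ δ * Real.exp (-γ * (T * l))
      ≤ c * ((2 * W) ^ D) ^ δ * Real.exp (-l) := by
    have h3 : ((ball u' L').card : ℝ) ^ δ ≤ ((2 * W) ^ D) ^ δ * Real.exp (D * l * δ) := by
      rw [Real.exp_mul, ← Real.mul_rpow (by positivity) (Real.exp_pos _).le]
      exact Real.rpow_le_rpow (by positivity) hBcard hδ.le
    have h4 : -γ * (T * l) = -((D * δ + 1) * l) := by rw [← hTγ]; ring
    rw [h4, mul_assoc, mul_assoc]
    refine mul_le_mul_of_nonneg_left ?_ hc.le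
    refine (mul_le_mul_of_nonneg_right h3 (Real.exp_pos _).le).trans (le_of_eq ?_)
    rw [mul_assoc, ← Real.exp_add]
    congr 2; ring
  have f₁ := mul_exp_mul_le hT0.le hv.le hC.le hp.le (Nat.cast_nonneg _) hcard
    (Real.exp_pos _).le (by positivity) hb d₁ d₂
  have f₂ := mul_exp_mul_le hT0.le hv.le hC.le hp.le (Nat.cast_nonneg _) hcard
    (Real.exp_pos _).le (by positivity) hb d₁ d₃
  have hQN : traceNorm (reduced A (pureOp (φ u L)) - reduced A (pureOp (φ u' L')))
      ≤ Q * Real.exp (-l) := by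
    refine key.trans ((add_le_add (add_le_add f₁ f₂) d₄).trans (le_of_eq ?_))
    rw [hQ]; ring
  obtain ⟨w⟩ := nonempty_conf_of_vnorm (h.norm_eq u L)
  have hneA : Nonempty (Conf q A) := ⟨restr hA w⟩
  have g1 := ent_le_ent_add (isState_reduced hA (isState_pureOp (h.norm_eq u L)))
    (isState_reduced hAB (isState_pureOp (h.norm_eq u' L')))
  have g2 := log_two_mul_card_conf_le h.dim_le h.one_le_m (by omega) hAN hneA
  have g3 := mul_le_mul g2 hQN (traceNorm_nonneg _) (by positivity)
  have e1 : N * (1 + Real.log m) * (Q * Real.exp (-l)) = (1 + Real.log m) * Q := by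
    rw [Real.exp_neg, hexp]; field_simp
  rw [e1] at g3
  have hs1 : (1 : ℝ) ≤ (layer 1 A).card := by
    exact_mod_cast Finset.card_pos.2 (layer_one_nonempty i hne)
  have h5 : 1 ≤ 2 * (l * (layer 1 A).card) := by nlinarith
  have h6 := Real.log_two_lt_d9
  have h7 : 0 ≤ (1 + Real.log m) * Q := by positivity
  have h8 : (1 + (1 + Real.log m) * Q) * 1
      ≤ (1 + (1 + Real.log m) * Q) * (2 * (l * (layer 1 A).card)) :=
    mul_le_mul_of_nonneg_left h5 (by linarith)
  linarith

/-- One of the first `N` spheres around a site of a region of `N` sites is disjoint from the region. -/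
theorem exists_shell_disjoint {A : Finset (Site D)} {N : ℕ} {x₀ : Site D} (hx₀ : x₀ ∈ A)
    (hA : A.card ≤ N) : ∃ k, 1 ≤ k ∧ k ≤ N ∧ ∀ x ∈ A, gdist x₀ x ≠ k := by
  by_contra! hcon
  have h1 : Finset.range (N + 1) ⊆ A.image (gdist x₀) := by
    intro k hk
    rw [Finset.mem_range] at hk
    rcases Nat.eq_zero_or_pos k with h0 | h0
    · exact Finset.mem_image.2 ⟨x₀, hx₀, by rw [h0, gdist_self]⟩
    · obtain ⟨x, hx, hxk⟩ := hcon k h0 (by omega)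
      exact Finset.mem_image.2 ⟨x, hx, hxk⟩
  have h2 := (Finset.card_le_card h1).trans Finset.card_image_le
  rw [Finset.card_range] at h2
  omega

/-- The boundaries of pieces at distance at least two add up. -/
theorem card_layer_one_add_le {A A₁ A₂ : Finset (Site D)} (h₁ : A₁ ⊆ A) (h₂ : A₂ = A \ A₁)
    (hd : ∀ x ∈ A₁, ∀ y ∈ A₂, 1 < gdist x y) :
    (layer 1 A₁).card + (layer 1 A₂).card ≤ (layer 1 A).card := by
  have hdisj : Disjoint (layer 1 A₁) (layer 1 A₂) := by
    refine Disjoint.mono (layer_subset 1 A₁) (layer_subset 1 A₂) ?_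
    rw [h₂]; exact Finset.disjoint_sdiff
  rw [← Finset.card_union_of_disjoint hdisj]
  refine Finset.card_le_card fun x hx => ?_
  have hmem : ∀ y, y ∈ A ↔ y ∈ A₁ ∨ y ∈ A₂ := fun y => by
    rw [h₂, Finset.mem_sdiff]
    have := @h₁ y
    tauto
  rw [Finset.mem_union, mem_layer_iff, mem_layer_iff] at hx
  rcases hx with ⟨hx, y, hy, hxy⟩ | ⟨hx, y, hy, hxy⟩
  · refine mem_layer_one_of_not_mem ((hmem x).2 (Or.inl hx)) (fun hyA => ?_) hxy
    rcases (hmem y).1 hyA with h | h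
    · exact hy h
    · have := hd x hx y h; omega
  · refine mem_layer_one_of_not_mem ((hmem x).2 (Or.inr hx)) (fun hyA => ?_) hxy
    rcases (hmem y).1 hyA with h | h
    · have := hd y h x hx
      rw [gdist_comm] at this; omega
    · exact hy h

/-- The area law for regions away from the boundary of the ball. A region that extends further than its
size falls apart along an empty sphere, and both sides of the inequality are additive. -/
theorem QuantFamily.exists_ent_le_of_dist (h : QuantFamily F φ m μ v p C c γ δ a)
    (i : Fin D) : ∃ κ c' : ℝ, 0 < κ ∧ 0 < c' ∧ ∀ (u : Site D) (L : ℕ) (A : Finset (Site D)) (N : ℕ),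
      A ⊆ ball u L → A.Nonempty → 2 ≤ N → A.card ≤ N → N ≤ (ball u L).card →
      (∀ x ∈ A, ∀ y, y ∉ ball u L → κ * Real.log ((ball u L).card) ≤ gdist x y) →
      ent (reduced A (pureOp (φ u L))) ≤ c' * (Real.log N * (layer 1 A).card) := by
  obtain ⟨κ, c', hκ, hc', hloc⟩ := h.exists_ent_le_of_extension_le i
  refine ⟨κ, c', hκ, hc', fun u L A N hA hne hN hAN hNΛ hdist => ?_⟩
  induction hn : A.card using Nat.strong_induction_on generalizing A with
  | _ n ih =>
  obtain ⟨x₀, hx₀⟩ := hne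
  by_cases hext : ∀ x ∈ A, gdist x₀ x ≤ N
  · exact hloc u L A N x₀ hA hx₀ hext hN hAN hNΛ hdist
  · push Not at hext
    obtain ⟨x₁, hx₁, hx₁N⟩ := hext
    obtain ⟨k, hk1, hkN, hk⟩ := exists_shell_disjoint hx₀ hAN
    set A₁ := A.filter fun x => gdist x₀ x < k with hA₁
    have hA₁A : A₁ ⊆ A := Finset.filter_subset _ _
    have hA₂A : A \ A₁ ⊆ A := Finset.sdiff_subset
    have h₀ : x₀ ∈ A₁ := Finset.mem_filter.2 ⟨hx₀, by rw [gdist_self]; omega⟩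
    have h₁ : x₁ ∈ A \ A₁ := Finset.mem_sdiff.2 ⟨hx₁, fun h => by
      have := (Finset.mem_filter.1 h).2; omega⟩
    have hc₁ : A₁.card < A.card := Finset.card_lt_card
      (Finset.ssubset_iff_of_subset hA₁A |>.2 ⟨x₁, hx₁, (Finset.mem_sdiff.1 h₁).2⟩)
    have hc₂ : (A \ A₁).card < A.card := Finset.card_lt_card
      (Finset.ssubset_iff_of_subset hA₂A |>.2
        ⟨x₀, hx₀, fun h => (Finset.mem_sdiff.1 h).2 h₀⟩)
    have i₁ := ih A₁.card (by omega) A₁ (hA₁A.trans hA) ⟨x₀, h₀⟩ (by omega)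
      (fun x hx => hdist x (hA₁A hx)) rfl
    have i₂ := ih (A \ A₁).card (by omega) (A \ A₁) (hA₂A.trans hA) ⟨x₁, h₁⟩ (by omega)
      (fun x hx => hdist x (hA₂A hx)) rfl
    have hsplit := ent_union_le hA₁A rfl (isState_reduced hA (isState_pureOp (h.norm_eq u L))).1
    rw [reduced_reduced hA₁A hA, reduced_reduced hA₂A hA] at hsplit
    have hlay := card_layer_one_add_le hA₁A rfl fun x hx y hy => by
      have h1 := (Finset.mem_filter.1 hx).2
      rw [Finset.mem_sdiff, hA₁, Finset.mem_filter] at hy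
      have h2 := hk y hy.1
      have h3 : ¬gdist x₀ y < k := fun h' => hy.2 ⟨hy.1, h'⟩
      have h4 := gdist_triangle x₀ x y
      omega
    have hlay' : ((layer 1 A₁).card : ℝ) + (layer 1 (A \ A₁)).card ≤ (layer 1 A).card := by
      exact_mod_cast hlay
    have hl : 0 ≤ c' * Real.log N := mul_nonneg hc'.le (Real.log_natCast_nonneg N)
    have := mul_le_mul_of_nonneg_left hlay' hl
    linarith

theorem exists_quantFamily (hq : ∀ x, q x ≤ m) (hμ : 0 < μ)
    (hLR : F.LiebRobinson (fun r => Real.exp (μ * r))) (hmix : F.RapidMixing)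
    (hφ : ∀ u L, HasUniquePureFixedPoint (F.closedGen u L) (φ u L)) :
    ∃ (v p C c γ δ : ℝ) (a : ℕ), QuantFamily F φ m μ v p C c γ δ a := by
  obtain ⟨v, hv, hbulk⟩ := exists_bulkDecay F hLR
  obtain ⟨p, a, hp, hbdry⟩ := exists_bdryDecay F hLR
  obtain ⟨C, hC1, hC⟩ := exists_sum_exp_gdist_le D hμ
  obtain ⟨c, γ, δ, hc, hγ, hδ, hm⟩ := exists_mixing F hmix hφ
  have hnorm : ∀ u L, vnorm (φ u L) = 1 := fun u L => vnorm_eq_one_of_isState (hφ u L).1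
  have hm1 : 1 ≤ m := by
    obtain ⟨w⟩ := nonempty_conf_of_vnorm (hnorm 0 0)
    have h0 : (0 : Site D) ∈ ball (0 : Site D) 0 := by rw [mem_ball_iff, gdist_self]
    exact (Nat.succ_le_of_lt (Fin.pos (w ⟨0, h0⟩))).trans (hq 0)
  exact ⟨v, p, C, c, γ, δ, a, ⟨hq, hm1, hμ, zero_lt_one.trans_le hv, hp, hc, hγ, hδ, hC1, hbulk,
    hbdry, hC, hnorm, fun u L t ht => ((hφ u L).2 _ (hφ u L).1).2 rfl t ht, hm⟩⟩

end AreaLaw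

theorem mainTheorem2 {D : ℕ} (q : Site D → ℕ) (m : ℕ) (hq : ∀ x, q x ≤ m)
    (F : UniformFamily q) (μ : ℝ) (hμ : 0 < μ)
    (hLR : F.LiebRobinson (fun r => Real.exp (μ * r)))
    (hmix : F.RapidMixing)
    (φ : (u : Site D) → (L : ℕ) → Conf q (ball u L) → ℂ)
    (hφ : ∀ u L, HasUniquePureFixedPoint (F.closedGen u L) (φ u L)) :
    ∃ κ : ℝ, 0 < κ ∧ ∀ K : ℕ, ∃ c : ℝ, 0 < c ∧
      ∀ (u : Site D) (L : ℕ) (A : Finset (Site D)), A ⊆ ball u L → 2 ≤ A.card →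
        ((∀ x ∈ A, ∀ y, y ∉ ball u L → κ * Real.log ((ball u L).card) ≤ gdist x y) ∨
          (ball u L).card ≤ A.card ^ K) →
        vnEntropy (reduced A (pureOp (φ u L)))
          ≤ c * Real.log A.card * ((layer 1 A).card : ℝ) := by
  obtain ⟨v, p, C, c, γ, δ, a, h⟩ := exists_quantFamily hq hμ hLR hmix hφ
  rcases Nat.eq_zero_or_pos D with hD | hD
  · -- in dimension zero there is only one site
    subst hD
    refine ⟨1, one_pos, fun K => ⟨1, one_pos, fun u L A _ hA2 => ?_⟩⟩
    have := Finset.card_le_one_of_subsingleton A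
    omega
  obtain ⟨κ, c₁, hκ, hc₁, h₁⟩ := h.exists_ent_le_of_dist ⟨0, hD⟩
  refine ⟨κ, hκ, fun K => ?_⟩
  obtain ⟨c₂, hc₂, h₂⟩ := h.exists_ent_le ⟨0, hD⟩ K
  have hlog2 : 0 < Real.log 2 := Real.log_pos one_lt_two
  refine ⟨max c₁ c₂ / Real.log 2, div_pos (lt_max_of_lt_left hc₁) hlog2,
    fun u L A hA hA2 hor => ?_⟩
  have hne : A.Nonempty := Finset.card_pos.1 (by omega)
  have hs : 0 ≤ Real.log A.card * ((layer 1 A).card : ℝ) :=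
    mul_nonneg (Real.log_natCast_nonneg _) (Nat.cast_nonneg _)
  rw [vnEntropy_eq (isState_reduced hA (hφ u L).1), div_le_iff₀ hlog2]
  have key : ent (reduced A (pureOp (φ u L)))
      ≤ max c₁ c₂ * (Real.log A.card * ((layer 1 A).card : ℝ)) := by
    rcases hor with hor | hor
    · exact (h₁ u L A A.card hA hne hA2 le_rfl (Finset.card_le_card hA) hor).trans
        (mul_le_mul_of_nonneg_right (le_max_left _ _) hs)
    · exact (h₂ u L A A.card hA hne hA2 le_rfl hor).trans
        (mul_le_mul_of_nonneg_right (le_max_right _ _) hs)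
  refine key.trans (le_of_eq ?_)
  field_simp

end
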